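/- **Setting.** Let $(\bar W,\bar\omega)$ be a compact simply connected Kähler threefold and $D\subset\bar W$ a smooth $K3$ divisor which is the zero set of a holomorphic coordinate $z$ on a tubular neighbourhood $U\simeq D\times\{|z|<1\}$ (a real diffeomorphism), with $\pi_1(W)$ finite for $W=\bar W\setminus D$. Write $z=e^{-s-i\alpha}$ on the end $U\setminus D$. Let $\kappa_I$ be the Ricci-flat Kähler form on $D$ in the class $[\bar\omega|_D]$, with holomorphic volume form $\kappa_J+i\kappa_K$, and let $(\omega,\Omega)$ be a Calabi–Yau structure on $W$ (a Ricci-flat Kähler form and a normalised holomorphic volume form) which is exponentially asymptotic, with all derivatives, to $\omega_\infty=\kappa_I+ds\wedge d\alpha$ and $\Omega_\infty=(ds+i\,d\alpha)\wedge(\kappa_J+i\kappa_K)$. Let $g(u,v)=\omega(u,Iv)$ and $d\mathrm{Vol}=\omega^3/3!$. Let $\mathcal E\to\bar W$ be a holomorphic vector bundle. For a Hermitian metric $H$ on $\mathcal E$ let $F_H$ be the curvature of its Chern connection and $\hat F_H=(F_H,\omega)$ its pointwise $g$-inner product with $\omega$; $H$ is Hermitian Yang–Mills (HYM) on $W$ if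 $\hat F_H=0$ there. Put $\|\hat F_H\|^2_{L^2(W)}=\int_W\mathrm{tr}(\hat F_H^{*}\hat F_H)\,d\mathrm{Vol}$, with $*$ the $H$-adjoint. Let $H_0$ be a reference metric: a smooth Hermitian metric on $\mathcal E\to\bar W$ with $\|\hat F_{H_0}\|_{L^2(W)}<\infty$ whose restriction to each slice $D_z$, for all small $|z|$, is HYM with respect to a Kähler form of $D_z$ in the class $[\bar\omega|_{D_z}]$, equal to $\kappa_I$ when $z=0$. (Such metrics exist in particular on bundles which are stable at infinity.) Let $\{H_t\}_{t\ge0}$ be a family of Hermitian metrics on $\mathcal E|_W$, smooth on $W\times[0,\infty)$, with $$H_t^{-1}\frac{\partial H_t}{\partial t}=-2i\,\hat F_{H_t},\qquad H_{t=0}=H_0\quad\text{on } W,$$ and such that $H_t$ and $H_0$ are mutually bounded, uniformly on $W\times[0,T]$, for every $T<\infty$. Put $$\Phi_t=2i\,\mathrm{tr}\Big(H_t^{-1}\frac{\partial H_t}{\partial t}\,F_{H_t}\Big),\qquad \mathcal N_W(H_T)=\int_0^T\Big(\int_W\Phi_t\wedge\omega^2\Big)dt .$$ **Proposition.** 1.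 $\mathcal N_W(H_T)$ is well defined for all $T\in[0,\infty)$: for each $t\ge 0$ the form $\Phi_t\wedge\omega^2$ is integrable over $W$, its integral is an integrable function of $t\in[0,T]$, and $\mathcal N_W(H_T)$ is real. 2. For all $t\ge0$, $\|\hat F_{H_t}\|_{L^2(W)}$ is finite and $$\frac{d}{dt}\mathcal N_W(H_t)=-8\,\|\hat F_{H_t}\|^2_{L^2(W)}$$ (a one-sided derivative at $t=0$). 3. If $H_t$ converges as $t\to\infty$, uniformly on compact subsets of $W$, to a smooth Hermitian metric $H$ on $\mathcal E|_W$, then $H$ is HYM on $W$. -/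

import Mathlib

open Set Filter Topology MeasureTheory Complex Bundle
open scoped Manifold ContDiff ComplexConjugate Matrix Bundle

noncomputable section

namespace HYM

/-! ### Differential forms on manifolds

A complex manifold of dimension `n` is a manifold modelled on `V n = ℂⁿ` with holomorphic
transition maps.  The tangent space at `p` is the model space, through the preferred chart at `p`;
multiplication by `I` is the complex structure. -/

/-- The model space `ℂⁿ`. -/
abbrev V (n : ℕ) : Type := Fin n → ℂ

/-- `k`-forms on a manifold modelled on `E`, with values in `𝕜`. -/
abbrev KForm (E : Type*) [NormedAddCommGroup E] [NormedSpace ℝ E] (k : ℕ) (M : Type*)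
    (𝕜 : Type*) [NormedAddCommGroup 𝕜] [NormedSpace ℝ 𝕜] : Type _ :=
  M → E [⋀^Fin k]→L[ℝ] 𝕜

section Forms

variable {E E' : Type*} [NormedAddCommGroup E] [NormedSpace ℝ E]
  [NormedAddCommGroup E'] [NormedSpace ℝ E']
  {M N : Type*} [TopologicalSpace M] [ChartedSpace E M] [TopologicalSpace N] [ChartedSpace E' N]
  {𝕜 : Type*} [NormedAddCommGroup 𝕜] [NormedSpace ℝ 𝕜] {k : ℕ}

/-- Pull-back of a form by a (real-differentiable) map. -/
def pullback (f : M → N) (β : KForm E' k N 𝕜) : KForm E k M 𝕜 := fun x =>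
  (β (f x)).compContinuousLinearMap
    (mfderiv (modelWithCornersSelf ℝ E) (modelWithCornersSelf ℝ E') f x : E →L[ℝ] E')

/-- A form read in the preferred chart at `p`. -/
def inChart (p : M) (β : KForm E k M 𝕜) : E → E [⋀^Fin k]→L[ℝ] 𝕜 :=
  pullback (M := E) (E := E) (chartAt E p).symm β

/-- Smoothness (over `ℝ`) of a form on an open set. -/
def SmoothForm (U : Set M) (β : KForm E k M 𝕜) : Prop :=
  ∀ p : M, ContDiffOn ℝ ∞ (inChart p β) ((chartAt E p).target ∩ (chartAt E p).symm ⁻¹' U)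

/-- The exterior derivative. -/
def extD (β : KForm E k M 𝕜) : KForm E (k + 1) M 𝕜 := fun p =>
  extDeriv (inChart p β) (chartAt E p p)

end Forms

/-! ### Kähler linear algebra, Kähler and Calabi-Yau structures -/

/-- The real family `u₁, I u₁, u₂, I u₂, …` attached to `u₁, u₂, …`. -/
def realFrame {m n : ℕ} (u : Fin m → V n) : Fin m × Fin 2 → V n := fun a =>
  if a.2 = 0 then u a.1 else I • u a.1

/-- The standard real basis `e₁, I e₁, e₂, I e₂, …` of `ℂⁿ`. -/
def stdFrame (n : ℕ) : Fin n × Fin 2 → V n := realFrame fun j => Pi.single j (1 : ℂ)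

/-- Gram matrix of the metric `g(u, v) = β(u, I v)` in the real frame `b`. -/
def gram {ι : Type*} {n : ℕ} (b : ι → V n) (β : V n [⋀^Fin 2]→L[ℝ] ℝ) : Matrix ι ι ℝ :=
  Matrix.of fun a c => β ![b a, I • b c]

/-- The pointwise inner product `(F, β)`, for the metric `g(u, v) = β(u, I v)`, of a
matrix-valued `2`-form `F` with `β`, both restricted to the span of the real frame `b`:
`½ ∑ g^{ac} g^{a'c'} β_{cc'} F_{aa'}`, i.e. `∑_{a<a'} β_{aa'} F_{aa'}` in an orthonormal frame. -/
def traceForm {ι : Type*} [Fintype ι] [DecidableEq ι] {n r : ℕ} (b : ι → V n)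
    (β : V n [⋀^Fin 2]→L[ℝ] ℝ) (F : V n → V n → Matrix (Fin r) (Fin r) ℂ) :
    Matrix (Fin r) (Fin r) ℂ :=
  (1 / 2 : ℂ) • ∑ a, ∑ a', ∑ c, ∑ c',
    (((gram b β)⁻¹ a c * (gram b β)⁻¹ a' c' * β ![b c, b c'] : ℝ) : ℂ) • F (b a) (b a')

section Kaehler

variable {n : ℕ} {M : Type*} [TopologicalSpace M] [ChartedSpace (V n) M]

/-- `β` is a (smooth) Kähler form on the open set `U`. -/
structure IsKaehler (U : Set M) (β : KForm (V n) 2 M ℝ) : Prop where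
  smooth : SmoothForm U β
  closed : ∀ p ∈ U, extD β p = 0
  type11 : ∀ p ∈ U, ∀ u v : V n, β p ![I • u, I • v] = β p ![u, v]
  pos : ∀ p ∈ U, ∀ u : V n, u ≠ 0 → 0 < β p ![u, I • u]

/-- `Ω` is a holomorphic `n`-form on the open subset `U` of an `n`-dimensional complex manifold:
a closed form of type `(n, 0)`. -/
structure IsHolomorphicTopForm (U : Set M) (Ω : KForm (V n) n M ℂ) : Prop where
  smooth : SmoothForm U Ω
  type_n0 : ∀ p ∈ U, ∀ (v : Fin n → V n) (j : Fin n),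
    Ω p (Function.update v j (I • v j)) = I * Ω p v
  closed : ∀ p ∈ U, extD Ω p = 0

/-- `(β, Ω)` is a Calabi-Yau structure on `U`: a Kähler form and a holomorphic volume form with
`|Ω(e₁,…,eₙ)|²` equal to the Riemannian volume of `(e₁, I e₁, …, eₙ, I eₙ)`.  The normalisation is
that of `β = (i/2) ∑ dzʲ ∧ dz̄ʲ`, `Ω = dz¹ ∧ … ∧ dzⁿ`; in particular the metric is Ricci-flat. -/
structure IsCalabiYau (U : Set M) (β : KForm (V n) 2 M ℝ) (Ω : KForm (V n) n M ℂ) : Prop where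
  kaehler : IsKaehler U β
  holomorphic : IsHolomorphicTopForm U Ω
  ricciFlat : ∀ p ∈ U,
    ‖Ω p fun j => Pi.single j (1 : ℂ)‖ ^ 2 = Real.sqrt (gram (stdFrame n) (β p)).det

/-- The Riemannian volume measure, on `U`, of the metric `g(u, v) = β(u, I v)`.  In the chart at
`p` it is `√det g` times Lebesgue measure; the supremum glues these local measures, which agree on
overlaps. -/
def volumeMeasure [MeasurableSpace M] (U : Set M) (β : KForm (V n) 2 M ℝ) : Measure M :=
  ⨆ p : M, Measure.map (chartAt (V n) p).symm
    ((volume.restrict ((chartAt (V n) p).target ∩ (chartAt (V n) p).symm ⁻¹' U)).withDensity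
      fun y => ENNReal.ofReal (Real.sqrt (gram (stdFrame n) (inChart p β y)).det))

end Kaehler

/-- The wedge product of three `2`-forms, evaluated on six vectors. -/
def wedge₃ {n : ℕ} (α β γ : V n → V n → ℂ) (v : Fin 6 → V n) : ℂ :=
  (1 / 8 : ℂ) * ∑ s : Equiv.Perm (Fin 6), ((Equiv.Perm.sign s : ℤ) : ℂ) *
    (α (v (s 0)) (v (s 1)) * β (v (s 2)) (v (s 3)) * γ (v (s 4)) (v (s 5)))

/-- The coefficient of the `6`-form `α ∧ β ∧ β` with respect to the Riemannian volume form of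
`g(u, v) = β(u, I v)`, at a point of a complex threefold. -/
def topCoeff (α : V 3 → V 3 → ℂ) (β : V 3 [⋀^Fin 2]→L[ℝ] ℝ) : ℂ :=
  wedge₃ α (fun u v => (β ![u, v] : ℂ)) (fun u v => (β ![u, v] : ℂ))
      (fun a => stdFrame 3 (finProdFinEquiv.symm a)) /
    (Real.sqrt (gram (stdFrame 3) β).det : ℂ)

/-! ### Hermitian metrics on holomorphic bundles, Chern curvature -/

/-- A Hermitian metric on the fibres of `E` (conjugate-linear in the first variable). -/
structure HermitianMetric {X : Type*} (E : X → Type*) [∀ x, AddCommGroup (E x)]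
    [∀ x, Module ℂ (E x)] where
  form : ∀ x, E x →ₗ⋆[ℂ] E x →ₗ[ℂ] ℂ
  herm : ∀ x u v, conj (form x u v) = form x v u
  pos : ∀ x v, v ≠ 0 → 0 < (form x v v).re

section Bundle

variable {n r : ℕ} {X : Type*} [TopologicalSpace X] [ChartedSpace (V n) X]
  {E : X → Type*} [∀ x, AddCommGroup (E x)] [∀ x, Module ℂ (E x)]
  [TopologicalSpace (TotalSpace (V r) E)] [∀ x, TopologicalSpace (E x)]
  [FiberBundle (V r) E]

variable (n r) in
/-- The matrix of `H` at the point with coordinate `y`, in the chart at `p` and the holomorphic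
frame of the preferred local trivialisation at `p`: `H(s, t) = s̄ᵀ G t`. -/
def hermMatrix (H : HermitianMetric E) (p : X) (y : V n) : Matrix (Fin r) (Fin r) ℂ :=
  Matrix.of fun a b =>
    H.form ((chartAt (V n) p).symm y)
      ((trivializationAt (V r) E p).symm _ (Pi.single a (1 : ℂ)))
      ((trivializationAt (V r) E p).symm _ (Pi.single b (1 : ℂ)))

variable (n r) in
/-- The matrix of `H` at `p` itself, in the preferred holomorphic frame at `p`. -/
def hermMatrixAt (H : HermitianMetric E) (p : X) : Matrix (Fin r) (Fin r) ℂ :=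
  hermMatrix n r H p (chartAt (V n) p p)

variable (n r E) in
/-- Coordinates, in the chart at `p`, of the points of `U` over which the preferred chart and the
preferred trivialisation at `p` are both defined. -/
def frameDomain (U : Set X) (p : X) : Set (V n) :=
  (chartAt (V n) p).target ∩
    (chartAt (V n) p).symm ⁻¹' (U ∩ (trivializationAt (V r) E p).baseSet)

variable (n r) in
/-- `H` is smooth over the open set `U`. -/
def SmoothMetric (U : Set X) (H : HermitianMetric E) : Prop :=
  ∀ (p : X) (a b : Fin r),
    ContDiffOn ℝ ∞ (fun y => hermMatrix n r H p y a b) (frameDomain n r E U p)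

variable (n r) in
/-- `(t, x) ↦ H t x` is smooth on `[0, ∞) × U`. -/
def SmoothFamily (U : Set X) (H : ℝ → HermitianMetric E) : Prop :=
  ∀ (p : X) (a b : Fin r),
    ContDiffOn ℝ ∞ (fun q : ℝ × V n => hermMatrix n r (H q.1) p q.2 a b)
      (Ici 0 ×ˢ frameDomain n r E U p)

variable (n r) in
/-- The Chern connection form `A = G⁻¹ ∂G` in the preferred holomorphic frame at `p`. -/
def connForm (H : HermitianMetric E) (p : X) (y v : V n) : Matrix (Fin r) (Fin r) ℂ :=
  (hermMatrix n r H p y)⁻¹ * Matrix.of fun a b =>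
    (1 / 2 : ℂ) * (fderiv ℝ (fun y' => hermMatrix n r H p y' a b) y v
      - I * fderiv ℝ (fun y' => hermMatrix n r H p y' a b) y (I • v))

variable (n r) in
/-- The curvature `F_H = dA + A ∧ A` of the Chern connection at `p`, an endomorphism-valued
`2`-form, written in the preferred frame at `p`. -/
def curvature (H : HermitianMetric E) (p : X) (u v : V n) : Matrix (Fin r) (Fin r) ℂ :=
  let y₀ := chartAt (V n) p p
  Matrix.of (fun a b => fderiv ℝ (fun y => connForm n r H p y v a b) y₀ u
      - fderiv ℝ (fun y => connForm n r H p y u a b) y₀ v)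
    + (connForm n r H p y₀ u * connForm n r H p y₀ v
      - connForm n r H p y₀ v * connForm n r H p y₀ u)

variable (n r) in
/-- `F̂_H = (F_H, β)` at `p`, an endomorphism written in the preferred frame at `p`. -/
def hatF (β : KForm (V n) 2 X ℝ) (H : HermitianMetric E) (p : X) : Matrix (Fin r) (Fin r) ℂ :=
  traceForm (stdFrame n) (β p) (curvature n r H p)

variable (r) in
/-- `H` is Hermitian Yang-Mills over `U`, with respect to the Kähler form `β`. -/
def IsHYM (U : Set X) (β : KForm (V n) 2 X ℝ) (H : HermitianMetric E) : Prop :=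
  ∀ p ∈ U, hatF n r β H p = 0

variable (n r) in
/-- The pointwise norm squared `|F̂_H|²_H = tr (F̂* F̂)`, with `F̂* = G⁻¹ F̂ᴴ G` the `H`-adjoint. -/
def normSqHatF (β : KForm (V n) 2 X ℝ) (H : HermitianMetric E) (p : X) : ℝ :=
  (((hermMatrixAt n r H p)⁻¹ * (hatF n r β H p)ᴴ * hermMatrixAt n r H p
    * hatF n r β H p).trace).re

variable (n r) in
/-- The endomorphism `H⁻¹ ∂H/∂t` at `(t, p)`, in the preferred frame at `p` (`t ≥ 0`). -/
def logVelocity (H : ℝ → HermitianMetric E) (t : ℝ) (p : X) : Matrix (Fin r) (Fin r) ℂ :=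
  (hermMatrixAt n r (H t) p)⁻¹ * Matrix.of fun a b =>
    derivWithin (fun τ => hermMatrixAt n r (H τ) p a b) (Ici 0) t

/-- Uniform convergence on the compact subsets of `U` as `t → ∞`. -/
def ConvergesOn (U : Set X) (H : ℝ → HermitianMetric E) (Hlim : HermitianMetric E) : Prop :=
  ∀ K ⊆ U, IsCompact K → ∀ ε > (0 : ℝ), ∀ᶠ t in atTop, ∀ x ∈ K, ∀ v : E x,
    |((H t).form x v v).re - (Hlim.form x v v).re| ≤ ε * (Hlim.form x v v).re

/-- The two metrics are mutually bounded over `U`, uniformly for `t` in compact intervals. -/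
def BoundedFamily (U : Set X) (H₀ : HermitianMetric E) (H : ℝ → HermitianMetric E) : Prop :=
  ∀ T : ℝ, ∃ C : ℝ, ∀ t ∈ Icc 0 T, ∀ x ∈ U, ∀ v : E x,
    ((H t).form x v v).re ≤ C * (H₀.form x v v).re ∧
      (H₀.form x v v).re ≤ C * ((H t).form x v v).re

end Bundle

/-! ### The asymptotically cylindrical Calabi-Yau threefold -/

section ACyl

variable {X D : Type*} [TopologicalSpace X] [ChartedSpace (V 3) X]
  [TopologicalSpace D] [ChartedSpace (V 2) D]

/-- Coordinates `(y, ζ)`, `ζ = s + iα`, on the cylindrical end: `y` is the coordinate of the chart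
of `D` at `d`, and `z = e^{-ζ}` in the tubular neighbourhood `Θ : D × {|z| < 1} → X`. -/
def cylMap (Θ : D × ℂ → X) (d : D) : V 2 × ℂ → X := fun q =>
  Θ ((chartAt (V 2) d).symm q.1, Complex.exp (-q.2))

/-- `ω_∞ = κ_I + ds ∧ dα` in these coordinates. -/
def omegaInfty (κI : KForm (V 2) 2 D ℝ) (d : D) (q : V 2 × ℂ) (u v : V 2 × ℂ) : ℝ :=
  inChart d κI q.1 ![u.1, v.1] + (u.2.re * v.2.im - u.2.im * v.2.re)

/-- `Ω_∞ = (ds + i dα) ∧ σ` in these coordinates, `σ = κ_J + i κ_K`. -/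
def OmegaInfty (σ : KForm (V 2) 2 D ℂ) (d : D) (q : V 2 × ℂ) (u v w : V 2 × ℂ) : ℂ :=
  u.2 * inChart d σ q.1 ![v.1, w.1] - v.2 * inChart d σ q.1 ![u.1, w.1]
    + w.2 * inChart d σ q.1 ![u.1, v.1]

/-- `f(y, ζ)` and all its derivatives are `O(e^{-rate · s})`, uniformly for `y` in compact parts
of the chart of `D` at `d`. -/
def ExpDecay {𝕜 : Type*} [NormedAddCommGroup 𝕜] [NormedSpace ℝ 𝕜] (rate : ℝ) (d : D)
    (f : V 2 × ℂ → 𝕜) : Prop :=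
  ∀ K ⊆ (chartAt (V 2) d).target, IsCompact K → ∀ m : ℕ, ∃ C : ℝ,
    ∀ y ∈ K, ∀ ζ : ℂ, 1 ≤ ζ.re → ‖iteratedFDeriv ℝ m f (y, ζ)‖ ≤ C * Real.exp (-rate * ζ.re)

variable (X D) in
/-- A base manifold `(X, ω̄, D)`, `X` playing the part of the compactification of `W = X ∖ D`,
with an asymptotically cylindrical Calabi-Yau structure `(ω, Ω)` on `W`. -/
structure ACylCalabiYau where
  /-- the embedding of the divisor at infinity -/
  emb : D → X
  emb_injective : Function.Injective emb
  emb_holo : ContMDiff (modelWithCornersSelf ℂ (V 2)) (modelWithCornersSelf ℂ (V 3)) ω emb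
  /-- the Kähler form of the compactification -/
  omegaBar : KForm (V 3) 2 X ℝ
  omegaBar_kaehler : IsKaehler univ omegaBar
  /-- the tubular neighbourhood of infinity, a real diffeomorphism onto its open image -/
  tube : D × ℂ → X
  tube_smooth : ContMDiffOn ((modelWithCornersSelf ℝ (V 2)).prod (modelWithCornersSelf ℝ ℂ))
    (modelWithCornersSelf ℝ (V 3)) ∞ tube (univ ×ˢ Metric.ball 0 1)
  tube_injOn : InjOn tube (univ ×ˢ Metric.ball 0 1)
  tube_immersion : ∀ q ∈ (univ : Set D) ×ˢ Metric.ball (0 : ℂ) 1, Function.Injective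
    (mfderiv ((modelWithCornersSelf ℝ (V 2)).prod (modelWithCornersSelf ℝ ℂ))
      (modelWithCornersSelf ℝ (V 3)) tube q)
  tube_zero : ∀ x, tube (x, 0) = emb x
  /-- the holomorphic coordinate near the divisor, which it defines -/
  z : X → ℂ
  z_holo : MDifferentiableOn (modelWithCornersSelf ℂ (V 3)) (modelWithCornersSelf ℂ ℂ) z
    (tube '' (univ ×ˢ Metric.ball 0 1))
  z_tube : ∀ x, ∀ w ∈ Metric.ball (0 : ℂ) 1, z (tube (x, w)) = w
  finite_pi1 : ∀ p : {p : X // p ∉ range emb},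
    Finite (FundamentalGroup {p : X // p ∉ range emb} p)
  /-- the Ricci-flat Kähler form of the divisor in the class of `ω̄`, and `σ = κ_J + i κ_K` -/
  kappaI : KForm (V 2) 2 D ℝ
  sigma : KForm (V 2) 2 D ℂ
  divisor_calabiYau : IsCalabiYau univ kappaI sigma
  kappaI_class : ∃ η : KForm (V 2) 1 D ℝ, SmoothForm univ η ∧
    ∀ x, kappaI x = pullback emb omegaBar x + extD η x
  /-- the Calabi-Yau structure of `W` -/
  om : KForm (V 3) 2 X ℝ
  Om : KForm (V 3) 3 X ℂ
  calabiYau : IsCalabiYau (range emb)ᶜ om Om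
  /-- `ω` and `Ω` are exponentially asymptotic, in all derivatives, to `ω_∞` and `Ω_∞` -/
  asymptotic : ∃ rate : ℝ, 0 < rate ∧ ∀ d : D,
    (∀ u v : V 2 × ℂ, ExpDecay rate d fun q =>
      pullback (E := V 2 × ℂ) (M := V 2 × ℂ) (cylMap tube d) om q ![u, v]
        - omegaInfty kappaI d q u v) ∧
    (∀ u v w : V 2 × ℂ, ExpDecay rate d fun q =>
      pullback (E := V 2 × ℂ) (M := V 2 × ℂ) (cylMap tube d) Om q ![u, v, w]
        - OmegaInfty sigma d q u v w)

namespace ACylCalabiYau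

variable (A : ACylCalabiYau X D)

/-- The noncompact threefold `W = X ∖ D`. -/
def W : Set X := (range A.emb)ᶜ

/-- The Riemannian volume measure of `(W, ω)`. -/
def vol [MeasurableSpace X] : Measure X := volumeMeasure A.W A.om

/-- `κ` restricts, on the slice `D_w = {z = w}`, to a Kähler form in the class of `ω̄`; at `w = 0`
this is the Ricci-flat form `κ_I`. -/
structure IsSliceKaehler (w : ℂ) (κ : KForm (V 3) 2 X ℝ) : Prop where
  cohomologous : ∃ η : KForm (V 2) 1 D ℝ, SmoothForm univ η ∧ ∀ x,
    pullback (fun x => A.tube (x, w)) κ x =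
      pullback (fun x => A.tube (x, w)) A.omegaBar x + extD η x
  type11 : ∀ x : D, ∀ u v : V 3,
    mfderiv (modelWithCornersSelf ℂ (V 3)) (modelWithCornersSelf ℂ ℂ) A.z (A.tube (x, w)) u = 0 →
    mfderiv (modelWithCornersSelf ℂ (V 3)) (modelWithCornersSelf ℂ ℂ) A.z (A.tube (x, w)) v = 0 →
    κ (A.tube (x, w)) ![I • u, I • v] = κ (A.tube (x, w)) ![u, v]
  pos : ∀ x : D, ∀ u : V 3, u ≠ 0 →
    mfderiv (modelWithCornersSelf ℂ (V 3)) (modelWithCornersSelf ℂ ℂ) A.z (A.tube (x, w)) u = 0 →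
    0 < κ (A.tube (x, w)) ![u, I • u]
  at_zero : w = 0 → ∀ x, pullback A.emb κ x = A.kappaI x

section Bundle

variable {r : ℕ} {E : X → Type*} [∀ x, AddCommGroup (E x)] [∀ x, Module ℂ (E x)]
  [TopologicalSpace (TotalSpace (V r) E)] [∀ x, TopologicalSpace (E x)]
  [FiberBundle (V r) E]

variable (r) in
/-- The restriction of `H` to the slice `D_w = {z = w}` is Hermitian Yang-Mills with respect to
the restriction of `κ`: `(F_H|_{D_w}, κ|_{D_w}) = 0`. -/
def IsSliceHYM (w : ℂ) (κ : KForm (V 3) 2 X ℝ) (H : HermitianMetric E) : Prop :=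
  ∀ x : D, ∀ u : Fin 2 → V 3, LinearIndependent ℂ u →
    (∀ j, mfderiv (modelWithCornersSelf ℂ (V 3)) (modelWithCornersSelf ℂ ℂ) A.z
      (A.tube (x, w)) (u j) = 0) →
    traceForm (realFrame u) (κ (A.tube (x, w))) (curvature 3 r H (A.tube (x, w))) = 0

variable (r) in
/-- `‖F̂_H‖²_{L²(W)}`. -/
def energy [MeasurableSpace X] (H : HermitianMetric E) : ℝ :=
  ∫ p, normSqHatF 3 r A.om H p ∂A.vol

variable (r) in
/-- Finiteness of `‖F̂_H‖²_{L²(W)}`. -/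
def FiniteEnergy [MeasurableSpace X] (H : HermitianMetric E) : Prop :=
  Integrable (normSqHatF 3 r A.om H) A.vol

variable (r) in
/-- Reference metrics: smooth metrics over the compactification, Hermitian Yang-Mills on the
slices `D_w` for all small `w` (including `D` itself), and of finite energy over `W`. -/
structure IsReferenceMetric [MeasurableSpace X] (H₀ : HermitianMetric E) : Prop where
  smooth : SmoothMetric 3 r univ H₀
  slices : ∃ δ : ℝ, 0 < δ ∧ δ ≤ 1 ∧ ∀ w ∈ Metric.ball (0 : ℂ) δ,
    ∃ κ : KForm (V 3) 2 X ℝ, A.IsSliceKaehler w κ ∧ A.IsSliceHYM r w κ H₀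
  finiteEnergy : A.FiniteEnergy r H₀

variable (r) in
/-- The evolution equation `H⁻¹ ∂H/∂t = -2i F̂_H`, `H(0) = H₀` on `W × [0, ∞)`, for smooth
families which stay at bounded distance from `H₀` over `W × [0, T]` for every finite `T`. -/
structure IsFlow (H₀ : HermitianMetric E) (H : ℝ → HermitianMetric E) : Prop where
  smooth : SmoothFamily 3 r A.W H
  initial : ∀ p ∈ A.W, (H 0).form p = H₀.form p
  bounded : BoundedFamily A.W H₀ H
  evolution : ∀ t, 0 ≤ t → ∀ p ∈ A.W,
    logVelocity 3 r H t p = (-2 * I) • hatF 3 r A.om (H t) p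

variable (r) in
/-- `Φ_t = θ_{H_t}(∂H_t/∂t) = 2i tr (H_t⁻¹ (∂H_t/∂t) F_{H_t})`, a `2`-form on `W`. -/
def Phi (H : ℝ → HermitianMetric E) (t : ℝ) (p : X) (u v : V 3) : ℂ :=
  2 * I * (logVelocity 3 r H t p * curvature 3 r (H t) p u v).trace

variable (r) in
/-- The integrand of `∫_W Φ_t ∧ ω²`, with respect to the volume measure of `(W, ω)`. -/
def rhoDensity (H : ℝ → HermitianMetric E) (t : ℝ) (p : X) : ℂ :=
  topCoeff (Phi r H t p) (A.om p)

variable (r) in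
/-- `(ρ_W)_{H_t}(∂H_t/∂t) = ∫_W Φ_t ∧ ω²`. -/
def rho [MeasurableSpace X] (H : ℝ → HermitianMetric E) (t : ℝ) : ℂ :=
  ∫ p, A.rhoDensity r H t p ∂A.vol

variable (r) in
/-- `N_W(H_T) = ∫₀ᵀ (∫_W Φ_t ∧ ω²) dt`, the integral of `ρ_W` along the path `t ↦ H_t`. -/
def functionalN [MeasurableSpace X] (H : ℝ → HermitianMetric E) (T : ℝ) : ℂ :=
  ∫ t in (0 : ℝ)..T, A.rho r H t

end Bundle

end ACylCalabiYau

end ACyl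

end HYM

end

/-!
The proof is a parabolic comparison argument on the cylindrical end, followed by differentiation
under the integral sign.

*Comparison.* For two families of Hermitian metrics solving the flow up to an error `c φ`, the
function `log (|v|₁² / |v|₂²)` on nonzero vectors satisfies, at a maximum, the inequality of a
subsolution of the heat equation with right-hand side `2 c φ`. A barrier is a function `φ ≥ 0` with
`Δ φ ≤ K φ`, accompanied by an exhaustion function `f` with `Δ f ≤ K`; since the families are
mutually bounded, the term `ε f` keeps the maximum in a compact set, and the logarithm of the ratio
is at most a multiple of `φ` (`logRatio_le_of_isBarrier`). Near the divisor `φ = |z|^{2s}` and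
`f = -log |z|` form a barrier, because the metric is asymptotically cylindrical
(`exists_isBarrier`).

*Decay.* In the frame `∂_y, ∂_s, ∂_α` of the cylinder the curvature of `H₀` extends smoothly to
`z = 0`, where its components along `∂_s, ∂_α` vanish, so that its contraction with `κ_I + ds ∧ dα`
is the contraction on the slice with `κ_I`, which is zero. As `ω` is exponentially close to
`κ_I + ds ∧ dα`, the initial velocity of the flow is `O(φ)` for a suitable `s`
(`exists_quad_hatF_le`). Comparing `H_τ` with the stationary family `H₀`, then `H_{t+τ}` with `H_t`,
and letting `τ → 0`, the velocity is `O(φ)` uniformly on bounded time intervals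
(`exists_abs_quad_hatF_le`). Hence `|F̂|²` is dominated by a multiple of `φ²`, which is integrable
over `W` because `|z|^{4s} = e^{-4s Re ζ}`, for `z = e^{-ζ}`, is integrable over a half-cylinder
(`integrable_sq_modulus`). Pointwise `Φ_t ∧ ω² = -8 |F̂|² dVol` (`IsFlow.rhoDensity_eq`), so the
first two assertions follow from dominated convergence and the fundamental theorem of calculus.

*Limits.* Along the flow the squared length of a local holomorphic section is a subsolution of the
heat equation, and `log det` is a solution. A function of the space variable which is the limit of
subsolutions is subharmonic (`sum_levi_nonneg_of_tendsto`). Applied to sections which are parallel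
at a point, this shows that `-2i F̂` is nonnegative for the limit metric; applied to `± log det`,
that its trace is zero (`traceForm_curv_eq_zero_of_tendsto`). Hence it vanishes
(`isHYM_of_convergesOn`).

Everything is computed in the preferred charts of the manifold and the preferred holomorphic frames
of the bundle. Since the Riemannian metric is `g(u, v) = ω(u, Iv)`, contracting a form of type
`(1, 1)` with `ω` needs only the inverse of the matrix of `ω` in a real frame (`pairing`); this lets
the contraction be computed in a chart, in a unitary frame, or in the frame of the cylinder.
-/

noncomputable section

namespace HYM

set_option linter.unusedSectionVars false

open scoped ComplexOrder
open Matrix (of_apply nonsing_inv_mul_cancel_left mul_nonsing_inv_cancel_left mulVec_mulVec det_mul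
  trace_smul trace_mul_comm nonsing_inv_mul mul_nonsing_inv conjTranspose_smul conjTranspose_mul
  mulVec_smul star_mulVec det_conjTranspose conjTranspose_apply)

/-- Square complex matrices. -/
local notation "𝕄(" r ")" => Matrix (Fin r) (Fin r) ℂ

/-! ### Calculus of matrix-valued functions -/

section MatrixCalculus

variable {F : Type*} [NormedAddCommGroup F] [NormedSpace ℝ F] {r : ℕ}

/-- Entrywise `C^k` regularity at a point of a matrix-valued function. -/
def SmoothMatAt (k : ℕ∞ω) (A : F → 𝕄(r)) (y : F) : Prop :=
  ∀ a b, ContDiffAt ℝ k (fun x => A x a b) y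

/-- Entrywise directional derivative of a matrix-valued function. -/
def dmat (A : F → 𝕄(r)) (y u : F) : 𝕄(r) :=
  Matrix.of fun a b => fderiv ℝ (fun x => A x a b) y u

variable {A B : F → 𝕄(r)} {y : F} {k : ℕ∞ω}

theorem SmoothMatAt.mono {l : ℕ∞ω} (h : SmoothMatAt k A y) (hl : l ≤ k) : SmoothMatAt l A y :=
  fun a b => (h a b).of_le hl

theorem SmoothMatAt.mul (hA : SmoothMatAt k A y) (hB : SmoothMatAt k B y) :
    SmoothMatAt k (fun x => A x * B x) y := fun a b => by
  simp only [Matrix.mul_apply]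
  exact ContDiffAt.sum fun i _ => (hA a i).mul (hB i b)

theorem SmoothMatAt.conjTranspose (hA : SmoothMatAt k A y) :
    SmoothMatAt k (fun x => (A x)ᴴ) y := fun a b => by
  simp only [conjTranspose_apply]
  exact Complex.conjCLE.contDiff.contDiffAt.comp y (hA b a)

theorem SmoothMatAt.congr (hA : SmoothMatAt k A y) (h : ∀ᶠ x in 𝓝 y, B x = A x) :
    SmoothMatAt k B y := fun a b =>
  (hA a b).congr_of_eventuallyEq (h.mono fun x hx => by simp [hx])

theorem contDiffWithinAt_matrix_det {ι : Type*} [Fintype ι] [DecidableEq ι] {s : Set F}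
    {A : F → Matrix ι ι ℂ}
    (hA : ∀ a b, ContDiffWithinAt ℝ k (fun x => A x a b) s y) :
    ContDiffWithinAt ℝ k (fun x => (A x).det) s y := by
  simp only [Matrix.det_apply]
  refine ContDiffWithinAt.sum fun σ _ => ?_
  have := contDiffWithinAt_prod (𝕜 := ℝ) (n := k) (s := s) (x := y)
    (t := Finset.univ) (f := fun i x => A x (σ i) i) (fun i _ => hA (σ i) i)
  simp only [Units.smul_def, zsmul_eq_mul]
  exact contDiffWithinAt_const.mul this

theorem contDiffWithinAt_matrix_inv {ι : Type*} [Fintype ι] [DecidableEq ι] {s : Set F}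
    {A : F → Matrix ι ι ℂ}
    (hA : ∀ a b, ContDiffWithinAt ℝ k (fun x => A x a b) s y) (hd : (A y).det ≠ 0) (a b : ι) :
    ContDiffWithinAt ℝ k (fun x => (A x)⁻¹ a b) s y := by
  simp only [Matrix.inv_def, Matrix.smul_apply, Ring.inverse_eq_inv', smul_eq_mul]
  refine ((contDiffWithinAt_matrix_det hA).inv hd).mul ?_
  simp only [Matrix.adjugate_apply]
  refine contDiffWithinAt_matrix_det fun i j => ?_
  simp only [Matrix.updateRow_apply]
  split_ifs
  · exact contDiffWithinAt_const
  · exact hA i j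

theorem SmoothMatAt.inv (hA : SmoothMatAt k A y) (hd : (A y).det ≠ 0) :
    SmoothMatAt k (fun x => (A x)⁻¹) y := fun a b => by
  rw [← contDiffWithinAt_univ]
  exact contDiffWithinAt_matrix_inv (fun a b => (hA a b).contDiffWithinAt) hd a b

theorem SmoothMatAt.differentiableAt (hA : SmoothMatAt k A y) (hk : k ≠ 0) (a b : Fin r) :
    DifferentiableAt ℝ (fun x => A x a b) y := (hA a b).differentiableAt hk

theorem SmoothMatAt.dmat {l : ℕ∞ω} (hA : SmoothMatAt k A y) (hl : l + 1 ≤ k) (u : F) :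
    SmoothMatAt l (fun x => dmat A x u) y := fun a b => by
  have := (hA a b).fderiv_right (m := l) hl
  exact this.clm_apply contDiffAt_const

theorem SmoothMatAt.eventually (hA : SmoothMatAt k A y) (hk : k ≠ ∞) :
    ∀ᶠ x in 𝓝 y, SmoothMatAt k A x := by
  simp only [SmoothMatAt, eventually_all]
  exact fun a b => (hA a b).eventually hk

theorem SmoothMatAt.eventually_det_ne_zero (hA : SmoothMatAt k A y) (hd : (A y).det ≠ 0) :
    ∀ᶠ x in 𝓝 y, (A x).det ≠ 0 := by
  have h : ContDiffWithinAt ℝ k (fun x => (A x).det) univ y :=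
    contDiffWithinAt_matrix_det fun a b => (hA a b).contDiffWithinAt
  rw [contDiffWithinAt_univ] at h
  exact h.continuousAt.eventually_ne hd

theorem SmoothMatAt.comp {F' : Type*} [NormedAddCommGroup F'] [NormedSpace ℝ F'] {f : F' → F}
    {x : F'} (hA : SmoothMatAt k A (f x)) (hf : ContDiffAt ℝ k f x) :
    SmoothMatAt k (fun x => A (f x)) x := fun a b => (hA a b).comp x hf

theorem dmat_mul (hA : SmoothMatAt 1 A y) (hB : SmoothMatAt 1 B y) (u : F) :
    dmat (fun x => A x * B x) y u = dmat A y u * B y + A y * dmat B y u := by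
  ext a b
  simp only [dmat, Matrix.mul_apply, of_apply, Matrix.add_apply]
  rw [fderiv_fun_sum (A := fun i x => A x a i * B x i b) fun i _ =>
    (hA.differentiableAt one_ne_zero a i).mul (hB.differentiableAt one_ne_zero i b)]
  rw [sum_apply, ← Finset.sum_add_distrib]
  refine Finset.sum_congr rfl fun i _ => ?_
  rw [fderiv_fun_mul (hA.differentiableAt one_ne_zero a i) (hB.differentiableAt one_ne_zero i b)]
  simp only [add_apply, smul_apply, smul_eq_mul]
  ring

theorem dmat_conjTranspose (u : F) :
    dmat (fun x => (A x)ᴴ) y u = (dmat A y u)ᴴ := by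
  ext a b
  simp only [dmat, conjTranspose_apply, of_apply]
  have := Complex.conjCLE.comp_fderiv (f := fun x => A x b a) (x := y)
  exact congrArg (fun L : F →L[ℝ] ℂ => L u) this

theorem dmat_comp {F' : Type*} [NormedAddCommGroup F'] [NormedSpace ℝ F'] {f : F' → F}
    {x : F'} (hA : SmoothMatAt 1 A (f x)) (hf : DifferentiableAt ℝ f x) (u : F') :
    dmat (fun x => A (f x)) x u = dmat A (f x) (fderiv ℝ f x u) := by
  ext a b
  simp only [dmat, of_apply]
  have := fderiv_comp x (hA.differentiableAt one_ne_zero a b) hf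
  exact congrArg (fun L : F' →L[ℝ] ℂ => L u) this

theorem dmat_congr (h : ∀ᶠ x in 𝓝 y, A x = B x) (u : F) : dmat A y u = dmat B y u := by
  ext a b
  simp only [dmat, of_apply]
  rw [Filter.EventuallyEq.fderiv_eq (f₁ := fun x => A x a b) (f := fun x => B x a b)
    (h.mono fun x hx => by simp [hx])]

theorem dmat_add (hA : SmoothMatAt 1 A y) (hB : SmoothMatAt 1 B y) (u : F) :
    dmat (fun x => A x + B x) y u = dmat A y u + dmat B y u := by
  ext a b
  simp only [dmat, of_apply, Matrix.add_apply]
  rw [fderiv_fun_add (hA.differentiableAt one_ne_zero a b) (hB.differentiableAt one_ne_zero a b)]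
  rfl

theorem dmat_const_smul (c : ℂ) (u : F) (hA : SmoothMatAt 1 A y) :
    dmat (fun x => c • A x) y u = c • dmat A y u := by
  ext a b
  simp only [dmat, of_apply, Matrix.smul_apply]
  rw [fderiv_fun_const_smul (hA.differentiableAt one_ne_zero a b)]
  rfl

theorem dmat_dmat_comm (hA : SmoothMatAt 2 A y) (u v : F) :
    dmat (fun x => dmat A x u) y v = dmat (fun x => dmat A x v) y u := by
  ext a b
  simp only [dmat, of_apply]
  have hs := (hA a b).isSymmSndFDerivAt (by simp)
  have hd : DifferentiableAt ℝ (fderiv ℝ (fun x => A x a b)) y :=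
    ((hA a b).fderiv_right (m := 1) (by norm_num)).differentiableAt one_ne_zero
  rw [fderiv_clm_apply hd (differentiableAt_const _), fderiv_clm_apply hd (differentiableAt_const _)]
  simpa using hs.eq v u

end MatrixCalculus

/-! ### The Chern connection in a holomorphic frame -/

section Chern

variable {n r : ℕ}

/-- The `(1,0)`-derivative `∂_u = ½ (D_u - i D_{Iu})` of a matrix-valued function on `ℂⁿ`. -/
def wirt (G : V n → 𝕄(r)) (y u : V n) :
    𝕄(r) :=
  Matrix.of fun a b => (1 / 2 : ℂ) * (fderiv ℝ (fun x => G x a b) y u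
      - I * fderiv ℝ (fun x => G x a b) y (I • u))

/-- The Chern connection form `G⁻¹ ∂G` of a Hermitian metric with matrix `G` in a holomorphic
frame. -/
def conn (G : V n → 𝕄(r)) (y u : V n) :
    𝕄(r) := (G y)⁻¹ * wirt G y u

/-- The curvature `dA + A ∧ A` of the Chern connection form `A = G⁻¹ ∂G`. -/
def curv (G : V n → 𝕄(r)) (y u v : V n) :
    𝕄(r) :=
  Matrix.of (fun a b => fderiv ℝ (fun x => conn G x v a b) y u
      - fderiv ℝ (fun x => conn G x u a b) y v)
    + (conn G y u * conn G y v - conn G y v * conn G y u)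

/-- `D_b D_b f + D_{Ib} D_{Ib} f`, the Laplacian of `f` along the complex line spanned by `b`. -/
def levi {F : Type*} [NormedAddCommGroup F] [NormedSpace ℝ F]
    (f : V n → F) (y b : V n) : F :=
  fderiv ℝ (fun x => fderiv ℝ f x b) y b + fderiv ℝ (fun x => fderiv ℝ f x (I • b)) y (I • b)

variable {G : V n → 𝕄(r)} {y : V n}

theorem wirt_eq (u : V n) : wirt G y u = (1 / 2 : ℂ) • (dmat G y u - I • dmat G y (I • u)) := by
  ext a b; simp [wirt, dmat]

theorem curv_eq (u v : V n) : curv G y u v = dmat (fun x => conn G x v) y u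
    - dmat (fun x => conn G x u) y v
    + (conn G y u * conn G y v - conn G y v * conn G y u) := rfl

theorem curv_antisymm (u v : V n) : curv G y u v = - curv G y v u := by
  rw [curv_eq, curv_eq]; abel

theorem dmat_neg_right (u : V n) : dmat G y (-u) = - dmat G y u := by ext a b; simp [dmat]

theorem wirt_I_smul (u : V n) : wirt G y (I • u) = I • wirt G y u := by
  rw [wirt_eq, wirt_eq, smul_smul, I_mul_I, neg_one_smul, dmat_neg_right]
  ext a b
  simp only [Matrix.smul_apply, Matrix.sub_apply, Matrix.neg_apply, smul_eq_mul]
  linear_combination (-(1/2 : ℂ) * dmat G y u a b + 1/2 * dmat G y u a b + 1/2 * dmat G y (I • u) a b) * I_mul_I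

theorem conn_I_smul (u : V n) : conn G y (I • u) = I • conn G y u := by
  rw [conn, conn, wirt_I_smul, Matrix.mul_smul]

theorem SmoothMatAt.wirt {k l : ℕ∞ω} (hG : SmoothMatAt k G y) (hl : l + 1 ≤ k) (u : V n) :
    SmoothMatAt l (fun x => wirt G x u) y := by
  intro a b
  simp only [wirt_eq, Matrix.smul_apply, Matrix.sub_apply, smul_eq_mul]
  exact contDiffAt_const.mul ((hG.dmat hl u a b).sub (contDiffAt_const.mul (hG.dmat hl _ a b)))

theorem SmoothMatAt.conn {k l : ℕ∞ω} (hG : SmoothMatAt k G y) (hl : l + 1 ≤ k)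
    (hd : (G y).det ≠ 0) (u : V n) :
    SmoothMatAt l (fun x => conn G x u) y :=
  ((hG.mono (le_trans le_self_add hl)).inv hd).mul (hG.wirt hl u)

theorem mul_conn (hd : (G y).det ≠ 0) (u : V n) : G y * conn G y u = wirt G y u := by
  rw [conn, mul_nonsing_inv_cancel_left _ _ (isUnit_iff_ne_zero.2 hd)]

theorem dmat_isHermitian (hh : ∀ᶠ x in 𝓝 y, (G x).IsHermitian) (u : V n) :
    (dmat G y u).IsHermitian := by
  rw [Matrix.IsHermitian, ← dmat_conjTranspose]
  exact dmat_congr hh u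

/-- Along a complex line the curvature of the Chern connection is
`G · (-2i F(b, Ib)) = Δ_b G - 4 (∂_b G)ᴴ G⁻¹ ∂_b G`. -/
theorem mul_curv_line (hG : SmoothMatAt 2 G y) (hd : (G y).det ≠ 0)
    (hh : ∀ᶠ x in 𝓝 y, (G x).IsHermitian) (b : V n) :
    G y * ((-2 * I) • curv G y b (I • b)) =
      (dmat (fun x => dmat G x b) y b + dmat (fun x => dmat G x (I • b)) y (I • b))
        - (4 : ℂ) • ((wirt G y b)ᴴ * (G y)⁻¹ * wirt G y b) := by
  have h1 : ∀ u, G y * dmat (fun x => conn G x b) y u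
      = dmat (fun x => wirt G x b) y u - dmat G y u * conn G y b := by
    intro u
    have e : ∀ᶠ x in 𝓝 y, wirt G x b = G x * conn G x b := by
      filter_upwards [hG.eventually_det_ne_zero hd] with x hx
      exact (mul_conn hx b).symm
    rw [dmat_congr e u, dmat_mul (hG.mono (by norm_num))
      (hG.conn (by norm_num) hd b)]
    abel
  have h2 : ∀ u, dmat (fun x => wirt G x b) y u = (1 / 2 : ℂ) •
      (dmat (fun x => dmat G x b) y u - I • dmat (fun x => dmat G x (I • b)) y u) := by
    intro u
    ext a c
    have d1 := (hG.dmat (l := 1) (by norm_num) b).differentiableAt one_ne_zero a c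
    have d2 := (hG.dmat (l := 1) (by norm_num) (I • b)).differentiableAt one_ne_zero a c
    have : (fun x => wirt G x b a c) = fun x => (1 / 2 : ℂ) •
        (dmat G x b a c - I • dmat G x (I • b) a c) := by
      ext x; simp [wirt_eq]
    show fderiv ℝ (fun x => wirt G x b a c) y u = _
    have e := ((d1.hasFDerivAt.sub (d2.hasFDerivAt.const_smul I)).const_smul (1 / 2 : ℂ)).fderiv
    rw [this]
    exact congrArg (fun L : V n →L[ℝ] ℂ => L u) e
  have h3 : dmat (fun x => conn G x (I • b)) y b = I • dmat (fun x => conn G x b) y b := by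
    rw [← dmat_const_smul I b (hG.conn (by norm_num) hd b)]
    exact dmat_congr (Eventually.of_forall fun x => conn_I_smul b) b
  have h4 : (wirt G y b)ᴴ = (1 / 2 : ℂ) • (dmat G y b + I • dmat G y (I • b)) := by
    rw [wirt_eq, conjTranspose_smul, Matrix.conjTranspose_sub, conjTranspose_smul,
      (dmat_isHermitian hh b).eq, (dmat_isHermitian hh (I • b)).eq]
    simp [sub_eq_add_neg]
  have h5 := dmat_dmat_comm hG b (I • b)
  have h6 : (wirt G y b)ᴴ * (G y)⁻¹ * wirt G y b = (wirt G y b)ᴴ * conn G y b := by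
    rw [conn, mul_assoc]
  rw [curv_eq, h3, conn_I_smul, Matrix.mul_smul (conn G y b), Matrix.smul_mul, sub_self, add_zero,
    Matrix.mul_smul, mul_sub, Matrix.mul_smul, h1, h1, h2, h2, h6, h4, ← h5]
  simp only [smul_sub, Matrix.smul_mul, add_mul, smul_add, smul_smul]
  have i2 : I * I = -1 := I_mul_I
  ext a c
  simp only [Matrix.sub_apply, Matrix.add_apply, Matrix.smul_apply, smul_eq_mul]
  linear_combination (2 * (dmat G y b * conn G y b) a c
    - dmat (fun x => dmat G x b) y b a c + I * dmat (fun x => dmat G x b) y (I • b) a c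
    - dmat (fun x => dmat G x (I • b)) y (I • b) a c) * i2

end Chern

/-! ### Change of holomorphic frame and coordinates -/

section Gauge

variable {n r : ℕ} {G G' τ : V n → 𝕄(r)} {φ : V n → V n} {y : V n}

/-- The connection form is real-linear in the direction, with coefficients which lose one derivative
of the metric. -/
theorem exists_clm_conn {k l : ℕ∞ω} (hG : SmoothMatAt k G y) (hl : l + 1 ≤ k)
    (hd : (G y).det ≠ 0) (a b : Fin r) :
    ∃ L : V n → (V n →L[ℝ] ℂ), ContDiffAt ℝ l L y ∧ ∀ x v, conn G x v a b = L x v := by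
  let J : V n →L[ℝ] V n := (I • ContinuousLinearMap.id ℂ (V n)).restrictScalars ℝ
  let Q : (V n →L[ℝ] ℂ) →L[ℝ] (V n →L[ℝ] ℂ) :=
    (1 / 2 : ℂ) • (ContinuousLinearMap.id ℝ _ - I • (ContinuousLinearMap.compL ℝ (V n) (V n) ℂ).flip J)
  refine ⟨fun x => ∑ c, (G x)⁻¹ a c • Q (fderiv ℝ (fun x => G x c b) x), ?_, fun x v => ?_⟩
  · refine ContDiffAt.sum fun c _ => ?_
    exact ((hG.mono (le_trans le_self_add hl)).inv hd a c).smul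
      (Q.contDiff.contDiffAt.comp y ((hG c b).fderiv_right hl))
  · have hQ : ∀ (T : V n →L[ℝ] ℂ) v, Q T v = (1 / 2 : ℂ) * (T v - I * T (I • v)) :=
      fun _ _ => rfl
    rw [sum_apply, conn, Matrix.mul_apply]
    refine Finset.sum_congr rfl fun c _ => ?_
    rw [smul_apply, hQ]
    rfl

/-- Transformation law of the Chern connection under a holomorphic change of frame `τ` and of
coordinates `φ`. -/
theorem conn_gauge (hG : SmoothMatAt 2 G (φ y)) (hd : (G (φ y)).det ≠ 0)
    (hτ : SmoothMatAt 2 τ y) (hτd : (τ y).det ≠ 0) (hφ : ContDiffAt ℝ 2 φ y)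
    (hτI : ∀ᶠ x in 𝓝 y, ∀ u, dmat τ x (I • u) = I • dmat τ x u)
    (hφI : ∀ᶠ x in 𝓝 y, ∀ u, fderiv ℝ φ x (I • u) = I • fderiv ℝ φ x u)
    (hG' : ∀ᶠ x in 𝓝 y, G' x = (τ x)ᴴ * G (φ x) * τ x) :
    ∀ᶠ x in 𝓝 y, ∀ u, τ x * conn G' x u
      = conn G (φ x) (fderiv ℝ φ x u) * τ x + dmat τ x u := by
  have e1 := hφ.continuousAt.eventually (hG.eventually (by simp))
  have e2 := hφ.continuousAt.eventually (hG.eventually_det_ne_zero hd)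
  filter_upwards [hG'.eventually_nhds, hτI, hφI, hτ.eventually (by simp),
    hτ.eventually_det_ne_zero hτd, hφ.eventually (by simp), e1, e2]
    with x hx hτx hφx sτ dτ sφ sG dG u
  have sφ1 : DifferentiableAt ℝ φ x := sφ.differentiableAt two_ne_zero
  have sτ1 : SmoothMatAt 1 τ x := sτ.mono (by norm_num)
  have sG1 : SmoothMatAt 1 G (φ x) := sG.mono (by norm_num)
  have sGφ : SmoothMatAt 1 (fun x => G (φ x)) x := sG1.comp (sφ.of_le (by norm_num))
  have key : ∀ u, dmat G' x u = (dmat τ x u)ᴴ * G (φ x) * τ x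
      + (τ x)ᴴ * dmat G (φ x) (fderiv ℝ φ x u) * τ x + (τ x)ᴴ * G (φ x) * dmat τ x u := by
    intro u
    rw [dmat_congr hx, dmat_mul (sτ1.conjTranspose.mul sGφ) sτ1, dmat_mul sτ1.conjTranspose sGφ,
      dmat_conjTranspose, dmat_comp sG1 sφ1, add_mul]
  have hw : wirt G' x u = (τ x)ᴴ * wirt G (φ x) (fderiv ℝ φ x u) * τ x
      + (τ x)ᴴ * G (φ x) * dmat τ x u := by
    rw [wirt_eq, wirt_eq, key, key, hτx, hφx, conjTranspose_smul]
    simp only [Matrix.mul_smul, Matrix.smul_mul, mul_sub, sub_mul]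
    ext a b
    simp only [Matrix.sub_apply, Matrix.add_apply, Matrix.smul_apply, smul_eq_mul, star_def, conj_I]
    linear_combination (1 / 2 * ((dmat τ x u)ᴴ * G (φ x) * τ x) a b
      - 1 / 2 * ((τ x)ᴴ * G (φ x) * dmat τ x u) a b) * I_mul_I
  have hτu : IsUnit (τ x).det := isUnit_iff_ne_zero.2 dτ
  have hτu' : IsUnit (τ x)ᴴ.det := by rw [det_conjTranspose]; exact hτu.star
  have hGu : IsUnit (G (φ x)).det := isUnit_iff_ne_zero.2 dG
  have hinv : (G' x)⁻¹ = (τ x)⁻¹ * ((G (φ x))⁻¹ * ((τ x)ᴴ)⁻¹) := by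
    rw [hx.self_of_nhds, Matrix.mul_inv_rev, Matrix.mul_inv_rev]
  rw [conn, conn, hinv, hw]
  rw [mul_assoc (τ x)⁻¹, mul_nonsing_inv_cancel_left _ _ hτu, mul_add,
    mul_assoc (G (φ x))⁻¹, mul_assoc (G (φ x))⁻¹, mul_assoc (τ x)ᴴ,
    mul_assoc (τ x)ᴴ, nonsing_inv_mul_cancel_left _ _ hτu',
    nonsing_inv_mul_cancel_left _ _ hτu', nonsing_inv_mul_cancel_left _ _ hGu,
    mul_assoc]

/-- The curvature of the Chern connection is tensorial: it is conjugated by a holomorphic change of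
frame `τ`, and pulled back by a holomorphic change of coordinates `φ`. -/
theorem curv_gauge (hG : SmoothMatAt 2 G (φ y)) (hd : (G (φ y)).det ≠ 0)
    (hτ : SmoothMatAt 2 τ y) (hτd : (τ y).det ≠ 0) (hφ : ContDiffAt ℝ 2 φ y)
    (hτI : ∀ᶠ x in 𝓝 y, ∀ u, dmat τ x (I • u) = I • dmat τ x u)
    (hφI : ∀ᶠ x in 𝓝 y, ∀ u, fderiv ℝ φ x (I • u) = I • fderiv ℝ φ x u)
    (hG' : ∀ᶠ x in 𝓝 y, G' x = (τ x)ᴴ * G (φ x) * τ x) (u v : V n) :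
    τ y * curv G' y u v = curv G (φ y) (fderiv ℝ φ y u) (fderiv ℝ φ y v) * τ y := by
  have hc := conn_gauge hG hd hτ hτd hφ hτI hφI hG'
  have sGφ : SmoothMatAt 2 (fun x => G (φ x)) y := hG.comp hφ
  have sG' : SmoothMatAt 2 G' y := ((hτ.conjTranspose.mul sGφ).mul hτ).congr hG'
  have dG' : (G' y).det ≠ 0 := by
    rw [hG'.self_of_nhds]; simp [hτd, hd]
  have sτ1 : SmoothMatAt 1 τ y := hτ.mono (by norm_num)
  choose L hL1 hL2 using exists_clm_conn (l := 1) hG (by norm_num) hd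
  have dφ : DifferentiableAt ℝ φ y := hφ.differentiableAt two_ne_zero
  have dφ' : DifferentiableAt ℝ (fderiv ℝ φ) y :=
    (hφ.fderiv_right (m := 1) (by norm_num)).differentiableAt one_ne_zero
  -- the pulled-back connection form and its derivative
  have sB : ∀ u, SmoothMatAt 1 (fun x => conn G (φ x) (fderiv ℝ φ x u)) y := fun u a b => by
    simp only [hL2]
    exact ((hL1 a b).comp y (hφ.of_le (by norm_num))).clm_apply
      ((hφ.fderiv_right (m := 1) (by norm_num)).clm_apply contDiffAt_const)
  have hB : ∀ w u, dmat (fun x => conn G (φ x) (fderiv ℝ φ x u)) y w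
      = dmat (fun x => conn G x (fderiv ℝ φ y u)) (φ y) (fderiv ℝ φ y w)
        + conn G (φ y) (fderiv ℝ (fderiv ℝ φ) y w u) := by
    intro w u
    ext a b
    simp only [dmat, of_apply, Matrix.add_apply, hL2]
    have hLφ : DifferentiableAt ℝ (fun x => L a b (φ x)) y :=
      ((hL1 a b).differentiableAt one_ne_zero).comp y dφ
    have hLφ' : fderiv ℝ (fun x => L a b (φ x)) y w
        = fderiv ℝ (L a b) (φ y) (fderiv ℝ φ y w) := by
      have := fderiv_comp y ((hL1 a b).differentiableAt one_ne_zero) dφ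
      exact congrArg (fun M : V n →L[ℝ] (V n →L[ℝ] ℂ) => M w) this
    have hu : DifferentiableAt ℝ (fun x => fderiv ℝ φ x u) y :=
      dφ'.clm_apply (differentiableAt_const _)
    rw [fderiv_clm_apply hLφ hu, fderiv_clm_apply ((hL1 a b).differentiableAt one_ne_zero)
      (differentiableAt_const _), fderiv_clm_apply dφ' (differentiableAt_const _)]
    simp [hLφ', add_comm]
  have hsymm : fderiv ℝ (fderiv ℝ φ) y u v = fderiv ℝ (fderiv ℝ φ) y v u :=
    (hφ.isSymmSndFDerivAt (by simp)).eq u v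
  have hD : ∀ w u, τ y * dmat (fun x => conn G' x u) y w
      = dmat (fun x => conn G (φ x) (fderiv ℝ φ x u)) y w * τ y
        + conn G (φ y) (fderiv ℝ φ y u) * dmat τ y w + dmat (fun x => dmat τ x u) y w
        - dmat τ y w * conn G' y u := by
    intro w u
    have := dmat_congr (hc.mono fun x hx => hx u) w
    rw [dmat_mul sτ1 (sG'.conn (by norm_num) dG' u),
      dmat_add ((sB u).mul sτ1) (hτ.dmat (by norm_num) u), dmat_mul (sB u) sτ1] at this
    rw [← this]; abel
  have hc0 := hc.self_of_nhds
  have hq : ∀ w u, τ y * (conn G' y w * conn G' y u)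
      = conn G (φ y) (fderiv ℝ φ y w) * conn G (φ y) (fderiv ℝ φ y u) * τ y
        + conn G (φ y) (fderiv ℝ φ y w) * dmat τ y u + dmat τ y w * conn G' y u := by
    intro w u
    rw [← mul_assoc, hc0, add_mul, mul_assoc, hc0, mul_add,
      mul_assoc]
  rw [curv_eq, curv_eq, mul_add, mul_sub, mul_sub, hD, hD, hq, hq, hB, hB,
    hsymm, dmat_dmat_comm hτ u v]
  simp only [add_mul, sub_mul]
  abel

end Gauge

/-! ### Second derivatives along complex lines -/

section Levi

variable {n r : ℕ} {G : V n → 𝕄(r)} {y : V n}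

/-- The second derivative test at a local maximum. -/
theorem IsLocalMax_fderiv_fderiv_nonpos {F : Type*} [NormedAddCommGroup F] [NormedSpace ℝ F]
    {f : F → ℝ} {y : F} (hf : ContDiffAt ℝ 2 f y) (hm : IsLocalMax f y) (b : F) :
    fderiv ℝ (fun x => fderiv ℝ f x b) y b ≤ 0 := by
  by_contra! hpos
  let g : ℝ → ℝ := fun s => f (y + s • b)
  have hline : ∀ s, HasDerivAt (fun s : ℝ => y + s • b) b s := fun s => by
    simpa using ((hasDerivAt_id s).smul_const b).const_add y
  have hc : ContinuousAt (fun s : ℝ => y + s • b) 0 := (hline 0).continuousAt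
  have hc' : Tendsto (fun s : ℝ => y + s • b) (𝓝 0) (𝓝 y) := by simpa using hc.tendsto
  have h1 : ∀ᶠ s in 𝓝 (0 : ℝ), deriv g s = fderiv ℝ f (y + s • b) b := by
    filter_upwards [hc'.eventually (hf.eventually (by simp))] with s hs
    exact ((hs.differentiableAt two_ne_zero).hasFDerivAt.comp_hasDerivAt s (hline s)).deriv
  have h2 : deriv (deriv g) 0 = fderiv ℝ (fun x => fderiv ℝ f x b) y b := by
    rw [Filter.EventuallyEq.deriv_eq h1]
    have hd : DifferentiableAt ℝ (fun x => fderiv ℝ f x b) (y + (0 : ℝ) • b) := by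
      rw [zero_smul, add_zero]
      exact ((hf.fderiv_right (m := 1) (by norm_num)).differentiableAt one_ne_zero).clm_apply
        (differentiableAt_const _)
    have := (hd.hasFDerivAt.comp_hasDerivAt 0 (hline 0)).deriv
    simpa [Function.comp_def] using this
  have hm' : IsLocalMax g 0 := by
    have : ∀ᶠ s in 𝓝 (0 : ℝ), f (y + s • b) ≤ f y := hc'.eventually hm
    simpa [IsLocalMax, IsMaxFilter, g] using this
  have hd0 : deriv g 0 = 0 := hm'.deriv_eq_zero
  have hgc : ContinuousAt g 0 :=
    ContinuousAt.comp (f := fun s : ℝ => y + s • b) (g := f) (by simpa using hf.continuousAt) hc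
  have hmin := isLocalMin_of_deriv_deriv_pos (h2 ▸ hpos) hd0 hgc
  -- a function with a local maximum and a local minimum is locally constant
  have hconst : ∀ᶠ s in 𝓝 (0 : ℝ), g s = g 0 := by
    filter_upwards [hm', hmin] with s h1 h2 using le_antisymm h1 h2
  have hd1 : deriv (deriv g) 0 = 0 := by
    have : deriv g =ᶠ[𝓝 0] fun _ => 0 := by
      filter_upwards [hconst.eventually_nhds] with s hs
      rw [Filter.EventuallyEq.deriv_eq (f := fun _ => g 0) hs, deriv_const]
    rw [this.deriv_eq, deriv_const]
  rw [h2] at hd1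
  exact hpos.ne' hd1

theorem IsLocalMax_levi_nonpos {f : V n → ℝ} (hf : ContDiffAt ℝ 2 f y) (hm : IsLocalMax f y)
    (b : V n) : levi f y b ≤ 0 :=
  add_nonpos (IsLocalMax_fderiv_fderiv_nonpos hf hm b) (IsLocalMax_fderiv_fderiv_nonpos hf hm _)

theorem levi_congr {F : Type*} [NormedAddCommGroup F] [NormedSpace ℝ F] {f g : V n → F}
    (h : f =ᶠ[𝓝 y] g) (b : V n) : levi f y b = levi g y b := by
  have : ∀ u, (fun x => fderiv ℝ f x u) =ᶠ[𝓝 y] fun x => fderiv ℝ g x u := fun u => by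
    filter_upwards [h.eventually_nhds] with x hx
    rw [Filter.EventuallyEq.fderiv_eq hx]
  rw [levi, levi, (this b).fderiv_eq, (this (I • b)).fderiv_eq]

theorem ContDiffAt.differentiableAt_fderiv_apply {E F : Type*} [NormedAddCommGroup E]
    [NormedSpace ℝ E] [NormedAddCommGroup F] [NormedSpace ℝ F] {f : E → F} {y : E}
    (hf : ContDiffAt ℝ 2 f y) (u : E) :
    DifferentiableAt ℝ (fun x => fderiv ℝ f x u) y :=
  ((hf.fderiv_right (m := 1) (by norm_num)).differentiableAt one_ne_zero).clm_apply
    (differentiableAt_const _)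

theorem levi_clm_comp {F F' : Type*} [NormedAddCommGroup F] [NormedSpace ℝ F]
    [NormedAddCommGroup F'] [NormedSpace ℝ F'] (T : F →L[ℝ] F') {f : V n → F}
    (hf : ContDiffAt ℝ 2 f y) (b : V n) : levi (fun x => T (f x)) y b = T (levi f y b) := by
  have : ∀ u, (fun x => fderiv ℝ (fun x => T (f x)) x u) =ᶠ[𝓝 y] fun x => T (fderiv ℝ f x u) :=
    fun u => by
      filter_upwards [hf.eventually (by simp)] with x hx
      exact congrArg (fun M : V n →L[ℝ] F' => M u)
        (T.hasFDerivAt.comp x (hx.differentiableAt two_ne_zero).hasFDerivAt).fderiv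
  have h2 : ∀ u, fderiv ℝ (fun x => T (fderiv ℝ f x u)) y = T.comp (fderiv ℝ (fun x => fderiv ℝ f x u) y) :=
    fun u =>
      (T.hasFDerivAt.comp y (ContDiffAt.differentiableAt_fderiv_apply hf u).hasFDerivAt).fderiv
  rw [levi, levi, (this b).fderiv_eq, (this (I • b)).fderiv_eq, h2, h2]
  simp

theorem levi_add {F : Type*} [NormedAddCommGroup F] [NormedSpace ℝ F] {f g : V n → F}
    (hf : ContDiffAt ℝ 2 f y) (hg : ContDiffAt ℝ 2 g y) (b : V n) :
    levi (fun x => f x + g x) y b = levi f y b + levi g y b := by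
  have := levi_clm_comp (ContinuousLinearMap.fst ℝ F F + ContinuousLinearMap.snd ℝ F F)
    (hf.prodMk hg) b
  have h1 := levi_clm_comp (ContinuousLinearMap.fst ℝ F F) (hf.prodMk hg) b
  have h2 := levi_clm_comp (ContinuousLinearMap.snd ℝ F F) (hf.prodMk hg) b
  simp only [ContinuousLinearMap.coe_fst', ContinuousLinearMap.coe_snd', add_apply] at this h1 h2
  rw [this, h1, h2]

theorem levi_const_mul {f : V n → ℝ} (hf : ContDiffAt ℝ 2 f y) (c : ℝ) (b : V n) :
    levi (fun x => c * f x) y b = c * levi f y b := by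
  simpa using levi_clm_comp (c • ContinuousLinearMap.id ℝ ℝ) hf b

theorem levi_neg {f : V n → ℝ} (hf : ContDiffAt ℝ 2 f y) (b : V n) :
    levi (fun x => - f x) y b = - levi f y b := by
  simpa using levi_const_mul hf (-1) b

theorem levi_const {F : Type*} [NormedAddCommGroup F] [NormedSpace ℝ F] (c : F) (b : V n) :
    levi (fun _ : V n => c) y b = 0 := by
  simp [levi]

/-- Chain rule for `levi` of a function of a real-valued function. -/
theorem levi_comp {f : V n → ℝ} {h : ℝ → ℝ} (hf : ContDiffAt ℝ 2 f y)
    (hh : ContDiffAt ℝ 2 h (f y)) (b : V n) :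
    levi (fun x => h (f x)) y b = deriv h (f y) * levi f y b
      + deriv (deriv h) (f y) * ((fderiv ℝ f y b) ^ 2 + (fderiv ℝ f y (I • b)) ^ 2) := by
  have e : ∀ u, (fun x => fderiv ℝ (fun x => h (f x)) x u) =ᶠ[𝓝 y]
      fun x => deriv h (f x) * fderiv ℝ f x u := fun u => by
    filter_upwards [hf.eventually (by simp), hf.continuousAt.eventually (hh.eventually (by simp))]
      with x hx hx'
    have := ((hx'.differentiableAt two_ne_zero).hasDerivAt.comp_hasFDerivAt x
      (hx.differentiableAt two_ne_zero).hasFDerivAt).fderiv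
    exact congrArg (fun M : V n →L[ℝ] ℝ => M u) this
  have hh' : ContDiffAt ℝ 1 (deriv h) (f y) :=
    (hh.fderiv_right (m := 1) (by norm_num)).clm_apply contDiffAt_const
  have hd : HasFDerivAt (fun x => deriv h (f x)) (deriv (deriv h) (f y) • fderiv ℝ f y) y :=
    (hh'.differentiableAt one_ne_zero).hasDerivAt.comp_hasFDerivAt y
      (hf.differentiableAt two_ne_zero).hasFDerivAt
  have h2 : ∀ u, fderiv ℝ (fun x => deriv h (f x) * fderiv ℝ f x u) y u
      = deriv h (f y) * fderiv ℝ (fun x => fderiv ℝ f x u) y u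
        + deriv (deriv h) (f y) * (fderiv ℝ f y u) ^ 2 := fun u => by
    rw [fderiv_fun_mul hd.differentiableAt (ContDiffAt.differentiableAt_fderiv_apply hf u), hd.fderiv]
    simp only [add_apply, smul_apply, smul_eq_mul]
    ring
  rw [levi, (e b).fderiv_eq, (e (I • b)).fderiv_eq, h2, h2, levi]
  ring

end Levi

/-! ### Norms of holomorphic sections -/

section Sections

variable {n r : ℕ} {G : V n → 𝕄(r)} {y : V n}

/-- The real part of `vᴴ M v`. -/
def quad (v : Fin r → ℂ) (M : 𝕄(r)) : ℝ :=
  (star v ⬝ᵥ M *ᵥ v).re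

theorem quad_add (v : Fin r → ℂ) (M N : 𝕄(r)) :
    quad v (M + N) = quad v M + quad v N := by
  simp [quad, Matrix.add_mulVec]

theorem quad_sub (v : Fin r → ℂ) (M N : 𝕄(r)) :
    quad v (M - N) = quad v M - quad v N := by
  simp [quad, Matrix.sub_mulVec]

theorem quad_smul (v : Fin r → ℂ) (c : ℝ) (M : 𝕄(r)) :
    quad v ((c : ℂ) • M) = c * quad v M := by
  simp [quad, Matrix.smul_mulVec]

theorem quad_sum {ι : Type*} (s : Finset ι) (v : Fin r → ℂ) (M : ι → 𝕄(r)) :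
    quad v (∑ j ∈ s, M j) = ∑ j ∈ s, quad v (M j) := by
  induction s using Finset.cons_induction with
  | empty => simp [quad]
  | cons a s ha ih => rw [Finset.sum_cons, Finset.sum_cons, quad_add, ih]

/-- `quad v` as a continuous real-linear functional of the entries. -/
theorem exists_clm_quad (v : Fin r → ℂ) :
    ∃ T : (Fin r → Fin r → ℂ) →L[ℝ] ℝ, ∀ M, T M = quad v (Matrix.of M) := by
  refine ⟨LinearMap.toContinuousLinearMap
    { toFun := fun M => quad v (Matrix.of M)
      map_add' := fun M N => by rw [← quad_add]; rfl
      map_smul' := fun c M => by rw [RingHom.id_apply, smul_eq_mul, ← quad_smul]; rfl }, fun M => rfl⟩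

theorem SmoothMatAt.contDiffAt_entries {F : Type*} [NormedAddCommGroup F] [NormedSpace ℝ F]
    {G : F → 𝕄(r)} {y : F} {k : ℕ∞ω} (hG : SmoothMatAt k G y) :
    ContDiffAt ℝ k (fun x => (fun a b => G x a b : Fin r → Fin r → ℂ)) y :=
  contDiffAt_pi.2 fun a => contDiffAt_pi.2 fun b => hG a b

theorem SmoothMatAt.contDiffAt_quad {k : ℕ∞ω} (hG : SmoothMatAt k G y) (v : Fin r → ℂ) :
    ContDiffAt ℝ k (fun x => quad v (G x)) y := by
  obtain ⟨T, hT⟩ := exists_clm_quad v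
  exact (T.contDiff.contDiffAt.comp y hG.contDiffAt_entries).congr_of_eventuallyEq
    (Eventually.of_forall fun x => (hT _).symm)

theorem fderiv_quad (hG : SmoothMatAt 1 G y) (v : Fin r → ℂ) (u : V n) :
    fderiv ℝ (fun x => quad v (G x)) y u = quad v (dmat G y u) := by
  obtain ⟨T, hT⟩ := exists_clm_quad v
  have h1 : (fun x => quad v (G x)) = fun x => T (fun a b => G x a b) :=
    funext fun x => (hT _).symm
  have hd := hG.contDiffAt_entries.differentiableAt one_ne_zero
  have h2 := (T.hasFDerivAt.comp y hd.hasFDerivAt).fderiv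
  rw [Function.comp_def] at h2
  rw [h1, h2, ContinuousLinearMap.comp_apply, hT]
  congr 1
  ext a b
  have e1 := (hasFDerivAt_pi'.1 (hasFDerivAt_pi'.1 hd.hasFDerivAt a) b).fderiv
  exact (congrArg (fun L : V n →L[ℝ] ℂ => L u) e1).symm

theorem levi_quad (hG : SmoothMatAt 2 G y) (v : Fin r → ℂ) (b : V n) :
    levi (fun x => quad v (G x)) y b = quad v (dmat (fun x => dmat G x b) y b
      + dmat (fun x => dmat G x (I • b)) y (I • b)) := by
  have h : ∀ u, (fun x => fderiv ℝ (fun x => quad v (G x)) x u) =ᶠ[𝓝 y]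
      fun x => quad v (dmat G x u) := fun u => by
    filter_upwards [(hG.mono (l := 1) (by norm_num)).eventually (by simp)] with x hx
    exact fderiv_quad hx v u
  rw [levi, (h b).fderiv_eq, (h (I • b)).fderiv_eq, fderiv_quad (hG.dmat (by norm_num) _),
    fderiv_quad (hG.dmat (by norm_num) _), quad_add]

theorem quad_pos {M : 𝕄(r)} (hM : M.PosDef) {v : Fin r → ℂ} (hv : v ≠ 0) :
    0 < quad v M := by
  have := (Complex.pos_iff.1 (hM.dotProduct_mulVec_pos hv)).1
  exact this

theorem quad_nonneg {M : 𝕄(r)} (hM : M.PosDef) (v : Fin r → ℂ) : 0 ≤ quad v M :=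
  (Complex.nonneg_iff.1 (hM.posSemidef.dotProduct_mulVec_nonneg v)).1

theorem star_dotProduct_mulVec {M : 𝕄(r)} (hM : M.IsHermitian)
    (v w : Fin r → ℂ) : star (star v ⬝ᵥ M *ᵥ w) = star w ⬝ᵥ M *ᵥ v := by
  rw [← Matrix.star_dotProduct_star, star_star, star_mulVec, hM.eq,
    Matrix.dotProduct_mulVec, dotProduct_comm]

theorem ofReal_quad {M : 𝕄(r)} (hM : M.IsHermitian) (v : Fin r → ℂ) :
    ((quad v M : ℝ) : ℂ) = star v ⬝ᵥ M *ᵥ v :=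
  Complex.conj_eq_iff_re.1 (star_dotProduct_mulVec hM v v)

/-- The Cauchy-Schwarz inequality for the Hermitian form of a positive definite matrix. -/
theorem normSq_le_quad_mul_quad {M : 𝕄(r)} (hM : M.PosDef)
    {v : Fin r → ℂ} (hv : v ≠ 0) (w : Fin r → ℂ) :
    Complex.normSq (star v ⬝ᵥ M *ᵥ w) ≤ quad v M * quad w M := by
  set q := quad v M with hq
  have q0 : 0 < q := quad_pos hM hv
  set c : ℂ := star v ⬝ᵥ M *ᵥ w with hc
  have h := (Complex.nonneg_iff.1 (hM.posSemidef.dotProduct_mulVec_nonneg ((q : ℂ) • w - c • v))).1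
  have e : star ((q : ℂ) • w - c • v) ⬝ᵥ M *ᵥ ((q : ℂ) • w - c • v)
      = (q : ℂ) * ((q : ℂ) * (star w ⬝ᵥ M *ᵥ w) - c * star c) := by
    rw [star_sub, star_smul, star_smul, Matrix.mulVec_sub, mulVec_smul, mulVec_smul,
      dotProduct_sub, sub_dotProduct, sub_dotProduct]
    simp only [smul_dotProduct, dotProduct_smul, smul_eq_mul]
    rw [← star_dotProduct_mulVec hM.1 v w, ← hc, ← ofReal_quad hM.1 v, ← hq]
    simp only [star_def, conj_ofReal]
    ring
  rw [e, ← ofReal_quad hM.1 w, star_def, mul_conj, ← ofReal_mul, ← ofReal_sub, ← ofReal_mul,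
    ofReal_re] at h
  have := nonneg_of_mul_nonneg_right h q0
  linarith

theorem quad_conjTranspose_mul {M B : 𝕄(r)} (v : Fin r → ℂ) :
    quad v (Bᴴ * M * B) = quad (B *ᵥ v) M := by
  rw [quad, quad, mul_assoc, ← mulVec_mulVec, ← mulVec_mulVec,
    Matrix.dotProduct_mulVec, star_mulVec]

/-- The Bochner formula along a complex line, for the squared length of the section with constant
coefficients `v`. -/
theorem quad_curv_line (hG : SmoothMatAt 2 G y) (hp : (G y).PosDef)
    (hh : ∀ᶠ x in 𝓝 y, (G x).IsHermitian) (v : Fin r → ℂ) (b : V n) :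
    levi (fun x => quad v (G x)) y b = quad v (G y * ((-2 * I) • curv G y b (I • b)))
      + 4 * quad (conn G y b *ᵥ v) (G y) := by
  have hd : (G y).det ≠ 0 := hp.det_pos.ne'
  rw [levi_quad hG, mul_curv_line hG hd hh, quad_sub, ← quad_conjTranspose_mul, conn,
    conjTranspose_mul, hp.1.inv.eq, mul_assoc _ _ (G y),
    nonsing_inv_mul _ (isUnit_iff_ne_zero.2 hd), mul_one, ← mul_assoc]
  have := quad_smul v 4 ((wirt G y b)ᴴ * (G y)⁻¹ * wirt G y b)
  push_cast at this
  rw [this]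
  ring

/-- The logarithm of the norm squared of a holomorphic section: the Laplacian along a complex line
is bounded below by the curvature, because of the Cauchy-Schwarz inequality; there is equality when
the section is parallel at the point. -/
theorem quad_curv_le_levi_log (hG : SmoothMatAt 2 G y) (hp : (G y).PosDef)
    (hh : ∀ᶠ x in 𝓝 y, (G x).IsHermitian) {v : Fin r → ℂ} (hv : v ≠ 0) (b : V n) :
    quad v (G y * ((-2 * I) • curv G y b (I • b))) / quad v (G y)
        ≤ levi (fun x => Real.log (quad v (G x))) y b ∧
      (wirt G y b = 0 → levi (fun x => Real.log (quad v (G x))) y b =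
        quad v (G y * ((-2 * I) • curv G y b (I • b))) / quad v (G y)) := by
  set q := quad v (G y) with hq
  have q0 : 0 < q := quad_pos hp hv
  have hd : (G y).det ≠ 0 := hp.det_pos.ne'
  have s2 := hG.contDiffAt_quad v
  have hl : ContDiffAt ℝ 2 Real.log q := Real.contDiffAt_log.2 q0.ne'
  have d2 : deriv (deriv Real.log) q = - (q ^ 2)⁻¹ := by
    simp [Real.deriv_log', deriv_inv]
  rw [levi_comp s2 hl, d2, Real.deriv_log, quad_curv_line hG hp hh]
  rw [fderiv_quad (hG.mono (by norm_num)), fderiv_quad (hG.mono (by norm_num))]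
  have hw : star v ⬝ᵥ G y *ᵥ (conn G y b *ᵥ v)
      = (1 / 2 : ℂ) * ((quad v (dmat G y b) : ℝ) - I * (quad v (dmat G y (I • b)) : ℝ)) := by
    rw [mulVec_mulVec, mul_conn hd, wirt_eq, ofReal_quad (dmat_isHermitian hh _),
      ofReal_quad (dmat_isHermitian hh _)]
    simp [Matrix.sub_mulVec, Matrix.smul_mulVec]
  have hn : Complex.normSq (star v ⬝ᵥ G y *ᵥ (conn G y b *ᵥ v))
      = 1 / 4 * (quad v (dmat G y b) ^ 2 + quad v (dmat G y (I • b)) ^ 2) := by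
    rw [hw, Complex.normSq_apply]
    simp
    ring
  set a := quad v (dmat G y b) ^ 2 + quad v (dmat G y (I • b)) ^ 2
  have hcs := normSq_le_quad_mul_quad hp hv (conn G y b *ᵥ v)
  rw [hn, ← hq] at hcs
  constructor
  · have : (q ^ 2)⁻¹ * a ≤ q⁻¹ * (4 * quad (conn G y b *ᵥ v) (G y)) := by
      rw [inv_mul_le_iff₀ (by positivity)]
      calc a ≤ 4 * (q * quad (conn G y b *ᵥ v) (G y)) := by linarith
        _ = _ := by field_simp
    rw [div_eq_inv_mul]
    linarith
  · intro h0
    have hc0 : conn G y b = 0 := by rw [conn, h0, mul_zero]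
    have e1 : quad (conn G y b *ᵥ v) (G y) = 0 := by simp [hc0, quad]
    have e2 : a = 0 := by
      have : star v ⬝ᵥ G y *ᵥ (conn G y b *ᵥ v) = 0 := by simp [hc0]
      rw [this] at hn
      simp at hn
      linarith
    rw [e1, e2, ← hq]
    ring

/-- The change of frame `1 - A(y) (x - y)`, after which the first derivatives of the metric vanish
at `y`. -/
def parallelFrame (G : V n → 𝕄(r)) (y x : V n) :
    𝕄(r) := 1 - conn G y (x - y)

theorem dmat_parallelFrame (hG : SmoothMatAt 2 G y) (hd : (G y).det ≠ 0) (x u : V n) :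
    SmoothMatAt ω (parallelFrame G y) x ∧ dmat (parallelFrame G y) x u = - conn G y u := by
  choose L _ hL using exists_clm_conn (l := 1) hG (by norm_num) hd
  have e : ∀ a b, (fun x => parallelFrame G y x a b)
      = fun x => (1 : 𝕄(r)) a b - L a b y (x - y) := fun a b => by
    funext x; simp [parallelFrame, hL]
  have hf : ∀ a b, HasFDerivAt (fun x => parallelFrame G y x a b) (- L a b y) x := fun a b => by
    rw [e]
    have := ((L a b y).hasFDerivAt (x := x - y)).comp x ((hasFDerivAt_id x).sub_const y)
    simpa using this.const_sub ((1 : 𝕄(r)) a b)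
  constructor
  · intro a b
    rw [e]
    exact contDiffAt_const.sub
      ((L a b y).contDiff.contDiffAt.comp x (contDiffAt_id.sub contDiffAt_const))
  · ext a b
    simp only [dmat, of_apply, Matrix.neg_apply, hL]
    rw [(hf a b).fderiv]
    rfl

theorem parallelFrame_self : parallelFrame G y y = 1 := by
  ext a b; simp [parallelFrame, conn, wirt, Matrix.mul_apply]

theorem fderiv_id_I_smul : ∀ᶠ x in 𝓝 y, ∀ u, fderiv ℝ (fun x : V n => x) x (I • u)
    = I • fderiv ℝ (fun x : V n => x) x u := Eventually.of_forall fun x u => by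
  rw [fderiv_fun_id]; rfl

theorem dmat_parallelFrame_I_smul (hG : SmoothMatAt 2 G y) (hd : (G y).det ≠ 0) (x u : V n) :
    dmat (parallelFrame G y) x (I • u) = I • dmat (parallelFrame G y) x u := by
  rw [(dmat_parallelFrame hG hd x _).2, (dmat_parallelFrame hG hd x _).2, conn_I_smul, smul_neg]

/-- In the holomorphic frame `parallelFrame` the first derivatives of the metric vanish at `y`,
while the curvature at `y` is that of the original frame. -/
theorem parallelFrame_wirt_curv (hG : SmoothMatAt 2 G y) (hd : (G y).det ≠ 0) (u v : V n) :
    wirt (fun x => (parallelFrame G y x)ᴴ * G x * parallelFrame G y x) y u = 0 ∧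
    curv (fun x => (parallelFrame G y x)ᴴ * G x * parallelFrame G y x) y u v = curv G y u v := by
  have hτ : SmoothMatAt 2 (parallelFrame G y) y :=
    ((dmat_parallelFrame hG hd y 0).1).mono le_top
  have hτd : (parallelFrame G y y).det ≠ 0 := by simp [parallelFrame_self]
  have hI : ∀ᶠ x in 𝓝 y, ∀ u, dmat (parallelFrame G y) x (I • u)
      = I • dmat (parallelFrame G y) x u :=
    Eventually.of_forall (dmat_parallelFrame_I_smul hG hd)
  have h1 := conn_gauge (φ := fun x => x) hG hd hτ hτd contDiffAt_id hI fderiv_id_I_smul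
    (Eventually.of_forall fun x => rfl)
  have h2 := curv_gauge (φ := fun x => x) hG hd hτ hτd contDiffAt_id hI fderiv_id_I_smul
    (Eventually.of_forall fun x => rfl) u v
  constructor
  · have := h1.self_of_nhds u
    rw [parallelFrame_self, one_mul, mul_one, (dmat_parallelFrame hG hd y u).2,
      fderiv_fun_id] at this
    simp only [ContinuousLinearMap.coe_id', id_eq, add_neg_cancel] at this
    rw [← mul_conn, this, mul_zero]
    simp [parallelFrame_self, hd]
  · rw [parallelFrame_self, one_mul, mul_one, fderiv_fun_id] at h2
    simpa using h2

end Sections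

/-! ### The determinant of a Hermitian metric -/

section Det

variable {n r : ℕ} {G : V n → 𝕄(r)} {y : V n}

/-- Jacobi's formula for the directional derivatives of a determinant. -/
theorem fderiv_det {F : Type*} [NormedAddCommGroup F] [NormedSpace ℝ F]
    {G : F → 𝕄(r)} {y : F} (hG : SmoothMatAt 1 G y) (hd : (G y).det ≠ 0)
    (u : F) :
    fderiv ℝ (fun x => (G x).det) y u = (G y).det * ((G y)⁻¹ * dmat G y u).trace := by
  -- the determinant as a function of the entries
  let δ : (Fin r → Fin r → ℂ) → ℂ := fun M => (Matrix.of M).det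
  have hδ : ∀ M, DifferentiableAt ℝ δ M := fun M => by
    have : ContDiffWithinAt ℝ 1 δ univ M := contDiffWithinAt_matrix_det (A := fun M => Matrix.of M)
      fun a b => ((ContinuousLinearMap.proj (R := ℝ) b).comp
        (ContinuousLinearMap.proj (R := ℝ) (φ := fun _ : Fin r => Fin r → ℂ) a)).contDiff.contDiffAt.contDiffWithinAt
    exact (contDiffWithinAt_univ.1 this).differentiableAt one_ne_zero
  have hline : ∀ N : 𝕄(r), HasDerivAt (fun s : ℝ => (G y + (s : ℂ) • N).det)
      ((G y).det * ((G y)⁻¹ * N).trace) 0 := fun N => by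
    have e : ∀ s : ℝ, (G y + (s : ℂ) • N).det
        = (G y).det * (1 + (s : ℂ) • ((G y)⁻¹ * N)).det := fun s => by
      rw [← det_mul, mul_add, mul_one, Matrix.mul_smul,
        mul_nonsing_inv_cancel_left _ _ (isUnit_iff_ne_zero.2 hd)]
    simp only [e]
    refine HasDerivAt.const_mul _ ?_
    generalize (G y)⁻¹ * N = K
    have hp := ((1 + (Polynomial.X : Polynomial ℂ) • K.map Polynomial.C).det).hasDerivAt
      (((0 : ℝ) : ℂ))
    have hp' := hp.comp_ofReal
    rw [ofReal_zero, Matrix.derivative_det_one_add_X_smul] at hp'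
    refine hp'.congr_of_eventuallyEq (Eventually.of_forall fun s => ?_)
    simp only
    rw [← Polynomial.coe_evalRingHom, RingHom.map_det]
    congr 1
    ext i j
    by_cases h : i = j <;> simp [h, RingHom.mapMatrix_apply, Matrix.map_apply, mul_comm (s : ℂ)]
  have hdG := hG.contDiffAt_entries.differentiableAt one_ne_zero
  have h1 : fderiv ℝ (fun x => (G x).det) y u
      = fderiv ℝ δ (fun a b => G y a b) (fun a b => dmat G y u a b) := by
    have := ((hδ (fun a b => G y a b)).hasFDerivAt.comp y hdG.hasFDerivAt).fderiv
    have e2 : fderiv ℝ (fun x => (fun a b => G x a b : Fin r → Fin r → ℂ)) y u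
        = fun a b => dmat G y u a b := by
      ext a b
      have e1 := (hasFDerivAt_pi'.1 (hasFDerivAt_pi'.1 hdG.hasFDerivAt a) b).fderiv
      exact (congrArg (fun L : F →L[ℝ] ℂ => L u) e1).symm
    rw [← e2]
    exact congrArg (fun L : F →L[ℝ] ℂ => L u) this
  rw [h1]
  have h3 : HasDerivAt (fun s : ℝ => (fun a b => G y a b : Fin r → Fin r → ℂ)
      + s • (fun a b => dmat G y u a b)) (fun a b => dmat G y u a b) 0 := by
    simpa using ((hasDerivAt_id (0 : ℝ)).smul_const
      (fun a b => dmat G y u a b : Fin r → Fin r → ℂ)).const_add (fun a b => G y a b)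
  have h4 := HasFDerivAt.comp_hasDerivAt (𝕜 := ℝ) 0 (l := δ) (by simpa using (hδ _).hasFDerivAt) h3
  exact h4.unique (hline (dmat G y u))

/-- The logarithm of the determinant of a Hermitian metric. -/
def logDet (M : 𝕄(r)) : ℝ := Real.log M.det.re

theorem ofReal_det_re {M : 𝕄(r)} (hM : M.PosDef) :
    ((M.det.re : ℝ) : ℂ) = M.det ∧ 0 < M.det.re := by
  have := Complex.pos_iff.1 hM.det_pos
  exact ⟨Complex.ext rfl (by simpa using this.2), this.1⟩

theorem contDiffAt_logDet {F : Type*} [NormedAddCommGroup F] [NormedSpace ℝ F]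
    {G : F → 𝕄(r)} {y : F} {k : ℕ∞ω} (hG : SmoothMatAt k G y)
    (hp : (G y).PosDef) : ContDiffAt ℝ k (fun x => logDet (G x)) y := by
  have h : ContDiffWithinAt ℝ k (fun x => (G x).det) univ y :=
    contDiffWithinAt_matrix_det fun a b => (hG a b).contDiffWithinAt
  rw [contDiffWithinAt_univ] at h
  exact (Complex.reCLM.contDiff.contDiffAt.comp y h).log (ofReal_det_re hp).2.ne'

theorem fderiv_logDet {F : Type*} [NormedAddCommGroup F] [NormedSpace ℝ F]
    {G : F → 𝕄(r)} {y : F} (hG : SmoothMatAt 1 G y)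
    (hp : (G y).PosDef) (u : F) :
    fderiv ℝ (fun x => logDet (G x)) y u = ((G y)⁻¹ * dmat G y u).trace.re := by
  have h : ContDiffWithinAt ℝ 1 (fun x => (G x).det) univ y :=
    contDiffWithinAt_matrix_det fun a b => (hG a b).contDiffWithinAt
  rw [contDiffWithinAt_univ] at h
  have hd := (Complex.reCLM.hasFDerivAt.comp y (h.differentiableAt one_ne_zero).hasFDerivAt)
  have := (hd.log (ofReal_det_re hp).2.ne').fderiv
  have e : fderiv ℝ (fun x => logDet (G x)) y u
      = ((G y).det.re)⁻¹ * (fderiv ℝ (fun x => (G x).det) y u).re :=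
    congrArg (fun L : F →L[ℝ] ℝ => L u) this
  rw [e, fderiv_det hG hp.det_pos.ne', ← (ofReal_det_re hp).1, re_ofReal_mul, ofReal_re,
    inv_mul_cancel_left₀ (ofReal_det_re hp).2.ne']

/-- The trace of the curvature is the Laplacian of `log det`. -/
theorem levi_logDet (hG : SmoothMatAt 2 G y) (hp : ∀ᶠ x in 𝓝 y, (G x).PosDef) (b : V n) :
    levi (fun x => logDet (G x)) y b = ((-2 * I) • curv G y b (I • b)).trace.re := by
  set g : V n → ℝ := fun x => logDet (G x)
  have hd : (G y).det ≠ 0 := hp.self_of_nhds.det_pos.ne'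
  have sg : ContDiffAt ℝ 2 g y := contDiffAt_logDet hG hp.self_of_nhds
  have hh : ∀ᶠ x in 𝓝 y, (G x).IsHermitian := hp.mono fun x hx => hx.1
  have key : (fun x => (conn G x b).trace)
      =ᶠ[𝓝 y] fun x => (1 / 2 : ℂ) * ((fderiv ℝ g x b : ℝ) - I * (fderiv ℝ g x (I • b) : ℝ)) := by
    filter_upwards [(hG.mono (l := 1) (by norm_num)).eventually (by simp), hp,
      hh.eventually_nhds] with x hx px hhx
    have hr : ∀ u, ((fderiv ℝ g x u : ℝ) : ℂ) = ((G x)⁻¹ * dmat G x u).trace := fun u => by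
      rw [fderiv_logDet hx px]
      refine Complex.conj_eq_iff_re.1 ?_
      rw [← star_def, ← Matrix.trace_conjTranspose, conjTranspose_mul,
        (dmat_isHermitian hhx u).eq, px.1.inv.eq, trace_mul_comm]
    rw [hr, hr, conn, wirt_eq]
    simp [mul_sub, Matrix.trace_sub, trace_smul]
  have ht : ∀ u w, (dmat (fun x => conn G x w) y u).trace
      = fderiv ℝ (fun x => (conn G x w).trace) y u := fun u w => by
    simp only [Matrix.trace, Matrix.diag, dmat, of_apply]
    rw [fderiv_fun_sum (A := fun i x => conn G x w i i) fun i _ =>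
      (hG.conn (l := 1) (by norm_num) hd w).differentiableAt one_ne_zero i i, sum_apply]
  have hI : dmat (fun x => conn G x (I • b)) y b = I • dmat (fun x => conn G x b) y b := by
    rw [← dmat_const_smul I b (hG.conn (by norm_num) hd b)]
    exact dmat_congr (Eventually.of_forall fun x => conn_I_smul b) b
  have hk : ∀ u, fderiv ℝ (fun x => (conn G x b).trace) y u = (1 / 2 : ℂ) *
      ((fderiv ℝ (fun x => fderiv ℝ g x b) y u : ℝ)
        - I * (fderiv ℝ (fun x => fderiv ℝ g x (I • b)) y u : ℝ)) := fun u => by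
    have d1 := (ContDiffAt.differentiableAt_fderiv_apply sg b).hasFDerivAt
    have d2 := (ContDiffAt.differentiableAt_fderiv_apply sg (I • b)).hasFDerivAt
    have := ((Complex.ofRealCLM.hasFDerivAt.comp y d1).sub
      ((Complex.ofRealCLM.hasFDerivAt.comp y d2).const_smul I)).const_smul (1 / 2 : ℂ)
    rw [key.fderiv_eq]
    exact congrArg (fun L : V n →L[ℝ] ℂ => L u) this.fderiv
  have hs : fderiv ℝ (fun x => fderiv ℝ g x b) y (I • b)
      = fderiv ℝ (fun x => fderiv ℝ g x (I • b)) y b := by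
    have hs := sg.isSymmSndFDerivAt (by simp)
    have hd : DifferentiableAt ℝ (fderiv ℝ g) y :=
      (sg.fderiv_right (m := 1) (by norm_num)).differentiableAt one_ne_zero
    rw [fderiv_clm_apply hd (differentiableAt_const _),
      fderiv_clm_apply hd (differentiableAt_const _)]
    simpa using hs.eq (I • b) b
  rw [trace_smul, curv_eq, Matrix.trace_add, Matrix.trace_sub, Matrix.trace_sub,
    trace_mul_comm (conn G y b), sub_self, add_zero, hI, trace_smul, ht, ht, hk, hk,
    hs, levi]
  generalize fderiv ℝ (fun x => fderiv ℝ g x b) y b = p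
  generalize fderiv ℝ (fun x => fderiv ℝ g x (I • b)) y b = q
  generalize fderiv ℝ (fun x => fderiv ℝ g x (I • b)) y (I • b) = s
  have : (-2 * I) • (I • (1 / 2 * ((p : ℂ) - I * q)) - 1 / 2 * ((q : ℂ) - I * s))
      = ((p + s : ℝ) : ℂ) := by
    simp only [smul_eq_mul]
    push_cast
    linear_combination (-(p : ℂ) + I * q - s) * I_mul_I
  rw [this, ofReal_re]

end Det

/-! ### Kähler linear algebra -/

section KaehlerAlgebra

variable {n : ℕ}

theorem update_pair_zero {α : Type*} (u v x : α) : Function.update ![u, v] 0 x = ![x, v] := by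
  funext i; fin_cases i <;> rfl

theorem update_pair_one {α : Type*} (u v x : α) : Function.update ![u, v] 1 x = ![u, x] := by
  funext i; fin_cases i <;> rfl

/-- A `2`-form as a bilinear map. -/
def bil {E : Type*} [NormedAddCommGroup E] [NormedSpace ℝ E]
    (β : E [⋀^Fin 2]→L[ℝ] ℝ) : E →ₗ[ℝ] E →ₗ[ℝ] ℝ :=
  LinearMap.mk₂ ℝ (fun u v => β ![u, v])
    (fun u u' v => by
      have := β.map_update_add ![u, v] 0 u u'
      simpa only [update_pair_zero] using this)
    (fun c u v => by
      have := β.map_update_smul ![u, v] 0 c u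
      simpa only [update_pair_zero] using this)
    (fun u v v' => by
      have := β.map_update_add ![u, v] 1 v v'
      simpa only [update_pair_one] using this)
    (fun c u v => by
      have := β.map_update_smul ![u, v] 1 c v
      simpa only [update_pair_one] using this)

theorem bil_apply {E : Type*} [NormedAddCommGroup E] [NormedSpace ℝ E]
    (β : E [⋀^Fin 2]→L[ℝ] ℝ) (u v : E) : bil β u v = β ![u, v] := rfl

theorem bil_self {E : Type*} [NormedAddCommGroup E] [NormedSpace ℝ E]
    (β : E [⋀^Fin 2]→L[ℝ] ℝ) (u : E) : bil β u u = 0 :=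
  β.map_eq_zero_of_eq ![u, u] (i := 0) (j := 1) rfl (by decide)

theorem bil_swap {E : Type*} [NormedAddCommGroup E] [NormedSpace ℝ E]
    (β : E [⋀^Fin 2]→L[ℝ] ℝ) (u v : E) : bil β u v = - bil β v u := by
  have := bil_self β (u + v)
  simp only [map_add, LinearMap.add_apply, bil_self] at this
  linarith

/-- The matrix `β(b_a, b_c)` of a `2`-form in a real frame. -/
def skew {ι E : Type*} [NormedAddCommGroup E] [NormedSpace ℝ E] (b : ι → E)
    (β : E [⋀^Fin 2]→L[ℝ] ℝ) : Matrix ι ι ℝ :=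
  Matrix.of fun a c => β ![b a, b c]

/-- `-½ ∑ (Ω⁻¹)_{aa'} F_{aa'}` for an invertible skew matrix `Ω`.  When `Ω` is the matrix of a
Kähler form in any real frame this is the inner product of `F` with that form; unlike `traceForm`
it does not refer to the complex structure. -/
def pairing {ι W : Type*} [Fintype ι] [DecidableEq ι] [AddCommGroup W] [Module ℂ W]
    (Ω : Matrix ι ι ℝ) (F : ι → ι → W) : W :=
  (-1 / 2 : ℂ) • ∑ a, ∑ a', ((Ω⁻¹ a a' : ℝ) : ℂ) • F a a'

/-- The matrix of multiplication by `I` in a frame `realFrame u`. -/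
def matI (n : ℕ) : Matrix (Fin n × Fin 2) (Fin n × Fin 2) ℝ :=
  Matrix.of fun d c => if d.1 = c.1 then
    (if c.2 = 0 then (if d.2 = 1 then 1 else 0) else (if d.2 = 0 then -1 else 0)) else 0

theorem matI_mul_matI : matI n * matI n = -1 := by
  ext ⟨i, a⟩ ⟨j, c⟩
  simp only [matI, Matrix.mul_apply, of_apply, Fintype.sum_prod_type, Matrix.neg_apply,
    Matrix.one_apply, Prod.mk.injEq, Fin.sum_univ_two]
  by_cases h : i = j
  · subst h
    fin_cases a <;> fin_cases c <;> simp
  · have : ∀ k, ¬ (i = k ∧ k = j) := fun k hk => h (hk.1.trans hk.2)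
    simp only [h, false_and, if_false, neg_zero]
    refine Finset.sum_eq_zero fun k _ => ?_
    by_cases h1 : i = k
    · simp [h1 ▸ h]
    · simp [h1]

theorem I_smul_realFrame {m : ℕ} (u : Fin m → V n) (c : Fin m × Fin 2) :
    I • realFrame u c = ∑ d, matI m d c • realFrame u d := by
  obtain ⟨j, c⟩ := c
  rw [Fintype.sum_prod_type, Finset.sum_eq_single j]
  · fin_cases c <;> simp [matI, realFrame, smul_smul]
  · intro i _ hi
    simp [matI, hi]
  · simp

theorem gram_realFrame {m : ℕ} (u : Fin m → V n) (β : V n [⋀^Fin 2]→L[ℝ] ℝ) :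
    gram (realFrame u) β = skew (realFrame u) β * matI m := by
  ext a c
  simp only [gram, skew, Matrix.mul_apply, of_apply]
  rw [I_smul_realFrame, ← bil_apply, map_sum]
  refine Finset.sum_congr rfl fun d _ => ?_
  rw [map_smul, smul_eq_mul, mul_comm]; rfl

/-- As `g(u, v) = β(u, Iv)`, the Gram matrix of a frame of the form `b_j, I b_j` is `Ω J`, where `Ω`
is the matrix of `β`; one of the two inverse Gram matrices in the contraction cancels against the
matrix of `β`, and only `Ω⁻¹` remains. -/
theorem traceForm_eq_pairing {r m : ℕ} (u : Fin m → V n) (β : V n [⋀^Fin 2]→L[ℝ] ℝ)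
    (h11 : ∀ u v : V n, β ![I • u, I • v] = β ![u, v])
    (F : V n → V n → 𝕄(r)) :
    traceForm (realFrame u) β F
      = pairing (skew (realFrame u) β) fun a a' => F (realFrame u a) (realFrame u a') := by
  set b := realFrame u
  set Ω := skew b β with hΩ
  have hg : gram b β = Ω * matI m := gram_realFrame u β
  have hsym : (gram b β)ᵀ = gram b β := by
    ext a c
    simp only [gram, Matrix.transpose_apply, of_apply]
    have h1 := h11 (b c) (I • b a)
    rw [smul_smul, I_mul_I, neg_one_smul] at h1
    rw [← h1, ← bil_apply, map_neg, ← bil_swap, bil_apply]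
  have hJinv : (matI m)⁻¹ = - matI m := by
    refine Matrix.inv_eq_right_inv ?_
    rw [mul_neg, matI_mul_matI, neg_neg]
  have hJ : IsUnit (matI m).det := by
    rw [← Matrix.isUnit_iff_isUnit_det]
    exact ⟨⟨matI m, -matI m, by rw [mul_neg, matI_mul_matI, neg_neg],
      by rw [neg_mul, matI_mul_matI, neg_neg]⟩, rfl⟩
  have hginv : (gram b β)⁻¹ = - (matI m * Ω⁻¹) := by
    rw [hg, Matrix.mul_inv_rev, hJinv, neg_mul]
  have hΩ' : Ω = - (gram b β * matI m) := by
    rw [hg, mul_assoc, matI_mul_matI, mul_neg, mul_one, neg_neg]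
  have hC : (gram b β)⁻¹ * Ω * ((gram b β)⁻¹)ᵀ = - Ω⁻¹ := by
    rw [Matrix.transpose_nonsing_inv, hsym]
    by_cases hu : IsUnit (gram b β).det
    · nth_rewrite 1 [hΩ']
      rw [mul_neg, nonsing_inv_mul_cancel_left _ _ hu, hginv, neg_mul_neg,
        ← mul_assoc, matI_mul_matI, neg_mul, one_mul]
    · have hu' : ¬ IsUnit Ω.det := fun h => hu (by rw [hg, det_mul]; exact h.mul hJ)
      rw [Matrix.nonsing_inv_apply_not_isUnit _ hu, Matrix.nonsing_inv_apply_not_isUnit _ hu']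
      simp
  unfold traceForm pairing
  rw [neg_div, neg_smul, ← smul_neg, ← Finset.sum_neg_distrib]
  refine congrArg _ (Finset.sum_congr rfl fun a _ => ?_)
  rw [← Finset.sum_neg_distrib]
  refine Finset.sum_congr rfl fun a' _ => ?_
  have : - Ω⁻¹ a a' = ∑ c, ∑ c', (gram b β)⁻¹ a c * (gram b β)⁻¹ a' c' * β ![b c, b c'] := by
    have h := congrFun (congrFun hC a) a'
    simp only [Matrix.neg_apply] at h
    rw [← h, Matrix.mul_apply]
    simp only [Matrix.mul_apply, Finset.sum_mul, Matrix.transpose_apply]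
    rw [Finset.sum_comm]
    refine Finset.sum_congr rfl fun c _ => Finset.sum_congr rfl fun c' _ => ?_
    simp only [hΩ, skew, of_apply]; ring
  rw [← neg_smul, ← ofReal_neg, this, ofReal_sum, Finset.sum_smul]
  refine Finset.sum_congr rfl fun c _ => ?_
  rw [ofReal_sum, Finset.sum_smul]

/-- The real basis `e₁, I e₁, e₂, I e₂, …` of `ℂⁿ`. -/
def stdBasis (n : ℕ) : Module.Basis (Fin n × Fin 2) ℝ (V n) :=
  Module.Basis.ofEquivFun
    { toFun := fun x a => if a.2 = 0 then (x a.1).re else (x a.1).im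
      map_add' := fun x y => by ext a; by_cases h : a.2 = 0 <;> simp [h]
      map_smul' := fun c x => by ext a; by_cases h : a.2 = 0 <;> simp [h]
      invFun := fun f j => ⟨f (j, 0), f (j, 1)⟩
      left_inv := fun x => by ext j; simp
      right_inv := fun f => by
        ext ⟨j, a⟩
        fin_cases a <;> simp }

theorem stdBasis_apply (a : Fin n × Fin 2) : stdBasis n a = stdFrame n a := by
  obtain ⟨j, a⟩ := a
  rw [stdBasis, Module.Basis.coe_ofEquivFun]
  ext i
  fin_cases a <;> by_cases h : i = j <;>
    simp [stdFrame, realFrame, h, Complex.ext_iff, Prod.ext_iff]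

theorem coe_stdBasis : ⇑(stdBasis n) = stdFrame n := funext stdBasis_apply

theorem realFrame_eq_comp (L : V n →ₗ[ℂ] V n) :
    realFrame (fun j => L (Pi.single j 1)) = fun a => L (stdFrame n a) := by
  funext a
  unfold stdFrame realFrame
  split_ifs <;> simp

variable {W : Type*} [AddCommGroup W] [Module ℂ W] [Module ℝ W] [IsScalarTower ℝ ℂ W]

theorem skew_comp (L : V n →ₗ[ℝ] V n) (β : V n [⋀^Fin 2]→L[ℝ] ℝ) :
    skew (fun a => L (stdFrame n a)) β = (LinearMap.toMatrix (stdBasis n) (stdBasis n) L)ᵀ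
      * skew (stdFrame n) β * LinearMap.toMatrix (stdBasis n) (stdBasis n) L := by
  have hL : ∀ a, L (stdFrame n a)
      = ∑ c, LinearMap.toMatrix (stdBasis n) (stdBasis n) L c a • stdFrame n c := fun a => by
    have := (stdBasis n).sum_repr (L (stdBasis n a))
    simp only [coe_stdBasis] at this
    simpa [LinearMap.toMatrix_apply, stdBasis_apply] using this.symm
  ext a c
  simp only [skew, Matrix.mul_apply, Matrix.transpose_apply, of_apply]
  rw [← bil_apply, hL a, hL c]
  simp only [map_sum, map_smul, LinearMap.sum_apply, LinearMap.smul_apply, smul_eq_mul,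
    Finset.mul_sum, Finset.sum_mul, bil_apply]
  refine Finset.sum_congr rfl fun d _ => Finset.sum_congr rfl fun d' _ => ?_
  ring

theorem det_skew_comp (L : V n →ₗ[ℝ] V n) (β : V n [⋀^Fin 2]→L[ℝ] ℝ) :
    (skew (fun a => L (stdFrame n a)) β).det = (LinearMap.det L) ^ 2 * (skew (stdFrame n) β).det := by
  rw [skew_comp, det_mul, det_mul, Matrix.det_transpose, LinearMap.det_toMatrix]
  ring

/-- `pairing` does not depend on the real frame. -/
theorem pairing_comp (L : V n →ₗ[ℝ] V n) (hL : LinearMap.det L ≠ 0) (β : V n [⋀^Fin 2]→L[ℝ] ℝ)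
    (F : V n →ₗ[ℝ] V n →ₗ[ℝ] W) :
    pairing (skew (fun a => L (stdFrame n a)) β)
        (fun a a' => F (L (stdFrame n a)) (L (stdFrame n a')))
      = pairing (skew (stdFrame n) β) fun a a' => F (stdFrame n a) (stdFrame n a') := by
  set P := LinearMap.toMatrix (stdBasis n) (stdBasis n) L with hP
  have hPu : IsUnit P.det := by rw [hP, LinearMap.det_toMatrix]; exact isUnit_iff_ne_zero.2 hL
  have hL : ∀ a, L (stdFrame n a) = ∑ c, P c a • stdFrame n c := fun a => by
    have := (stdBasis n).sum_repr (L (stdBasis n a))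
    simp only [coe_stdBasis] at this
    simpa [hP, LinearMap.toMatrix_apply, stdBasis_apply] using this.symm
  have hF : ∀ a a', F (L (stdFrame n a)) (L (stdFrame n a'))
      = ∑ c, ∑ c', ((P c a * P c' a' : ℝ) : ℂ) • F (stdFrame n c) (stdFrame n c') := by
    intro a a'
    rw [hL a, hL a']
    simp only [map_sum, map_smul, LinearMap.sum_apply, LinearMap.smul_apply, Finset.smul_sum,
      smul_smul]
    rw [Finset.sum_comm]
    refine Finset.sum_congr rfl fun d _ => Finset.sum_congr rfl fun d' _ => ?_
    rw [mul_comm]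
    exact (algebraMap_smul ℂ (P d a * P d' a') _).symm
  have hinv : ∀ c c', (skew (stdFrame n) β)⁻¹ c c'
      = ∑ a, ∑ a', (Pᵀ * skew (stdFrame n) β * P)⁻¹ a a' * (P c a * P c' a') := by
    intro c c'
    have : (skew (stdFrame n) β)⁻¹ = P * (Pᵀ * skew (stdFrame n) β * P)⁻¹ * Pᵀ := by
      have hPt : IsUnit Pᵀ.det := by rwa [Matrix.det_transpose]
      rw [Matrix.mul_inv_rev, Matrix.mul_inv_rev, mul_nonsing_inv_cancel_left _ _ hPu,
        mul_assoc, nonsing_inv_mul _ hPt, mul_one]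
    rw [this, Matrix.mul_apply]
    simp only [Matrix.mul_apply, Finset.sum_mul, Matrix.transpose_apply]
    rw [Finset.sum_comm]
    refine Finset.sum_congr rfl fun a _ => Finset.sum_congr rfl fun a' _ => ?_
    ring
  unfold pairing
  rw [skew_comp]
  congr 1
  simp only [hF, hinv, Finset.smul_sum, smul_smul, ofReal_sum, Finset.sum_smul]
  rw [Finset.sum_congr rfl fun a _ => Finset.sum_comm, Finset.sum_comm]
  refine Finset.sum_congr rfl fun c _ => ?_
  rw [Finset.sum_congr rfl fun a _ => Finset.sum_comm, Finset.sum_comm]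
  refine Finset.sum_congr rfl fun c' _ => Finset.sum_congr rfl fun a _ =>
    Finset.sum_congr rfl fun a' _ => ?_
  rw [← hP]
  congr 1
  push_cast
  ring

end KaehlerAlgebra

/-! ### Unitary frames and the top-degree coefficient -/

section Unitary

variable {n : ℕ}

open scoped MatrixOrder Matrix.Norms.L2Operator in
theorem exists_eq_conjTranspose_mul_self {M : Matrix (Fin n) (Fin n) ℂ} (hM : M.PosDef) :
    ∃ B : Matrix (Fin n) (Fin n) ℂ, B.det ≠ 0 ∧ M = Bᴴ * B := by
  obtain ⟨B, hB⟩ := CStarAlgebra.nonneg_iff_eq_star_mul_self.mp hM.posSemidef.nonneg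
  refine ⟨B, fun h => hM.det_pos.ne' ?_, hB⟩
  rw [hB, det_mul, h, mul_zero]

/-- A complex basis is unitary for `β` when the metric `β(u, I v)` is the identity in the
associated real frame. -/
def IsUnitary (β : V n [⋀^Fin 2]→L[ℝ] ℝ) (b : Fin n → V n) : Prop :=
  gram (realFrame b) β = 1

theorem det_restrictScalars_pos (L : V n →ₗ[ℂ] V n) (hL : LinearMap.det L ≠ 0) :
    0 < LinearMap.det (L.restrictScalars ℝ) := by
  rw [LinearMap.det_restrictScalars, Algebra.norm_complex_apply]
  exact Complex.normSq_pos.2 hL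

/-- A positive `(1,1)`-form admits a unitary basis. -/
theorem exists_isUnitary (β : V n [⋀^Fin 2]→L[ℝ] ℝ)
    (h11 : ∀ u v : V n, β ![I • u, I • v] = β ![u, v])
    (hpos : ∀ u : V n, u ≠ 0 → 0 < β ![u, I • u]) :
    ∃ L : V n →ₗ[ℂ] V n, LinearMap.det L ≠ 0 ∧ IsUnitary β fun j => L (Pi.single j 1) := by
  -- the Hermitian form `h(u, v) = β(u, I v) + i β(u, v)`
  have hneg : ∀ u v : V n, bil β (I • u) v = - bil β u (I • v) := fun u v => by
    have := h11 u (I • v)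
    rw [smul_smul, I_mul_I, neg_one_smul, ← bil_apply, map_neg, ← bil_apply] at this
    linarith
  let h : V n → V n → ℂ := fun u v => bil β u (I • v) + I * bil β u v
  have hI : ∀ c : ℂ, ∀ w : V n, c • w = c.re • w + c.im • (I • w) := fun c w => by
    ext i
    simp only [Pi.smul_apply, Pi.add_apply, smul_eq_mul, real_smul]
    nth_rewrite 1 [← re_add_im c]; ring
  have hadd : ∀ u v w, h u (v + w) = h u v + h u w := fun u v w => by
    simp only [h, smul_add, map_add]; push_cast; ring
  have hII : ∀ u v : V n, bil β u (I • I • v) = - bil β u v := fun u v => by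
    rw [smul_smul, I_mul_I, neg_one_smul, map_neg]
  have hreal : ∀ (c : ℝ) u v, h u (c • v) = c * h u v := fun c u v => by
    simp only [h, smul_comm I c v, map_smul, smul_eq_mul]; push_cast; ring
  have hsmul : ∀ c u v, h u (c • v) = c * h u v := fun c u v => by
    have e : h u (I • v) = I * h u v := by
      simp only [h, hII]; push_cast; linear_combination (-(bil β u v : ℂ)) * I_mul_I
    rw [hI, hadd, hreal, hreal, e]
    nth_rewrite 3 [← re_add_im c]; ring
  have hconj : ∀ u v, conj (h u v) = h v u := fun u v => by
    simp only [h, map_add, map_mul, conj_ofReal, conj_I]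
    rw [bil_swap β v (I • u), hneg, bil_swap β v u]
    push_cast; ring
  have hsum : ∀ u v, h u v = star u ⬝ᵥ (Matrix.of fun i j => h (Pi.single i 1) (Pi.single j 1)) *ᵥ v := by
    have hs : ∀ u v : V n, h u v = ∑ j, v j * h u (Pi.single j 1) := fun u v => by
      let T : V n →ₗ[ℂ] ℂ := { toFun := h u, map_add' := hadd u, map_smul' := fun c v => hsmul c u v }
      have : T v = _ := LinearMap.pi_apply_eq_sum_univ T v
      refine this.trans (Finset.sum_congr rfl fun j _ => ?_)
      have e : (fun i => if j = i then (1 : ℂ) else 0) = Pi.single j 1 := by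
        funext i; simp [Pi.single_apply, eq_comm]
      rw [e]; rfl
    intro u v
    rw [hs u v]
    have e : ∀ j, h u (Pi.single j 1) = ∑ i, star (u i) * h (Pi.single i 1) (Pi.single j 1) :=
      fun j => by
        rw [← hconj, hs, map_sum]
        exact Finset.sum_congr rfl fun i _ => by rw [map_mul, hconj]; rfl
    simp only [e, dotProduct, Matrix.mulVec, of_apply, Pi.star_apply, Finset.mul_sum]
    rw [Finset.sum_comm]
    exact Finset.sum_congr rfl fun i _ => Finset.sum_congr rfl fun j _ => by ring
  set M : Matrix (Fin n) (Fin n) ℂ := Matrix.of fun i j => h (Pi.single i 1) (Pi.single j 1)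
  have hMpos : M.PosDef := by
    refine Matrix.PosDef.of_dotProduct_mulVec_pos ?_ fun x hx => ?_
    · ext i j; simp only [M, conjTranspose_apply, of_apply]; exact hconj _ _
    · rw [← hsum, Complex.pos_iff]
      simp only [h, bil_self]
      constructor
      · simpa [bil_apply] using hpos x hx
      · simp
  obtain ⟨B, hBd, hB⟩ := exists_eq_conjTranspose_mul_self hMpos
  have hBu : IsUnit B.det := isUnit_iff_ne_zero.2 hBd
  have hBu' : IsUnit Bᴴ.det := by rw [det_conjTranspose]; exact hBu.star
  refine ⟨Matrix.toLin' B⁻¹, ?_, ?_⟩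
  · rw [LinearMap.det_toLin', Matrix.det_nonsing_inv, Ring.inverse_eq_inv']
    exact inv_ne_zero hBd
  have horth : ∀ i j, h (Matrix.toLin' B⁻¹ (Pi.single i 1)) (Matrix.toLin' B⁻¹ (Pi.single j 1))
      = if i = j then 1 else 0 := by
    intro i j
    rw [hsum, Matrix.toLin'_apply, Matrix.toLin'_apply, mulVec_mulVec, star_mulVec,
      ← Matrix.dotProduct_mulVec, mulVec_mulVec, hB, mul_assoc Bᴴ,
      mul_nonsing_inv _ hBu, mul_one, Matrix.conjTranspose_nonsing_inv,
      nonsing_inv_mul _ hBu', Matrix.one_mulVec]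
    by_cases hij : i = j <;> simp [hij, Pi.single_apply, dotProduct, eq_comm]
  have hre : ∀ u v, (h u v).re = bil β u (I • v) := fun u v => by simp [h]
  have him : ∀ u v, (h u v).im = bil β u v := fun u v => by simp [h]
  ext ⟨i, a⟩ ⟨j, c⟩
  set b : Fin n → V n := fun j => Matrix.toLin' B⁻¹ (Pi.single j 1)
  have e1 : bil β (b i) (I • b j) = if i = j then 1 else 0 := by
    rw [← hre, horth]; split_ifs <;> simp
  have e2 : bil β (b i) (b j) = 0 := by
    rw [← him, horth]; split_ifs <;> simp
  simp only [gram, of_apply, ← bil_apply, realFrame]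
  fin_cases a <;> fin_cases c <;>
    simp [e1, e2, hneg, hII, Matrix.one_apply]

theorem IsUnitary.skew_eq {β : V n [⋀^Fin 2]→L[ℝ] ℝ} {b : Fin n → V n} (h : IsUnitary β b) :
    skew (realFrame b) β = - matI n := by
  have h' : skew (realFrame b) β * matI n = 1 := by rw [← gram_realFrame]; exact h
  calc skew (realFrame b) β = - (skew (realFrame b) β * (matI n * matI n)) := by
        rw [matI_mul_matI, mul_neg, mul_one, neg_neg]
    _ = _ := by rw [← mul_assoc, h', one_mul]

theorem sum_matI_smul {W : Type*} [AddCommGroup W] [Module ℂ W]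
    (F : Fin n × Fin 2 → Fin n × Fin 2 → W) :
    ∑ a, ∑ a', ((matI n a a' : ℝ) : ℂ) • F a a' = ∑ j, (F (j, 1) (j, 0) - F (j, 0) (j, 1)) := by
  rw [Fintype.sum_prod_type]
  refine Finset.sum_congr rfl fun j _ => ?_
  have : ∀ a, ∑ a', ((matI n (j, a) a' : ℝ) : ℂ) • F (j, a) a'
      = ∑ c, ((matI n (j, a) (j, c) : ℝ) : ℂ) • F (j, a) (j, c) := fun a => by
    rw [Fintype.sum_prod_type, Finset.sum_eq_single j]
    · intro i _ hi
      exact Finset.sum_eq_zero fun c _ => by simp [matI, hi.symm]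
    · simp
  simp only [this, Fin.sum_univ_two]
  simp [matI]
  abel

variable {W : Type*} [AddCommGroup W] [Module ℂ W] [Module ℝ W] [IsScalarTower ℝ ℂ W]

/-- In a unitary basis, the inner product with the Kähler form is the sum over the complex lines
spanned by the basis vectors. -/
theorem pairing_eq_sum_unitary (β : V n [⋀^Fin 2]→L[ℝ] ℝ) (L : V n →ₗ[ℂ] V n)
    (hL : LinearMap.det L ≠ 0) (hb : IsUnitary β fun j => L (Pi.single j 1))
    (F : V n →ₗ[ℝ] V n →ₗ[ℝ] W) :
    pairing (skew (stdFrame n) β) (fun a a' => F (stdFrame n a) (stdFrame n a'))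
      = (1 / 2 : ℂ) • ∑ j, (F (L (Pi.single j 1)) (I • L (Pi.single j 1))
        - F (I • L (Pi.single j 1)) (L (Pi.single j 1))) := by
  have h1 := pairing_comp (L.restrictScalars ℝ) (det_restrictScalars_pos L hL).ne' β F
  have h2 := realFrame_eq_comp L
  simp only [LinearMap.coe_restrictScalars] at h1
  have h3 : ∀ a, L (stdFrame n a) = realFrame (fun j => L (Pi.single j 1)) a := fun a =>
    (congrFun h2 a).symm
  rw [← h1]
  simp only [h3]
  have hinv : (-matI n)⁻¹ = matI n := by
    refine Matrix.inv_eq_right_inv ?_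
    rw [neg_mul, matI_mul_matI, neg_neg]
  rw [show (fun a => realFrame (fun j => L (Pi.single j 1)) a)
    = realFrame (fun j => L (Pi.single j 1)) from rfl, hb.skew_eq, pairing, hinv, sum_matI_smul,
    neg_div, neg_smul, ← smul_neg, ← Finset.sum_neg_distrib]
  congr 1
  refine Finset.sum_congr rfl fun j _ => ?_
  simp [realFrame]

theorem traceForm_eq_sum_unitary {r : ℕ} (β : V n [⋀^Fin 2]→L[ℝ] ℝ)
    (h11 : ∀ u v : V n, β ![I • u, I • v] = β ![u, v]) (L : V n →ₗ[ℂ] V n)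
    (hL : LinearMap.det L ≠ 0) (hb : IsUnitary β fun j => L (Pi.single j 1))
    (F : V n → V n → 𝕄(r))
    (B : V n →ₗ[ℝ] V n →ₗ[ℝ] 𝕄(r)) (hB : ∀ u v, F u v = B u v)
    (hF : ∀ u v, F u v = - F v u) :
    traceForm (stdFrame n) β F = ∑ j, F (L (Pi.single j 1)) (I • L (Pi.single j 1)) := by
  have h1 := traceForm_eq_pairing (fun j => Pi.single j (1 : ℂ)) β h11 F
  have h2 := pairing_eq_sum_unitary β L hL hb B
  rw [show stdFrame n = realFrame fun j => Pi.single j (1 : ℂ) from rfl] at h2 ⊢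
  rw [h1]
  simp only [hB]
  rw [h2, Finset.smul_sum]
  refine Finset.sum_congr rfl fun j _ => ?_
  rw [← hB, ← hB, hF (I • _), sub_neg_eq_add, ← two_smul ℂ, smul_smul]
  norm_num

/-! ### The coefficient of `α ∧ β ∧ β` -/

/-- The integer matrix of the standard Kähler form of `ℂ³`. -/
def J6 (i j : Fin 6) : ℤ := if i.1 / 2 = j.1 / 2 then (j.1 : ℤ) - i.1 else 0

theorem sum_perm_J6 : ∀ i j : Fin 6, (∑ s : Equiv.Perm (Fin 6), if s 0 = i ∧ s 1 = j then
    (Equiv.Perm.sign s : ℤ) * (J6 (s 2) (s 3) * J6 (s 4) (s 5)) else 0) = 8 * J6 i j := by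
  decide +kernel

theorem sum_perm_mul_J6 (a : Fin 6 → Fin 6 → ℂ) :
    ∑ s : Equiv.Perm (Fin 6), ((Equiv.Perm.sign s : ℤ) : ℂ) *
      (a (s 0) (s 1) * J6 (s 2) (s 3) * J6 (s 4) (s 5))
      = 8 * (a 0 1 - a 1 0 + (a 2 3 - a 3 2) + (a 4 5 - a 5 4)) := by
  have h : ∀ s : Equiv.Perm (Fin 6), ((Equiv.Perm.sign s : ℤ) : ℂ) *
      (a (s 0) (s 1) * J6 (s 2) (s 3) * J6 (s 4) (s 5)) = ∑ i, ∑ j, a i j *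
      (((if s 0 = i ∧ s 1 = j then (Equiv.Perm.sign s : ℤ) * (J6 (s 2) (s 3) * J6 (s 4) (s 5))
        else 0 : ℤ)) : ℂ) := fun s => by
    rw [Finset.sum_eq_single (s 0), Finset.sum_eq_single (s 1)]
    · simp only [and_self, if_true]; push_cast; ring
    · intro j _ hj; simp [hj.symm]
    · simp
    · intro i _ hi; exact Finset.sum_eq_zero fun j _ => by simp [hi.symm]
    · simp
  simp only [h]
  rw [Finset.sum_comm]
  have : ∀ i, ∑ s : Equiv.Perm (Fin 6), ∑ j, a i j *
      (((if s 0 = i ∧ s 1 = j then (Equiv.Perm.sign s : ℤ) * (J6 (s 2) (s 3) * J6 (s 4) (s 5))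
        else 0 : ℤ)) : ℂ) = ∑ j, a i j * (8 * J6 i j : ℤ) := fun i => by
    rw [Finset.sum_comm]
    refine Finset.sum_congr rfl fun j _ => ?_
    rw [← sum_perm_J6 i j, Int.cast_sum, Finset.mul_sum]
  rw [Finset.sum_congr rfl fun i _ => this i]
  simp only [Fin.sum_univ_six, J6]
  norm_num
  ring

/-- `wedge₃` of bilinear forms, as an alternating map. -/
theorem exists_alternatingMap_wedge (α β γ : V 3 →ₗ[ℝ] V 3 →ₗ[ℝ] ℂ) :
    ∃ w : V 3 [⋀^Fin 6]→ₗ[ℝ] ℂ, ∀ v,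
      w v = wedge₃ (fun a b => α a b) (fun a b => β a b) (fun a b => γ a b) v := by
  let m : MultilinearMap ℝ (fun _ : Fin 6 => V 3) ℂ :=
    { toFun := fun v => α (v 0) (v 1) * β (v 2) (v 3) * γ (v 4) (v 5)
      map_update_add' := fun v i x y => by
        rename_i inst
        cases Subsingleton.elim inst (instDecidableEqFin 6)
        fin_cases i <;> simp <;> ring
      map_update_smul' := fun v i c x => by
        rename_i inst
        cases Subsingleton.elim inst (instDecidableEqFin 6)
        fin_cases i <;> simp <;> ring }
  refine ⟨(1 / 8 : ℝ) • MultilinearMap.alternatization m, fun v => ?_⟩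
  rw [AlternatingMap.smul_apply, MultilinearMap.alternatization_apply, wedge₃, real_smul]
  congr 1
  · push_cast; rfl
  · refine Finset.sum_congr rfl fun s _ => ?_
    rw [Units.smul_def, zsmul_eq_mul]; rfl

/-- A top-degree alternating form is multiplied by the determinant of a linear map, for values in
`ℂ`; the real case is applied to each real functional of the value. -/
theorem alternatingMap_comp_basis {ι : Type*} [Fintype ι] [DecidableEq ι]
    (w : V n [⋀^ι]→ₗ[ℝ] ℂ) (e : Module.Basis ι ℝ (V n)) (L : V n →ₗ[ℝ] V n) :
    w (fun i => L (e i)) = (LinearMap.det L : ℝ) * w e := by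
  have key : ∀ T : ℂ →ₗ[ℝ] ℝ, T (w fun i => L (e i)) = LinearMap.det L * T (w e) := fun T => by
    have h := AlternatingMap.eq_smul_basis_det e (T.compAlternatingMap w)
    have h1 := congrArg (fun f : V n [⋀^ι]→ₗ[ℝ] ℝ => f (L ∘ e)) h
    simp only [AlternatingMap.smul_apply, Module.Basis.det_comp, e.det_self,
      LinearMap.compAlternatingMap_apply, smul_eq_mul] at h1
    rw [show (fun i => L (e i)) = L ∘ e from rfl, h1]
    ring
  apply Complex.ext
  · rw [re_ofReal_mul]; exact key Complex.reLm
  · rw [im_ofReal_mul]; exact key Complex.imLm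

/-- `α ∧ β² = 2 (α, β) dvol`: the coefficient of `α ∧ β ∧ β` in a unitary basis. -/
theorem topCoeff_eq_sum_unitary (β : V 3 [⋀^Fin 2]→L[ℝ] ℝ) (L : V 3 →ₗ[ℂ] V 3)
    (hL : LinearMap.det L ≠ 0) (hb : IsUnitary β fun j => L (Pi.single j 1))
    (α : V 3 →ₗ[ℝ] V 3 →ₗ[ℝ] ℂ) :
    topCoeff (fun u v => α u v) β = ∑ j, (α (L (Pi.single j 1)) (I • L (Pi.single j 1))
        - α (I • L (Pi.single j 1)) (L (Pi.single j 1))) := by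
  set LR := L.restrictScalars ℝ
  have hdet : 0 < LinearMap.det LR := det_restrictScalars_pos L hL
  set b : Fin 3 → V 3 := fun j => L (Pi.single j 1)
  have hfr : ∀ a, LR (stdFrame 3 a) = realFrame b a := fun a =>
    (congrFun (realFrame_eq_comp L) a).symm
  have hfr' : (fun a => LR (stdFrame 3 a)) = realFrame b := funext hfr
  -- the volume of the standard frame
  have hgram : (gram (stdFrame 3) β).det = ((LinearMap.det LR)⁻¹) ^ 2 := by
    have h1 : (skew (realFrame b) β).det = (LinearMap.det LR) ^ 2 * (skew (stdFrame 3) β).det := by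
      rw [← hfr']; exact det_skew_comp LR β
    have h2 : (gram (realFrame b) β).det = 1 := by
      rw [show gram (realFrame b) β = 1 from hb, Matrix.det_one]
    rw [gram_realFrame, det_mul, h1] at h2
    have h3 : (gram (stdFrame 3) β).det = (skew (stdFrame 3) β).det * (matI 3).det := by
      rw [show stdFrame 3 = realFrame fun j => Pi.single j (1 : ℂ) from rfl, gram_realFrame,
        det_mul]
    rw [h3, inv_pow, ← mul_eq_one_iff_eq_inv₀ (pow_ne_zero 2 hdet.ne'), ← h2]
    ring
  let βc : V 3 →ₗ[ℝ] V 3 →ₗ[ℝ] ℂ := (bil β).compr₂ Complex.ofRealCLM.toLinearMap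
  have hβc : ∀ u v, βc u v = (β ![u, v] : ℂ) := fun u v => rfl
  obtain ⟨w, hw⟩ := exists_alternatingMap_wedge α βc βc
  simp only [hβc] at hw
  have hw2 := alternatingMap_comp_basis w ((stdBasis 3).reindex finProdFinEquiv) LR
  have he : ∀ i, ((stdBasis 3).reindex finProdFinEquiv) i = stdFrame 3 (finProdFinEquiv.symm i) :=
    fun i => by rw [Module.Basis.reindex_apply, stdBasis_apply]
  have hfe : ⇑((stdBasis 3).reindex finProdFinEquiv)
      = fun i => stdFrame 3 (finProdFinEquiv.symm i) := funext he
  simp only [hfe] at hw2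
  rw [hw, hw] at hw2
  rw [topCoeff, hgram, Real.sqrt_sq (by positivity), ofReal_inv, div_inv_eq_mul, mul_comm, ← hw2]
  simp only [hfr]
  have hβ : ∀ i j : Fin 6, β ![realFrame b (finProdFinEquiv.symm i),
      realFrame b (finProdFinEquiv.symm j)] = J6 i j := fun i j => by
    have h1 : skew (realFrame b) β (finProdFinEquiv.symm i) (finProdFinEquiv.symm j)
        = - matI 3 (finProdFinEquiv.symm i) (finProdFinEquiv.symm j) := by rw [hb.skew_eq]; rfl
    have hz : ∀ i j : Fin 6, (if (finProdFinEquiv.symm i : Fin 3 × Fin 2).1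
        = (finProdFinEquiv.symm j : Fin 3 × Fin 2).1 then
        (if (finProdFinEquiv.symm j : Fin 3 × Fin 2).2 = 0 then
          (if (finProdFinEquiv.symm i : Fin 3 × Fin 2).2 = 1 then (-1 : ℤ) else 0) else
          (if (finProdFinEquiv.symm i : Fin 3 × Fin 2).2 = 0 then 1 else 0)) else 0) = J6 i j := by
      decide
    refine h1.trans ?_
    rw [← hz]
    simp only [matI, of_apply]
    split_ifs <;> simp
  unfold wedge₃
  simp only [hβ]
  have := sum_perm_mul_J6 fun i j => α (realFrame b (finProdFinEquiv.symm i))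
    (realFrame b (finProdFinEquiv.symm j))
  simp only [ofReal_intCast]
  rw [this, Fin.sum_univ_three]
  simp [finProdFinEquiv, Fin.divNat, Fin.modNat, realFrame]
  ring

end Unitary

/-! ### Curvature in local coordinates -/

section CurvBilinear

variable {n r : ℕ} {G : V n → 𝕄(r)} {y : V n}

/-- The curvature is real-bilinear in its two directions. -/
theorem exists_bilin_curv (hG : SmoothMatAt 2 G y) (hd : (G y).det ≠ 0) :
    ∃ B : V n →ₗ[ℝ] V n →ₗ[ℝ] 𝕄(r), ∀ u v, curv G y u v = B u v := by
  choose L hL hLe using fun a b => exists_clm_conn (k := 2) (l := 1) hG le_rfl hd a b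
  have hf : ∀ u v a b, curv G y u v a b = fderiv ℝ (L a b) y u v - fderiv ℝ (L a b) y v u
      + ∑ c, (L a c y u * L c b y v - L a c y v * L c b y u) := fun u v a b => by
    have h1 : ∀ u v, dmat (fun x => conn G x v) y u a b = fderiv ℝ (L a b) y u v := fun u v => by
      have h2 : (fun x => conn G x v a b) = fun x => L a b x v := funext fun x => hLe a b x v
      have h3 := (((hL a b).differentiableAt (by simp)).hasFDerivAt.clm_apply
        (hasFDerivAt_const v y)).fderiv
      change fderiv ℝ (fun x => conn G x v a b) y u = _
      rw [h2, h3]; simp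
    rw [curv_eq]
    simp only [Matrix.add_apply, Matrix.sub_apply, Matrix.mul_apply, h1, hLe,
      Finset.sum_sub_distrib]
  refine ⟨LinearMap.mk₂ ℝ (fun u v => curv G y u v) ?_ ?_ ?_ ?_, fun u v => rfl⟩
  · intro u u' v; ext a b
    simp only [hf, Matrix.add_apply, map_add, add_apply, add_mul, mul_add,
      Finset.sum_sub_distrib, Finset.sum_add_distrib]
    ring
  · intro c u v; ext a b
    simp only [hf, Matrix.smul_apply, map_smul, smul_apply, smul_mul_assoc, mul_smul_comm,
      ← smul_sub, ← Finset.smul_sum, ← smul_add]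
  · intro u v v'; ext a b
    simp only [hf, Matrix.add_apply, map_add, add_apply, add_mul, mul_add,
      Finset.sum_sub_distrib, Finset.sum_add_distrib]
    ring
  · intro c u v; ext a b
    simp only [hf, Matrix.smul_apply, map_smul, smul_apply, smul_mul_assoc, mul_smul_comm,
      ← smul_sub, ← Finset.smul_sum, ← smul_add]

/-- The contracted curvature as a sum over a unitary basis. -/
theorem traceForm_curv_eq_sum (hG : SmoothMatAt 2 G y) (hd : (G y).det ≠ 0)
    (β : V n [⋀^Fin 2]→L[ℝ] ℝ)
    (h11 : ∀ u v : V n, β ![I • u, I • v] = β ![u, v]) (L : V n →ₗ[ℂ] V n)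
    (hL : LinearMap.det L ≠ 0) (hb : IsUnitary β fun j => L (Pi.single j 1)) :
    traceForm (stdFrame n) β (curv G y)
      = ∑ j, curv G y (L (Pi.single j 1)) (I • L (Pi.single j 1)) := by
  obtain ⟨B, hB⟩ := exists_bilin_curv hG hd
  exact traceForm_eq_sum_unitary β h11 L hL hb _ B hB fun u v => curv_antisymm u v

/-- The sum, over a unitary basis, of the Hessians along complex lines of `vᴴ G v`. -/
theorem sum_levi_quad {r : ℕ} {G : V n → 𝕄(r)} (hG : SmoothMatAt 2 G y)
    (hp : (G y).PosDef) (hh : ∀ᶠ x in 𝓝 y, (G x).IsHermitian) (v : Fin r → ℂ)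
    (b : Fin n → V n) :
    ∑ j, levi (fun x => quad v (G x)) y (b j)
      = quad v (G y * ((-2 * I) • ∑ j, curv G y (b j) (I • b j)))
        + ∑ j, 4 * quad (conn G y (b j) *ᵥ v) (G y) := by
  rw [Finset.smul_sum, Finset.mul_sum, quad_sum, ← Finset.sum_add_distrib]
  exact Finset.sum_congr rfl fun j _ => quad_curv_line hG hp hh v (b j)

end CurvBilinear

theorem curv_congr {n r : ℕ} {G G' : V n → 𝕄(r)} {y : V n}
    (h : ∀ᶠ x in 𝓝 y, G x = G' x) (u v : V n) : curv G y u v = curv G' y u v := by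
  have hc : ∀ᶠ x in 𝓝 y, ∀ v, conn G x v = conn G' x v := by
    filter_upwards [h.eventually_nhds] with x hx v
    have hw : wirt G x v = wirt G' x v := by
      ext a b
      simp only [wirt, of_apply]
      rw [Filter.EventuallyEq.fderiv_eq (f₁ := fun x => G x a b) (f := fun x => G' x a b)
        (hx.mono fun x hx => by simp [hx])]
    rw [conn, conn, hx.self_of_nhds, hw]
  rw [curv_eq, curv_eq, hc.self_of_nhds, hc.self_of_nhds,
    dmat_congr (hc.mono fun x hx => hx v), dmat_congr (hc.mono fun x hx => hx u)]

theorem tendsto_quad {r : ℕ} {Z : Type*} {l : Filter Z} {v : Z → Fin r → ℂ} {v₀ : Fin r → ℂ}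
    {M : Z → 𝕄(r)} {M₀ : 𝕄(r)} (hv : Tendsto v l (𝓝 v₀))
    (hM : ∀ a b, Tendsto (fun z => M z a b) l (𝓝 (M₀ a b))) :
    Tendsto (fun z => quad (v z) (M z)) l (𝓝 (quad v₀ M₀)) := by
  have hv' := tendsto_pi_nhds.1 hv
  simp only [quad, dotProduct, Matrix.mulVec, Pi.star_apply]
  refine (continuous_re.tendsto _).comp (tendsto_finsetSum _ fun a _ => ?_)
  refine ((continuous_star.tendsto _).comp (hv' a)).mul (tendsto_finsetSum _ fun b _ => ?_)
  exact (hM a b).mul (hv' b)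

section LocalInequality

variable {n r : ℕ} {G G₁ G₂ τ : V n → 𝕄(r)} {y : V n}

theorem contDiffAt_log_quad (hG : SmoothMatAt 2 G y) {v : Fin r → ℂ} (hv : 0 < quad v (G y)) :
    ContDiffAt ℝ 2 (fun x => Real.log (quad v (G x))) y :=
  (hG.contDiffAt_quad v).log hv.ne'

theorem levi_sub {f g : V n → ℝ} (hf : ContDiffAt ℝ 2 f y) (hg : ContDiffAt ℝ 2 g y) (b : V n) :
    levi (fun x => f x - g x) y b = levi f y b - levi g y b := by
  simp only [sub_eq_add_neg]
  rw [levi_add hf hg.neg, levi_neg hg]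

/-- In a frame which is parallel to first order for `G₂`, the logarithm of the ratio of the
squared norms of a constant section is controlled from below by the curvatures. -/
theorem sub_le_sum_levi_log_sub (h₁ : SmoothMatAt 2 G₁ y) (h₂ : SmoothMatAt 2 G₂ y)
    (hp₁ : (G₁ y).PosDef) (hp₂ : (G₂ y).PosDef) (hh₁ : ∀ᶠ x in 𝓝 y, (G₁ x).IsHermitian)
    (hh₂ : ∀ᶠ x in 𝓝 y, (G₂ x).IsHermitian) {v : Fin r → ℂ} (hv : v ≠ 0) (b : Fin n → V n) :
    ContDiffAt ℝ 2 (fun x =>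
      Real.log (quad v ((parallelFrame G₂ y x)ᴴ * G₁ x * parallelFrame G₂ y x))
      - Real.log (quad v ((parallelFrame G₂ y x)ᴴ * G₂ x * parallelFrame G₂ y x))) y ∧
    quad v (G₁ y * ((-2 * I) • ∑ j, curv G₁ y (b j) (I • b j))) / quad v (G₁ y)
      - quad v (G₂ y * ((-2 * I) • ∑ j, curv G₂ y (b j) (I • b j))) / quad v (G₂ y)
    ≤ ∑ j, levi (fun x =>
      Real.log (quad v ((parallelFrame G₂ y x)ᴴ * G₁ x * parallelFrame G₂ y x))
      - Real.log (quad v ((parallelFrame G₂ y x)ᴴ * G₂ x * parallelFrame G₂ y x))) y (b j) := by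
  set P := parallelFrame G₂ y
  have hd₁ := hp₁.det_pos.ne'
  have hd₂ := hp₂.det_pos.ne'
  have hPs : ∀ x, SmoothMatAt 2 P x := fun x =>
    (dmat_parallelFrame h₂ hd₂ x 0).1.mono (by simp)
  have hP1 : P y = 1 := parallelFrame_self
  have hPI : ∀ᶠ x in 𝓝 y, ∀ u, dmat P x (I • u) = I • dmat P x u :=
    Eventually.of_forall fun x u => dmat_parallelFrame_I_smul h₂ hd₂ x u
  have hs : ∀ {G : V n → 𝕄(r)}, SmoothMatAt 2 G y →
      SmoothMatAt 2 (fun x => (P x)ᴴ * G x * P x) y := fun hG =>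
    ((hPs y).conjTranspose.mul hG).mul (hPs y)
  have he : ∀ G : V n → 𝕄(r), (P y)ᴴ * G y * P y = G y := fun G => by
    rw [hP1]; simp
  have hherm : ∀ {G : V n → 𝕄(r)}, (∀ᶠ x in 𝓝 y, (G x).IsHermitian) →
      ∀ᶠ x in 𝓝 y, ((P x)ᴴ * G x * P x).IsHermitian := fun hG => by
    filter_upwards [hG] with x hx
    exact Matrix.isHermitian_conjTranspose_mul_mul _ hx
  have hcurv : ∀ {G : V n → 𝕄(r)}, SmoothMatAt 2 G y → (G y).det ≠ 0 →
      ∀ u v, curv (fun x => (P x)ᴴ * G x * P x) y u v = curv G y u v := fun hG hd u v => by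
    have := curv_gauge (φ := fun x => x) (τ := P) (G' := fun x => (P x)ᴴ * _ * P x) hG hd (hPs y)
      (by rw [hP1]; simp) contDiffAt_id hPI fderiv_id_I_smul
      (Eventually.of_forall fun x => rfl) u v
    simpa [hP1] using this
  have hq₁ := quad_pos hp₁ hv
  have hq₂ := quad_pos hp₂ hv
  have hc₁ := contDiffAt_log_quad (v := v) (hs h₁) (by rw [he G₁]; exact hq₁)
  have hc₂ := contDiffAt_log_quad (v := v) (hs h₂) (by rw [he G₂]; exact hq₂)
  refine ⟨hc₁.sub hc₂, ?_⟩
  simp_rw [levi_sub hc₁ hc₂]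
  rw [Finset.sum_sub_distrib]
  have e : ∀ G : V n → 𝕄(r),
      quad v (G y * ((-2 * I) • ∑ j, curv G y (b j) (I • b j))) / quad v (G y)
        = ∑ j, quad v (G y * ((-2 * I) • curv G y (b j) (I • b j))) / quad v (G y) := fun G => by
    rw [Finset.smul_sum, Finset.mul_sum, quad_sum, Finset.sum_div]
  rw [e G₁, e G₂]
  refine sub_le_sub (Finset.sum_le_sum fun j _ => ?_) (le_of_eq (Finset.sum_congr rfl fun j _ => ?_))
  · have := (quad_curv_le_levi_log (hs h₁) (by rw [he G₁]; exact hp₁) (hherm hh₁) hv (b j)).1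
    rwa [hcurv h₁ hd₁, he G₁] at this
  · have := (quad_curv_le_levi_log (hs h₂) (by rw [he G₂]; exact hp₂) (hherm hh₂) hv (b j)).2
      (parallelFrame_wirt_curv h₂ hd₂ (b j) 0).1
    rwa [hcurv h₂ hd₂, he G₂] at this

end LocalInequality

/-! ### Estimates for Hermitian forms -/

theorem hasDerivWithinAt_quad {r : ℕ} {M : ℝ → 𝕄(r)}
    {M' : 𝕄(r)} {s : Set ℝ} {t : ℝ}
    (h : ∀ a b, HasDerivWithinAt (fun τ => M τ a b) (M' a b) s t) (v : Fin r → ℂ) :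
    HasDerivWithinAt (fun τ => quad v (M τ)) (quad v M') s t := by
  obtain ⟨T, hT⟩ := exists_clm_quad v
  have h1 : HasDerivWithinAt (fun τ => (fun a b => M τ a b : Fin r → Fin r → ℂ))
      (fun a b => M' a b) s t :=
    hasDerivWithinAt_pi.2 fun a => hasDerivWithinAt_pi.2 fun b => h a b
  have h2 := T.hasFDerivAt.comp_hasDerivWithinAt t h1
  rw [hT] at h2
  exact h2.congr (fun τ _ => (hT _).symm) (hT _).symm

/-- The first-order condition at a maximum over a time interval, possibly attained at the final
time. -/
theorem deriv_nonneg_of_isMaxOn_left {g : ℝ → ℝ} {g' t T : ℝ} (ht : 0 < t) (htT : t ≤ T)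
    (hg : HasDerivWithinAt g g' (Icc 0 T) t) (hm : ∀ τ ∈ Icc 0 T, g τ ≤ g t) : 0 ≤ g' := by
  have h1 : IsLocalMaxOn g (Icc 0 T) t := by
    filter_upwards [self_mem_nhdsWithin] with τ hτ using hm τ hτ
  have h2 : (0 - t) ∈ posTangentConeAt (Icc 0 T) t := by
    refine mem_posTangentConeAt_of_segment_subset ?_
    rw [show t + (0 - t) = 0 by ring]
    exact (convex_Icc 0 T).segment_subset ⟨ht.le, htT⟩ ⟨le_rfl, ht.le.trans htT⟩
  have h3 := h1.hasFDerivWithinAt_nonpos hg.hasFDerivWithinAt h2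
  simp at h3
  nlinarith

section Quad

variable {r : ℕ}

theorem abs_quad_le (v : Fin r → ℂ) (M : 𝕄(r)) :
    |quad v M| ≤ (∑ a, ∑ b, ‖M a b‖) * ‖v‖ ^ 2 := by
  refine (Complex.abs_re_le_norm _).trans ?_
  simp only [dotProduct, Matrix.mulVec, Pi.star_apply]
  rw [Finset.sum_mul]
  refine (norm_sum_le _ _).trans (Finset.sum_le_sum fun a _ => ?_)
  rw [norm_mul, norm_star, Finset.sum_mul]
  refine (mul_le_mul_of_nonneg_left (norm_sum_le _ _) (norm_nonneg _)).trans ?_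
  rw [Finset.mul_sum]
  refine Finset.sum_le_sum fun b _ => ?_
  rw [norm_mul]
  have h1 := norm_le_pi_norm v a
  have h2 := norm_le_pi_norm v b
  calc ‖v a‖ * (‖M a b‖ * ‖v b‖) = ‖M a b‖ * (‖v a‖ * ‖v b‖) := by ring
    _ ≤ ‖M a b‖ * (‖v‖ * ‖v‖) := by gcongr
    _ = _ := by ring

theorem quad_real_smul (c : ℝ) (v : Fin r → ℂ) (M : 𝕄(r)) :
    quad (c • v) M = c ^ 2 * quad v M := by
  have h : c • v = (c : ℂ) • v := by ext i; simp
  rw [h, quad, quad, star_smul, mulVec_smul, smul_dotProduct, dotProduct_smul]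
  simp only [smul_eq_mul, star_def, conj_ofReal]
  rw [← mul_assoc, ← ofReal_mul, re_ofReal_mul]
  ring

/-- By compactness of the unit sphere, a positive definite form is bounded below by a multiple of
the squared norm. -/
theorem exists_le_quad {M : 𝕄(r)}
    (hM : ∀ v : Fin r → ℂ, v ≠ 0 → 0 < quad v M) :
    ∃ c, 0 < c ∧ ∀ v : Fin r → ℂ, c * ‖v‖ ^ 2 ≤ quad v M := by
  rcases (Metric.sphere (0 : Fin r → ℂ) 1).eq_empty_or_nonempty with he | hne
  · refine ⟨1, one_pos, fun v => ?_⟩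
    have hv : v = 0 := by
      by_contra hv
      have : (‖v‖⁻¹ : ℝ) • v ∈ Metric.sphere (0 : Fin r → ℂ) 1 := by
        rw [mem_sphere_zero_iff_norm, norm_smul, norm_inv, norm_norm,
          inv_mul_cancel₀ (norm_ne_zero_iff.2 hv)]
      rw [he] at this; exact this
    subst hv; simp [quad]
  · have hc : Continuous fun v : Fin r → ℂ => quad v M :=
      continuous_iff_continuousAt.2 fun v => tendsto_quad tendsto_id fun _ _ => tendsto_const_nhds
    obtain ⟨v₀, h0, hmin⟩ := (isCompact_sphere (0 : Fin r → ℂ) 1).exists_isMinOn hne hc.continuousOn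
    have hv0 : v₀ ≠ 0 := fun h => by
      rw [mem_sphere_zero_iff_norm, h, norm_zero] at h0; exact zero_ne_one h0
    refine ⟨quad v₀ M, hM _ hv0, fun v => ?_⟩
    by_cases hv : v = 0
    · subst hv; simp [quad]
    have hn : ‖v‖ ≠ 0 := norm_ne_zero_iff.2 hv
    have h1 : (‖v‖⁻¹ : ℝ) • v ∈ Metric.sphere (0 : Fin r → ℂ) 1 := by
      rw [mem_sphere_zero_iff_norm, norm_smul, norm_inv, norm_norm, inv_mul_cancel₀ hn]
    have h2 : quad v₀ M ≤ quad ((‖v‖⁻¹ : ℝ) • v) M := hmin h1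
    rw [quad_real_smul, inv_pow, inv_mul_eq_div, le_div_iff₀ (by positivity)] at h2
    exact h2

/-- Positivity of a Hermitian form is locally uniform. -/
theorem eventually_le_quad {Z : Type*} {l : Filter Z} {M : Z → 𝕄(r)}
    {M₀ : 𝕄(r)} (hM : ∀ v : Fin r → ℂ, v ≠ 0 → 0 < quad v M₀)
    (h : ∀ a b, Tendsto (fun z => M z a b) l (𝓝 (M₀ a b))) :
    ∃ c, 0 < c ∧ ∀ᶠ z in l, ∀ v : Fin r → ℂ, c * ‖v‖ ^ 2 ≤ quad v (M z) := by
  obtain ⟨c, hc, hq⟩ := exists_le_quad hM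
  refine ⟨c / 2, half_pos hc, ?_⟩
  have h1 : Tendsto (fun z => ∑ a, ∑ b, ‖(M z - M₀) a b‖) l (𝓝 0) := by
    have : Tendsto (fun z => ∑ a, ∑ b, ‖(M z - M₀) a b‖) l
        (𝓝 (∑ _a : Fin r, ∑ _b : Fin r, ‖(0 : ℂ)‖)) := by
      refine tendsto_finsetSum _ fun a _ => tendsto_finsetSum _ fun b _ => ?_
      have := ((h a b).sub_const (M₀ a b)).norm
      rwa [sub_self] at this
    simpa using this
  filter_upwards [h1.eventually (gt_mem_nhds (half_pos hc))] with z hz v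
  have h2 := abs_quad_le v (M z - M₀)
  have h3 : (∑ a, ∑ b, ‖(M z - M₀) a b‖) * ‖v‖ ^ 2 ≤ c / 2 * ‖v‖ ^ 2 :=
    mul_le_mul_of_nonneg_right hz.le (by positivity)
  rw [quad_sub] at h2
  have h4 := (abs_le.1 (h2.trans h3)).1
  linarith [hq v]

end Quad

/-- A Hermitian matrix is controlled by a positive one, uniformly near a limit. -/
theorem eventually_abs_quad_le {r : ℕ} {Z : Type*} {l : Filter Z}
    {M N : Z → 𝕄(r)} {M₀ N₀ : 𝕄(r)}
    (hM₀ : ∀ v : Fin r → ℂ, v ≠ 0 → 0 < quad v M₀)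
    (hM : ∀ a b, Tendsto (fun z => M z a b) l (𝓝 (M₀ a b)))
    (hN : ∀ a b, Tendsto (fun z => N z a b) l (𝓝 (N₀ a b))) :
    ∃ C, 0 ≤ C ∧ ∀ᶠ z in l, ∀ v, |quad v (N z)| ≤ C * quad v (M z) := by
  obtain ⟨c, hc, hcM⟩ := eventually_le_quad hM₀ hM
  have h1 : Tendsto (fun z => ∑ a, ∑ b, ‖N z a b‖) l (𝓝 (∑ a, ∑ b, ‖N₀ a b‖)) :=
    tendsto_finsetSum _ fun a _ => tendsto_finsetSum _ fun b _ => (hN a b).norm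
  have h0 : 0 ≤ ∑ a, ∑ b, ‖N₀ a b‖ := by positivity
  refine ⟨(∑ a, ∑ b, ‖N₀ a b‖ + 1) / c, by positivity, ?_⟩
  filter_upwards [hcM, h1.eventually (gt_mem_nhds (lt_add_one _))] with z hz h2 v
  refine (abs_quad_le v _).trans ((mul_le_mul_of_nonneg_right h2.le (sq_nonneg _)).trans ?_)
  rw [div_mul_eq_mul_div, le_div_iff₀ hc, mul_assoc]
  refine mul_le_mul_of_nonneg_left ?_ (by positivity)
  rw [mul_comm]; exact hz v

/-- An entrywise bound on `N`, along a filter, gives a bound on the quadratic form of `G N` relative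
to that of `G`, since `G` is continuous and positive at the limit point. -/
theorem exists_abs_quad_mul_le {n r : ℕ} {G : V n → 𝕄(r)} {y₀ : V n}
    (hG : ∀ a b, ContinuousAt (fun y => G y a b) y₀) (hpos : ∀ v : Fin r → ℂ, v ≠ 0 → 0 < quad v (G y₀))
    {Z : Type*} {l : Filter Z} {y : Z → V n} (hy : Tendsto y l (𝓝 y₀))
    {N : Z → 𝕄(r)} {e : Z → ℝ} (he : ∀ z, 0 ≤ e z) {C : ℝ} (hC : 0 ≤ C)
    (hN : ∀ᶠ z in l, ∀ i j, ‖N z i j‖ ≤ C * e z) :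
    ∃ C', 0 ≤ C' ∧ ∀ᶠ z in l, ∀ v, |quad v (G (y z) * ((-2 * I) • N z))|
      ≤ C' * e z * quad v (G (y z)) := by
  have hGt : ∀ a b, Tendsto (fun z => G (y z) a b) l (𝓝 (G y₀ a b)) := fun a b =>
    (hG a b).tendsto.comp hy
  obtain ⟨c, hc, hcG⟩ := eventually_le_quad (M := fun z => G (y z)) hpos hGt
  have h1 : Tendsto (fun z => ∑ a, ∑ b, ‖G (y z) a b‖) l (𝓝 (∑ a, ∑ b, ‖G y₀ a b‖)) :=
    tendsto_finsetSum _ fun a _ => tendsto_finsetSum _ fun b _ => (hGt a b).norm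
  have h0 : 0 ≤ ∑ a, ∑ b, ‖G y₀ a b‖ := by positivity
  set S := ∑ a, ∑ b, ‖G y₀ a b‖
  refine ⟨r * ((S + 1) * (2 * C)) / c, by positivity, ?_⟩
  filter_upwards [hcG, h1.eventually (gt_mem_nhds (lt_add_one _)), hN] with z hz h2 h3 v
  have h4 : ∑ a, ∑ b, ‖(G (y z) * ((-2 * I) • N z)) a b‖ ≤ r * ((S + 1) * (2 * C)) * e z := by
    have h5 : ∀ a b, ‖(G (y z) * ((-2 * I) • N z)) a b‖ ≤ (∑ c, ‖G (y z) a c‖) * (2 * C * e z) :=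
      fun a b => by
        rw [Matrix.mul_apply, Finset.sum_mul]
        refine (norm_sum_le _ _).trans (Finset.sum_le_sum fun c _ => ?_)
        rw [norm_mul, Matrix.smul_apply, norm_smul]
        refine mul_le_mul_of_nonneg_left ?_ (norm_nonneg _)
        have : ‖(-2 * I : ℂ)‖ = 2 := by simp
        rw [this, mul_assoc]
        exact mul_le_mul_of_nonneg_left (h3 c b) zero_le_two
    have hCe := mul_nonneg (mul_nonneg zero_le_two hC) (he z)
    calc ∑ a, ∑ b, ‖(G (y z) * ((-2 * I) • N z)) a b‖
        ≤ ∑ a, ∑ _b : Fin r, (∑ c, ‖G (y z) a c‖) * (2 * C * e z) :=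
          Finset.sum_le_sum fun a _ => Finset.sum_le_sum fun b _ => h5 a b
      _ = r * ((∑ a, ∑ c, ‖G (y z) a c‖) * (2 * C * e z)) := by
          simp only [Finset.sum_const, Finset.card_univ, Fintype.card_fin, nsmul_eq_mul]
          rw [← Finset.mul_sum, ← Finset.sum_mul]
      _ ≤ r * ((S + 1) * (2 * C * e z)) := by gcongr
      _ = _ := by ring
  refine (abs_quad_le v _).trans ((mul_le_mul_of_nonneg_right h4 (sq_nonneg _)).trans ?_)
  rw [div_mul_eq_mul_div, div_mul_eq_mul_div, le_div_iff₀ hc, mul_assoc]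
  refine mul_le_mul_of_nonneg_left ?_ (mul_nonneg (by positivity) (he z))
  rw [mul_comm]; exact hz v

theorem quad_add_left {r : ℕ} {M : 𝕄(r)} (hM : M.IsHermitian)
    (u w : Fin r → ℂ) : quad (u + w) M = quad u M + quad w M + 2 * (star u ⬝ᵥ M *ᵥ w).re := by
  have h := congrArg Complex.re (star_dotProduct_mulVec hM u w)
  rw [star_def, conj_re] at h
  simp only [quad, star_add, Matrix.mulVec_add, add_dotProduct, dotProduct_add, add_re]
  linarith

/-- Polarisation. -/
theorem apply_eq_quad {r : ℕ} {M : 𝕄(r)} (hM : M.IsHermitian) (a b : Fin r) :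
    M a b = (((quad (Pi.single a 1 + Pi.single b 1) M - quad (Pi.single a 1) M
        - quad (Pi.single b 1) M) / 2 : ℝ) : ℂ)
      + (((quad (Pi.single a 1 + Pi.single b (-I)) M - quad (Pi.single a 1) M
        - quad (Pi.single b (-I)) M) / 2 : ℝ) : ℂ) * I := by
  have e : ∀ c, star (Pi.single a (1 : ℂ)) ⬝ᵥ M *ᵥ (Pi.single b c) = M a b * c := fun c => by
    rw [← Pi.single_star, star_one, single_one_dotProduct, Matrix.mulVec_single]
    simp
  rw [quad_add_left hM, quad_add_left hM, e, e]
  apply Complex.ext <;> simp <;> ring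

/-- Hermitian matrices converge if their quadratic forms do. -/
theorem tendsto_of_tendsto_quad {r : ℕ} {Z : Type*} {l : Filter Z}
    {M : Z → 𝕄(r)} {M₀ : 𝕄(r)}
    (hM : ∀ z, (M z).IsHermitian) (hM₀ : M₀.IsHermitian)
    (h : ∀ v, Tendsto (fun z => quad v (M z)) l (𝓝 (quad v M₀))) (a b : Fin r) :
    Tendsto (fun z => M z a b) l (𝓝 (M₀ a b)) := by
  rw [apply_eq_quad hM₀]
  simp_rw [apply_eq_quad (hM _)]
  have h1 : ∀ u v w, Tendsto (fun z => (((quad u (M z) - quad v (M z) - quad w (M z)) / 2 : ℝ) : ℂ))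
      l (𝓝 (((quad u M₀ - quad v M₀ - quad w M₀) / 2 : ℝ) : ℂ)) := fun u v w =>
    (continuous_ofReal.tendsto _).comp ((((h u).sub (h v)).sub (h w)).div_const _)
  exact (h1 _ _ _).add ((h1 _ _ _).mul_const _)

section Algebra

variable {r : ℕ}

theorem trace_adjoint_mul_self {G F : 𝕄(r)} (hd : IsUnit G.det)
    (hG : G.IsHermitian) (hF : (G * ((-2 * I) • F)).IsHermitian) :
    (F * F).trace = ((-((G⁻¹ * Fᴴ * G * F).trace.re) : ℝ) : ℂ) := by
  have h1 : Fᴴ * G = -(G * F) := by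
    have h := hF
    rw [Matrix.IsHermitian, conjTranspose_mul, conjTranspose_smul, hG.eq,
      Matrix.mul_smul, Matrix.smul_mul] at h
    have h2 : star (-2 * I : ℂ) = 2 * I := by simp
    rw [h2, show (-2 * I : ℂ) = -(2 * I) by ring, neg_smul, ← smul_neg] at h
    exact smul_right_injective _ (by simp : (2 * I : ℂ) ≠ 0) h
  have h2 : G⁻¹ * Fᴴ * G * F = -(F * F) := by
    rw [mul_assoc G⁻¹, h1, mul_neg, nonsing_inv_mul_cancel_left _ _ hd,
      neg_mul]
  have h3 : star (F * F).trace = (F * F).trace := by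
    have h4 : Fᴴ = -(G * F * G⁻¹) := by
      rw [← neg_mul, ← h1, Matrix.mul_nonsing_inv_cancel_right _ _ hd]
    rw [← Matrix.trace_conjTranspose, conjTranspose_mul, h4, neg_mul, mul_neg,
      neg_neg, mul_assoc, trace_mul_comm, ← mul_assoc, ← mul_assoc,
      mul_assoc, mul_assoc, nonsing_inv_mul_cancel_left _ _ hd]
  rw [h2, Matrix.trace_neg, neg_re, neg_neg]
  exact (Complex.conj_eq_iff_re.1 h3).symm

/-- A Hermitian matrix bounded by `c G` as a quadratic form has norm at most a multiple of `c`
relative to `G`. -/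
theorem trace_adjoint_mul_self_le {G F : 𝕄(r)} (hG : G.PosDef)
    (hF : (G * ((-2 * I) • F)).IsHermitian) {c : ℝ} (hc : 0 ≤ c)
    (h : ∀ v, |quad v (G * ((-2 * I) • F))| ≤ c * quad v G) :
    (G⁻¹ * Fᴴ * G * F).trace.re ≤ 9 * r ^ 2 * c ^ 2 := by
  have hd : IsUnit G.det := hG.det_pos.ne'.isUnit
  set M := G * ((-2 * I) • F) with hM
  obtain ⟨B, hB, hGB⟩ := exists_eq_conjTranspose_mul_self hG.inv
  set S := B * M * Bᴴ with hS
  have hSh : S.IsHermitian := Matrix.isHermitian_mul_mul_conjTranspose _ hF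
  -- in a `G`-unitary frame `G` becomes the identity
  have hB1 : B * G * Bᴴ = 1 := by
    have h1 : Bᴴ * (B * G) = 1 := by
      rw [← mul_assoc, ← hGB, nonsing_inv_mul _ hd]
    exact mul_eq_one_comm.1 h1
  have hq : ∀ v, |quad v S| ≤ c * quad v 1 := fun v => by
    have e : ∀ N, quad v (B * N * Bᴴ) = quad (Bᴴ *ᵥ v) N := fun N => by
      rw [← quad_conjTranspose_mul, Matrix.conjTranspose_conjTranspose]
    rw [← hB1, hS, e, e]
    exact h _
  -- by polarisation, each of the real and imaginary parts of an entry is at most `3 c`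
  have hent : ∀ a b, ‖S a b‖ ≤ 6 * c := fun a b => by
    have q1 : ∀ (i : Fin r) (z : ℂ), quad (Pi.single i z) 1 = normSq z := fun i z => by
      rw [quad, Matrix.one_mulVec, ← Pi.single_star, single_dotProduct, Pi.single_eq_same, star_def,
        ← normSq_eq_conj_mul_self, ofReal_re]
    have q2 : ∀ z, normSq z = 1 → quad (Pi.single a 1 + Pi.single b z) 1 ≤ 4 := fun z hz => by
      have h1 : 0 ≤ quad (Pi.single a 1 + Pi.single b (-z)) (1 : 𝕄(r)) :=
        (Complex.nonneg_iff.1 (Matrix.PosSemidef.one.dotProduct_mulVec_nonneg _)).1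
      have hs : (Pi.single b (-z) : Fin r → ℂ) = -Pi.single b z := by
        ext i; by_cases h : i = b <;> simp [h]
      rw [quad_add_left Matrix.isHermitian_one, q1, q1, hs, Matrix.mulVec_neg, dotProduct_neg,
        neg_re, normSq_neg, normSq_one, hz] at h1
      rw [quad_add_left Matrix.isHermitian_one, q1, q1, normSq_one, hz]
      linarith
    have key : ∀ z, normSq z = 1 → |(quad (Pi.single a 1 + Pi.single b z) S - quad (Pi.single a 1) S
        - quad (Pi.single b z) S) / 2| ≤ 3 * c := fun z hz => by
      have h1 := abs_le.1 (hq (Pi.single a 1 + Pi.single b z))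
      have h2 := abs_le.1 (hq (Pi.single a 1))
      have h3 := abs_le.1 (hq (Pi.single b z))
      have h4 := mul_le_mul_of_nonneg_left (q2 z hz) hc
      rw [q1, normSq_one] at h2
      rw [q1, hz] at h3
      rw [abs_le]
      constructor <;> linarith
    rw [apply_eq_quad hSh a b]
    refine (norm_add_le _ _).trans ?_
    rw [norm_mul, norm_I, mul_one, norm_real, norm_real, Real.norm_eq_abs, Real.norm_eq_abs]
    linarith [key 1 normSq_one, key (-I) (by rw [normSq_neg, normSq_I])]
  have hSS : (S * S).trace = ((∑ a, ∑ b, ‖S a b‖ ^ 2 : ℝ) : ℂ) := by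
    rw [Matrix.trace, ofReal_sum]
    refine Finset.sum_congr rfl fun a _ => ?_
    rw [Matrix.diag_apply, Matrix.mul_apply, ofReal_sum]
    refine Finset.sum_congr rfl fun b _ => ?_
    rw [← hSh.apply b a, star_def, mul_conj, normSq_eq_norm_sq]
  have hle : (S * S).trace.re ≤ r ^ 2 * (6 * c) ^ 2 := by
    rw [hSS, ofReal_re]
    calc ∑ a, ∑ b, ‖S a b‖ ^ 2 ≤ ∑ _a : Fin r, ∑ _b : Fin r, (6 * c) ^ 2 :=
          Finset.sum_le_sum fun a _ => Finset.sum_le_sum fun b _ =>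
            pow_le_pow_left₀ (norm_nonneg _) (hent a b) 2
      _ = r ^ 2 * (6 * c) ^ 2 := by simp; ring
  have htr : (S * S).trace = ((-2 * I) * (-2 * I)) • (F * F).trace := by
    have hN : G⁻¹ * M = (-2 * I) • F := by rw [hM, nonsing_inv_mul_cancel_left _ _ hd]
    have e : S * S = B * (M * (G⁻¹ * M)) * Bᴴ := by
      rw [hS, hGB]; simp only [mul_assoc]
    rw [e, trace_mul_comm, ← mul_assoc, ← hGB, ← mul_assoc, hN,
      Matrix.smul_mul, Matrix.mul_smul, smul_smul, trace_smul]
  rw [trace_adjoint_mul_self hd hG.1 hF, smul_eq_mul] at htr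
  have h1 : (-2 * I) * (-2 * I) = ((-4 : ℝ) : ℂ) := by
    push_cast; linear_combination 4 * I_mul_I
  rw [h1, ← ofReal_mul] at htr
  rw [htr, ofReal_re] at hle
  linarith

end Algebra

theorem abs_deriv_le_of_le_mul {g : ℝ → ℝ} {g' c : ℝ} (hg : HasDerivWithinAt g g' (Ici 0) 0)
    (h : ∀ τ, 0 < τ → τ ≤ 1 → |g τ - g 0| ≤ c * τ) : |g'| ≤ c := by
  have h1 := (hasDerivWithinAt_iff_tendsto_slope' (self_notMem_Ioi (a := (0 : ℝ)))).1
    (hg.mono Ioi_subset_Ici_self)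
  refine le_of_tendsto h1.abs ?_
  have h2 : Iio (1 : ℝ) ∈ 𝓝[>] (0 : ℝ) := mem_nhdsWithin_of_mem_nhds (Iio_mem_nhds one_pos)
  filter_upwards [self_mem_nhdsWithin, h2] with τ h0 hτ
  rw [slope_def_field, sub_zero, abs_div, abs_of_pos (show 0 < τ from h0), div_le_iff₀ h0]
  exact h τ h0 (le_of_lt hτ)

theorem tendsto_det {ι Z : Type*} [Fintype ι] [DecidableEq ι] {l : Filter Z}
    {M : Z → Matrix ι ι ℝ} {M₀ : Matrix ι ι ℝ}
    (h : ∀ a b, Tendsto (fun z => M z a b) l (𝓝 (M₀ a b))) :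
    Tendsto (fun z => (M z).det) l (𝓝 M₀.det) := by
  simp only [Matrix.det_apply]
  exact tendsto_finsetSum _ fun σ _ => (tendsto_finsetProd _ fun i _ => h _ _).const_smul _

theorem tendsto_matrix_inv {ι Z : Type*} [Fintype ι] [DecidableEq ι] {l : Filter Z}
    {M : Z → Matrix ι ι ℝ} {M₀ : Matrix ι ι ℝ}
    (h : ∀ a b, Tendsto (fun z => M z a b) l (𝓝 (M₀ a b))) (hd : M₀.det ≠ 0) (a b : ι) :
    Tendsto (fun z => (M z)⁻¹ a b) l (𝓝 (M₀⁻¹ a b)) := by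
  have e : ∀ M : Matrix ι ι ℝ, M⁻¹ a b = M.det⁻¹ * (M.updateRow b (Pi.single a 1)).det := fun M => by
    rw [Matrix.inv_def, Matrix.smul_apply, Ring.inverse_eq_inv', smul_eq_mul, Matrix.adjugate_apply]
  simp only [e]
  refine ((tendsto_det h).inv₀ hd).mul (tendsto_det fun c d => ?_)
  by_cases hc : c = b
  · subst hc; simp only [Matrix.updateRow_self]; exact tendsto_const_nhds
  · simp only [Matrix.updateRow_ne hc]; exact h c d

/-! ### Limits of subsolutions of the heat equation -/

section Viscosity

variable {n : ℕ}

/-- The square of the Euclidean distance to `y₀`. -/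
def distSq (y₀ y : V n) : ℝ := ∑ j, normSq (y j - y₀ j)

theorem contDiff_distSq (y₀ : V n) : ContDiff ℝ ∞ (distSq y₀) := by
  refine ContDiff.sum fun j _ => ?_
  have h1 : ContDiff ℝ ∞ fun y : V n => y j - y₀ j := (contDiff_apply ℝ ℂ j).sub contDiff_const
  have h2 : ContDiff ℝ ∞ (fun z : ℂ => normSq z) := by
    simp only [normSq_apply]
    exact (reCLM.contDiff.mul reCLM.contDiff).add (imCLM.contDiff.mul imCLM.contDiff)
  exact h2.comp h1

theorem distSq_self (y₀ : V n) : distSq y₀ y₀ = 0 := by simp [distSq]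

theorem distSq_nonneg (y₀ y : V n) : 0 ≤ distSq y₀ y :=
  Finset.sum_nonneg fun _ _ => normSq_nonneg _

theorem sq_norm_sub_le_distSq (y₀ y : V n) : ‖y - y₀‖ ^ 2 ≤ distSq y₀ y := by
  have h : ‖y - y₀‖ ≤ Real.sqrt (distSq y₀ y) := by
    refine (pi_norm_le_iff_of_nonneg (Real.sqrt_nonneg _)).2 fun j => Real.le_sqrt_of_sq_le ?_
    rw [Pi.sub_apply, ← normSq_eq_norm_sq]
    exact Finset.single_le_sum (f := fun j => normSq (y j - y₀ j)) (fun _ _ => normSq_nonneg _)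
      (Finset.mem_univ j)
  calc ‖y - y₀‖ ^ 2 ≤ Real.sqrt (distSq y₀ y) ^ 2 := by gcongr
    _ = _ := Real.sq_sqrt (distSq_nonneg _ _)

theorem IsUnitary.det_skew_ne_zero {β : V n [⋀^Fin 2]→L[ℝ] ℝ} {L : V n →ₗ[ℂ] V n}
    (hb : IsUnitary β fun j => L (Pi.single j 1)) : (skew (stdFrame n) β).det ≠ 0 := by
  have h := det_skew_comp (L.restrictScalars ℝ) β
  have h1 := hb.skew_eq
  rw [realFrame_eq_comp] at h1
  intro h0
  rw [h0, mul_zero] at h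
  have h2 : (skew (fun a => L (stdFrame n a)) β).det = 0 := h
  rw [h1] at h2
  have h3 : (-matI n * matI n).det = 0 := by rw [det_mul, h2, zero_mul]
  rw [neg_mul, matI_mul_matI, neg_neg, Matrix.det_one] at h3
  exact one_ne_zero h3

theorem det_skew_ne_zero (β : V n [⋀^Fin 2]→L[ℝ] ℝ)
    (h11 : ∀ u v : V n, β ![I • u, I • v] = β ![u, v])
    (hpos : ∀ u : V n, u ≠ 0 → 0 < β ![u, I • u]) : (skew (stdFrame n) β).det ≠ 0 :=
  have ⟨_, _, hb⟩ := exists_isUnitary β h11 hpos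
  hb.det_skew_ne_zero

/-- The Laplacian of a Kähler metric, as a sum over a unitary basis and as a contraction with the
inverse of the matrix of the Kähler form. -/
theorem sum_levi_eq_pairing {β : V n [⋀^Fin 2]→L[ℝ] ℝ} {L : V n →ₗ[ℂ] V n}
    (hL : LinearMap.det L ≠ 0) (hb : IsUnitary β fun j => L (Pi.single j 1)) {g : V n → ℝ}
    {y : V n} (hg : ContDiffAt ℝ 2 g y) :
    ((∑ j, levi g y (L (Pi.single j 1)) : ℝ) : ℂ)
      = 2 * pairing (skew (stdFrame n) β) (fun a a' =>
        ((fderiv ℝ (fderiv ℝ g) y (I • stdFrame n a) (stdFrame n a') : ℝ) : ℂ)) := by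
  let J : V n →ₗ[ℝ] V n := (I • LinearMap.id (R := ℂ) (M := V n)).restrictScalars ℝ
  let F : V n →ₗ[ℝ] V n →ₗ[ℝ] ℂ := LinearMap.mk₂ ℝ
    (fun u v => ((fderiv ℝ (fderiv ℝ g) y (J u) v : ℝ) : ℂ))
    (fun u u' v => by simp) (fun c u v => by simp) (fun u v v' => by simp) (fun c u v => by simp)
  have hF : ∀ u v, F u v = ((fderiv ℝ (fderiv ℝ g) y (I • u) v : ℝ) : ℂ) := fun u v => rfl
  have h := pairing_eq_sum_unitary β L hL hb F
  simp only [hF] at h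
  rw [h, smul_eq_mul, ← mul_assoc, mul_one_div_cancel two_ne_zero, one_mul, ofReal_sum]
  refine Finset.sum_congr rfl fun j _ => ?_
  have hd : DifferentiableAt ℝ (fderiv ℝ g) y :=
    (hg.fderiv_right (m := 1) (by norm_num)).differentiableAt one_ne_zero
  have h2 : ∀ u, fderiv ℝ (fun x => fderiv ℝ g x u) y u = fderiv ℝ (fderiv ℝ g) y u u := fun u => by
    rw [fderiv_clm_apply hd (differentiableAt_const _)]
    simp
  have h3 : ∀ u v, fderiv ℝ (fderiv ℝ g) y (-u) v = - fderiv ℝ (fderiv ℝ g) y u v := fun u v => by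
    generalize fderiv ℝ (fderiv ℝ g) y = B
    rw [← neg_one_smul ℝ u, map_smul, smul_apply, neg_one_smul]
  rw [levi, h2, h2, smul_smul, I_mul_I, neg_one_smul, h3]
  push_cast
  ring

/-- Semicontinuity of the Laplacian. -/
theorem eventually_sum_levi_lt {β : V n → V n [⋀^Fin 2]→L[ℝ] ℝ} {y₀ : V n}
    (hβ : ContinuousAt β y₀) {g : V n → ℝ} (hg : ContDiffAt ℝ 2 g y₀) {L : V n →ₗ[ℂ] V n}
    (hL : LinearMap.det L ≠ 0) (hb : IsUnitary (β y₀) fun j => L (Pi.single j 1)) {c : ℝ}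
    (hlt : ∑ j, levi g y₀ (L (Pi.single j 1)) < c) :
    ∀ᶠ y in 𝓝 y₀, ∀ L' : V n →ₗ[ℂ] V n, LinearMap.det L' ≠ 0 →
      IsUnitary (β y) (fun j => L' (Pi.single j 1)) →
      ∑ j, levi g y (L' (Pi.single j 1)) < c := by
  have hs : ∀ a b, Tendsto (fun y => skew (stdFrame n) (β y) a b) (𝓝 y₀)
      (𝓝 (skew (stdFrame n) (β y₀) a b)) := fun a b => by
    have h2 : Continuous fun β : V n [⋀^Fin 2]→L[ℝ] ℝ => β ![stdFrame n a, stdFrame n b] :=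
      (ContinuousAlternatingMap.apply ℝ (V n) ℝ _).continuous
    exact (h2.tendsto _).comp hβ
  have hinv := tendsto_matrix_inv hs hb.det_skew_ne_zero
  have hB : ContinuousAt (fderiv ℝ (fderiv ℝ g)) y₀ :=
    ((hg.fderiv_right (m := 1) (by norm_num)).fderiv_right (m := 0) (by norm_num)).continuousAt
  have hP : Tendsto (fun y => (2 * pairing (skew (stdFrame n) (β y)) (fun a a' =>
      ((fderiv ℝ (fderiv ℝ g) y (I • stdFrame n a) (stdFrame n a') : ℝ) : ℂ))).re) (𝓝 y₀)
      (𝓝 (2 * pairing (skew (stdFrame n) (β y₀)) (fun a a' =>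
      ((fderiv ℝ (fderiv ℝ g) y₀ (I • stdFrame n a) (stdFrame n a') : ℝ) : ℂ))).re) := by
    refine (continuous_re.tendsto _).comp (Tendsto.const_mul _ (Tendsto.const_smul ?_ _))
    refine tendsto_finsetSum _ fun a _ => tendsto_finsetSum _ fun a' _ => ?_
    refine ((continuous_ofReal.tendsto _).comp (hinv a a')).smul
      ((continuous_ofReal.tendsto _).comp ?_)
    exact (hB.clm_apply continuousAt_const).clm_apply continuousAt_const
  rw [← sum_levi_eq_pairing hL hb hg, ofReal_re] at hP
  filter_upwards [hP.eventually (gt_mem_nhds hlt), hg.eventually (by simp)] with y hy hgy L' hL' hb'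
  rwa [← sum_levi_eq_pairing hL' hb' hgy, ofReal_re] at hy

/-- The limit, as `t → ∞`, of subsolutions of the heat equation is subharmonic. -/
theorem sum_levi_nonneg_of_tendsto {O : Set (V n)} (hO : IsOpen O)
    {β : V n → V n [⋀^Fin 2]→L[ℝ] ℝ} {y₀ : V n} (hy₀ : y₀ ∈ O) (hβ : ContinuousAt β y₀)
    (h11 : ∀ y ∈ O, ∀ u v : V n, β y ![I • u, I • v] = β y ![u, v])
    (hpos : ∀ y ∈ O, ∀ u : V n, u ≠ 0 → 0 < β y ![u, I • u])
    {f f' : ℝ → V n → ℝ} {g : V n → ℝ}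
    (hc : ContinuousOn (fun q : ℝ × V n => f q.1 q.2) (Ioi 0 ×ˢ O))
    (hf : ∀ t, 0 < t → ∀ y ∈ O, ContDiffAt ℝ 2 (f t) y)
    (hf' : ∀ t, 0 < t → ∀ y ∈ O, HasDerivAt (fun τ => f τ y) (f' t y) t)
    (hle : ∀ t, 0 < t → ∀ y ∈ O, ∀ L : V n →ₗ[ℂ] V n, LinearMap.det L ≠ 0 →
      IsUnitary (β y) (fun j => L (Pi.single j 1)) → f' t y ≤ ∑ j, levi (f t) y (L (Pi.single j 1)))
    (hg : ∀ y ∈ O, ContDiffAt ℝ 2 g y)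
    (hlim : ∀ y ∈ O, Tendsto (fun q : ℝ × V n => f q.1 q.2) (atTop ×ˢ 𝓝 y) (𝓝 (g y)))
    {L : V n →ₗ[ℂ] V n} (hL : LinearMap.det L ≠ 0)
    (hb : IsUnitary (β y₀) fun j => L (Pi.single j 1)) :
    0 ≤ ∑ j, levi g y₀ (L (Pi.single j 1)) := by
  by_contra! hS
  set S := ∑ j, levi g y₀ (L (Pi.single j 1)) with hSdef
  set Q := ∑ j, levi (distSq y₀) y₀ (L (Pi.single j 1)) with hQ
  have hq2 : ∀ y, ContDiffAt ℝ 2 (distSq y₀) y := fun y =>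
    (contDiff_distSq y₀).contDiffAt.of_le (by norm_cast)
  -- the test function is `g + ε |y - y₀|²`
  obtain ⟨ε, hε, hεS⟩ : ∃ ε : ℝ, 0 < ε ∧ S + ε * Q < 0 := by
    refine ⟨-S / (2 * (|Q| + 1)), by have := abs_nonneg Q; apply div_pos <;> linarith, ?_⟩
    have h1 : -S / (2 * (|Q| + 1)) * Q ≤ -S / 2 := by
      rw [div_mul_eq_mul_div, div_le_div_iff₀ (by positivity) two_pos]
      nlinarith [le_abs_self Q, abs_nonneg Q]
    linarith
  set G : V n → ℝ := fun y => g y + ε * distSq y₀ y with hG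
  have hG2 : ∀ y ∈ O, ContDiffAt ℝ 2 G y := fun y hy =>
    (hg y hy).add (contDiffAt_const.mul (hq2 y))
  set m : ℝ := -(S + ε * Q) / 2 with hm
  have hm0 : 0 < m := by rw [hm]; linarith
  have hGlt : ∑ j, levi G y₀ (L (Pi.single j 1)) < -m := by
    have : ∀ b, levi G y₀ b = levi g y₀ b + ε * levi (distSq y₀) y₀ b := fun b => by
      rw [← levi_const_mul (hq2 _), ← levi_add (hg _ hy₀) (contDiffAt_const.mul (hq2 y₀))]
    simp_rw [this]
    rw [Finset.sum_add_distrib, ← Finset.mul_sum, ← hSdef, ← hQ, hm]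
    linarith
  obtain ⟨R, hR, hball⟩ := Metric.nhds_basis_closedBall.mem_iff.1
    (inter_mem (hO.mem_nhds hy₀) (eventually_sum_levi_lt hβ (hG2 _ hy₀) hL hb hGlt))
  set δ : ℝ := ε * R ^ 2 / 4 with hδ
  have hδ0 : 0 < δ := by positivity
  obtain ⟨T, hT0, hT⟩ : ∃ T : ℝ, 0 < T ∧ ∀ t, T ≤ t → ∀ y ∈ Metric.closedBall y₀ R,
      |f t y - g y| ≤ δ := by
    have h1 : TendstoLocallyUniformlyOn f g atTop O := by
      rw [Metric.tendstoLocallyUniformlyOn_iff]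
      intro ρ hρ y hy
      have h2 : Tendsto (fun q : ℝ × V n => dist (g q.2) (f q.1 q.2)) (atTop ×ˢ 𝓝 y)
          (𝓝 (dist (g y) (g y))) :=
        ((hg y hy).continuousAt.tendsto.comp tendsto_snd).dist (hlim y hy)
      rw [dist_self] at h2
      obtain ⟨pa, hpa, pb, hpb, hab⟩ := eventually_prod_iff.1 (h2.eventually (gt_mem_nhds hρ))
      exact ⟨{y | pb y}, mem_nhdsWithin_of_mem_nhds hpb,
        hpa.mono fun t ht x hx => hab ht hx⟩
    have h3 := (tendstoLocallyUniformlyOn_iff_tendstoUniformlyOn_of_compact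
      (isCompact_closedBall y₀ R)).1 (h1.mono fun y hy => (hball hy).1)
    obtain ⟨T, hT⟩ := eventually_atTop.1 (Metric.tendstoUniformlyOn_iff.1 h3 δ hδ0)
    refine ⟨max T 1, by positivity, fun t ht y hy => ?_⟩
    have := hT t ((le_max_left _ _).trans ht) y hy
    rw [dist_comm, Real.dist_eq] at this
    exact this.le
  -- `u = f - G + m τ` is at least `2 δ` at `(ℓ, y₀)`, and at most `δ` at `τ = 0`, below `2 δ` for
  -- `|y - y₀| = R`: its maximum over the cylinder is attained off the parabolic boundary
  set ℓ : ℝ := 3 * δ / m with hℓ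
  have hℓ0 : 0 < ℓ := by positivity
  have hℓm : m * ℓ = 3 * δ := by rw [hℓ]; field_simp
  set u : ℝ × V n → ℝ := fun q => f (T + q.1) q.2 - G q.2 + m * q.1 with hu
  have huc : ContinuousOn u (Icc 0 ℓ ×ˢ Metric.closedBall y₀ R) := by
    refine ContinuousOn.add (ContinuousOn.sub ?_ ?_) (by fun_prop)
    · exact hc.comp (f := fun q : ℝ × V n => (T + q.1, q.2)) (by fun_prop)
        fun q hq => ⟨by have := hq.1.1; simp; linarith, (hball hq.2).1⟩
    · have h1 : ContinuousOn G (Metric.closedBall y₀ R) := fun y hy =>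
        (hG2 y (hball hy).1).continuousAt.continuousWithinAt
      exact h1.comp (f := Prod.snd) continuousOn_snd fun q hq => hq.2
  obtain ⟨⟨τ, y⟩, ⟨hτ, hy⟩, hmax⟩ := (isCompact_Icc.prod (isCompact_closedBall y₀ R)).exists_isMaxOn
    ⟨(ℓ, y₀), ⟨hℓ0.le, le_rfl⟩, Metric.mem_closedBall_self hR.le⟩ huc
  have hmax' : ∀ τ' ∈ Icc 0 ℓ, ∀ y' ∈ Metric.closedBall y₀ R, u (τ', y') ≤ u (τ, y) :=
    fun τ' h1 y' h2 => hmax (show (τ', y') ∈ _ from ⟨h1, h2⟩)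
  have hlow : 2 * δ ≤ u (τ, y) := by
    refine le_trans ?_ (hmax' ℓ ⟨hℓ0.le, le_rfl⟩ y₀ (Metric.mem_closedBall_self hR.le))
    have := (abs_le.1 (hT (T + ℓ) (by linarith) y₀ (Metric.mem_closedBall_self hR.le))).1
    simp only [hu, hG, distSq_self]
    linarith
  have hup : u (τ, y) ≤ δ - ε * distSq y₀ y + m * τ := by
    have := (abs_le.1 (hT (T + τ) (by linarith [hτ.1]) y hy)).2
    simp only [hu, hG]
    linarith
  have hq0 : 0 ≤ ε * distSq y₀ y := mul_nonneg hε.le (distSq_nonneg _ _)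
  have hmτ : m * τ ≤ 3 * δ := by
    rw [← hℓm]; exact mul_le_mul_of_nonneg_left hτ.2 hm0.le
  have hτ0 : 0 < τ := by
    rcases hτ.1.eq_or_lt with h | h
    · subst h; linarith
    · exact h
  have hyR : y ∈ Metric.ball y₀ R := by
    rw [Metric.mem_ball, dist_eq_norm]
    by_contra! h
    have h1 : R ^ 2 ≤ distSq y₀ y :=
      (pow_le_pow_left₀ hR.le h 2).trans (sq_norm_sub_le_distSq _ _)
    have h2 := mul_le_mul_of_nonneg_left h1 hε.le
    linarith
  have hyO := (hball hy).1
  have ht0 : 0 < T + τ := by linarith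
  -- first-order condition in time
  have h1 : HasDerivAt (fun τ' => u (τ', y)) (f' (T + τ) y + m) τ := by
    have h2 := (hf' (T + τ) ht0 y hyO).comp_const_add T τ
    have h3 := (h2.sub_const (G y)).add ((hasDerivAt_id τ).const_mul m)
    exact h3.congr_deriv (by rw [mul_one])
  have htime := deriv_nonneg_of_isMaxOn_left hτ0 hτ.2 h1.hasDerivWithinAt fun τ' hτ' =>
    hmax' τ' hτ' y hy
  -- second-order condition in space
  obtain ⟨L', hL', hb'⟩ := exists_isUnitary (β y) (h11 y hyO) (hpos y hyO)
  have hfc := hf _ ht0 y hyO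
  have hspace : ∑ j, levi (f (T + τ)) y (L' (Pi.single j 1)) ≤ ∑ j, levi G y (L' (Pi.single j 1)) := by
    refine Finset.sum_le_sum fun j _ => ?_
    rw [← sub_nonpos, ← levi_sub hfc (hG2 y hyO)]
    refine IsLocalMax_levi_nonpos (hfc.sub (hG2 y hyO)) ?_ _
    filter_upwards [Metric.isOpen_ball.mem_nhds hyR] with y' hy'
    have := hmax' τ hτ y' (Metric.ball_subset_closedBall hy')
    simp only [hu] at this
    linarith
  have h4 := hle _ ht0 y hyO L' hL' hb'
  have h5 := (hball hy).2 L' hL' hb'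
  linarith

end Viscosity

/-! ### Local limits of the flow -/

section LocalLimit

variable {n r : ℕ}

theorem isHermitian_mul_curv {G : V n → 𝕄(r)} {y : V n}
    (hG : SmoothMatAt 2 G y) (hd : (G y).det ≠ 0) (hh : ∀ᶠ x in 𝓝 y, (G x).IsHermitian)
    (b : V n) : (G y * ((-2 * I) • curv G y b (I • b))).IsHermitian := by
  have h2 : ∀ u, (dmat (fun x => dmat G x u) y u).IsHermitian := fun u =>
    dmat_isHermitian (hh.eventually_nhds.mono fun x hx => dmat_isHermitian hx u) u
  have h3 : ((wirt G y b)ᴴ * (G y)⁻¹ * wirt G y b).IsHermitian :=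
    Matrix.isHermitian_conjTranspose_mul_mul _ hh.self_of_nhds.inv
  rw [mul_curv_line hG hd hh]
  refine ((h2 _).add (h2 _)).sub ?_
  rw [Matrix.IsHermitian, conjTranspose_smul, h3.eq]
  congr 1
  simp

/-- A positive semidefinite matrix is zero if its trace relative to a positive definite one is. -/
theorem eq_zero_of_trace_inv_mul {K M : 𝕄(r)} (hK : K.PosDef)
    (hM : M.PosSemidef) (h : (K⁻¹ * M).trace.re = 0) : M = 0 := by
  obtain ⟨B, hB, hKB⟩ := exists_eq_conjTranspose_mul_self hK.inv
  have hP : (B * M * Bᴴ).PosSemidef := hM.mul_mul_conjTranspose_same B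
  have ht : (B * M * Bᴴ).trace = (K⁻¹ * M).trace := by
    rw [trace_mul_comm, hKB, mul_assoc]
  have h0 : (B * M * Bᴴ).trace = 0 := by
    have h1 := Complex.nonneg_iff.1 hP.trace_nonneg
    exact Complex.ext (by rw [ht]; exact h) h1.2.symm
  have h2 := hP.trace_eq_zero_iff.1 h0
  have hu : IsUnit B.det := hB.isUnit
  have hu' : IsUnit (Bᴴ).det := by
    rw [det_conjTranspose]; exact hu.star
  have h3 : B⁻¹ * (B * M * Bᴴ) * (Bᴴ)⁻¹ = M := by
    rw [mul_assoc B M, nonsing_inv_mul_cancel_left _ _ hu,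
      Matrix.mul_nonsing_inv_cancel_right _ _ hu']
  rw [← h3, h2, mul_zero, zero_mul]

/-- The quadratic form of a Hermitian metric in a holomorphic frame is a subsolution. -/
theorem quad_mulVec_curv_le {G τ : V n → 𝕄(r)} {y : V n}
    (hG : SmoothMatAt 2 G y) (hp : ∀ᶠ x in 𝓝 y, (G x).PosDef) (hτ : SmoothMatAt 2 τ y)
    (hτd : (τ y).det ≠ 0) (hτI : ∀ᶠ x in 𝓝 y, ∀ u, dmat τ x (I • u) = I • dmat τ x u)
    (v : Fin r → ℂ) (b : Fin n → V n) :
    quad (τ y *ᵥ v) (G y * ((-2 * I) • ∑ j, curv G y (b j) (I • b j)))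
      ≤ ∑ j, levi (fun x => quad v ((τ x)ᴴ * G x * τ x)) y (b j) := by
  have hd := hp.self_of_nhds.det_pos.ne'
  have hG' : SmoothMatAt 2 (fun x => (τ x)ᴴ * G x * τ x) y := (hτ.conjTranspose.mul hG).mul hτ
  have hpd' : ((τ y)ᴴ * G y * τ y).PosDef :=
    hp.self_of_nhds.conjTranspose_mul_mul_same (Matrix.mulVec_injective_iff_isUnit.2
      ((Matrix.isUnit_iff_isUnit_det _).2 hτd.isUnit))
  have h := sum_levi_quad hG' hpd' (hp.mono fun x hx =>
    Matrix.isHermitian_conjTranspose_mul_mul _ hx.1) v b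
  rw [h]
  have h0 : 0 ≤ ∑ j, 4 * quad (conn (fun x => (τ x)ᴴ * G x * τ x) y (b j) *ᵥ v)
      ((τ y)ᴴ * G y * τ y) := Finset.sum_nonneg fun j _ =>
    mul_nonneg (by norm_num) (Complex.nonneg_iff.1 (hpd'.posSemidef.dotProduct_mulVec_nonneg _)).1
  refine le_trans (le_of_eq ?_) (le_add_of_nonneg_right h0)
  rw [← quad_conjTranspose_mul]
  congr 1
  have hc : ∀ j, τ y * curv (fun x => (τ x)ᴴ * G x * τ x) y (b j) (I • b j)
      = curv G y (b j) (I • b j) * τ y := fun j => by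
    have := curv_gauge (φ := fun x => x) (G' := fun x => (τ x)ᴴ * G x * τ x) hG hd hτ hτd
      contDiffAt_id hτI fderiv_id_I_smul (Eventually.of_forall fun x => rfl) (b j) (I • b j)
    rw [fderiv_fun_id] at this
    simpa using this
  generalize (fun x => (τ x)ᴴ * G x * τ x) = G₁ at hc ⊢
  simp only [mul_assoc, Matrix.mul_smul, Matrix.smul_mul, Finset.mul_sum, Finset.sum_mul, hc]

variable {O : Set (V n)} {β : V n → V n [⋀^Fin 2]→L[ℝ] ℝ} {y₀ : V n}
  {G G' : ℝ → V n → 𝕄(r)} {K : V n → 𝕄(r)}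

theorem hasDerivAt_logDet {M : ℝ → 𝕄(r)}
    {M' : 𝕄(r)} {t : ℝ} (hM : SmoothMatAt 1 M t) (hp : (M t).PosDef)
    (h : ∀ a b, HasDerivAt (fun τ => M τ a b) (M' a b) t) :
    HasDerivAt (fun τ => logDet (M τ)) ((M t)⁻¹ * M').trace.re t := by
  have h1 := ((contDiffAt_logDet hM hp).differentiableAt one_ne_zero).hasDerivAt
  refine h1.congr_deriv ?_
  rw [← fderiv_apply_one_eq_deriv, fderiv_logDet hM hp]
  congr 4
  ext a b
  rw [dmat, of_apply, fderiv_apply_one_eq_deriv, (h a b).deriv]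

theorem tendsto_logDet {Z : Type*} {l : Filter Z} {M : Z → 𝕄(r)}
    {M₀ : 𝕄(r)} (h : ∀ a b, Tendsto (fun z => M z a b) l (𝓝 (M₀ a b)))
    (hp : M₀.PosDef) : Tendsto (fun z => logDet (M z)) l (𝓝 (logDet M₀)) := by
  have h1 : Tendsto (fun z => (M z).det) l (𝓝 M₀.det) := by
    simp only [Matrix.det_apply]
    exact tendsto_finsetSum _ fun σ _ => (tendsto_finsetProd _ fun i _ => h _ _).const_smul _
  exact ((continuous_re.tendsto _).comp h1).log (ofReal_det_re hp).2.ne'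

/-- The `C⁰` limit of the flow, over an open set of `ℂⁿ`, is Hermitian Yang-Mills: the lengths of
holomorphic sections are subsolutions of the heat equation, which makes `K (-2i F̂_K)` nonnegative,
and `log det` solves the heat equation, which makes its trace relative to `K` vanish. -/
theorem traceForm_curv_eq_zero_of_tendsto (hO : IsOpen O) (hy₀ : y₀ ∈ O) (hβ : ContinuousAt β y₀)
    (h11 : ∀ y ∈ O, ∀ u v : V n, β y ![I • u, I • v] = β y ![u, v])
    (hpos : ∀ y ∈ O, ∀ u : V n, u ≠ 0 → 0 < β y ![u, I • u])
    (hc : ∀ a b, ContinuousOn (fun q : ℝ × V n => G q.1 q.2 a b) (Ioi 0 ×ˢ O))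
    (hs : ∀ t, 0 < t → ∀ y ∈ O, SmoothMatAt 2 (G t) y)
    (hst : ∀ t, 0 < t → ∀ y ∈ O, SmoothMatAt 1 (fun τ => G τ y) t)
    (hpd : ∀ t, ∀ y ∈ O, (G t y).PosDef)
    (hd : ∀ t, 0 < t → ∀ y ∈ O, ∀ a b, HasDerivAt (fun τ => G τ y a b) (G' t y a b) t)
    (hev : ∀ t, 0 < t → ∀ y ∈ O,
      G' t y = G t y * ((-2 * I) • traceForm (stdFrame n) (β y) (curv (G t) y)))
    (hK : ∀ y ∈ O, SmoothMatAt 2 K y) (hKp : ∀ y ∈ O, (K y).PosDef)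
    (hlim : ∀ y ∈ O, ∀ a b,
      Tendsto (fun q : ℝ × V n => G q.1 q.2 a b) (atTop ×ˢ 𝓝 y) (𝓝 (K y a b))) :
    traceForm (stdFrame n) (β y₀) (curv K y₀) = 0 := by
  obtain ⟨L, hL, hb⟩ := exists_isUnitary (β y₀) (h11 y₀ hy₀) (hpos y₀ hy₀)
  have hKd : (K y₀).det ≠ 0 := (hKp y₀ hy₀).det_pos.ne'
  have hOev : ∀ y ∈ O, ∀ᶠ x in 𝓝 y, x ∈ O := fun y hy => hO.mem_nhds hy
  rw [traceForm_curv_eq_sum (hK _ hy₀) hKd (β y₀) (h11 y₀ hy₀) L hL hb]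
  set F := ∑ j, curv K y₀ (L (Pi.single j 1)) (I • L (Pi.single j 1)) with hF
  -- the sign of `K (-2i F)`
  have hnonneg : ∀ v, 0 ≤ quad v (K y₀ * ((-2 * I) • F)) := fun v => by
    set P := parallelFrame K y₀ with hP
    have hPs : ∀ y, SmoothMatAt 2 P y := fun y =>
      ((dmat_parallelFrame (hK _ hy₀) hKd y 0).1).mono le_top
    have hPI := fun y => Eventually.of_forall (f := 𝓝 y) (dmat_parallelFrame_I_smul (hK _ hy₀) hKd)
    have hPc : ∀ y a b, ContinuousAt (fun y => P y a b) y := fun y a b => (hPs y a b).continuousAt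
    set O' := O ∩ {y | (P y).det ≠ 0}
    have hO'o : IsOpen O' := isOpen_iff_mem_nhds.2 fun y hy =>
      inter_mem (hO.mem_nhds hy.1) ((hPs y).eventually_det_ne_zero hy.2)
    have hq : ∀ M : 𝕄(r), ∀ y, quad v ((P y)ᴴ * M * P y) = quad (P y *ᵥ v) M :=
      fun M y => quad_conjTranspose_mul v
    have hPv : ∀ {Z : Type} {l : Filter Z} {g : Z → V n} {y : V n}, Tendsto g l (𝓝 y) →
        Tendsto (fun z => P (g z) *ᵥ v) l (𝓝 (P y *ᵥ v)) := fun {Z l g y} hg => by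
      refine tendsto_pi_nhds.2 fun a => ?_
      simp only [Matrix.mulVec, dotProduct]
      refine tendsto_finsetSum _ fun b _ => ?_
      exact ((hPc y a b).tendsto.comp hg).mul_const _
    have h := sum_levi_nonneg_of_tendsto hO'o (β := β) (y₀ := y₀) (L := L)
      (f := fun t y => quad v ((P y)ᴴ * G t y * P y)) (f' := fun t y => quad (P y *ᵥ v) (G' t y))
      (g := fun y => quad v ((P y)ᴴ * K y * P y))
      ⟨hy₀, by rw [mem_ofPred_eq, hP, parallelFrame_self]; simp⟩ hβ (fun y hy => h11 y hy.1)
      (fun y hy => hpos y hy.1) ?_ ?_ ?_ ?_ ?_ ?_ hL hb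
    · have h2 := sum_levi_quad (((hPs y₀).conjTranspose.mul (hK _ hy₀)).mul (hPs y₀)) (by
        rw [hP, parallelFrame_self]; simpa using hKp _ hy₀) ((hOev _ hy₀).mono fun x hx =>
        Matrix.isHermitian_conjTranspose_mul_mul _ (hKp x hx).1) v fun j => L (Pi.single j 1)
      rw [h2] at h
      have h3 : ∀ u, conn (fun x => (P x)ᴴ * K x * P x) y₀ u = 0 := fun u => by
        rw [conn, (parallelFrame_wirt_curv (hK _ hy₀) hKd u 0).1, mul_zero]
      have h4 : ∀ u w, curv (fun x => (P x)ᴴ * K x * P x) y₀ u w = curv K y₀ u w := fun u w =>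
        (parallelFrame_wirt_curv (hK _ hy₀) hKd u w).2
      simp only [h3, h4, Matrix.zero_mulVec] at h
      rw [← hF, hP, parallelFrame_self] at h
      simpa [quad] using h
    · rintro ⟨t, y⟩ ⟨ht, hy⟩
      simp only [hq]
      refine tendsto_quad (hPv (tendsto_snd.mono_left (nhdsWithin_le_nhds.trans
        (nhds_prod_eq (x := t) (y := y)).le))) fun a b => ?_
      exact (hc a b (t, y) ⟨ht, hy.1⟩).mono_left (nhdsWithin_mono _
        (prod_mono_right inter_subset_left))
    · exact fun t ht y hy =>
        (((hPs y).conjTranspose.mul (hs t ht y hy.1)).mul (hPs y)).contDiffAt_quad v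
    · intro t ht y hy
      simp only [hq]
      have := hasDerivWithinAt_quad (s := univ) (fun a b => (hd t ht y hy.1 a b).hasDerivWithinAt)
        (P y *ᵥ v)
      rwa [hasDerivWithinAt_univ] at this
    · intro t ht y hy L' hL' hb'
      rw [hev t ht y hy.1, traceForm_curv_eq_sum (hs t ht y hy.1) (hpd t y hy.1).det_pos.ne' (β y)
        (h11 y hy.1) L' hL' hb']
      exact quad_mulVec_curv_le (hs t ht y hy.1) ((hOev y hy.1).mono fun x hx => hpd t x hx)
        (hPs y) hy.2 (hPI y) v _
    · exact fun y hy => (((hPs y).conjTranspose.mul (hK y hy.1)).mul (hPs y)).contDiffAt_quad v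
    · intro y hy
      simp only [hq]
      exact tendsto_quad (hPv tendsto_snd) (hlim y hy.1)
  -- the trace
  have hlevi : ∀ (G : V n → 𝕄(r)) (y : V n), y ∈ O → SmoothMatAt 2 G y →
      (∀ x ∈ O, (G x).PosDef) → ∀ b : Fin n → V n,
      ∑ j, levi (fun x => logDet (G x)) y (b j)
        = ((-2 * I) • ∑ j, curv G y (b j) (I • b j)).trace.re := fun G y hy hG hp b => by
    rw [Finset.smul_sum, Matrix.trace_sum, re_sum]
    exact Finset.sum_congr rfl fun j _ => levi_logDet hG ((hOev y hy).mono hp) _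
  have hheat : ∀ t, 0 < t → ∀ y ∈ O, ∀ L' : V n →ₗ[ℂ] V n, LinearMap.det L' ≠ 0 →
      IsUnitary (β y) (fun j => L' (Pi.single j 1)) →
      ((G t y)⁻¹ * G' t y).trace.re = ∑ j, levi (fun x => logDet (G t x)) y (L' (Pi.single j 1)) :=
    fun t ht y hy L' hL' hb' => by
      rw [hev t ht y hy, traceForm_curv_eq_sum (hs t ht y hy) (hpd t y hy).det_pos.ne' (β y)
        (h11 y hy) L' hL' hb', nonsing_inv_mul_cancel_left _ _ (hpd t y hy).det_pos.ne'.isUnit,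
        hlevi (G t) y hy (hs t ht y hy) (hpd t)]
  have hcd : ContinuousOn (fun q : ℝ × V n => logDet (G q.1 q.2)) (Ioi 0 ×ˢ O) := fun q hq =>
    tendsto_logDet (fun a b => hc a b q hq) (hpd _ _ hq.2)
  have hsd : ∀ t, 0 < t → ∀ y ∈ O, ContDiffAt ℝ 2 (fun x => logDet (G t x)) y := fun t ht y hy =>
    contDiffAt_logDet (hs t ht y hy) (hpd t y hy)
  have htd : ∀ t, 0 < t → ∀ y ∈ O, HasDerivAt (fun τ => logDet (G τ y))
      ((G t y)⁻¹ * G' t y).trace.re t := fun t ht y hy =>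
    hasDerivAt_logDet (hst t ht y hy) (hpd t y hy) (hd t ht y hy)
  have hKsd : ∀ y ∈ O, ContDiffAt ℝ 2 (fun x => logDet (K x)) y := fun y hy =>
    contDiffAt_logDet (hK y hy) (hKp y hy)
  have hld : ∀ y ∈ O, Tendsto (fun q : ℝ × V n => logDet (G q.1 q.2)) (atTop ×ˢ 𝓝 y)
      (𝓝 (logDet (K y))) := fun y hy => tendsto_logDet (hlim y hy) (hKp y hy)
  have hp1 := sum_levi_nonneg_of_tendsto hO hy₀ hβ h11 hpos
    (f' := fun t y => ((G t y)⁻¹ * G' t y).trace.re) hcd hsd htd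
    (fun t ht y hy L' hL' hb' => (hheat t ht y hy L' hL' hb').le) hKsd hld hL hb
  have hp2 := sum_levi_nonneg_of_tendsto hO hy₀ hβ h11 hpos
    (f := fun t y => -logDet (G t y)) (f' := fun t y => -((G t y)⁻¹ * G' t y).trace.re)
    (g := fun y => -logDet (K y)) hcd.neg (fun t ht y hy => (hsd t ht y hy).neg)
    (fun t ht y hy => (htd t ht y hy).neg)
    (fun t ht y hy L' hL' hb' => by
      simp only [levi_neg (hsd t ht y hy), Finset.sum_neg_distrib, neg_le_neg_iff]
      exact (hheat t ht y hy L' hL' hb').ge)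
    (fun y hy => (hKsd y hy).neg) (fun y hy => (hld y hy).neg) hL hb
  simp only [levi_neg (hKsd y₀ hy₀), Finset.sum_neg_distrib, Left.nonneg_neg_iff] at hp2
  have htr := le_antisymm hp2 hp1
  rw [hlevi K y₀ hy₀ (hK _ hy₀) hKp, ← hF] at htr
  have hherm : (K y₀ * ((-2 * I) • F)).IsHermitian := by
    rw [hF, Finset.smul_sum, Finset.mul_sum, Matrix.IsHermitian, Matrix.conjTranspose_sum]
    exact Finset.sum_congr rfl fun j _ => (isHermitian_mul_curv (hK _ hy₀) hKd
      ((hOev _ hy₀).mono fun x hx => (hKp x hx).1) _).eq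
  have hM : K y₀ * ((-2 * I) • F) = 0 := by
    refine eq_zero_of_trace_inv_mul (hKp _ hy₀) (Matrix.PosSemidef.of_dotProduct_mulVec_nonneg hherm
      fun v => ?_) ?_
    · rw [← ofReal_quad hherm]
      exact_mod_cast hnonneg v
    · rw [nonsing_inv_mul_cancel_left _ _ hKd.isUnit]
      exact htr
  have h5 := congrArg (fun M => (K y₀)⁻¹ * M) hM
  simp only [nonsing_inv_mul_cancel_left _ _ hKd.isUnit, mul_zero] at h5
  exact (smul_eq_zero.1 h5).resolve_left (by simp)

end LocalLimit

/-! ### Charts and holomorphic frames -/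

section Charts

variable {n : ℕ} {X : Type*} [TopologicalSpace X] [ChartedSpace (V n) X]

/-- The coordinate change from the chart at `p` to the chart at `q`. -/
def coordChange (p q : X) (y : V n) : V n := chartAt (V n) q ((chartAt (V n) p).symm y)

/-- Coordinates in the chart at `p` of the points in the domain of the chart at `q`. -/
def overlap (p q : X) : Set (V n) :=
  (chartAt (V n) p).target ∩ (chartAt (V n) p).symm ⁻¹' (chartAt (V n) q).source

theorem isOpen_overlap (p q : X) : IsOpen (overlap (n := n) p q) :=
  (chartAt (V n) p).isOpen_inter_preimage_symm (chartAt (V n) q).open_source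

theorem contDiffOn_coordChange_complex [IsManifold 𝓘(ℂ, V n) ω X] (p q : X) :
    ContDiffOn ℂ ω (coordChange (n := n) p q) (overlap p q) := by
  rw [← contMDiffOn_iff_contDiffOn]
  exact (contMDiffOn_chart (I := 𝓘(ℂ, V n)) (n := ω) (x := q)).comp
    ((contMDiffOn_chart_symm (I := 𝓘(ℂ, V n)) (n := ω) (x := p)).mono
      inter_subset_left) fun y hy => hy.2

variable [IsManifold 𝓘(ℂ, V n) ω X]

theorem contDiffAt_coordChange {p q : X} {y : V n} (hy : y ∈ overlap p q) :
    ContDiffAt ℝ ∞ (coordChange (n := n) p q) y :=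
  (((contDiffOn_coordChange_complex p q).contDiffAt ((isOpen_overlap p q).mem_nhds hy)).restrict_scalars
    ℝ).of_le le_top

theorem fderiv_real_I_smul {F : Type*} [NormedAddCommGroup F] [NormedSpace ℂ F] {f : V n → F}
    {y : V n} (hf : DifferentiableAt ℂ f y) (u : V n) :
    fderiv ℝ f y (I • u) = I • fderiv ℝ f y u := by
  rw [hf.fderiv_restrictScalars ℝ]
  simp

theorem fderiv_coordChange_I_smul {p q : X} {y : V n} (hy : y ∈ overlap p q) (u : V n) :
    fderiv ℝ (coordChange (n := n) p q) y (I • u) = I • fderiv ℝ (coordChange p q) y u :=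
  fderiv_real_I_smul (((contDiffOn_coordChange_complex p q).contDiffAt
    ((isOpen_overlap p q).mem_nhds hy)).differentiableAt (by simp)) u

theorem coordChange_coordChange {p q : X} {y : V n} (hy : y ∈ overlap p q) :
    coordChange q p (coordChange (n := n) p q y) = y := by
  rw [coordChange, coordChange, (chartAt (V n) q).left_inv hy.2, (chartAt (V n) p).right_inv hy.1]

theorem coordChange_mem_overlap {p q : X} {y : V n} (hy : y ∈ overlap p q) :
    coordChange p q y ∈ overlap (n := n) q p :=
  ⟨(chartAt (V n) q).map_source hy.2, by
    rw [mem_preimage, coordChange, (chartAt (V n) q).left_inv hy.2]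
    exact (chartAt (V n) p).map_target hy.1⟩

theorem fderiv_coordChange_comp {p q : X} {y : V n} (hy : y ∈ overlap p q) (u : V n) :
    fderiv ℝ (coordChange q p) (coordChange p q y) (fderiv ℝ (coordChange (n := n) p q) y u) = u := by
  have h1 := (contDiffAt_coordChange hy).differentiableAt (by simp)
  have h2 := (contDiffAt_coordChange (coordChange_mem_overlap hy)).differentiableAt (by simp)
  have h3 := (h2.hasFDerivAt.comp y h1.hasFDerivAt)
  have h4 : (coordChange q p ∘ coordChange p q) =ᶠ[𝓝 y] id := by
    filter_upwards [(isOpen_overlap p q).mem_nhds hy] with x hx using coordChange_coordChange hx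
  have := (h3.congr_of_eventuallyEq h4.symm).unique (hasFDerivAt_id y)
  exact congrArg (fun L : V n →L[ℝ] V n => L u) this

theorem isManifold_real : IsManifold 𝓘(ℝ, V n) ∞ X := by
  refine isManifold_of_contDiffOn _ _ _ fun e e' he he' => ?_
  have h := HasGroupoid.compatible (G := contDiffGroupoid ω 𝓘(ℂ, V n)) he he'
  rw [contDiffGroupoid, mem_groupoid_of_pregroupoid] at h
  have h1 : ContDiffOn ℂ ω _ _ := h.1
  exact (h1.restrict_scalars ℝ).of_le le_top

/-- The manifold derivative of a map from a normed space is its derivative in the chart at the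
image point. -/
theorem mfderiv_eq_fderiv_chart {E' : Type*} [NormedAddCommGroup E'] [NormedSpace ℝ E']
    {σ : E' → X} {q : E'} (hc : ContinuousAt σ q) :
    (mfderiv 𝓘(ℝ, E') 𝓘(ℝ, V n) σ q : E' →L[ℝ] V n)
      = fderiv ℝ (fun x => chartAt (V n) (σ q) (σ x)) q := by
  unfold mfderiv
  have e : writtenInExtChartAt 𝓘(ℝ, E') 𝓘(ℝ, V n) q σ
      = fun x => chartAt (V n) (σ q) (σ x) := by
    rfl
  by_cases h : MDifferentiableAt 𝓘(ℝ, E') 𝓘(ℝ, V n) σ q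
  · refine (if_pos h).trans ?_
    rw [e, modelWithCornersSelf_coe, range_id, fderivWithin_univ]; rfl
  · refine (if_neg h).trans ?_
    rw [mdifferentiableAt_iff, e] at h
    simp only [hc, true_and, modelWithCornersSelf_coe, range_id, differentiableWithinAt_univ] at h
    exact (fderiv_zero_of_not_differentiableAt h).symm

/-- The derivative in the chart at the image point, computed through another chart. -/
theorem fderiv_chart_eq {E' : Type*} [NormedAddCommGroup E'] [NormedSpace ℝ E']
    {σ : E' → X} {q : E'} (hc : ContinuousAt σ q) {p : X} (hp : σ q ∈ (chartAt (V n) p).source)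
    (hd : DifferentiableAt ℝ (fun x => chartAt (V n) p (σ x)) q) (p' : X)
    (hp' : σ q ∈ (chartAt (V n) p').source) :
    fderiv ℝ (fun x => chartAt (V n) p' (σ x)) q
      = (fderiv ℝ (coordChange p p') (chartAt (V n) p (σ q))).comp
        (fderiv ℝ (fun x => chartAt (V n) p (σ x)) q) := by
  have hmem : chartAt (V n) p (σ q) ∈ overlap p p' :=
    ⟨(chartAt (V n) p).map_source hp, by
      rw [mem_preimage, (chartAt (V n) p).left_inv hp]; exact hp'⟩
  have h2 := (contDiffAt_coordChange hmem).differentiableAt (by simp)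
  have h3 := h2.hasFDerivAt.comp q hd.hasFDerivAt
  refine (h3.congr_of_eventuallyEq ?_).fderiv
  filter_upwards [hc.eventually ((chartAt (V n) p).open_source.mem_nhds hp)] with x hx
  rw [Function.comp_apply, coordChange, (chartAt (V n) p).left_inv hx]

theorem inChart_apply {𝕜 : Type*} [NormedAddCommGroup 𝕜] [NormedSpace ℝ 𝕜] {k : ℕ}
    (β : KForm (V n) k X 𝕜) {p : X} {y : V n} (hy : y ∈ (chartAt (V n) p).target)
    (v : Fin k → V n) :
    inChart p β y v = β ((chartAt (V n) p).symm y)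
      (fun i => fderiv ℝ (coordChange p ((chartAt (V n) p).symm y)) y (v i)) := by
  have hc : ContinuousAt (chartAt (V n) p).symm y :=
    (chartAt (V n) p).continuousAt_symm hy
  rw [inChart, pullback, mfderiv_eq_fderiv_chart hc]
  rfl

theorem fderiv_coordChange_self {p : X} :
    fderiv ℝ (coordChange p p) (chartAt (V n) p p) = ContinuousLinearMap.id ℝ (V n) := by
  have h : coordChange p p =ᶠ[𝓝 (chartAt (V n) p p)] id := by
    filter_upwards [(chartAt (V n) p).open_target.mem_nhds (mem_chart_target (V n) p)] with x hx
      using (chartAt (V n) p).right_inv hx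
  rw [h.fderiv_eq, fderiv_id]

theorem inChart_self {𝕜 : Type*} [NormedAddCommGroup 𝕜] [NormedSpace ℝ 𝕜] {k : ℕ}
    (β : KForm (V n) k X 𝕜) (p : X) (v : Fin k → V n) :
    inChart p β (chartAt (V n) p p) v = β p v := by
  rw [inChart_apply β (mem_chart_target (V n) p), (chartAt (V n) p).left_inv (mem_chart_source _ p),
    fderiv_coordChange_self]
  rfl

end Charts

section Frames

variable {n r : ℕ} {X : Type*} [TopologicalSpace X] [ChartedSpace (V n) X]
  {E : X → Type*} [∀ x, AddCommGroup (E x)] [∀ x, Module ℂ (E x)]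
  [TopologicalSpace (TotalSpace (V r) E)] [∀ x, TopologicalSpace (E x)]
  [FiberBundle (V r) E] [VectorBundle ℂ (V r) E]

/-- The vector of `E x` with coordinates `v` in the preferred frame at `p`. -/
def frameVec (E : X → Type*) [∀ x, AddCommGroup (E x)]
    [TopologicalSpace (TotalSpace (V r) E)] [∀ x, TopologicalSpace (E x)]
    [FiberBundle (V r) E] (p x : X) (v : V r) : E x := (trivializationAt (V r) E p).symm x v

/-- The domain of the preferred frame at `p`. -/
def baseSet (r : ℕ) (E : X → Type*) [∀ x, AddCommGroup (E x)]
    [TopologicalSpace (TotalSpace (V r) E)] [∀ x, TopologicalSpace (E x)]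
    [FiberBundle (V r) E] (p : X) : Set X := (trivializationAt (V r) E p).baseSet

theorem isOpen_baseSet (p : X) : IsOpen (baseSet r E p) := (trivializationAt (V r) E p).open_baseSet

theorem mem_baseSet (p : X) : p ∈ baseSet r E p := mem_baseSet_trivializationAt (V r) E p

theorem frameVec_eq_linear {p x : X} (hx : x ∈ baseSet r E p) (v : V r) :
    frameVec E p x v = (trivializationAt (V r) E p).symmₗ ℂ x v :=
  ((trivializationAt (V r) E p).symmₗ_apply (R := ℂ) hx v).symm

theorem frameVec_ne_zero {p x : X} (hx : x ∈ baseSet r E p) {v : V r} (hv : v ≠ 0) :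
    frameVec E p x v ≠ 0 := by
  intro h
  rw [frameVec_eq_linear hx] at h
  have := (trivializationAt (V r) E p).linearMapAt_symmₗ (R := ℂ) hx v
  rw [h, map_zero] at this
  exact hv this.symm

theorem exists_frameVec {p x : X} (hx : x ∈ baseSet r E p) (s : E x) :
    ∃ v : V r, frameVec E p x v = s :=
  ⟨(trivializationAt (V r) E p).linearMapAt ℂ x s, by
    rw [frameVec_eq_linear hx]; exact (trivializationAt (V r) E p).symmₗ_linearMapAt hx s⟩

theorem star_dotProduct_hermMatrix (H : HermitianMetric E) {p : X} {y : V n}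
    (hy : (chartAt (V n) p).symm y ∈ baseSet r E p) (v w : V r) :
    star v ⬝ᵥ hermMatrix n r H p y *ᵥ w
      = H.form ((chartAt (V n) p).symm y) (frameVec E p _ v) (frameVec E p _ w) := by
  set x := (chartAt (V n) p).symm y
  rw [frameVec_eq_linear hy, frameVec_eq_linear hy]
  set T := (trivializationAt (V r) E p).symmₗ ℂ x with hT
  have hs : ∀ v : V r, T v = ∑ a, v a • T (Pi.single a 1) := fun v => by
    have h := LinearMap.pi_apply_eq_sum_univ T v
    refine h.trans (Finset.sum_congr rfl fun j _ => ?_)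
    congr 2
    funext i; simp [Pi.single_apply, eq_comm]
  have hm : ∀ a b, hermMatrix n r H p y a b = H.form x (T (Pi.single a 1)) (T (Pi.single b 1)) :=
    fun a b => by
      rw [hT, ← frameVec_eq_linear hy, ← frameVec_eq_linear hy]; rfl
  rw [hs v, hs w]
  simp only [map_sum, LinearMap.sum_apply, LinearMap.map_smulₛₗ, LinearMap.smul_apply, map_smul,
    dotProduct, Matrix.mulVec, hm, Pi.star_apply, smul_eq_mul, Finset.mul_sum]
  rw [Finset.sum_comm]
  refine Finset.sum_congr rfl fun b _ => Finset.sum_congr rfl fun a _ => ?_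
  rw [star_def]; ring

theorem quad_hermMatrix (H : HermitianMetric E) {p : X} {y : V n}
    (hy : (chartAt (V n) p).symm y ∈ baseSet r E p) (v : V r) :
    quad v (hermMatrix n r H p y)
      = (H.form ((chartAt (V n) p).symm y) (frameVec E p _ v) (frameVec E p _ v)).re := by
  rw [quad, star_dotProduct_hermMatrix H hy]

theorem hermMatrix_isHermitian (H : HermitianMetric E) (p : X) (y : V n) :
    (hermMatrix n r H p y).IsHermitian := by
  ext a b
  simp only [conjTranspose_apply, hermMatrix, of_apply]
  exact H.herm _ _ _

theorem hermMatrix_posDef (H : HermitianMetric E) {p : X} {y : V n}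
    (hy : (chartAt (V n) p).symm y ∈ baseSet r E p) : (hermMatrix n r H p y).PosDef := by
  refine Matrix.PosDef.of_dotProduct_mulVec_pos (hermMatrix_isHermitian H p y) fun v hv => ?_
  rw [Complex.pos_iff]
  constructor
  · rw [star_dotProduct_hermMatrix H hy]
    exact H.pos _ _ (frameVec_ne_zero hy hv)
  · have := congrArg Complex.im (ofReal_quad (hermMatrix_isHermitian H p y) v)
    simpa using this

/-- The matrix of the change of frame: the columns are the vectors of the preferred frame at `p`,
expressed in the preferred frame at `q`, at the point with coordinate `y` in the chart at `p`. -/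
def transMatrix (r : ℕ) (E : X → Type*) [∀ x, AddCommGroup (E x)] [∀ x, Module ℂ (E x)]
    [TopologicalSpace (TotalSpace (V r) E)] [∀ x, TopologicalSpace (E x)]
    [FiberBundle (V r) E] [VectorBundle ℂ (V r) E] (p q : X) (y : V n) :
    𝕄(r) :=
  Matrix.of fun a b => ((trivializationAt (V r) E p).coordChangeL ℂ (trivializationAt (V r) E q)
    ((chartAt (V n) p).symm y) : V r →L[ℂ] V r) (Pi.single b 1) a

/-- Coordinates in the chart at `p` of the points where the preferred charts and frames at `p` and
at `q` are all defined. -/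
def frameOverlap (r : ℕ) (E : X → Type*) [∀ x, AddCommGroup (E x)]
    [TopologicalSpace (TotalSpace (V r) E)] [∀ x, TopologicalSpace (E x)]
    [FiberBundle (V r) E] (p q : X) : Set (V n) :=
  overlap p q ∩ (chartAt (V n) p).symm ⁻¹' (baseSet r E p ∩ baseSet r E q)

theorem isOpen_frameOverlap (p q : X) : IsOpen (frameOverlap (n := n) r E p q) := by
  have := (chartAt (V n) p).isOpen_inter_preimage_symm ((chartAt (V n) q).open_source.inter
    ((isOpen_baseSet (r := r) (E := E) p).inter (isOpen_baseSet (r := r) (E := E) q)))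
  convert this using 1
  ext y; simp only [frameOverlap, overlap, mem_inter_iff, mem_preimage]; tauto

theorem frameVec_trans {p q : X} {y : V n} (hy : y ∈ frameOverlap r E p q) (v : V r) :
    frameVec E p ((chartAt (V n) p).symm y) v
      = frameVec E q ((chartAt (V n) p).symm y) (transMatrix r E p q y *ᵥ v) := by
  set x := (chartAt (V n) p).symm y
  set T := ((trivializationAt (V r) E p).coordChangeL ℂ (trivializationAt (V r) E q) x :
    V r →L[ℂ] V r) with hT
  have hv : transMatrix r E p q y *ᵥ v = T v := by
    have h := LinearMap.pi_apply_eq_sum_univ T.toLinearMap v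
    ext a
    have h' := congrFun h a
    rw [Finset.sum_apply] at h'
    refine Eq.trans ?_ h'.symm
    simp only [Matrix.mulVec, dotProduct, transMatrix, of_apply, Pi.smul_apply, smul_eq_mul]
    refine Finset.sum_congr rfl fun b _ => ?_
    rw [mul_comm]
    have e : (fun j => if b = j then (1 : ℂ) else 0) = Pi.single b 1 := by
      funext i; simp [Pi.single_apply, eq_comm]
    rw [e]; rfl
  rw [hv, hT]
  have h1 := (trivializationAt (V r) E p).coordChangeL_apply (R := ℂ) (trivializationAt (V r) E q)
    (b := x) hy.2 v
  have h2 : (T : V r → V r) v = (trivializationAt (V r) E q ⟨x, frameVec E p x v⟩).2 := h1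
  rw [h2]
  exact ((trivializationAt (V r) E q).symm_apply_apply_mk hy.2.2 _).symm

theorem transMatrix_det_ne_zero {p q : X} {y : V n} (hy : y ∈ frameOverlap r E p q) :
    (transMatrix r E p q y).det ≠ 0 := by
  intro h
  obtain ⟨v, hv, h0⟩ := Matrix.exists_mulVec_eq_zero_iff.2 h
  have := frameVec_trans hy v
  rw [h0, frameVec_eq_linear hy.2.2, map_zero] at this
  exact frameVec_ne_zero hy.2.1 hv this

theorem hermMatrix_trans (H : HermitianMetric E) {p q : X} {y : V n}
    (hy : y ∈ frameOverlap r E p q) :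
    hermMatrix n r H p y = (transMatrix r E p q y)ᴴ * hermMatrix n r H q (coordChange p q y)
      * transMatrix r E p q y := by
  have hx : (chartAt (V n) q).symm (coordChange p q y) = (chartAt (V n) p).symm y :=
    (chartAt (V n) q).left_inv hy.1.2
  have key : ∀ v w : V r, star v ⬝ᵥ hermMatrix n r H p y *ᵥ w
      = star v ⬝ᵥ ((transMatrix r E p q y)ᴴ * hermMatrix n r H q (coordChange p q y)
      * transMatrix r E p q y) *ᵥ w := fun v w => by
    rw [← mulVec_mulVec, ← mulVec_mulVec, Matrix.dotProduct_mulVec _ _ᴴ,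
      ← star_mulVec, star_dotProduct_hermMatrix H hy.2.1,
      star_dotProduct_hermMatrix H (by rw [hx]; exact hy.2.2), hx, ← frameVec_trans hy,
      ← frameVec_trans hy]
  ext a b
  simpa [Pi.star_apply, ← Pi.single_star] using key (Pi.single a 1) (Pi.single b 1)

variable [IsManifold 𝓘(ℂ, V n) ω X]
  [ContMDiffVectorBundle ω (V r) E 𝓘(ℂ, V n)]

theorem contDiffAt_transMatrix_complex {p q : X} {y : V n} (hy : y ∈ frameOverlap r E p q)
    (a b : Fin r) : ContDiffAt ℂ ω (fun y => transMatrix r E p q y a b) y := by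
  have h1 : ContMDiffOn 𝓘(ℂ, V n) 𝓘(ℂ, V r →L[ℂ] V r) ω
      (fun y : V n => ((trivializationAt (V r) E p).coordChangeL ℂ (trivializationAt (V r) E q)
        ((chartAt (V n) p).symm y) : V r →L[ℂ] V r)) (frameOverlap r E p q) :=
    (contMDiffOn_coordChangeL (IB := 𝓘(ℂ, V n)) (n := ω)
      (trivializationAt (V r) E p) (trivializationAt (V r) E q)).comp
      ((contMDiffOn_chart_symm (I := 𝓘(ℂ, V n)) (n := ω) (x := p)).mono
        fun y hy => hy.1.1) fun y hy => hy.2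
  rw [contMDiffOn_iff_contDiffOn] at h1
  have h2 := h1.contDiffAt ((isOpen_frameOverlap p q).mem_nhds hy)
  have h3 := contDiffAt_pi.1 (h2.clm_apply (contDiffAt_const (c := (Pi.single b 1 : V r)))) a
  exact h3

theorem smoothMatAt_transMatrix {p q : X} {y : V n} (hy : y ∈ frameOverlap r E p q) :
    SmoothMatAt ∞ (transMatrix (n := n) r E p q) y := fun a b =>
  ((contDiffAt_transMatrix_complex hy a b).restrict_scalars ℝ).of_le le_top

theorem dmat_transMatrix_I_smul {p q : X} {y : V n} (hy : y ∈ frameOverlap r E p q) (u : V n) :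
    dmat (transMatrix (n := n) r E p q) y (I • u) = I • dmat (transMatrix r E p q) y u := by
  ext a b
  exact fderiv_real_I_smul ((contDiffAt_transMatrix_complex hy a b).differentiableAt (by simp)) u

/-- The curvature at a point, in the frame and the chart at `p`, against that in the frame and the
chart at `q`. -/
theorem curv_hermMatrix_trans (H : HermitianMetric E) {p q : X} {y : V n}
    (hy : y ∈ frameOverlap r E p q)
    (hs : SmoothMatAt 2 (hermMatrix n r H q) (coordChange p q y)) (u v : V n) :
    transMatrix r E p q y * curv (hermMatrix n r H p) y u v
      = curv (hermMatrix n r H q) (coordChange p q y) (fderiv ℝ (coordChange p q) y u)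
        (fderiv ℝ (coordChange p q) y v) * transMatrix r E p q y := by
  have hx : (chartAt (V n) q).symm (coordChange p q y) = (chartAt (V n) p).symm y :=
    (chartAt (V n) q).left_inv hy.1.2
  have ho := (isOpen_frameOverlap p q).mem_nhds hy
  refine curv_gauge hs (hermMatrix_posDef H (by rw [hx]; exact hy.2.2)).det_pos.ne'
    ((smoothMatAt_transMatrix hy).mono (by norm_cast)) (transMatrix_det_ne_zero hy)
    ((contDiffAt_coordChange hy.1).of_le (by norm_cast)) ?_ ?_ ?_ u v
  · filter_upwards [ho] with x hx using dmat_transMatrix_I_smul hx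
  · filter_upwards [ho] with x hx using fderiv_coordChange_I_smul hx.1
  · filter_upwards [ho] with x hx using hermMatrix_trans H hx

/-! ### The contracted curvature in local frames -/

section Local

/-- Coordinates, in the chart at `p`, of the points over which the preferred frame at `p` is
defined. -/
def chartFrame (n r : ℕ) (E : X → Type*) [∀ x, AddCommGroup (E x)]
    [ChartedSpace (V n) X]
    [TopologicalSpace (TotalSpace (V r) E)] [∀ x, TopologicalSpace (E x)]
    [FiberBundle (V r) E] (p : X) : Set (V n) :=
  (chartAt (V n) p).target ∩ (chartAt (V n) p).symm ⁻¹' baseSet r E p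

theorem chart_mem_chartFrame (p : X) : chartAt (V n) p p ∈ chartFrame n r E p :=
  ⟨mem_chart_target _ p, by
    rw [mem_preimage, (chartAt (V n) p).left_inv (mem_chart_source _ p)]; exact mem_baseSet p⟩

theorem hermMatrixAt_posDef (H : HermitianMetric E) (p : X) : (hermMatrixAt n r H p).PosDef :=
  hermMatrix_posDef H (chart_mem_chartFrame (n := n) (r := r) (E := E) p).2

theorem mem_frameOverlap_of_mem_chartFrame {p : X} {y : V n} (hy : y ∈ chartFrame n r E p) :
    y ∈ frameOverlap r E p ((chartAt (V n) p).symm y) :=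
  ⟨⟨hy.1, mem_chart_source _ _⟩, hy.2, mem_baseSet _⟩

/-- `F̂_H` in the chart and the holomorphic frame at `p`, at the point with coordinate `y`. -/
def hatLocal (β : KForm (V n) 2 X ℝ) (H : HermitianMetric E) (p : X) (y : V n) :
    𝕄(r) :=
  traceForm (stdFrame n) (inChart p β y) (curv (hermMatrix n r H p) y)

variable {β : KForm (V n) 2 X ℝ} {H : HermitianMetric E}

theorem overlap_self {p : X} {y : V n} (hy : y ∈ (chartAt (V n) p).target) :
    y ∈ overlap p ((chartAt (V n) p).symm y) := ⟨hy, mem_chart_source _ _⟩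

theorem fderiv_coordChange_eq_zero_iff {p q : X} {y : V n} (hy : y ∈ overlap p q) (u : V n) :
    fderiv ℝ (coordChange p q) y u = 0 ↔ u = 0 := by
  refine ⟨fun h => ?_, fun h => by rw [h, map_zero]⟩
  rw [← fderiv_coordChange_comp hy u, h, map_zero]

theorem inChart_pair {p : X} {y : V n} (hy : y ∈ (chartAt (V n) p).target) (u v : V n) :
    inChart p β y ![u, v] = β ((chartAt (V n) p).symm y)
      ![fderiv ℝ (coordChange p ((chartAt (V n) p).symm y)) y u,
        fderiv ℝ (coordChange p ((chartAt (V n) p).symm y)) y v] := by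
  rw [inChart_apply β hy]
  congr 1
  funext i; fin_cases i <;> rfl

theorem inChart_type11 {p : X} {y : V n} (hy : y ∈ (chartAt (V n) p).target)
    (h11 : ∀ u v : V n, β ((chartAt (V n) p).symm y) ![I • u, I • v]
      = β ((chartAt (V n) p).symm y) ![u, v]) (u v : V n) :
    inChart p β y ![I • u, I • v] = inChart p β y ![u, v] := by
  rw [inChart_pair hy, inChart_pair hy, fderiv_coordChange_I_smul (overlap_self hy),
    fderiv_coordChange_I_smul (overlap_self hy), h11]

theorem inChart_pos {p : X} {y : V n} (hy : y ∈ (chartAt (V n) p).target)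
    (hpos : ∀ u : V n, u ≠ 0 → 0 < β ((chartAt (V n) p).symm y) ![u, I • u]) (u : V n)
    (hu : u ≠ 0) : 0 < inChart p β y ![u, I • u] := by
  rw [inChart_pair hy, fderiv_coordChange_I_smul (overlap_self hy)]
  exact hpos _ fun h => hu ((fderiv_coordChange_eq_zero_iff (overlap_self hy) u).1 h)

/-- `F̂` transforms by conjugation under a change of holomorphic frame. -/
theorem hatLocal_trans {p : X} {y : V n} (hy : y ∈ chartFrame n r E p)
    (h11 : ∀ u v : V n, β ((chartAt (V n) p).symm y) ![I • u, I • v]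
      = β ((chartAt (V n) p).symm y) ![u, v])
    (hs : SmoothMatAt 2 (hermMatrix n r H ((chartAt (V n) p).symm y))
      (chartAt (V n) ((chartAt (V n) p).symm y) ((chartAt (V n) p).symm y))) :
    transMatrix r E p ((chartAt (V n) p).symm y) y * hatLocal β H p y
      = hatF n r β H ((chartAt (V n) p).symm y)
        * transMatrix r E p ((chartAt (V n) p).symm y) y := by
  set p' := (chartAt (V n) p).symm y
  set τ := transMatrix r E p p' y
  have hov : y ∈ frameOverlap r E p p' := mem_frameOverlap_of_mem_chartFrame hy
  have hτd : IsUnit τ.det := isUnit_iff_ne_zero.2 (transMatrix_det_ne_zero hov)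
  set D := fderiv ℝ (coordChange p p') y
  set F := curv (hermMatrix n r H p') (chartAt (V n) p' p')
  have hd : (hermMatrix n r H p' (chartAt (V n) p' p')).det ≠ 0 :=
    (hermMatrix_posDef H (chart_mem_chartFrame (r := r) p').2).det_pos.ne'
  have hc : ∀ u v, curv (hermMatrix n r H p) y u v = τ⁻¹ * F (D u) (D v) * τ := fun u v => by
    have h0 : τ * curv (hermMatrix n r H p) y u v = F (D u) (D v) * τ :=
      curv_hermMatrix_trans H hov hs u v
    rw [mul_assoc, ← h0, nonsing_inv_mul_cancel_left _ _ hτd]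
  obtain ⟨B, hB⟩ := exists_bilin_curv hs hd
  -- conjugation by `τ` passes through the contraction
  have hpull : hatLocal β H p y = τ⁻¹ * pairing (skew (fun a => D (stdFrame n a)) (β p'))
      (fun a a' => B (D (stdFrame n a)) (D (stdFrame n a'))) * τ := by
    have h1 := traceForm_eq_pairing (fun j => Pi.single j (1 : ℂ)) (inChart p β y)
      (inChart_type11 hy.1 h11) (curv (hermMatrix n r H p) y)
    rw [hatLocal]
    refine h1.trans ?_
    have h2 : skew (realFrame fun j => Pi.single j (1 : ℂ)) (inChart p β y)
        = skew (fun a => D (stdFrame n a)) (β p') := by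
      ext a c; exact inChart_pair hy.1 _ _
    rw [h2, pairing, pairing, Matrix.mul_smul, Matrix.smul_mul, Finset.mul_sum, Finset.sum_mul]
    congr 1
    refine Finset.sum_congr rfl fun a _ => ?_
    rw [Finset.mul_sum, Finset.sum_mul]
    refine Finset.sum_congr rfl fun a' _ => ?_
    rw [hc, Matrix.mul_smul, Matrix.smul_mul, ← hB]; rfl
  have hdet : LinearMap.det (D : V n →ₗ[ℝ] V n) ≠ 0 := by
    intro h
    have := LinearMap.bot_lt_ker_of_det_eq_zero h
    obtain ⟨u, hu, hu0⟩ := (Submodule.ne_bot_iff _).1 this.ne'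
    exact hu0 ((fderiv_coordChange_eq_zero_iff hov.1 u).1 hu)
  have h3 := pairing_comp (D : V n →ₗ[ℝ] V n) hdet (β p') B
  have h4 : hatF n r β H p' = pairing (skew (stdFrame n) (β p'))
      fun a a' => B (stdFrame n a) (stdFrame n a') := by
    refine (traceForm_eq_pairing (fun j => Pi.single j (1 : ℂ)) (β p') h11
      (curvature n r H p')).trans ?_
    congr 1
    funext a a'
    exact hB _ _
  rw [h4, ← h3, hpull, mul_assoc, mul_nonsing_inv_cancel_left _ _ hτd]; rfl

theorem transMatrix_self_conj {p : X} {y : V n} (hy : y ∈ chartFrame n r E p) :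
    hermMatrix n r H p y = (transMatrix r E p ((chartAt (V n) p).symm y) y)ᴴ
      * hermMatrixAt n r H ((chartAt (V n) p).symm y)
      * transMatrix r E p ((chartAt (V n) p).symm y) y :=
  hermMatrix_trans H (mem_frameOverlap_of_mem_chartFrame hy)

theorem trace_adjoint_mul_conj {τ G G' F F' : 𝕄(r)} (hτ : τ.det ≠ 0)
    (hG : G = τᴴ * G' * τ) (hF : τ * F = F' * τ) :
    ((G⁻¹ * Fᴴ * G * F).trace).re = ((G'⁻¹ * F'ᴴ * G' * F').trace).re := by
  have hτd : IsUnit τ.det := hτ.isUnit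
  have hτd' : IsUnit τᴴ.det := by rw [det_conjTranspose]; exact hτd.star
  have h3 : F = τ⁻¹ * F' * τ := by
    rw [mul_assoc, ← hF, nonsing_inv_mul_cancel_left _ _ hτd]
  have h4 : G⁻¹ * Fᴴ * G * F = τ⁻¹ * (G'⁻¹ * F'ᴴ * G' * F' * τ) := by
    rw [hG, h3]
    simp only [Matrix.mul_inv_rev, conjTranspose_mul, Matrix.conjTranspose_nonsing_inv,
      mul_assoc]
    rw [mul_nonsing_inv_cancel_left _ _ hτd, nonsing_inv_mul_cancel_left _ _ hτd',
      nonsing_inv_mul_cancel_left _ _ hτd']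
  rw [h4, trace_mul_comm, Matrix.mul_nonsing_inv_cancel_right _ _ hτd]

/-- `|F̂_H|²` computed in the frame at `p`. -/
theorem normSqHatF_eq_local {p : X} {y : V n} (hy : y ∈ chartFrame n r E p)
    (h11 : ∀ u v : V n, β ((chartAt (V n) p).symm y) ![I • u, I • v]
      = β ((chartAt (V n) p).symm y) ![u, v])
    (hs : SmoothMatAt 2 (hermMatrix n r H ((chartAt (V n) p).symm y))
      (chartAt (V n) ((chartAt (V n) p).symm y) ((chartAt (V n) p).symm y))) :
    normSqHatF n r β H ((chartAt (V n) p).symm y)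
      = (((hermMatrix n r H p y)⁻¹ * (hatLocal β H p y)ᴴ * hermMatrix n r H p y
        * hatLocal β H p y).trace).re := by
  have hov := mem_frameOverlap_of_mem_chartFrame hy
  exact (trace_adjoint_mul_conj (transMatrix_det_ne_zero hov) (transMatrix_self_conj (H := H) hy)
    (hatLocal_trans hy h11 hs)).symm

/-- The time derivative of the matrix of a family of metrics in the frame at `p`. -/
def velocity (n r : ℕ) {X : Type*} [TopologicalSpace X] [ChartedSpace (V n) X]
    {E : X → Type*} [∀ x, AddCommGroup (E x)] [∀ x, Module ℂ (E x)]
    [TopologicalSpace (TotalSpace (V r) E)] [∀ x, TopologicalSpace (E x)]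
    [FiberBundle (V r) E] (H : ℝ → HermitianMetric E) (t : ℝ) (p : X) (y : V n) :
    𝕄(r) :=
  Matrix.of fun a b => derivWithin (fun τ => hermMatrix n r (H τ) p y a b) (Ici 0) t

section Family

variable {Hf : ℝ → HermitianMetric E} {U : Set X}

theorem isOpen_frameDomain (hU : IsOpen U) (p : X) : IsOpen (frameDomain n r E U p) :=
  (chartAt (V n) p).isOpen_inter_preimage_symm (hU.inter (isOpen_baseSet p))

theorem frameDomain_subset (p : X) : frameDomain n r E U p ⊆ chartFrame n r E p :=
  fun _ hy => ⟨hy.1, hy.2.2⟩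

theorem chart_mem_frameDomain {p : X} (hp : p ∈ U) : chartAt (V n) p p ∈ frameDomain n r E U p :=
  ⟨mem_chart_target _ p, by
    rw [mem_preimage, (chartAt (V n) p).left_inv (mem_chart_source _ p)]
    exact ⟨hp, mem_baseSet_trivializationAt _ _ p⟩⟩

theorem SmoothMetric.smoothMatAt (hU : IsOpen U) (hs : SmoothMetric n r U H) {p : X} {y : V n}
    (hy : y ∈ frameDomain n r E U p) : SmoothMatAt ∞ (hermMatrix n r H p) y := fun a b =>
  (hs p a b).contDiffAt ((isOpen_frameDomain hU p).mem_nhds hy)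

theorem SmoothFamily.smoothMatAt (hU : IsOpen U) (hs : SmoothFamily n r U Hf) {t : ℝ}
    (ht : 0 ≤ t) {p : X} {y : V n} (hy : y ∈ frameDomain n r E U p) :
    SmoothMatAt ∞ (hermMatrix n r (Hf t) p) y := fun a b => by
  have h := (hs p a b).comp (f := fun y : V n => (t, y)) (contDiff_prodMk_right t).contDiffOn
    (s := frameDomain n r E U p) fun y hy => ⟨ht, hy⟩
  exact h.contDiffAt ((isOpen_frameDomain hU p).mem_nhds hy)

theorem SmoothFamily.hasDerivWithinAt (hs : SmoothFamily n r U Hf) {t : ℝ}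
    (ht : 0 ≤ t) {p : X} {y : V n} (hy : y ∈ frameDomain n r E U p) (a b : Fin r) :
    HasDerivWithinAt (fun τ => hermMatrix n r (Hf τ) p y a b) (velocity n r Hf t p y a b)
      (Ici 0) t := by
  have h := (hs p a b).comp (f := fun τ : ℝ => (τ, y)) (contDiff_prodMk_left y).contDiffOn
    (s := Ici 0) fun τ hτ => ⟨hτ, hy⟩
  exact ((h t ht).differentiableWithinAt (by simp)).hasDerivWithinAt

theorem SmoothFamily.continuousOn (hs : SmoothFamily n r U Hf) (p : X) (a b : Fin r) :
    ContinuousOn (fun q : ℝ × V n => hermMatrix n r (Hf q.1) p q.2 a b)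
      (Ici 0 ×ˢ frameDomain n r E U p) := (hs p a b).continuousOn

theorem SmoothFamily.continuousOn_velocity (hU : IsOpen U) (hs : SmoothFamily n r U Hf) (p : X)
    (a b : Fin r) :
    ContinuousOn (fun q : ℝ × V n => velocity n r Hf q.1 p q.2 a b)
      (Ici 0 ×ˢ frameDomain n r E U p) := by
  have hu : UniqueDiffOn ℝ (Ici (0 : ℝ) ×ˢ frameDomain n r E U p) :=
    (uniqueDiffOn_Ici 0).prod (isOpen_frameDomain hU p).uniqueDiffOn
  have h := (hs p a b).continuousOn_fderivWithin hu (by simp)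
  refine (h.clm_apply (continuousOn_const (c := ((1 : ℝ), (0 : V n))))).congr fun q hq => ?_
  have h1 := (((hs p a b) q hq).differentiableWithinAt (by simp)).hasFDerivWithinAt
  have h2 : HasDerivWithinAt (fun τ : ℝ => (τ, q.2)) ((1 : ℝ), (0 : V n)) (Ici 0) q.1 :=
    (hasDerivWithinAt_id _ _).prodMk (hasDerivWithinAt_const _ _ _)
  have h3 := h1.comp_hasDerivWithinAt_of_eq q.1 h2 (t := Ici (0 : ℝ) ×ˢ frameDomain n r E U p)
    (fun τ hτ => ⟨hτ, hq.2⟩) rfl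
  exact h3.derivWithin ((uniqueDiffOn_Ici 0) q.1 hq.1)

/-- The evolution equation, read in the frame centred at the point. -/
theorem velocity_self (hev : ∀ t, 0 ≤ t → ∀ p ∈ U,
    logVelocity n r Hf t p = (-2 * I) • hatF n r β (Hf t) p) {t : ℝ} (ht : 0 ≤ t) {p : X}
    (hp : p ∈ U) : velocity n r Hf t p (chartAt (V n) p p)
      = hermMatrixAt n r (Hf t) p * ((-2 * I) • hatF n r β (Hf t) p) := by
  rw [← hev t ht p hp, logVelocity, mul_nonsing_inv_cancel_left _ _
    (hermMatrixAt_posDef (Hf t) p).det_pos.ne'.isUnit]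
  rfl

/-- The evolution equation in the holomorphic frame at `p`, at nearby points. -/
theorem velocity_eq (hU : IsOpen U) (hs : SmoothFamily n r U Hf)
    (h11 : ∀ p ∈ U, ∀ u v : V n, β p ![I • u, I • v] = β p ![u, v])
    (hev : ∀ t, 0 ≤ t → ∀ p ∈ U, logVelocity n r Hf t p = (-2 * I) • hatF n r β (Hf t) p)
    {t : ℝ} (ht : 0 ≤ t) {p : X} {y : V n} (hy : y ∈ frameDomain n r E U p) :
    velocity n r Hf t p y
      = hermMatrix n r (Hf t) p y * ((-2 * I) • hatLocal β (Hf t) p y) := by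
  have hyc := frameDomain_subset p hy
  have hp'U : (chartAt (V n) p).symm y ∈ U := hy.2.1
  have h1 := hatLocal_trans (H := Hf t) hyc (h11 _ hp'U)
    ((SmoothFamily.smoothMatAt hU hs ht (chart_mem_frameDomain hp'U)).mono (by norm_cast))
  have h2 := fun τ => transMatrix_self_conj (H := Hf τ) hyc
  set p' := (chartAt (V n) p).symm y
  set τm := transMatrix r E p p' y
  have h3 := velocity_self hev ht hp'U
  have h4 : velocity n r Hf t p y
      = τmᴴ * velocity n r Hf t p' (chartAt (V n) p' p') * τm := by
    ext a b
    refine HasDerivWithinAt.derivWithin ?_ ((uniqueDiffOn_Ici 0) t ht)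
    have h5 : (fun τ => hermMatrix n r (Hf τ) p y a b) = fun τ => ∑ d, (∑ c, τmᴴ a c
        * hermMatrix n r (Hf τ) p' (chartAt (V n) p' p') c d) * τm d b := by
      funext τ; rw [h2 τ, Matrix.mul_apply]
      refine Finset.sum_congr rfl fun d _ => ?_
      rw [Matrix.mul_apply]; rfl
    rw [h5, Matrix.mul_apply]
    refine HasDerivWithinAt.fun_sum fun d _ => ?_
    rw [Matrix.mul_apply]
    refine HasDerivWithinAt.mul_const ?_ _
    refine HasDerivWithinAt.fun_sum fun c _ => ?_
    exact (SmoothFamily.hasDerivWithinAt hs ht (chart_mem_frameDomain hp'U) c d).const_mul _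
  rw [h4, h3, h2 t, Matrix.mul_smul, Matrix.mul_smul, Matrix.smul_mul, Matrix.mul_smul]
  simp only [mul_assoc]
  rw [h1]

end Family
end Local

theorem hermMatrix_congr {U : Set X} {H H' : HermitianMetric E}
    (h : ∀ p ∈ U, H.form p = H'.form p) {p : X} {y : V n} (hy : (chartAt (V n) p).symm y ∈ U) :
    hermMatrix n r H p y = hermMatrix n r H' p y := by
  ext a b; simp only [hermMatrix, of_apply, h _ hy]

/-- The contracted curvature depends on the metric only near the point. -/
theorem hatF_congr {U : Set X} (hU : IsOpen U) {β : KForm (V n) 2 X ℝ} {H H' : HermitianMetric E}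
    (h : ∀ p ∈ U, H.form p = H'.form p) {p : X} (hp : p ∈ U) :
    hermMatrixAt n r H p = hermMatrixAt n r H' p ∧ hatF n r β H p = hatF n r β H' p := by
  have hev : ∀ᶠ y in 𝓝 (chartAt (V n) p p), hermMatrix n r H p y = hermMatrix n r H' p y := by
    filter_upwards [(isOpen_frameDomain (r := r) (E := E) hU p).mem_nhds
      (chart_mem_frameDomain hp)] with y hy
    exact hermMatrix_congr h hy.2.1
  refine ⟨hev.self_of_nhds, ?_⟩
  have : curvature n r H p = curvature n r H' p := by
    funext u v; exact curv_congr hev u v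
  rw [hatF, hatF, this]

/-- The Hermitian form of `H F̂_H` at nearby points, computed in a fixed frame. -/
theorem quad_hatF_eq_local {β : KForm (V n) 2 X ℝ} {H : HermitianMetric E}
    {p : X} {y : V n} (hy : y ∈ chartFrame n r E p)
    (h11 : ∀ u v : V n, β ((chartAt (V n) p).symm y) ![I • u, I • v]
      = β ((chartAt (V n) p).symm y) ![u, v])
    (hs : SmoothMatAt 2 (hermMatrix n r H ((chartAt (V n) p).symm y))
      (chartAt (V n) ((chartAt (V n) p).symm y) ((chartAt (V n) p).symm y))) (v : V r) :
    quad (transMatrix r E p ((chartAt (V n) p).symm y) y *ᵥ v)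
        (hermMatrixAt n r H ((chartAt (V n) p).symm y)
          * ((-2 * I) • hatF n r β H ((chartAt (V n) p).symm y)))
      = quad v (hermMatrix n r H p y * ((-2 * I) • hatLocal β H p y)) ∧
    quad (transMatrix r E p ((chartAt (V n) p).symm y) y *ᵥ v)
        (hermMatrixAt n r H ((chartAt (V n) p).symm y)) = quad v (hermMatrix n r H p y) := by
  have h1 := hatLocal_trans hy h11 hs
  have h2 := transMatrix_self_conj (H := H) hy
  set τ := transMatrix r E p ((chartAt (V n) p).symm y) y
  rw [← quad_conjTranspose_mul, ← quad_conjTranspose_mul, h2]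
  refine ⟨?_, rfl⟩
  simp only [Matrix.mul_smul, Matrix.smul_mul, mul_assoc]
  rw [h1]

theorem abs_quad_hatF_le_of_local {β : KForm (V n) 2 X ℝ} {H : HermitianMetric E}
    {p : X} {y : V n} (hy : y ∈ chartFrame n r E p)
    (h11 : ∀ u v : V n, β ((chartAt (V n) p).symm y) ![I • u, I • v]
      = β ((chartAt (V n) p).symm y) ![u, v])
    (hs : SmoothMatAt 2 (hermMatrix n r H ((chartAt (V n) p).symm y))
      (chartAt (V n) ((chartAt (V n) p).symm y) ((chartAt (V n) p).symm y))) {C : ℝ}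
    (h : ∀ v : V r, |quad v (hermMatrix n r H p y * ((-2 * I) • hatLocal β H p y))|
      ≤ C * quad v (hermMatrix n r H p y)) (w : V r) :
    |quad w (hermMatrixAt n r H ((chartAt (V n) p).symm y)
          * ((-2 * I) • hatF n r β H ((chartAt (V n) p).symm y)))|
      ≤ C * quad w (hermMatrixAt n r H ((chartAt (V n) p).symm y)) := by
  have hτ := (transMatrix_det_ne_zero (mem_frameOverlap_of_mem_chartFrame hy)).isUnit
  have hq := quad_hatF_eq_local hy h11 hs ((transMatrix r E p ((chartAt (V n) p).symm y) y)⁻¹ *ᵥ w)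
  rw [mulVec_mulVec, mul_nonsing_inv _ hτ, Matrix.one_mulVec] at hq
  rw [hq.1, hq.2]
  exact h _

/-! ### The comparison principle for the flow -/

/-- A family of metrics over `W`, for times in `[0, T]`, continuous in space and time, twice
differentiable in space, and differentiable in time with derivative `dG`. -/
structure IsRegularFamily (n r : ℕ) {X : Type*} [TopologicalSpace X] [ChartedSpace (V n) X]
    {E : X → Type*} [∀ x, AddCommGroup (E x)] [∀ x, Module ℂ (E x)]
    [TopologicalSpace (TotalSpace (V r) E)] [∀ x, TopologicalSpace (E x)]
    [FiberBundle (V r) E] (W : Set X) (T : ℝ) (H : ℝ → HermitianMetric E)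
    (dG : ℝ → X → 𝕄(r)) : Prop where
  continuousOn : ∀ p ∈ W, ∀ a b, ContinuousOn
    (fun q : ℝ × V n => hermMatrix n r (H q.1) p q.2 a b) (Icc 0 T ×ˢ frameDomain n r E W p)
  smooth : ∀ t ∈ Icc 0 T, ∀ p ∈ W, SmoothMatAt 2 (hermMatrix n r (H t) p) (chartAt (V n) p p)
  hasDeriv : ∀ t ∈ Icc 0 T, ∀ p ∈ W, ∀ a b,
    HasDerivWithinAt (fun τ => hermMatrixAt n r (H τ) p a b) (dG t p a b) (Icc 0 T) t

/-- Nonnegative functions `φ` and `f` on `W`, with `f` exhausting, such that the Kähler Laplacian,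
computed as the sum of `levi` over a unitary basis, is bounded above by `K φ` for `φ` and by `K` for
`f`. -/
structure IsBarrier (W : Set X) (β : KForm (V n) 2 X ℝ) (K : ℝ) (φ f : X → ℝ) : Prop where
  nonneg : ∀ p ∈ W, 0 ≤ φ p
  nonneg_exhaustion : ∀ p ∈ W, 0 ≤ f p
  isCompact_sublevel : ∀ R, IsCompact {p | p ∈ W ∧ f p ≤ R}
  contDiffAt : ∀ p ∈ W, ContDiffAt ℝ 2 (fun y => φ ((chartAt (V n) p).symm y)) (chartAt (V n) p p)
  contDiffAt_exhaustion : ∀ p ∈ W,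
    ContDiffAt ℝ 2 (fun y => f ((chartAt (V n) p).symm y)) (chartAt (V n) p p)
  sum_levi_le : ∀ p ∈ W, ∀ L : V n →ₗ[ℂ] V n, LinearMap.det L ≠ 0 →
    (IsUnitary (β p) fun j => L (Pi.single j 1)) →
    ∑ j, levi (fun y => φ ((chartAt (V n) p).symm y)) (chartAt (V n) p p) (L (Pi.single j 1))
      ≤ K * φ p
  sum_levi_exhaustion_le : ∀ p ∈ W, ∀ L : V n →ₗ[ℂ] V n, LinearMap.det L ≠ 0 →
    (IsUnitary (β p) fun j => L (Pi.single j 1)) →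
    ∑ j, levi (fun y => f ((chartAt (V n) p).symm y)) (chartAt (V n) p p) (L (Pi.single j 1)) ≤ K

theorem continuousAt_of_chart {f : X → ℝ} {p : X}
    (h : ContDiffAt ℝ 2 (fun y => f ((chartAt (V n) p).symm y)) (chartAt (V n) p p)) :
    ContinuousAt f p := by
  have h1 := h.continuousAt.comp (f := chartAt (V n) p) (x := p)
    ((chartAt (V n) p).continuousAt (mem_chart_source _ p))
  refine h1.congr ?_
  filter_upwards [(chartAt (V n) p).open_source.mem_nhds (mem_chart_source _ p)] with x hx
  simp [(chartAt (V n) p).left_inv hx]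

/-- The logarithm of the ratio of the squared lengths of a vector for two metrics. -/
def logRatio (H₁ H₂ : HermitianMetric E) (x : X) (v : E x) : ℝ :=
  Real.log (H₁.form x v v).re - Real.log (H₂.form x v v).re

theorem form_smul_re (H : HermitianMetric E) (x : X) (c : ℝ) (v : E x) :
    (H.form x ((c : ℂ) • v) ((c : ℂ) • v)).re = c ^ 2 * (H.form x v v).re := by
  simp only [LinearMap.map_smulₛₗ, LinearMap.smul_apply, map_smul, conj_ofReal, smul_eq_mul]
  rw [← mul_assoc, ← ofReal_mul, re_ofReal_mul]; ring

theorem logRatio_smul (H₁ H₂ : HermitianMetric E) (x : X) {c : ℝ} (hc : c ≠ 0) {v : E x}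
    (hv : v ≠ 0) : logRatio H₁ H₂ x ((c : ℂ) • v) = logRatio H₁ H₂ x v := by
  rw [logRatio, logRatio, form_smul_re, form_smul_re,
    Real.log_mul (by positivity) (H₁.pos x v hv).ne',
    Real.log_mul (by positivity) (H₂.pos x v hv).ne']
  ring

theorem logRatio_frameVec (H₁ H₂ : HermitianMetric E) {p x : X}
    (hx : x ∈ (chartAt (V n) p).source) (hb : x ∈ baseSet r E p) (v : V r) :
    logRatio H₁ H₂ x (frameVec E p x v)
      = Real.log (quad v (hermMatrix n r H₁ p (chartAt (V n) p x)))
        - Real.log (quad v (hermMatrix n r H₂ p (chartAt (V n) p x))) := by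
  have e := (chartAt (V n) p).left_inv hx
  rw [logRatio, quad_hermMatrix H₁ (by rw [e]; exact hb), quad_hermMatrix H₂ (by rw [e]; exact hb),
    e]

theorem IsRegularFamily.tendsto_hermMatrix {W : Set X} (hW : IsOpen W) {T : ℝ}
    {H : ℝ → HermitianMetric E} {dG : ℝ → X → 𝕄(r)}
    (hR : IsRegularFamily n r W T H dG) {Z : Type*} {l : Filter Z} {t : Z → ℝ} {y : Z → V n}
    {t₀ : ℝ} {p : X} (hp : p ∈ W) (ht₀ : t₀ ∈ Icc 0 T)
    (ht : Tendsto t l (𝓝 t₀)) (ht' : ∀ᶠ z in l, t z ∈ Icc 0 T)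
    (hy : Tendsto y l (𝓝 (chartAt (V n) p p))) (a b : Fin r) :
    Tendsto (fun z => hermMatrix n r (H (t z)) p (y z) a b) l
      (𝓝 (hermMatrix n r (H t₀) p (chartAt (V n) p p) a b)) := by
  have hin : Tendsto (fun z => (t z, y z)) l
      (𝓝[Icc 0 T ×ˢ frameDomain n r E W p] (t₀, chartAt (V n) p p)) := by
    refine tendsto_nhdsWithin_iff.2 ⟨ht.prodMk_nhds hy, ?_⟩
    filter_upwards [ht', hy.eventually ((isOpen_frameDomain (n := n) (r := r) (E := E) hW
      p).mem_nhds (chart_mem_frameDomain hp))] with z h1 h2 using ⟨h1, h2⟩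
  have hc := hR.continuousOn p hp a b (t₀, chartAt (V n) p p) ⟨ht₀, chart_mem_frameDomain hp⟩
  generalize hg : (fun q : ℝ × V n => hermMatrix n r (H q.1) p q.2 a b) = g at hc
  have e1 : ∀ z, hermMatrix n r (H (t z)) p (y z) a b = g (t z, y z) := fun z => by rw [← hg]
  have e2 : hermMatrix n r (H t₀) p (chartAt (V n) p p) a b = g (t₀, chartAt (V n) p p) := by
    rw [← hg]
  simp only [e1, e2]
  exact hc.tendsto.comp hin

theorem IsRegularFamily.tendsto_log_quad {W : Set X} (hW : IsOpen W) {T : ℝ}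
    {H : ℝ → HermitianMetric E} {dG : ℝ → X → 𝕄(r)}
    (hR : IsRegularFamily n r W T H dG) {Z : Type*} {l : Filter Z} {t : Z → ℝ} {x : Z → X}
    {w : Z → V r} {t₀ : ℝ} {p : X} {w₀ : V r} (hp : p ∈ W) (ht₀ : t₀ ∈ Icc 0 T) (hw₀ : w₀ ≠ 0)
    (ht : Tendsto t l (𝓝 t₀)) (ht' : ∀ᶠ z in l, t z ∈ Icc 0 T) (hx : Tendsto x l (𝓝 p))
    (hw : Tendsto w l (𝓝 w₀)) :
    Tendsto (fun z => Real.log (quad (w z) (hermMatrix n r (H (t z)) p (chartAt (V n) p (x z)))))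
      l (𝓝 (Real.log (quad w₀ (hermMatrix n r (H t₀) p (chartAt (V n) p p))))) := by
  have hy : Tendsto (fun z => chartAt (V n) p (x z)) l (𝓝 (chartAt (V n) p p)) :=
    ((chartAt (V n) p).continuousAt (mem_chart_source _ p)).tendsto.comp hx
  exact (tendsto_quad hw (hR.tendsto_hermMatrix hW hp ht₀ ht ht' hy)).log
    (quad_pos (hermMatrixAt_posDef _ _) hw₀).ne'

/-- A maximum of `log (|v|²₁ / |v|²₂) - ψ` exists when `ψ` is continuous and proper. -/
theorem exists_max_logRatio {W : Set X} (hW : IsOpen W) {T : ℝ}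
    {H₁ H₂ : ℝ → HermitianMetric E} {dG₁ dG₂ : ℝ → X → 𝕄(r)}
    (hR₁ : IsRegularFamily n r W T H₁ dG₁) (hR₂ : IsRegularFamily n r W T H₂ dG₂)
    {ψ : ℝ → X → ℝ} (hψ : ∀ t, ∀ p ∈ W, ContinuousAt (fun q : ℝ × X => ψ q.1 q.2) (t, p))
    {K : Set X} (hK : IsCompact K) (hKW : K ⊆ W) {B : ℝ}
    (hB : ∀ t ∈ Icc 0 T, ∀ x ∈ W, ∀ v : E x, v ≠ 0 → logRatio (H₁ t) (H₂ t) x v - ψ t x ≤ B)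
    (hout : ∀ t ∈ Icc 0 T, ∀ x ∈ W, x ∉ K → ∀ v : E x, v ≠ 0 →
      logRatio (H₁ t) (H₂ t) x v - ψ t x ≤ 0)
    {t₁ : ℝ} (ht₁ : t₁ ∈ Icc 0 T) {x₁ : X} (hx₁ : x₁ ∈ W) {v₁ : E x₁} (hv₁ : v₁ ≠ 0)
    (hpos : 0 < logRatio (H₁ t₁) (H₂ t₁) x₁ v₁ - ψ t₁ x₁) :
    ∃ t ∈ Icc 0 T, ∃ p ∈ W, ∃ w : V r, w ≠ 0 ∧
      0 < logRatio (H₁ t) (H₂ t) p (frameVec E p p w) - ψ t p ∧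
      ∀ t' ∈ Icc 0 T, ∀ x ∈ W, ∀ v : E x, v ≠ 0 → logRatio (H₁ t') (H₂ t') x v - ψ t' x
        ≤ logRatio (H₁ t) (H₂ t) p (frameVec E p p w) - ψ t p := by
  set Z : Set (ℝ × TotalSpace (V r) E) := {z | z.1 ∈ Icc 0 T ∧ z.2.proj ∈ W ∧ z.2.snd ≠ 0}
  set u : ℝ × TotalSpace (V r) E → ℝ := fun z =>
    logRatio (H₁ z.1) (H₂ z.1) z.2.proj z.2.snd - ψ z.1 z.2.proj
  have hne : (u '' Z).Nonempty := ⟨_, (t₁, ⟨x₁, v₁⟩), ⟨ht₁, hx₁, hv₁⟩, rfl⟩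
  have hbd : BddAbove (u '' Z) := ⟨B, by rintro _ ⟨z, hz, rfl⟩; exact hB _ hz.1 _ hz.2.1 _ hz.2.2⟩
  set S := sSup (u '' Z)
  have hle : ∀ z ∈ Z, u z ≤ S := fun z hz => le_csSup hbd ⟨z, hz, rfl⟩
  have hS0 : 0 < S := hpos.trans_le (hle (t₁, ⟨x₁, v₁⟩) ⟨ht₁, hx₁, hv₁⟩)
  have hF : (𝓟 Z ⊓ comap u (𝓝 S)).NeBot := by
    have h1 := csSup_mem_closure hne hbd
    rw [mem_closure_iff_clusterPt, ClusterPt, ← map_principal] at h1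
    have h2 : (map u (𝓟 Z) ⊓ 𝓝 S).NeBot := by rwa [inf_comm]
    rw [← Filter.push_pull] at h2
    exact h2.of_map
  set 𝒰 := Ultrafilter.of (𝓟 Z ⊓ comap u (𝓝 S))
  have hle𝒰 : (𝒰 : Filter _) ≤ 𝓟 Z ⊓ comap u (𝓝 S) := Ultrafilter.of_le _
  have hZ𝒰 : ∀ᶠ z in (𝒰 : Filter _), z ∈ Z := le_principal_iff.1 (hle𝒰.trans inf_le_left)
  have hu𝒰 : Tendsto u 𝒰 (𝓝 S) := tendsto_iff_comap.2 (hle𝒰.trans inf_le_right)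
  -- limits of the time, of the base point and of the normalised vector
  obtain ⟨t, ht, htl⟩ := (isCompact_Icc (a := (0 : ℝ)) (b := T)).ultrafilter_le_nhds
    (𝒰.map Prod.fst) (by
      rw [le_principal_iff]
      change ∀ᶠ z in (𝒰 : Filter (ℝ × TotalSpace (V r) E)), z.1 ∈ Icc 0 T
      filter_upwards [hZ𝒰] with z hz using hz.1)
  obtain ⟨p, hp, hpl⟩ := hK.ultrafilter_le_nhds (𝒰.map fun z => z.2.proj) (by
      rw [le_principal_iff]
      change ∀ᶠ z in (𝒰 : Filter (ℝ × TotalSpace (V r) E)), z.2.proj ∈ K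
      filter_upwards [hZ𝒰, hu𝒰.eventually (lt_mem_nhds hS0)] with z hz hz0
      by_contra hk
      exact absurd (hout _ hz.1 _ hz.2.1 hk _ hz.2.2) (not_le.2 hz0))
  have hpW := hKW hp
  have htl' : Tendsto (fun z : ℝ × TotalSpace (V r) E => z.1) 𝒰 (𝓝 t) := htl
  have hpl' : Tendsto (fun z : ℝ × TotalSpace (V r) E => z.2.proj) 𝒰 (𝓝 p) := hpl
  have hbase : ∀ᶠ z in (𝒰 : Filter (ℝ × TotalSpace (V r) E)), z.2.proj ∈ baseSet r E p :=
    hpl'.eventually ((isOpen_baseSet p).mem_nhds (mem_baseSet p))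
  have hsrc : ∀ᶠ z in (𝒰 : Filter (ℝ × TotalSpace (V r) E)),
      z.2.proj ∈ (chartAt (V n) p).source :=
    hpl'.eventually ((chartAt (V n) p).open_source.mem_nhds (mem_chart_source _ p))
  have hchoose : ∀ z : ℝ × TotalSpace (V r) E, ∃ w : V r, (z ∈ Z → z.2.proj ∈ baseSet r E p →
      ‖w‖ = 1 ∧ w ≠ 0 ∧ u z = logRatio (H₁ z.1) (H₂ z.1) z.2.proj (frameVec E p z.2.proj w)
        - ψ z.1 z.2.proj) := fun z => by
    by_cases h : z ∈ Z ∧ z.2.proj ∈ baseSet r E p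
    · obtain ⟨w, hw⟩ := exists_frameVec h.2 z.2.snd
      have hw0 : w ≠ 0 := by
        rintro rfl
        rw [frameVec_eq_linear h.2, map_zero] at hw
        exact h.1.2.2 hw.symm
      have hn : ‖w‖⁻¹ ≠ 0 := inv_ne_zero (norm_ne_zero_iff.2 hw0)
      refine ⟨((‖w‖⁻¹ : ℝ) : ℂ) • w, fun _ _ => ⟨?_, ?_, ?_⟩⟩
      · rw [norm_smul, norm_real, norm_inv, norm_norm, inv_mul_cancel₀ (norm_ne_zero_iff.2 hw0)]
      · exact smul_ne_zero (ofReal_ne_zero.2 hn) hw0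
      · rw [frameVec_eq_linear h.2, map_smul, ← frameVec_eq_linear h.2, hw,
          logRatio_smul _ _ _ hn h.1.2.2]
    · exact ⟨0, fun h1 h2 => absurd ⟨h1, h2⟩ h⟩
  choose w hw using hchoose
  obtain ⟨w₀, hw₀, hwl⟩ := (isCompact_sphere (0 : V r) 1).ultrafilter_le_nhds (𝒰.map w) (by
      rw [le_principal_iff]
      change ∀ᶠ z in (𝒰 : Filter (ℝ × TotalSpace (V r) E)), w z ∈ Metric.sphere 0 1
      filter_upwards [hZ𝒰, hbase] with z hz hzb
      simpa using (hw z hz hzb).1)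
  have hwl' : Tendsto w 𝒰 (𝓝 w₀) := hwl
  have hw₀0 : w₀ ≠ 0 := by
    rintro rfl; simp at hw₀
  have hlim := ((hR₁.tendsto_log_quad hW hpW ht hw₀0 htl' (hZ𝒰.mono fun z hz => hz.1) hpl' hwl').sub
    (hR₂.tendsto_log_quad hW hpW ht hw₀0 htl' (hZ𝒰.mono fun z hz => hz.1) hpl' hwl')).sub
    ((hψ t p hpW).tendsto.comp (htl'.prodMk_nhds hpl'))
  have hSeq : S = logRatio (H₁ t) (H₂ t) p (frameVec E p p w₀) - ψ t p := by
    rw [logRatio_frameVec (n := n) _ _ (mem_chart_source _ p) (mem_baseSet p)]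
    refine tendsto_nhds_unique hu𝒰 (hlim.congr' ?_)
    filter_upwards [hZ𝒰, hbase, hsrc] with z hz hzb hzs
    rw [(hw z hz hzb).2.2, logRatio_frameVec (n := n) _ _ hzs hzb]; rfl
  exact ⟨t, ht, p, hpW, w₀, hw₀0, hSeq ▸ hS0, fun t' ht' x hx v hv =>
    hSeq ▸ hle (t', ⟨x, v⟩) ⟨ht', hx, hv⟩⟩

/-- Second-order condition at a point where `log (|v|²₁ / |v|²₂) - ψ` is maximal. -/
theorem curvature_sub_le_of_isMax {W : Set X} (hW : IsOpen W) {β : KForm (V n) 2 X ℝ}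
    {H₁ H₂ : HermitianMetric E} {p : X} (hp : p ∈ W)
    (h11 : ∀ u v : V n, β p ![I • u, I • v] = β p ![u, v])
    (hs₁ : SmoothMatAt 2 (hermMatrix n r H₁ p) (chartAt (V n) p p))
    (hs₂ : SmoothMatAt 2 (hermMatrix n r H₂ p) (chartAt (V n) p p))
    {L : V n →ₗ[ℂ] V n} (hL : LinearMap.det L ≠ 0)
    (hb : IsUnitary (β p) fun j => L (Pi.single j 1))
    {ψ : X → ℝ}
    (hψ : ContDiffAt ℝ 2 (fun y => ψ ((chartAt (V n) p).symm y)) (chartAt (V n) p p))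
    {w : V r} (hw : w ≠ 0)
    (hmax : ∀ x ∈ W, ∀ v : E x, v ≠ 0 → logRatio H₁ H₂ x v - ψ x
      ≤ logRatio H₁ H₂ p (frameVec E p p w) - ψ p) :
    quad w (hermMatrixAt n r H₁ p * ((-2 * I) • hatF n r β H₁ p)) / quad w (hermMatrixAt n r H₁ p)
      - quad w (hermMatrixAt n r H₂ p * ((-2 * I) • hatF n r β H₂ p))
        / quad w (hermMatrixAt n r H₂ p)
      ≤ ∑ j, levi (fun y => ψ ((chartAt (V n) p).symm y)) (chartAt (V n) p p)
        (L (Pi.single j 1)) := by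
  set y₀ := chartAt (V n) p p
  set P := parallelFrame (hermMatrix n r H₂ p) y₀
  have hpd : ∀ H : HermitianMetric E, (hermMatrix n r H p y₀).PosDef := fun H =>
    hermMatrixAt_posDef H p
  have hhat : ∀ H : HermitianMetric E, SmoothMatAt 2 (hermMatrix n r H p) y₀ →
      hatF n r β H p = ∑ j, curv (hermMatrix n r H p) y₀ (L (Pi.single j 1))
        (I • L (Pi.single j 1)) := fun H hs =>
    traceForm_curv_eq_sum hs (hpd H).det_pos.ne' (β p) h11 L hL hb
  obtain ⟨hc, hle⟩ := sub_le_sum_levi_log_sub hs₁ hs₂ (hpd H₁) (hpd H₂)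
    (Eventually.of_forall fun x => hermMatrix_isHermitian H₁ p x)
    (Eventually.of_forall fun x => hermMatrix_isHermitian H₂ p x) hw
    fun j => L (Pi.single j 1)
  rw [← hhat H₁ hs₁, ← hhat H₂ hs₂] at hle
  refine hle.trans ?_
  rw [← sub_nonpos, ← Finset.sum_sub_distrib]
  refine Finset.sum_nonpos fun j _ => ?_
  rw [← levi_sub hc hψ]
  refine IsLocalMax_levi_nonpos (hc.sub hψ) ?_ _
  have hPd : ∀ᶠ y in 𝓝 y₀, (P y).det ≠ 0 := by
    refine ((dmat_parallelFrame hs₂ (hpd H₂).det_pos.ne' y₀ 0).1).eventually_det_ne_zero ?_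
    rw [parallelFrame_self]; simp
  have hval : ∀ y ∈ frameDomain n r E W p,
      Real.log (quad w ((P y)ᴴ * hermMatrix n r H₁ p y * P y))
        - Real.log (quad w ((P y)ᴴ * hermMatrix n r H₂ p y * P y))
      = logRatio H₁ H₂ ((chartAt (V n) p).symm y)
        (frameVec E p ((chartAt (V n) p).symm y) (P y *ᵥ w)) := fun y hy => by
    rw [logRatio_frameVec (n := n) _ _ ((chartAt (V n) p).map_target hy.1) hy.2.2,
      quad_conjTranspose_mul, quad_conjTranspose_mul, (chartAt (V n) p).right_inv hy.1]
  have h0 := hval y₀ (chart_mem_frameDomain hp)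
  have e0 : P y₀ = 1 := parallelFrame_self
  have es : (chartAt (V n) p).symm y₀ = p := (chartAt (V n) p).left_inv (mem_chart_source _ p)
  filter_upwards [(isOpen_frameDomain hW p).mem_nhds (chart_mem_frameDomain (r := r) (E := E) hp),
    hPd] with y hy hd
  have hne : P y *ᵥ w ≠ 0 := fun h => hd (Matrix.exists_mulVec_eq_zero_iff.1 ⟨w, hw, h⟩)
  have h1 := hmax _ hy.2.1 _ (frameVec_ne_zero hy.2.2 hne)
  rw [← hval y hy] at h1
  refine h1.trans (le_of_eq ?_)
  rw [e0, Matrix.one_mulVec] at h0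
  have h2 : logRatio H₁ H₂ ((chartAt (V n) p).symm y₀)
      (frameVec E p ((chartAt (V n) p).symm y₀) w) = logRatio H₁ H₂ p (frameVec E p p w) := by
    rw [es]
  rw [← h2, ← h0, es, parallelFrame_self]

/-- The comparison principle: for two families of metrics which solve the flow up to an error
`c φ`, the logarithm of their ratio is bounded by a multiple of the barrier `φ`, if it is so
initially. -/
theorem logRatio_le_of_isBarrier {W : Set X} (hW : IsOpen W) {T : ℝ} {β : KForm (V n) 2 X ℝ}
    (h11 : ∀ p ∈ W, ∀ u v : V n, β p ![I • u, I • v] = β p ![u, v])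
    (hpos : ∀ p ∈ W, ∀ u : V n, u ≠ 0 → 0 < β p ![u, I • u])
    {K : ℝ} (hK : 0 ≤ K) {φ f : X → ℝ} (hb : IsBarrier W β K φ f)
    {H₁ H₂ : ℝ → HermitianMetric E} {dG₁ dG₂ : ℝ → X → 𝕄(r)}
    (hR₁ : IsRegularFamily n r W T H₁ dG₁) (hR₂ : IsRegularFamily n r W T H₂ dG₂) {C : ℝ}
    (hC : ∀ t ∈ Icc 0 T, ∀ x ∈ W, ∀ v : E x, v ≠ 0 → logRatio (H₁ t) (H₂ t) x v ≤ C)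
    {c : ℝ} (hc : 0 ≤ c)
    (h₁ : ∀ t ∈ Icc 0 T, ∀ p ∈ W, ∀ w : V r, quad w (dG₁ t p)
      ≤ quad w (hermMatrixAt n r (H₁ t) p * ((-2 * I) • hatF n r β (H₁ t) p))
        + c * φ p * quad w (hermMatrixAt n r (H₁ t) p))
    (h₂ : ∀ t ∈ Icc 0 T, ∀ p ∈ W, ∀ w : V r,
      quad w (hermMatrixAt n r (H₂ t) p * ((-2 * I) • hatF n r β (H₂ t) p))
        - c * φ p * quad w (hermMatrixAt n r (H₂ t) p) ≤ quad w (dG₂ t p))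
    {Λ : ℝ} (hΛ : 0 ≤ Λ)
    (h0 : ∀ x ∈ W, ∀ v : E x, v ≠ 0 → logRatio (H₁ 0) (H₂ 0) x v ≤ Λ * φ x) :
    ∀ t ∈ Icc 0 T, ∀ x ∈ W, ∀ v : E x, v ≠ 0 →
      logRatio (H₁ t) (H₂ t) x v ≤ (Λ + 2 * c * t) * Real.exp (K * t) * φ x := by
  -- `bt` solves `bt' = K bt + 2 c e^{Kt}`, so that `bt φ` is a supersolution for the error `2 c φ`
  set bt : ℝ → ℝ := fun t => (Λ + 2 * c * t) * Real.exp (K * t) with hbt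
  have hbt0 : ∀ t, 0 ≤ t → 0 ≤ bt t := fun t ht => by positivity
  have hbtd : ∀ t, HasDerivAt bt (2 * c * Real.exp (K * t) + K * bt t) t := fun t => by
    have h1 : HasDerivAt (fun t : ℝ => Λ + 2 * c * t) (2 * c) t := by
      simpa using ((hasDerivAt_id t).const_mul (2 * c)).const_add Λ
    have h2 : HasDerivAt (fun t : ℝ => Real.exp (K * t)) (Real.exp (K * t) * K) t := by
      simpa using ((hasDerivAt_id t).const_mul K).exp
    refine (h1.mul h2).congr_deriv ?_
    simp only [hbt]; ring
  -- it suffices to have the estimate with the term `ε (f + (K + 1) t)` added; its time derivative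
  -- `ε (K + 1)` strictly exceeds its Laplacian, which is at most `ε K`
  suffices h : ∀ ε : ℝ, 0 < ε → ∀ t ∈ Icc 0 T, ∀ x ∈ W, ∀ v : E x, v ≠ 0 →
      logRatio (H₁ t) (H₂ t) x v - (bt t * φ x + ε * (f x + (K + 1) * t)) ≤ 0 by
    intro t ht x hx v hv
    refine le_of_forall_pos_le_add fun δ hδ => ?_
    have hq : 0 ≤ f x + (K + 1) * t :=
      add_nonneg (hb.nonneg_exhaustion x hx) (mul_nonneg (by linarith) ht.1)
    have h1 := h (δ / (f x + (K + 1) * t + 1)) (by positivity) t ht x hx v hv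
    have h2 : δ / (f x + (K + 1) * t + 1) * (f x + (K + 1) * t) ≤ δ := by
      rw [div_mul_eq_mul_div, div_le_iff₀ (by linarith)]
      nlinarith
    linarith
  intro ε hε
  by_contra! hcon
  obtain ⟨t₁, ht₁, x₁, hx₁, v₁, hv₁, hpos₁⟩ := hcon
  have hψ0 : ∀ t, 0 ≤ t → ∀ x ∈ W, 0 ≤ bt t * φ x := fun t ht x hx =>
    mul_nonneg (hbt0 t ht) (hb.nonneg x hx)
  obtain ⟨t, ht, p, hp, w, hw, hup, hmax⟩ := exists_max_logRatio hW hR₁ hR₂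
    (ψ := fun t x => bt t * φ x + ε * (f x + (K + 1) * t))
    (fun t p hp => by
      have hφc := continuousAt_of_chart (hb.contDiffAt p hp)
      have hfc := continuousAt_of_chart (hb.contDiffAt_exhaustion p hp)
      have hφ' : ContinuousAt (fun q : ℝ × X => φ q.2) (t, p) :=
        ContinuousAt.comp (f := Prod.snd) (x := ((t, p) : ℝ × X)) hφc continuousAt_snd
      have hf' : ContinuousAt (fun q : ℝ × X => f q.2) (t, p) :=
        ContinuousAt.comp (f := Prod.snd) (x := ((t, p) : ℝ × X)) hfc continuousAt_snd
      have hb' : ContinuousAt (fun q : ℝ × X => bt q.1) (t, p) :=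
        ContinuousAt.comp (f := Prod.fst) (x := ((t, p) : ℝ × X)) (hbtd t).continuousAt
          continuousAt_fst
      exact (hb'.mul hφ').add (continuousAt_const.mul (hf'.add
        (continuousAt_const.mul continuousAt_fst))))
    -- outside this sublevel set `ε f > C`, so that the function is negative
    (hb.isCompact_sublevel (C / ε)) (fun x hx => hx.1) (B := C)
    (fun t ht x hx v hv => by
      have := hC t ht x hx v hv
      have h1 := hψ0 t ht.1 x hx
      have h2 : 0 ≤ ε * (f x + (K + 1) * t) := mul_nonneg hε.le
        (add_nonneg (hb.nonneg_exhaustion x hx) (mul_nonneg (by linarith) ht.1))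
      linarith)
    (fun t ht x hx hxK v hv => by
      have := hC t ht x hx v hv
      have h1 := hψ0 t ht.1 x hx
      have h2 : C / ε < f x := by
        by_contra! h; exact hxK ⟨hx, h⟩
      rw [div_lt_iff₀ hε] at h2
      have h3 : 0 ≤ ε * ((K + 1) * t) := mul_nonneg hε.le (mul_nonneg (by linarith) ht.1)
      nlinarith)
    ht₁ hx₁ hv₁ hpos₁
  have hφp := hb.nonneg p hp
  have hfp := hb.nonneg_exhaustion p hp
  have hpd : ∀ H : HermitianMetric E, (hermMatrixAt n r H p).PosDef := fun H =>
    hermMatrixAt_posDef H p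
  have hlog : ∀ τ, logRatio (H₁ τ) (H₂ τ) p (frameVec E p p w)
      = Real.log (quad w (hermMatrixAt n r (H₁ τ) p))
        - Real.log (quad w (hermMatrixAt n r (H₂ τ) p)) := fun τ =>
    logRatio_frameVec (n := n) _ _ (mem_chart_source _ p) (mem_baseSet p) w
  -- the maximum, being positive, is not attained at the initial time
  have ht0 : 0 < t := by
    rcases ht.1.eq_or_lt with h | h
    · exfalso
      subst h
      have h1 := h0 p hp _ (frameVec_ne_zero (mem_baseSet p) hw)
      have h2 : bt 0 = Λ := by simp [hbt]
      rw [h2] at hup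
      have : 0 ≤ ε * (f p + (K + 1) * 0) := by simp; positivity
      linarith
    · exact h
  -- first-order condition in time
  have hq₁ := quad_pos (hpd (H₁ t)) hw
  have hq₂ := quad_pos (hpd (H₂ t)) hw
  have hd₁ := (hasDerivWithinAt_quad (hR₁.hasDeriv t ht p hp) w).log hq₁.ne'
  have hd₂ := (hasDerivWithinAt_quad (hR₂.hasDeriv t ht p hp) w).log hq₂.ne'
  have hdψ : HasDerivWithinAt (fun τ => bt τ * φ p + ε * (f p + (K + 1) * τ))
      ((2 * c * Real.exp (K * t) + K * bt t) * φ p + ε * (K + 1)) (Icc 0 T) t := by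
    refine (((hbtd t).mul_const (φ p)).add (((((hasDerivAt_id t).const_mul (K + 1)).const_add
      (f p)).const_mul ε))).hasDerivWithinAt.congr_deriv ?_
    simp
  have htime := deriv_nonneg_of_isMaxOn_left ht0 ht.2 ((hd₁.sub hd₂).sub hdψ) fun τ hτ => by
    have := hmax τ hτ p hp _ (frameVec_ne_zero (mem_baseSet p) hw)
    rw [hlog, hlog] at this
    exact this
  -- second-order condition in space
  obtain ⟨L, hL, hbL⟩ := exists_isUnitary (β p) (h11 p hp) (hpos p hp)
  have hcφ := hb.contDiffAt p hp
  have hcf := hb.contDiffAt_exhaustion p hp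
  have hcφ' : ContDiffAt ℝ 2 (fun y => bt t * φ ((chartAt (V n) p).symm y)) (chartAt (V n) p p) :=
    contDiffAt_const.mul hcφ
  have hcf1 : ContDiffAt ℝ 2 (fun y => f ((chartAt (V n) p).symm y) + (K + 1) * t)
      (chartAt (V n) p p) := hcf.add contDiffAt_const
  have hcf' : ContDiffAt ℝ 2 (fun y => ε * (f ((chartAt (V n) p).symm y) + (K + 1) * t))
      (chartAt (V n) p p) := contDiffAt_const.mul hcf1
  have hspace := curvature_sub_le_of_isMax hW hp (h11 p hp) (hR₁.smooth t ht p hp)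
    (hR₂.smooth t ht p hp) hL hbL (ψ := fun x => bt t * φ x + ε * (f x + (K + 1) * t))
    (hcφ'.add hcf') hw fun x hx v hv => hmax t ht x hx v hv
  simp_rw [levi_add hcφ' hcf', levi_const_mul hcφ, levi_const_mul hcf1,
    levi_add hcf contDiffAt_const, levi_const, add_zero] at hspace
  rw [Finset.sum_add_distrib, ← Finset.mul_sum, ← Finset.mul_sum] at hspace
  have hl1 := mul_le_mul_of_nonneg_left (hb.sum_levi_le p hp L hL hbL) (hbt0 t ht.1)
  have hl2 := mul_le_mul_of_nonneg_left (hb.sum_levi_exhaustion_le p hp L hL hbL) hε.le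
  have e₁ : quad w (dG₁ t p) / quad w (hermMatrixAt n r (H₁ t) p)
      ≤ quad w (hermMatrixAt n r (H₁ t) p * ((-2 * I) • hatF n r β (H₁ t) p))
        / quad w (hermMatrixAt n r (H₁ t) p) + c * φ p := by
    rw [div_le_iff₀ hq₁, add_mul, div_mul_cancel₀ _ hq₁.ne']; exact h₁ t ht p hp w
  have e₂ : quad w (hermMatrixAt n r (H₂ t) p * ((-2 * I) • hatF n r β (H₂ t) p))
        / quad w (hermMatrixAt n r (H₂ t) p) - c * φ p
      ≤ quad w (dG₂ t p) / quad w (hermMatrixAt n r (H₂ t) p) := by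
    rw [le_div_iff₀ hq₂, sub_mul, div_mul_cancel₀ _ hq₂.ne']; exact h₂ t ht p hp w
  have hexp : 1 ≤ Real.exp (K * t) := Real.one_le_exp (mul_nonneg hK ht.1)
  have hcp : 0 ≤ 2 * c * φ p := by positivity
  have := mul_le_mul_of_nonneg_left hexp hcp
  nlinarith

/-! ### Limits of the flow -/

/-- Uniform convergence on compact sets to a continuous limit gives convergence of the matrices
jointly in time and space. -/
theorem ConvergesOn.tendsto_hermMatrix {W : Set X} (hW : IsOpen W) {H : ℝ → HermitianMetric E}
    {K : HermitianMetric E} (hconv : ConvergesOn W H K) (hKs : SmoothMetric n r W K) {p : X}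
    {y : V n} (hy : y ∈ frameDomain n r E W p) (a b : Fin r) :
    Tendsto (fun q : ℝ × V n => hermMatrix n r (H q.1) p q.2 a b) (atTop ×ˢ 𝓝 y)
      (𝓝 (hermMatrix n r K p y a b)) := by
  have : LocallyCompactSpace X := ChartedSpace.locallyCompactSpace (V n) X
  obtain ⟨S, hS, hxS, hSW⟩ := exists_compact_subset hW hy.2.1
  refine tendsto_of_tendsto_quad (fun z => hermMatrix_isHermitian _ _ _)
    (hermMatrix_isHermitian _ _ _) (fun v => ?_) a b
  have hKc : Tendsto (fun q : ℝ × V n => quad v (hermMatrix n r K p q.2)) (atTop ×ˢ 𝓝 y)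
      (𝓝 (quad v (hermMatrix n r K p y))) :=
    (((hKs.smoothMatAt hW hy).contDiffAt_quad v).continuousAt.tendsto).comp tendsto_snd
  have hdiff : Tendsto (fun q : ℝ × V n => quad v (hermMatrix n r (H q.1) p q.2)
      - quad v (hermMatrix n r K p q.2)) (atTop ×ˢ 𝓝 y) (𝓝 0) := by
    rw [Metric.tendsto_nhds]
    intro ρ hρ
    set c := quad v (hermMatrix n r K p y)
    have hc0 : 0 < |c| + 1 := by positivity
    have h1 : ∀ᶠ q in (atTop : Filter ℝ) ×ˢ 𝓝 y, quad v (hermMatrix n r K p q.2) < |c| + 1 :=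
      hKc.eventually (gt_mem_nhds (lt_of_le_of_lt (le_abs_self c) (lt_add_one _)))
    have h2 : ∀ᶠ y' in 𝓝 y, y' ∈ frameDomain n r E W p ∧ (chartAt (V n) p).symm y' ∈ S :=
      Filter.inter_mem ((isOpen_frameDomain hW p).mem_nhds hy)
        ((chartAt (V n) p).continuousAt_symm hy.1 (mem_interior_iff_mem_nhds.1 hxS))
    have h3 := hconv S hSW hS (ρ / (2 * (|c| + 1))) (by positivity)
    filter_upwards [h1, h3.prod_mk h2] with q hq1 hq2
    have h4 := hq2.1 _ hq2.2.2 (frameVec E p _ v)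
    rw [← quad_hermMatrix (n := n) (H q.1) hq2.2.1.2.2,
      ← quad_hermMatrix (n := n) K hq2.2.1.2.2] at h4
    rw [Real.dist_eq, sub_zero]
    refine h4.trans_lt ((mul_le_mul_of_nonneg_left hq1.le (by positivity)).trans_lt ?_)
    rw [div_mul_eq_mul_div, div_lt_iff₀ (by positivity)]
    nlinarith
  have := hdiff.add hKc
  simpa using this

/-- A `C⁰` limit of the flow is Hermitian Yang-Mills. -/
theorem isHYM_of_convergesOn {W : Set X} (hW : IsOpen W) {β : KForm (V n) 2 X ℝ}
    (hβ : IsKaehler W β) {H : ℝ → HermitianMetric E} (hs : SmoothFamily n r W H)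
    (hev : ∀ t, 0 ≤ t → ∀ p ∈ W, logVelocity n r H t p = (-2 * I) • hatF n r β (H t) p)
    {K : HermitianMetric E} (hKs : SmoothMetric n r W K) (hconv : ConvergesOn W H K) :
    IsHYM r W β K := by
  intro p hp
  have hO := isOpen_frameDomain (n := n) (r := r) (E := E) hW p
  have hy₀ := chart_mem_frameDomain (n := n) (r := r) (E := E) hp
  have hz := traceForm_curv_eq_zero_of_tendsto (G := fun t y => hermMatrix n r (H t) p y)
    (G' := fun t y => velocity n r H t p y) (K := fun y => hermMatrix n r K p y)
    (β := inChart p β) hO hy₀ ?_ ?_ ?_ ?_ ?_ ?_ ?_ ?_ ?_ ?_ ?_ ?_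
  · have e : hatF n r β K p = traceForm (stdFrame n) (inChart p β (chartAt (V n) p p))
        (curv (hermMatrix n r K p) (chartAt (V n) p p)) := by
      rw [show inChart p β (chartAt (V n) p p) = β p from
        ContinuousAlternatingMap.ext fun v => inChart_self β p v]
      rfl
    rw [e]
    exact hz
  · exact (hβ.smooth p).continuousOn.continuousAt
      (((chartAt (V n) p).isOpen_inter_preimage_symm hW).mem_nhds ⟨hy₀.1, hy₀.2.1⟩)
  · exact fun y hy => inChart_type11 hy.1 (hβ.type11 _ hy.2.1)
  · exact fun y hy => inChart_pos hy.1 (hβ.pos _ hy.2.1)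
  · exact fun a b => (hs.continuousOn p a b).mono (prod_mono_left Ioi_subset_Ici_self)
  · exact fun t ht y hy => (hs.smoothMatAt hW ht.le hy).mono (by norm_cast)
  · intro t ht y hy a b
    have h := (hs p a b).comp (f := fun τ : ℝ => (τ, y)) (contDiff_prodMk_left y).contDiffOn
      (s := Ici 0) fun τ hτ => ⟨hτ, hy⟩
    exact (h.contDiffAt (Ici_mem_nhds ht)).of_le (by norm_cast)
  · exact fun t y hy => hermMatrix_posDef (H t) hy.2.2
  · exact fun t ht y hy a b => (hs.hasDerivWithinAt ht.le hy a b).hasDerivAt (Ici_mem_nhds ht)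
  · exact fun t ht y hy => velocity_eq hW hs hβ.type11 hev ht.le hy
  · exact fun y hy => (hKs.smoothMatAt hW hy).mono (by norm_cast)
  · exact fun y hy => hermMatrix_posDef K hy.2.2
  · exact fun y hy a b => hconv.tendsto_hermMatrix hW hKs hy a b

/-! ### The pointwise norm of the contracted curvature -/

/-- The endomorphism `-2i F̂` is self-adjoint with respect to the metric. -/
theorem isHermitian_mul_hatF {β : KForm (V n) 2 X ℝ} {H : HermitianMetric E} {p : X}
    (h11 : ∀ u v : V n, β p ![I • u, I • v] = β p ![u, v])
    (hpos : ∀ u : V n, u ≠ 0 → 0 < β p ![u, I • u])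
    (hs : SmoothMatAt 2 (hermMatrix n r H p) (chartAt (V n) p p)) :
    (hermMatrixAt n r H p * ((-2 * I) • hatF n r β H p)).IsHermitian := by
  obtain ⟨L, hL, hb⟩ := exists_isUnitary (β p) h11 hpos
  have hd := (hermMatrixAt_posDef (n := n) (r := r) H p).det_pos.ne'
  have e : hatF n r β H p = ∑ j, curv (hermMatrix n r H p) (chartAt (V n) p p) (L (Pi.single j 1))
      (I • L (Pi.single j 1)) := traceForm_curv_eq_sum hs hd (β p) h11 L hL hb
  rw [e, Finset.smul_sum, Finset.mul_sum, Matrix.IsHermitian, Matrix.conjTranspose_sum]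
  exact Finset.sum_congr rfl fun j _ => (isHermitian_mul_curv hs hd
    (Eventually.of_forall fun x => hermMatrix_isHermitian H p x) _).eq

/-- A bound on the quadratic form of `-2i F̂` controls `|F̂|²`. -/
theorem normSqHatF_le {β : KForm (V n) 2 X ℝ} {H : HermitianMetric E} {p : X}
    (h11 : ∀ u v : V n, β p ![I • u, I • v] = β p ![u, v])
    (hpos : ∀ u : V n, u ≠ 0 → 0 < β p ![u, I • u])
    (hs : SmoothMatAt 2 (hermMatrix n r H p) (chartAt (V n) p p)) {c : ℝ} (hc : 0 ≤ c)
    (h : ∀ v, |quad v (hermMatrixAt n r H p * ((-2 * I) • hatF n r β H p))|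
      ≤ c * quad v (hermMatrixAt n r H p)) :
    normSqHatF n r β H p ≤ 9 * r ^ 2 * c ^ 2 :=
  trace_adjoint_mul_self_le (hermMatrixAt_posDef H p) (isHermitian_mul_hatF h11 hpos hs) hc h

theorem normSqHatF_nonneg {β : KForm (V n) 2 X ℝ} {H : HermitianMetric E} {p : X} :
    0 ≤ normSqHatF n r β H p := by
  have hG := hermMatrixAt_posDef (n := n) (r := r) H p
  rw [normSqHatF]
  generalize hatF n r β H p = F
  generalize hermMatrixAt n r H p = G at hG ⊢
  obtain ⟨B, hB, hGB⟩ := exists_eq_conjTranspose_mul_self hG.inv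
  have h1 : (B * (Fᴴ * G * F) * Bᴴ).PosSemidef :=
    (hG.posSemidef.conjTranspose_mul_mul_same F).mul_mul_conjTranspose_same B
  have h2 := (Complex.nonneg_iff.1 h1.trace_nonneg).1
  rwa [trace_mul_comm, ← mul_assoc, ← hGB, ← mul_assoc,
    ← mul_assoc] at h2

/-- `|F̂|²` is continuous in space and time along the flow. -/
theorem continuousOn_normSqHatF {W : Set X} (hW : IsOpen W) {β : KForm (V n) 2 X ℝ}
    (h11 : ∀ p ∈ W, ∀ u v : V n, β p ![I • u, I • v] = β p ![u, v])
    {H : ℝ → HermitianMetric E} (hs : SmoothFamily n r W H)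
    (hev : ∀ t, 0 ≤ t → ∀ p ∈ W, logVelocity n r H t p = (-2 * I) • hatF n r β (H t) p) (p : X) :
    ContinuousOn (fun q : ℝ × V n => normSqHatF n r β (H q.1) ((chartAt (V n) p).symm q.2))
      (Ici 0 ×ˢ frameDomain n r E W p) := by
  have hinv : ∀ a b, ContinuousOn (fun q : ℝ × V n => (hermMatrix n r (H q.1) p q.2)⁻¹ a b)
      (Ici 0 ×ˢ frameDomain n r E W p) := fun a b q hq =>
    (contDiffWithinAt_matrix_inv (fun a b => ((hs p a b) q hq))
      (hermMatrix_posDef (H q.1) hq.2.2.2).det_pos.ne' a b).continuousWithinAt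
  have hG := hs.continuousOn p
  have hV := hs.continuousOn_velocity hW p
  have hmul : ∀ {A B : ℝ × V n → 𝕄(r)} {S : Set (ℝ × V n)},
      (∀ a b, ContinuousOn (fun q => A q a b) S) → (∀ a b, ContinuousOn (fun q => B q a b) S) →
      ∀ a b, ContinuousOn (fun q => (A q * B q) a b) S := fun hA hB a b => by
    simp only [Matrix.mul_apply]
    exact continuousOn_finsetSum _ fun c _ => (hA a c).mul (hB c b)
  have hF := hmul (S := Ici 0 ×ˢ frameDomain n r E W p) (A := fun q => (I / 2) •
    (hermMatrix n r (H q.1) p q.2)⁻¹) (fun a b => (hinv a b).const_smul (I / 2)) hV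
  have hFs : ∀ a b, ContinuousOn (fun q : ℝ × V n => (((I / 2) • (hermMatrix n r (H q.1) p q.2)⁻¹)
      * velocity n r H q.1 p q.2)ᴴ a b) (Ici 0 ×ˢ frameDomain n r E W p) := fun a b =>
    continuous_star.comp_continuousOn (hF b a)
  have hT := hmul (hmul (hmul hinv hFs) hG) hF
  have hre := continuous_re.comp_continuousOn (continuousOn_finsetSum Finset.univ fun a _ => hT a a)
  refine hre.congr fun q hq => ?_
  have hd := (hermMatrix_posDef (H q.1) hq.2.2.2 (n := n) (r := r)).det_pos.ne'.isUnit
  have hFq : hatLocal β (H q.1) p q.2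
      = ((I / 2) • (hermMatrix n r (H q.1) p q.2)⁻¹) * velocity n r H q.1 p q.2 := by
    rw [velocity_eq hW hs h11 hev hq.1 hq.2, Matrix.smul_mul,
      nonsing_inv_mul_cancel_left _ _ hd, smul_smul,
      show I / 2 * (-2 * I) = 1 by linear_combination -I_mul_I, one_smul]
  have h := normSqHatF_eq_local (H := H q.1) (frameDomain_subset p hq.2) (h11 _ hq.2.2.1)
    ((hs.smoothMatAt hW hq.1 (chart_mem_frameDomain hq.2.2.1)).mono (by norm_cast))
  rw [hFq] at h
  exact h

/-! ### Propagation of the decay along the flow -/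

section Flow

variable {W : Set X} {H : ℝ → HermitianMetric E}

/-- The time translate of a smooth family is regular. -/
theorem SmoothFamily.isRegularFamily (hW : IsOpen W) (hs : SmoothFamily n r W H) {t₀ : ℝ}
    (ht₀ : 0 ≤ t₀) (T : ℝ) : IsRegularFamily n r W T (fun t => H (t₀ + t))
      (fun t p => velocity n r H (t₀ + t) p (chartAt (V n) p p)) where
  continuousOn p hp a b := (hs.continuousOn p a b).comp (f := fun q : ℝ × V n => (t₀ + q.1, q.2))
    (by fun_prop) fun q hq => ⟨add_nonneg ht₀ hq.1.1, hq.2⟩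
  smooth t ht p hp := (hs.smoothMatAt hW (add_nonneg ht₀ ht.1) (chart_mem_frameDomain hp)).mono
    (by norm_cast)
  hasDeriv t ht p hp a b := by
    have h := hs.hasDerivWithinAt (add_nonneg ht₀ ht.1) (chart_mem_frameDomain hp) a b
    have h1 : HasDerivWithinAt (fun t => t₀ + t) 1 (Icc 0 T) t :=
      ((hasDerivAt_id t).const_add t₀).hasDerivWithinAt
    have h2 := h.scomp t h1 fun τ hτ => add_nonneg ht₀ hτ.1
    rw [one_smul] at h2
    exact h2

/-- The stationary family at the initial metric is regular. -/
theorem SmoothFamily.isRegularFamily_const (hW : IsOpen W) (hs : SmoothFamily n r W H) (T : ℝ) :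
    IsRegularFamily n r W T (fun _ => H 0) (fun _ _ => 0) where
  continuousOn p hp a b := (hs.continuousOn p a b).comp (f := fun q : ℝ × V n => (0, q.2))
    (by fun_prop) fun q hq => ⟨self_mem_Ici, hq.2⟩
  smooth t ht p hp := (hs.smoothMatAt hW le_rfl (chart_mem_frameDomain hp)).mono (by norm_cast)
  hasDeriv t ht p hp a b := hasDerivWithinAt_const _ _ _

/-- Mutual boundedness with `H₀` bounds the logarithm of the ratio of any two members of the family
on a bounded time interval; this is the a priori bound required by the maximum principle. -/
theorem BoundedFamily.exists_logRatio_le {H₀ : HermitianMetric E} (h : BoundedFamily W H₀ H)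
    (T : ℝ) : ∃ C, ∀ t ∈ Icc 0 T, ∀ t' ∈ Icc 0 T, ∀ x ∈ W, ∀ v : E x, v ≠ 0 →
      logRatio (H t) (H t') x v ≤ C := by
  obtain ⟨C, hC⟩ := h T
  refine ⟨Real.log (C * C), fun t ht t' ht' x hx v hv => ?_⟩
  have h0 := H₀.pos x v hv
  have h1 := (H t).pos x v hv
  have h2 := (H t').pos x v hv
  have h3 := (hC t ht x hx v).1
  have h4 := (hC t' ht' x hx v).2
  have hC0 : 0 < C := pos_of_mul_pos_left (h1.trans_le h3) h0.le
  rw [logRatio, sub_le_iff_le_add, ← Real.log_mul (by positivity) h2.ne']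
  refine Real.log_le_log h1 (h3.trans ?_)
  rw [mul_assoc]
  exact mul_le_mul_of_nonneg_left h4 hC0.le

variable {β : KForm (V n) 2 X ℝ}

/-- If the initial velocity of the flow is bounded by a multiple of the barrier `φ`, so is the
velocity at later times: `H_τ` is compared with the stationary family `H₀`, then `H_{t+τ}` with
`H_t`. -/
theorem exists_abs_quad_hatF_le (hW : IsOpen W)
    (h11 : ∀ p ∈ W, ∀ u v : V n, β p ![I • u, I • v] = β p ![u, v])
    (hpos : ∀ p ∈ W, ∀ u : V n, u ≠ 0 → 0 < β p ![u, I • u])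
    {K : ℝ} (hK : 0 ≤ K) {φ f : X → ℝ} (hb : IsBarrier W β K φ f) (hs : SmoothFamily n r W H)
    (hev : ∀ t, 0 ≤ t → ∀ p ∈ W, logVelocity n r H t p = (-2 * I) • hatF n r β (H t) p)
    {H₀ : HermitianMetric E} (hbd : BoundedFamily W H₀ H) {c : ℝ} (hc : 0 ≤ c)
    (h0 : ∀ p ∈ W, ∀ w : V r, |quad w (hermMatrixAt n r (H 0) p * ((-2 * I) • hatF n r β (H 0) p))|
      ≤ c * φ p * quad w (hermMatrixAt n r (H 0) p)) {T : ℝ} (hT : 0 ≤ T) :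
    ∃ c', 0 ≤ c' ∧ ∀ t ∈ Icc 0 T, ∀ p ∈ W, ∀ w : V r,
      |quad w (hermMatrixAt n r (H t) p * ((-2 * I) • hatF n r β (H t) p))|
        ≤ c' * φ p * quad w (hermMatrixAt n r (H t) p) := by
  -- the a priori bound has to hold for the translates by `τ ∈ [0, 1]` also
  obtain ⟨C, hC⟩ := hbd.exists_logRatio_le (T + 1)
  have hq0 : ∀ t p (w : V r), 0 ≤ quad w (hermMatrixAt n r (H t) p) := fun t p w =>
    quad_nonneg (hermMatrixAt_posDef (H t) p) w
  have hself : ∀ t x (v : E x), logRatio (H t) (H t) x v = 0 := fun t x v => sub_self _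
  set c₁ := 2 * c * Real.exp K with hc₁
  have hc₁0 : 0 ≤ c₁ := by positivity
  -- the flow against the stationary family
  have hRflow : ∀ t₀, 0 ≤ t₀ → ∀ S, IsRegularFamily n r W S (fun t => H (t₀ + t))
      (fun t p => velocity n r H (t₀ + t) p (chartAt (V n) p p)) := fun t₀ ht₀ S =>
    hs.isRegularFamily hW ht₀ S
  have hRconst : ∀ S, IsRegularFamily n r W S (fun _ => H 0) (fun _ _ => 0) := fun S =>
    hs.isRegularFamily_const hW S
  have hquad0 : ∀ w : V r, quad w (0 : 𝕄(r)) = 0 := fun w => by simp [quad]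
  have hflow_le : ∀ c : ℝ, 0 ≤ c → ∀ t, 0 ≤ t → ∀ p ∈ W, ∀ w : V r,
      quad w (velocity n r H t p (chartAt (V n) p p))
        ≤ quad w (hermMatrixAt n r (H t) p * ((-2 * I) • hatF n r β (H t) p))
          + c * φ p * quad w (hermMatrixAt n r (H t) p) := fun c hc t ht p hp w => by
    rw [velocity_self hev ht hp]
    exact le_add_of_nonneg_right (mul_nonneg (mul_nonneg hc (hb.nonneg p hp)) (hq0 t p w))
  have hle_flow : ∀ c : ℝ, 0 ≤ c → ∀ t, 0 ≤ t → ∀ p ∈ W, ∀ w : V r,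
      quad w (hermMatrixAt n r (H t) p * ((-2 * I) • hatF n r β (H t) p))
          - c * φ p * quad w (hermMatrixAt n r (H t) p)
        ≤ quad w (velocity n r H t p (chartAt (V n) p p)) := fun c hc t ht p hp w => by
    rw [velocity_self hev ht hp]
    exact sub_le_self _ (mul_nonneg (mul_nonneg hc (hb.nonneg p hp)) (hq0 t p w))
  have hstep : ∀ τ ∈ Icc (0 : ℝ) 1, ∀ x ∈ W, ∀ v : E x, v ≠ 0 →
      logRatio (H τ) (H 0) x v ≤ c₁ * τ * φ x ∧ logRatio (H 0) (H τ) x v ≤ c₁ * τ * φ x := by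
    intro τ hτ x hx v hv
    have hexp : (0 + 2 * c * τ) * Real.exp (K * τ) * φ x ≤ c₁ * τ * φ x := by
      refine mul_le_mul_of_nonneg_right ?_ (hb.nonneg x hx)
      have : Real.exp (K * τ) ≤ Real.exp K :=
        Real.exp_le_exp.2 (mul_le_of_le_one_right hK hτ.2)
      calc (0 + 2 * c * τ) * Real.exp (K * τ) ≤ (2 * c * τ) * Real.exp K := by
            rw [zero_add]
            exact mul_le_mul_of_nonneg_left this (mul_nonneg (by positivity) hτ.1)
        _ = c₁ * τ := by rw [hc₁]; ring
    have hsub : ∀ t ∈ Icc (0 : ℝ) 1, 0 + t ∈ Icc 0 (T + 1) := fun t ht =>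
      ⟨by linarith [ht.1], by linarith [ht.2]⟩
    have hz : (0 : ℝ) ∈ Icc 0 (T + 1) := ⟨le_rfl, by linarith⟩
    have h1 := logRatio_le_of_isBarrier hW h11 hpos hK hb (hRflow 0 le_rfl 1) (hRconst 1) (C := C)
      (fun t ht => hC _ (hsub t ht) 0 hz) hc
      (fun t ht => hflow_le c hc (0 + t) (add_nonneg le_rfl ht.1))
      (fun t ht p hp w => by
        rw [hquad0]
        have := (abs_le.1 (h0 p hp w)).2
        linarith) le_rfl (fun x hx v hv => by simp [hself]) τ hτ x hx v hv
    have h2 := logRatio_le_of_isBarrier hW h11 hpos hK hb (hRconst 1) (hRflow 0 le_rfl 1) (C := C)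
      (fun t ht => hC 0 hz _ (hsub t ht)) hc
      (fun t ht p hp w => by
        rw [hquad0]
        have := (abs_le.1 (h0 p hp w)).1
        linarith)
      (fun t ht => hle_flow c hc (0 + t) (add_nonneg le_rfl ht.1))
      le_rfl (fun x hx v hv => by simp [hself]) τ hτ x hx v hv
    rw [zero_add τ] at h1 h2
    exact ⟨h1.trans hexp, h2.trans hexp⟩
  -- the flow against its translate
  set c₂ := c₁ * Real.exp (K * T) with hc₂
  have hstep2 : ∀ τ ∈ Icc (0 : ℝ) 1, ∀ t ∈ Icc 0 T, ∀ x ∈ W, ∀ v : E x, v ≠ 0 →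
      |logRatio (H (t + τ)) (H t) x v| ≤ c₂ * φ x * τ := by
    intro τ hτ t ht x hx v hv
    have hΛ : 0 ≤ c₁ * τ := mul_nonneg hc₁0 hτ.1
    have hexp : (c₁ * τ + 2 * 0 * t) * Real.exp (K * t) * φ x ≤ c₂ * φ x * τ := by
      have : Real.exp (K * t) ≤ Real.exp (K * T) :=
        Real.exp_le_exp.2 (mul_le_mul_of_nonneg_left ht.2 hK)
      calc (c₁ * τ + 2 * 0 * t) * Real.exp (K * t) * φ x
            ≤ c₁ * τ * Real.exp (K * T) * φ x := by
            rw [mul_zero, zero_mul, add_zero]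
            exact mul_le_mul_of_nonneg_right (mul_le_mul_of_nonneg_left this hΛ) (hb.nonneg x hx)
        _ = c₂ * φ x * τ := by rw [hc₂]; ring
    have hin : ∀ t ∈ Icc 0 T, 0 + t ∈ Icc 0 (T + 1) ∧ τ + t ∈ Icc 0 (T + 1) := fun t ht =>
      ⟨⟨by linarith [ht.1], by linarith [ht.2]⟩, ⟨by linarith [ht.1, hτ.1], by linarith [ht.2, hτ.2]⟩⟩
    have h1 := logRatio_le_of_isBarrier hW h11 hpos hK hb (hRflow τ hτ.1 T) (hRflow 0 le_rfl T)
      (fun t ht => hC _ (hin t ht).2 _ (hin t ht).1) le_rfl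
      (fun t ht => hflow_le 0 le_rfl (τ + t) (add_nonneg hτ.1 ht.1))
      (fun t ht => hle_flow 0 le_rfl (0 + t) (add_nonneg le_rfl ht.1)) hΛ
      (fun x hx v hv => by
        simp only [add_zero]; exact (hstep τ hτ x hx v hv).1) t ht x hx v hv
    have h2 := logRatio_le_of_isBarrier hW h11 hpos hK hb (hRflow 0 le_rfl T) (hRflow τ hτ.1 T)
      (fun t ht => hC _ (hin t ht).1 _ (hin t ht).2) le_rfl
      (fun t ht => hflow_le 0 le_rfl (0 + t) (add_nonneg le_rfl ht.1))
      (fun t ht => hle_flow 0 le_rfl (τ + t) (add_nonneg hτ.1 ht.1)) hΛ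
      (fun x hx v hv => by
        simp only [add_zero]; exact (hstep τ hτ x hx v hv).2) t ht x hx v hv
    rw [zero_add t, add_comm τ t] at h1 h2
    have h3 : logRatio (H t) (H (t + τ)) x v = -logRatio (H (t + τ)) (H t) x v := by
      rw [logRatio, logRatio, neg_sub]
    rw [h3] at h2
    rw [abs_le]
    exact ⟨by linarith, h1.trans hexp⟩
  -- the velocity at time `t` is the derivative at `τ = 0` of the logarithm of the ratio
  refine ⟨c₂, by positivity, fun t ht p hp w => ?_⟩
  rcases eq_or_ne w 0 with rfl | hw
  · simp [quad]
  have hq := quad_pos (hermMatrixAt_posDef (n := n) (r := r) (H t) p) hw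
  have hR := ((hRflow t ht.1 1).hasDeriv 0 ⟨le_rfl, zero_le_one⟩ p hp)
  have hd : HasDerivWithinAt (fun τ => Real.log (quad w (hermMatrixAt n r (H (t + τ)) p)))
      (quad w (velocity n r H t p (chartAt (V n) p p)) / quad w (hermMatrixAt n r (H t) p))
      (Ici 0) 0 := by
    have h1 := hasDerivWithinAt_quad hR w
    have h2 : HasDerivWithinAt (fun τ => quad w (hermMatrixAt n r (H (t + τ)) p))
      (quad w (velocity n r H t p (chartAt (V n) p p))) (Ici 0) 0 := by
      have h3 := h1.mono_of_mem_nhdsWithin (Icc_mem_nhdsGE one_pos)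
      rwa [add_zero] at h3
    have h3 := h2.log (by rw [add_zero]; exact hq.ne')
    rwa [add_zero] at h3
  have h4 := abs_deriv_le_of_le_mul hd (c := c₂ * φ p) fun τ h0 h1 => by
    have h5 := hstep2 τ ⟨h0.le, h1⟩ t ht p hp _ (frameVec_ne_zero (mem_baseSet p) hw)
    rw [logRatio_frameVec (n := n) _ _ (mem_chart_source _ p) (mem_baseSet p)] at h5
    rw [add_zero]
    exact h5
  rw [← velocity_self hev ht.1 hp]
  rwa [abs_div, abs_of_pos hq, div_le_iff₀ hq] at h4

end Flow

end Frames

/-! ### Estimates on matrices and on the model cylinder -/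

/-- The Hessian along complex lines of the squared modulus of a holomorphic function. -/
theorem levi_normSq {n : ℕ} {ζ : V n → ℂ} {y : V n} (hζ : ContDiffAt ℝ 2 ζ y)
    (hI : ∀ᶠ x in 𝓝 y, ∀ u, fderiv ℝ ζ x (I • u) = I * fderiv ℝ ζ x u) (b : V n) :
    levi (fun x => normSq (ζ x)) y b = 4 * normSq (fderiv ℝ ζ y b) ∧
    (fderiv ℝ (fun x => normSq (ζ x)) y b) ^ 2 + (fderiv ℝ (fun x => normSq (ζ x)) y (I • b)) ^ 2
      = 4 * normSq (ζ y) * normSq (fderiv ℝ ζ y b) := by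
  have hev : ∀ᶠ x in 𝓝 y, ContDiffAt ℝ 2 ζ x := hζ.eventually (by simp)
  have hd : ∀ x, ContDiffAt ℝ 2 ζ x → HasFDerivAt ζ (fderiv ℝ ζ x) x := fun x hx =>
    (hx.differentiableAt (by simp)).hasFDerivAt
  have hf : ∀ x, ContDiffAt ℝ 2 ζ x → ∀ u, fderiv ℝ (fun x => normSq (ζ x)) x u
      = 2 * ((ζ x).re * (fderiv ℝ ζ x u).re + (ζ x).im * (fderiv ℝ ζ x u).im) := fun x hx u => by
    have h1 : HasFDerivAt (fun x => (ζ x).re) (reCLM.comp (fderiv ℝ ζ x)) x :=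
      reCLM.hasFDerivAt.comp x (hd x hx)
    have h2 : HasFDerivAt (fun x => (ζ x).im) (imCLM.comp (fderiv ℝ ζ x)) x :=
      imCLM.hasFDerivAt.comp x (hd x hx)
    have h3 := ((h1.mul h1).add (h2.mul h2)).fderiv
    have h4 : (fun x => normSq (ζ x)) = fun x => (ζ x).re * (ζ x).re + (ζ x).im * (ζ x).im :=
      funext fun x => normSq_apply _
    rw [h4]
    refine (congrArg (fun L : V n →L[ℝ] ℝ => L u) h3).trans ?_
    simp; ring
  have hI0 := hI.self_of_nhds
  constructor
  · have hs : ∀ u, DifferentiableAt ℝ (fun x => fderiv ℝ ζ x u) y := fun u =>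
      ContDiffAt.differentiableAt_fderiv_apply hζ u
    set s : V n → V n → ℂ := fun u v => fderiv ℝ (fun x => fderiv ℝ ζ x u) y v with hsdef
    have hff : ∀ u, fderiv ℝ (fun x => fderiv ℝ (fun x => normSq (ζ x)) x u) y u
        = 2 * (normSq (fderiv ℝ ζ y u) + (ζ y).re * (s u u).re + (ζ y).im * (s u u).im) :=
      fun u => by
      have e : (fun x => fderiv ℝ (fun x => normSq (ζ x)) x u) =ᶠ[𝓝 y] fun x =>
          2 * ((ζ x).re * (fderiv ℝ ζ x u).re + (ζ x).im * (fderiv ℝ ζ x u).im) :=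
        hev.mono fun x hx => hf x hx u
      rw [e.fderiv_eq]
      have h1 : HasFDerivAt (fun x => (ζ x).re) (reCLM.comp (fderiv ℝ ζ y)) y :=
        reCLM.hasFDerivAt.comp y (hd y hζ)
      have h2 : HasFDerivAt (fun x => (ζ x).im) (imCLM.comp (fderiv ℝ ζ y)) y :=
        imCLM.hasFDerivAt.comp y (hd y hζ)
      have h3 : HasFDerivAt (fun x => (fderiv ℝ ζ x u).re)
          (reCLM.comp (fderiv ℝ (fun x => fderiv ℝ ζ x u) y)) y :=
        reCLM.hasFDerivAt.comp y (hs u).hasFDerivAt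
      have h4 : HasFDerivAt (fun x => (fderiv ℝ ζ x u).im)
          (imCLM.comp (fderiv ℝ (fun x => fderiv ℝ ζ x u) y)) y :=
        imCLM.hasFDerivAt.comp y (hs u).hasFDerivAt
      have h5 := (((h1.mul h3).add (h2.mul h4)).const_mul 2).fderiv
      refine (congrArg (fun L : V n →L[ℝ] ℝ => L u) h5).trans ?_
      simp [normSq_apply, hsdef]; ring
    -- the Hessian of a holomorphic function vanishes on complex lines
    have hsym : ∀ u v, s u v = s v u := fun u v => by
      have hc : ContDiffAt ℝ 1 (fderiv ℝ ζ) y := hζ.fderiv_right (by norm_num)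
      have hdd := (hc.differentiableAt (by simp)).hasFDerivAt
      have h1 : ∀ u v, s u v = fderiv ℝ (fderiv ℝ ζ) y v u := fun u v => by
        have := (hdd.clm_apply (hasFDerivAt_const u y)).fderiv
        refine (congrArg (fun L : V n →L[ℝ] ℂ => L v) this).trans ?_
        simp
      rw [h1, h1]
      exact (hζ.isSymmSndFDerivAt (by simp)) v u
    have hsI : ∀ u v, s (I • u) v = I * s u v := fun u v => by
      have e : (fun x => fderiv ℝ ζ x (I • u)) =ᶠ[𝓝 y] fun x => I * fderiv ℝ ζ x u :=
        hI.mono fun x hx => hx u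
      simp only [hsdef]
      rw [e.fderiv_eq]
      have := ((hs u).hasFDerivAt.const_mul I).fderiv
      refine (congrArg (fun L : V n →L[ℝ] ℂ => L v) this).trans ?_
      simp
    have h0 : s (I • b) (I • b) = - s b b := by
      rw [hsI, hsym, hsI, ← mul_assoc, I_mul_I]; ring
    change fderiv ℝ (fun x => fderiv ℝ (fun x => normSq (ζ x)) x b) y b
      + fderiv ℝ (fun x => fderiv ℝ (fun x => normSq (ζ x)) x (I • b)) y (I • b) = _
    rw [hff, hff, h0, hI0]
    simp [normSq_apply]; ring
  · rw [hf y hζ, hf y hζ, hI0]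
    simp [normSq_apply]; ring

section Pairing

variable {n : ℕ} {W : Type*} [AddCommGroup W] [Module ℂ W]

theorem pairing_submatrix {ι ι' : Type*} [Fintype ι] [DecidableEq ι] [Fintype ι'] [DecidableEq ι']
    (σ : ι ≃ ι') (Ω : Matrix ι' ι' ℝ) (F : ι' → ι' → W) :
    pairing (Ω.submatrix σ σ) (fun a a' => F (σ a) (σ a')) = pairing Ω F := by
  rw [pairing, pairing, Matrix.inv_submatrix_equiv]
  congr 1
  rw [← σ.sum_comp]
  refine Finset.sum_congr rfl fun a _ => ?_
  rw [← σ.sum_comp (fun a' => ((Ω⁻¹ (σ a) a' : ℝ) : ℂ) • F (σ a) a')]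
  rfl

variable [Module ℝ W] [IsScalarTower ℝ ℂ W]

/-- `pairing` may be computed in any real frame in which the form is nondegenerate. -/
theorem pairing_frame {ι : Type*} [Fintype ι] [DecidableEq ι] (σ : Fin n × Fin 2 ≃ ι)
    (e : ι → V n) (β : V n [⋀^Fin 2]→L[ℝ] ℝ) (he : (skew e β).det ≠ 0)
    (F : V n →ₗ[ℝ] V n →ₗ[ℝ] W) :
    pairing (skew (stdFrame n) β) (fun a a' => F (stdFrame n a) (stdFrame n a'))
      = pairing (skew e β) fun a a' => F (e a) (e a') := by
  set L : V n →ₗ[ℝ] V n := (stdBasis n).constr ℝ (e ∘ σ) with hL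
  have hLa : ∀ a, L (stdFrame n a) = e (σ a) := fun a => by
    rw [← stdBasis_apply, hL, Module.Basis.constr_basis]; rfl
  have hs : skew (fun a => L (stdFrame n a)) β = (skew e β).submatrix σ σ := by
    ext a c; simp [skew, hLa]
  have hdet : LinearMap.det L ≠ 0 := by
    intro h
    have h1 := det_skew_comp L β
    rw [hs, Matrix.det_submatrix_equiv_self, h] at h1
    apply he; rw [h1]; ring
  rw [← pairing_comp L hdet β F, hs]
  simp only [hLa]
  exact pairing_submatrix σ (skew e β) fun a a' => F (e a) (e a')

theorem norm_pairing_le {ι : Type*} [Fintype ι] [DecidableEq ι] {W : Type*}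
    [NormedAddCommGroup W] [NormedSpace ℂ W] (Ω : Matrix ι ι ℝ) (F : ι → ι → W) {C M : ℝ}
    (hC : ∀ a b, |Ω⁻¹ a b| ≤ C) (hM : ∀ a b, ‖F a b‖ ≤ M) (hC0 : 0 ≤ C) :
    ‖pairing Ω F‖ ≤ (Fintype.card ι : ℝ) ^ 2 * (C * M) := by
  rw [pairing, norm_smul]
  have h1 : ‖(-1 / 2 : ℂ)‖ ≤ 1 := by norm_num
  have h2 : ‖∑ a, ∑ a', ((Ω⁻¹ a a' : ℝ) : ℂ) • F a a'‖ ≤ ∑ _a : ι, ∑ _a' : ι, C * M := by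
    refine (norm_sum_le _ _).trans (Finset.sum_le_sum fun a _ => (norm_sum_le _ _).trans
      (Finset.sum_le_sum fun a' _ => ?_))
    rw [norm_smul, norm_real, Real.norm_eq_abs]
    exact mul_le_mul (hC a a') (hM a a') (norm_nonneg _) hC0
  simp only [Finset.sum_const, Finset.card_univ, nsmul_eq_mul] at h2
  calc _ ≤ 1 * _ := mul_le_mul h1 h2 (norm_nonneg _) zero_le_one
    _ = _ := by ring

end Pairing

theorem le_sum_sum {ι κ : Type*} [Fintype ι] [Fintype κ] {f : ι → κ → ℝ} (hf : ∀ a b, 0 ≤ f a b)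
    (a : ι) (b : κ) : f a b ≤ ∑ a, ∑ b, f a b :=
  (Finset.single_le_sum (f := f a) (fun b _ => hf a b) (Finset.mem_univ b)).trans
    (Finset.single_le_sum (f := fun a => ∑ b, f a b)
      (fun a _ => Finset.sum_nonneg fun b _ => hf a b) (Finset.mem_univ a))

/-! ### The model cylinder -/

/-- The index set of the real coordinates of a slice, followed by the two cylinder coordinates. -/
abbrev EndIdx : Type := (Fin 2 × Fin 2) ⊕ Fin 2

/-- The frame `∂_y, ∂_s, ∂_α` of the cylinder. -/
def cylFrame : EndIdx → V 2 × ℂ :=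
  Sum.elim (fun a => (stdFrame 2 a, 0)) fun i => (0, if i = 0 then 1 else I)

/-- The matrix of `ds ∧ dα` in the frame `∂_s, ∂_α`. -/
def matJ : Matrix (Fin 2) (Fin 2) ℝ := !![0, 1; -1, 0]

/-- The matrix of `κ + ds ∧ dα` in the cylinder frame. -/
def cylMat (κ : V 2 [⋀^Fin 2]→L[ℝ] ℝ) : Matrix EndIdx EndIdx ℝ :=
  Matrix.fromBlocks (skew (stdFrame 2) κ) 0 0 matJ

theorem inv_cylMat {κ : V 2 [⋀^Fin 2]→L[ℝ] ℝ} (h : (skew (stdFrame 2) κ).det ≠ 0) :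
    (cylMat κ).det ≠ 0 ∧
      (cylMat κ)⁻¹ = Matrix.fromBlocks (skew (stdFrame 2) κ)⁻¹ 0 0 (-matJ) := by
  have hJ : matJ * -matJ = 1 := by
    ext i j; fin_cases i <;> fin_cases j <;> simp [matJ, Matrix.mul_apply, Fin.sum_univ_two]
  have h1 : cylMat κ * Matrix.fromBlocks (skew (stdFrame 2) κ)⁻¹ 0 0 (-matJ) = 1 := by
    rw [cylMat, Matrix.fromBlocks_multiply, hJ, mul_nonsing_inv _ h.isUnit]
    simp [Matrix.fromBlocks_one]
  exact ⟨fun h0 => by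
    have := congrArg Matrix.det h1
    rw [det_mul, h0, zero_mul, Matrix.det_one] at this
    exact zero_ne_one this, Matrix.inv_eq_right_inv h1⟩

theorem omegaInfty_cylFrame {D : Type*} [TopologicalSpace D] [ChartedSpace (V 2) D]
    (κ : KForm (V 2) 2 D ℝ) (d : D) (q : V 2 × ℂ) (a b : EndIdx) :
    omegaInfty κ d q (cylFrame a) (cylFrame b) = cylMat (inChart d κ q.1) a b := by
  have hz1 : ∀ u : V 2, inChart d κ q.1 ![0, u] = 0 := fun u => by
    rw [← bil_apply, map_zero, LinearMap.zero_apply]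
  have hz2 : ∀ u : V 2, inChart d κ q.1 ![u, 0] = 0 := fun u => by
    rw [← bil_apply, map_zero]
  rcases a with a | i <;> rcases b with b | j
  · simp [omegaInfty, cylFrame, cylMat, skew]
  · simp [omegaInfty, cylFrame, cylMat, hz2]
  · simp [omegaInfty, cylFrame, cylMat, hz1]
  · fin_cases i <;> fin_cases j <;> simp [omegaInfty, cylFrame, cylMat, hz1, matJ]

/-- The filter of the points of the cylinder which tend to the point `y` of the slice at
infinity. -/
def endFilter (y : V 2) : Filter (V 2 × ℂ) := 𝓝 y ×ˢ comap re atTop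

/-- A smooth function equal to the identity on `(-∞, a]` and to the constant `b` on `[b, ∞)`. -/
def cutoff (a b x : ℝ) : ℝ := x + (b - x) * Real.smoothTransition ((x - a) / (b - a))

theorem contDiff_cutoff (a b : ℝ) : ContDiff ℝ ∞ (cutoff a b) := by
  have h : ContDiff ℝ ∞ fun x : ℝ => Real.smoothTransition ((x - a) / (b - a)) :=
    Real.smoothTransition.contDiff.comp ((contDiff_id.sub contDiff_const).div_const _)
  exact contDiff_id.add ((contDiff_const.sub contDiff_id).mul h)

theorem cutoff_of_le {a b x : ℝ} (hab : a < b) (hx : x ≤ a) : cutoff a b x = x := by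
  rw [cutoff, Real.smoothTransition.zero_of_nonpos
    (div_nonpos_of_nonpos_of_nonneg (by linarith) (by linarith))]
  ring

theorem cutoff_of_ge {a b x : ℝ} (hab : a < b) (hx : b ≤ x) : cutoff a b x = b := by
  rw [cutoff, Real.smoothTransition.one_of_one_le ((one_le_div (by linarith)).2 (by linarith))]
  ring

theorem min_le_cutoff {a b x : ℝ} : min x b ≤ cutoff a b x := by
  have h0 := Real.smoothTransition.nonneg ((x - a) / (b - a))
  have h1 := Real.smoothTransition.le_one ((x - a) / (b - a))
  rw [cutoff]
  rcases le_total x b with h | h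
  · rw [min_eq_left h]; nlinarith [mul_nonneg (sub_nonneg.2 h) h0]
  · rw [min_eq_right h]; nlinarith [mul_nonneg (sub_nonneg.2 h) (sub_nonneg.2 h1)]

theorem cutoff_le {a b x : ℝ} (hab : a < b) : cutoff a b x ≤ b := by
  rcases le_total x b with h | h
  · have h1 := Real.smoothTransition.le_one ((x - a) / (b - a))
    rw [cutoff]
    nlinarith [mul_nonneg (sub_nonneg.2 h) (sub_nonneg.2 h1)]
  · exact (cutoff_of_ge hab h).le

theorem pairing_conj {ι : Type*} [Fintype ι] [DecidableEq ι] {r : ℕ} (Ω : Matrix ι ι ℝ)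
    (F : ι → ι → 𝕄(r)) (P Q : 𝕄(r)) :
    pairing Ω (fun a a' => P * F a a' * Q) = P * pairing Ω F * Q := by
  rw [pairing, pairing, Matrix.mul_smul, Matrix.smul_mul, Finset.mul_sum, Finset.sum_mul]
  congr 1
  refine Finset.sum_congr rfl fun a _ => ?_
  rw [Finset.mul_sum, Finset.sum_mul]
  refine Finset.sum_congr rfl fun a' _ => ?_
  rw [Matrix.mul_smul, Matrix.smul_mul]

section Curv

variable {n r : ℕ} {G : V n → 𝕄(r)}

/-- Regularity of the curvature, evaluated on vector fields, along a map. -/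
theorem contDiffAt_curv_comp {F : Type*} [NormedAddCommGroup F] [NormedSpace ℝ F]
    {Ψ u v : F → V n} {q : F} (hG : SmoothMatAt ∞ G (Ψ q)) (hd : (G (Ψ q)).det ≠ 0)
    (hΨ : ContDiffAt ℝ 1 Ψ q) (hu : ContDiffAt ℝ 1 u q) (hv : ContDiffAt ℝ 1 v q) (a b : Fin r) :
    ContDiffAt ℝ 1 (fun q => curv G (Ψ q) (u q) (v q) a b) q := by
  choose L hL hLe using fun a b => exists_clm_conn (k := 3) (l := 2) (hG.mono (by norm_cast))
    (by norm_num) hd a b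
  have hev : ∀ᶠ q in 𝓝 q, ∀ a b, ContDiffAt ℝ 2 (L a b) (Ψ q) := by
    have : ∀ᶠ x in 𝓝 (Ψ q), ∀ a b, ContDiffAt ℝ 2 (L a b) x := by
      simp only [eventually_all]
      exact fun a b => (hL a b).eventually (by simp)
    exact hΨ.continuousAt.eventually this
  have h1 : ∀ a b, ContDiffAt ℝ 1 (fun q => L a b (Ψ q)) q := fun a b =>
    ContDiffAt.comp (f := Ψ) q ((hL a b).of_le (by norm_num)) hΨ
  have h2 : ∀ a b, ContDiffAt ℝ 1 (fun q => fderiv ℝ (L a b) (Ψ q)) q := fun a b =>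
    ContDiffAt.comp (f := Ψ) q ((hL a b).fderiv_right (m := 1) (by norm_num)) hΨ
  have h3 : ContDiffAt ℝ 1 (fun q => fderiv ℝ (L a b) (Ψ q) (u q) (v q)
      - fderiv ℝ (L a b) (Ψ q) (v q) (u q) + ∑ c, (L a c (Ψ q) (u q) * L c b (Ψ q) (v q)
        - L a c (Ψ q) (v q) * L c b (Ψ q) (u q))) q := by
    refine ((((h2 a b).clm_apply hu).clm_apply hv).sub (((h2 a b).clm_apply hv).clm_apply hu)).add
      (ContDiffAt.sum fun c _ => ?_)
    exact (((h1 a c).clm_apply hu).mul ((h1 c b).clm_apply hv)).sub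
      (((h1 a c).clm_apply hv).mul ((h1 c b).clm_apply hu))
  refine h3.congr_of_eventuallyEq ?_
  filter_upwards [hev] with q hq
  have h4 : ∀ u v, dmat (fun x => conn G x v) (Ψ q) u a b = fderiv ℝ (L a b) (Ψ q) u v :=
    fun u v => by
      have h5 : (fun x => conn G x v a b) = fun x => L a b x v := funext fun x => hLe a b x v
      have h6 := (((hq a b).differentiableAt (by simp)).hasFDerivAt.clm_apply
        (hasFDerivAt_const v (Ψ q))).fderiv
      change fderiv ℝ (fun x => conn G x v a b) (Ψ q) u = _
      rw [h5, h6]; simp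
  rw [curv_eq]
  simp only [Matrix.add_apply, Matrix.sub_apply, Matrix.mul_apply, h4, hLe,
    Finset.sum_sub_distrib]

end Curv

section Pairing

theorem pairing_apply {ι : Type*} [Fintype ι] [DecidableEq ι] {r : ℕ} (Ω : Matrix ι ι ℝ)
    (F : ι → ι → 𝕄(r)) (i j : Fin r) :
    pairing Ω F i j = pairing Ω fun a a' => F a a' i j := by
  simp only [pairing, Matrix.smul_apply, Matrix.sum_apply]

/-- Continuity of the contraction in both arguments. -/
theorem norm_pairing_sub_le {ι : Type*} [Fintype ι] [DecidableEq ι] (Ω Ω₀ : Matrix ι ι ℝ)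
    (F F₀ : ι → ι → ℂ) {C M ε δ : ℝ} (hΩ : ∀ a b, |Ω⁻¹ a b| ≤ C)
    (hΩ₀ : ∀ a b, |Ω⁻¹ a b - Ω₀⁻¹ a b| ≤ ε) (hF : ∀ a b, ‖F₀ a b‖ ≤ M)
    (hF₀ : ∀ a b, ‖F a b - F₀ a b‖ ≤ δ) (hC : 0 ≤ C) (hε : 0 ≤ ε) :
    ‖pairing Ω F - pairing Ω₀ F₀‖ ≤ (Fintype.card ι : ℝ) ^ 2 * (C * δ + ε * M) := by
  have e : pairing Ω F - pairing Ω₀ F₀ = (-1 / 2 : ℂ) • ∑ a, ∑ a',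
      (((Ω⁻¹ a a' : ℝ) : ℂ) * (F a a' - F₀ a a')
        + ((Ω⁻¹ a a' - Ω₀⁻¹ a a' : ℝ) : ℂ) * F₀ a a') := by
    rw [pairing, pairing, ← smul_sub, ← Finset.sum_sub_distrib]
    congr 1
    refine Finset.sum_congr rfl fun a _ => ?_
    rw [← Finset.sum_sub_distrib]
    refine Finset.sum_congr rfl fun a' _ => ?_
    push_cast; simp only [smul_eq_mul]; ring
  rw [e, norm_smul]
  have h1 : ‖(-1 / 2 : ℂ)‖ ≤ 1 := by norm_num
  have h2 : ‖∑ a, ∑ a', (((Ω⁻¹ a a' : ℝ) : ℂ) * (F a a' - F₀ a a')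
      + ((Ω⁻¹ a a' - Ω₀⁻¹ a a' : ℝ) : ℂ) * F₀ a a')‖
      ≤ ∑ _a : ι, ∑ _a' : ι, (C * δ + ε * M) := by
    refine (norm_sum_le _ _).trans (Finset.sum_le_sum fun a _ => ?_)
    refine (norm_sum_le _ _).trans (Finset.sum_le_sum fun a' _ => ?_)
    refine (norm_add_le _ _).trans (add_le_add ?_ ?_)
    · rw [norm_mul, norm_real, Real.norm_eq_abs]
      exact mul_le_mul (hΩ _ _) (hF₀ _ _) (norm_nonneg _) hC
    · rw [norm_mul, norm_real, Real.norm_eq_abs]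
      exact mul_le_mul (hΩ₀ _ _) (hF _ _) (norm_nonneg _) hε
  refine (mul_le_of_le_one_left (norm_nonneg _) h1).trans (h2.trans (le_of_eq ?_))
  simp only [Finset.sum_const, Finset.card_univ, nsmul_eq_mul]; ring

/-- On the cylinder, a form vanishing on `∂_s` and `∂_α` is contracted as on the cross-section. -/
theorem pairing_cylMat {W : Type*} [AddCommGroup W] [Module ℂ W] {κ : V 2 [⋀^Fin 2]→L[ℝ] ℝ}
    (h : (skew (stdFrame 2) κ).det ≠ 0) (F : EndIdx → EndIdx → W)
    (h1 : ∀ i a, F (Sum.inr i) a = 0) :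
    pairing (cylMat κ) F
      = pairing (skew (stdFrame 2) κ) fun a a' => F (Sum.inl a) (Sum.inl a') := by
  rw [pairing, pairing, (inv_cylMat h).2]
  congr 1
  rw [Fintype.sum_sum_type]
  simp only [h1, smul_zero, Finset.sum_const_zero, add_zero, Fintype.sum_sum_type,
    Matrix.fromBlocks_apply₁₁, Matrix.fromBlocks_apply₁₂, Matrix.zero_apply, ofReal_zero,
    zero_smul]

end Pairing

/-! ### The Riemannian volume -/

theorem abs_det_matI (m : ℕ) : |(matI m).det| = 1 := by
  have h := congrArg Matrix.det (matI_mul_matI (n := m))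
  rw [det_mul, Matrix.det_neg, Matrix.det_one, mul_one, Fintype.card_prod,
    Fintype.card_fin, Fintype.card_fin, pow_mul'] at h
  rw [← sq, neg_one_sq, one_pow] at h
  rcases sq_eq_one_iff.1 h with h | h <;> simp [h]

theorem measurableSet_inter_preimage {α β : Type*} [TopologicalSpace α] [MeasurableSpace α]
    [OpensMeasurableSpace α] [TopologicalSpace β] [MeasurableSpace β] [BorelSpace β] {P : α → β}
    {S : Set α} (hS : MeasurableSet S) (hP : ContinuousOn P S) {B : Set β} (hB : MeasurableSet B) :
    MeasurableSet (S ∩ P ⁻¹' B) := by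
  have h := hS.subtype_image ((continuousOn_iff_continuous_domRestrict.1 hP).measurable hB)
  convert h using 1
  ext x
  simp only [mem_inter_iff, mem_preimage, mem_image, Subtype.exists, exists_and_right,
    exists_eq_right]
  exact ⟨fun h => ⟨h.1, h.2⟩, fun ⟨h1, h2⟩ => ⟨h1, h2⟩⟩

section Volume

variable {n : ℕ} {X : Type*} [TopologicalSpace X] [ChartedSpace (V n) X] [MeasurableSpace X]
  [BorelSpace X]

/-- The Riemannian measure in the chart at `p`. -/
def chartMeasure (U : Set X) (β : KForm (V n) 2 X ℝ) (p : X) : Measure X :=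
  Measure.map (chartAt (V n) p).symm
    ((volume.restrict ((chartAt (V n) p).target ∩ (chartAt (V n) p).symm ⁻¹' U)).withDensity
      fun y => ENNReal.ofReal (Real.sqrt (gram (stdFrame n) (inChart p β y)).det))

theorem chartMeasure_apply {U : Set X} (hU : IsOpen U) (β : KForm (V n) 2 X ℝ) (p : X) {B : Set X}
    (hB : MeasurableSet B) : chartMeasure U β p B
      = ∫⁻ y in (chartAt (V n) p).symm ⁻¹' B ∩ ((chartAt (V n) p).target
        ∩ (chartAt (V n) p).symm ⁻¹' U),
        ENNReal.ofReal (Real.sqrt (gram (stdFrame n) (inChart p β y)).det) := by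
  have hT : IsOpen ((chartAt (V n) p).target ∩ (chartAt (V n) p).symm ⁻¹' U) :=
    (chartAt (V n) p).isOpen_inter_preimage_symm hU
  have hm : AEMeasurable (chartAt (V n) p).symm
      ((volume.restrict ((chartAt (V n) p).target ∩ (chartAt (V n) p).symm ⁻¹' U)).withDensity
      fun y => ENNReal.ofReal (Real.sqrt (gram (stdFrame n) (inChart p β y)).det)) :=
    (((chartAt (V n) p).continuousOn_symm.mono inter_subset_left).aemeasurable
      hT.measurableSet).mono_ac (withDensity_absolutelyContinuous _ _)
  rw [chartMeasure, Measure.map_apply_of_aemeasurable hm hB, withDensity_apply',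
    Measure.restrict_restrict' hT.measurableSet]

/-- The Riemannian measure of a set, bounded in a parametrisation. -/
theorem chartMeasure_le {U : Set X} (hU : IsOpen U) {β : KForm (V n) 2 X ℝ} {p : X}
    {P : V n → X} {S : Set (V n)} (hS : MeasurableSet S) (hPc : ContinuousOn P S)
    (hinj : InjOn P S) {c : ℝ}
    (hP : ∀ y ∈ S, P y ∈ (chartAt (V n) p).source → ∃ D' : V n →L[ℝ] V n,
      HasFDerivAt (fun y => chartAt (V n) p (P y)) D' y ∧
      |(skew (fun a => D' (stdFrame n a)) (inChart p β (chartAt (V n) p (P y)))).det| ≤ c)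
    {B : Set X} (hB : MeasurableSet B) (hBS : B ∩ U ⊆ P '' S) :
    chartMeasure U β p B ≤ ENNReal.ofReal (Real.sqrt c) * volume (S ∩ P ⁻¹' B) := by
  set ψ := chartAt (V n) p
  set S' := S ∩ P ⁻¹' (B ∩ (U ∩ ψ.source))
  have hS'm : MeasurableSet S' := measurableSet_inter_preimage hS hPc
    (hB.inter (hU.inter ψ.open_source).measurableSet)
  have himg : ψ.symm ⁻¹' B ∩ (ψ.target ∩ ψ.symm ⁻¹' U) = (fun y => ψ (P y)) '' S' := by
    ext y
    constructor
    · rintro ⟨h1, h2, h3⟩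
      obtain ⟨x, hx, hxy⟩ := hBS ⟨h1, h3⟩
      refine ⟨x, ⟨hx, ?_⟩, ?_⟩
      · rw [mem_preimage, hxy]; exact ⟨h1, h3, ψ.map_target h2⟩
      · dsimp only; rw [hxy, ψ.right_inv h2]
    · rintro ⟨x, ⟨hx, h1, h2, h3⟩, rfl⟩
      refine ⟨?_, ψ.map_source h3, ?_⟩
      · rw [mem_preimage, ψ.left_inv h3]; exact h1
      · rw [mem_preimage, ψ.left_inv h3]; exact h2
  have hD : ∀ y, ∃ D' : V n →L[ℝ] V n, y ∈ S' → HasFDerivAt (fun y => ψ (P y)) D' y ∧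
      |(skew (fun a => D' (stdFrame n a)) (inChart p β (ψ (P y)))).det| ≤ c := fun y => by
    by_cases hy : y ∈ S'
    · obtain ⟨D', h⟩ := hP y hy.1 hy.2.2.2
      exact ⟨D', fun _ => h⟩
    · exact ⟨0, fun h => absurd h hy⟩
  choose D' hD' using hD
  have hinj' : InjOn (fun y => ψ (P y)) S' := fun y hy y' hy' h =>
    hinj hy.1 hy'.1 (ψ.injOn hy.2.2.2 hy'.2.2.2 h)
  rw [chartMeasure_apply hU β p hB, himg, lintegral_image_eq_lintegral_abs_det_fderiv_mul volume
    hS'm (fun y hy => (hD' y hy).1.hasFDerivWithinAt) hinj']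
  calc _ ≤ ∫⁻ _y in S', ENNReal.ofReal (Real.sqrt c) := by
        refine setLIntegral_mono' hS'm fun y hy => ?_
        rw [← ENNReal.ofReal_mul (abs_nonneg _)]
        refine ENNReal.ofReal_le_ofReal ?_
        rw [← Real.sqrt_sq (abs_nonneg (D' y).det), ← Real.sqrt_mul (sq_nonneg _)]
        refine Real.sqrt_le_sqrt (le_trans ?_ (hD' y hy).2)
        have h1 : (gram (stdFrame n) (inChart p β (ψ (P y)))).det
            = (skew (stdFrame n) (inChart p β (ψ (P y)))).det * (matI n).det := by
          rw [stdFrame, gram_realFrame, det_mul]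
        have h2 := det_skew_comp (D' y : V n →ₗ[ℝ] V n) (inChart p β (ψ (P y)))
        have h3 : (D' y).det = LinearMap.det (D' y : V n →ₗ[ℝ] V n) := rfl
        rw [h1, sq_abs, h3, ← mul_assoc]
        refine (le_abs_self _).trans (le_of_eq ?_)
        rw [abs_mul, abs_det_matI, mul_one]
        exact congrArg abs h2.symm
    _ = ENNReal.ofReal (Real.sqrt c) * volume S' := by rw [setLIntegral_const]
    _ ≤ _ := by
        gcongr
        exact fun y hy => ⟨hy.1, hy.2.1⟩

/-- Finiteness of an integral, from local parametrisations. -/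
theorem exists_volumeMeasure_le [CompactSpace X] {U : Set X} {β : KForm (V n) 2 X ℝ}
    {g : X → ENNReal}
    (h : ∀ x : X, ∃ N : Set X, IsOpen N ∧ x ∈ N ∧ ∃ ν : Measure X, ∫⁻ x, g x ∂ν ≠ ⊤ ∧ ν Uᶜ = 0 ∧
      ∀ p : X, ∀ B ⊆ N, MeasurableSet B → chartMeasure U β p B ≤ ν B) :
    ∫⁻ x, g x ∂(volumeMeasure U β) ≠ ⊤ ∧ volumeMeasure U β Uᶜ = 0 := by
  choose N hN hxN ν hg hU hle using h
  obtain ⟨t, ht⟩ := isCompact_univ.elim_nhds_subcover N fun x _ => (hN x).mem_nhds (hxN x)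
  have hvol : volumeMeasure U β ≤ ∑ x ∈ t, ν x := by
    refine iSup_le fun p => ?_
    refine Measure.le_iff.2 fun B hB => ?_
    change chartMeasure U β p B ≤ _
    have h1 : B ⊆ ⋃ x ∈ t, B ∩ N x := fun b hb => by
      obtain ⟨x, hx, hbx⟩ := mem_iUnion₂.1 (ht.2 (mem_univ b))
      exact mem_iUnion₂.2 ⟨x, hx, hb, hbx⟩
    calc chartMeasure U β p B ≤ chartMeasure U β p (⋃ x ∈ t, B ∩ N x) := measure_mono h1
      _ ≤ ∑ x ∈ t, chartMeasure U β p (B ∩ N x) := measure_biUnion_finset_le _ _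
      _ ≤ ∑ x ∈ t, ν x B := Finset.sum_le_sum fun x _ =>
          (hle x p _ inter_subset_right (hB.inter (hN x).measurableSet)).trans
            (measure_mono inter_subset_left)
      _ = _ := by rw [Measure.finsetSum_apply]
  refine ⟨ne_top_of_le_ne_top ?_ (lintegral_mono' hvol le_rfl), le_antisymm ((hvol _).trans ?_)
    zero_le⟩
  · rw [lintegral_finsetSum_measure]
    exact ENNReal.sum_ne_top.2 fun x _ => hg x
  · rw [Measure.finsetSum_apply]
    exact (Finset.sum_eq_zero fun x _ => hU x).le

end Volume

/-! ### The volume of the cylindrical end -/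

theorem skew_coordChange {n : ℕ} {X : Type*} [TopologicalSpace X] [ChartedSpace (V n) X]
    [IsManifold 𝓘(ℂ, V n) ω X] {β : KForm (V n) 2 X ℝ} {p q : X} {y : V n}
    (hy : y ∈ overlap p q) :
    skew (fun a => fderiv ℝ (coordChange p q) y (stdFrame n a)) (inChart q β (coordChange p q y))
      = skew (stdFrame n) (inChart p β y) := by
  have hY := coordChange_mem_overlap hy
  have e : (chartAt (V n) q).symm (coordChange p q y) = (chartAt (V n) p).symm y :=
    (chartAt (V n) q).left_inv hy.2
  set p' := (chartAt (V n) p).symm y with hp'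
  have hov : coordChange p q y ∈ overlap q p' := by
    have := overlap_self hY.1
    rwa [e] at this
  have h1 := ((contDiffAt_coordChange hy).differentiableAt (by simp)).hasFDerivAt
  have h2 := ((contDiffAt_coordChange hov).differentiableAt (by simp)).hasFDerivAt
  have h3 := (h2.comp y h1).congr_of_eventuallyEq (f₁ := coordChange p p') (by
    filter_upwards [(isOpen_overlap p q).mem_nhds hy] with x hx
    rw [Function.comp_apply]
    simp only [coordChange]
    rw [(chartAt (V n) q).left_inv hx.2])
  ext a b
  rw [skew, skew, of_apply, of_apply, inChart_pair hY.1, inChart_pair hy.1, e,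
    ← hp', h3.fderiv]
  rfl

/-- The splitting `ℂ³ = ℂ² × ℂ`. -/
def endSplit : V 3 →L[ℝ] V 2 × ℂ :=
  (ContinuousLinearMap.pi fun j : Fin 2 => ContinuousLinearMap.proj j.castSucc).prod
    (ContinuousLinearMap.proj (Fin.last 2))

theorem endSplit_apply (v : V 3) : endSplit v = (fun j : Fin 2 => v j.castSucc, v (Fin.last 2)) := rfl

theorem endSplit_bijective : Function.Bijective endSplit := by
  constructor
  · intro u v h
    rw [endSplit_apply, endSplit_apply, Prod.mk.injEq] at h
    ext i
    exact Fin.lastCases h.2 (fun j => congrFun h.1 j) i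
  · rintro ⟨y, ζ⟩
    refine ⟨Fin.snoc (α := fun _ => ℂ) y ζ, ?_⟩
    rw [endSplit_apply]
    exact Prod.ext (funext fun j => Fin.snoc_castSucc (α := fun _ => ℂ) ζ y j)
      (Fin.snoc_last (α := fun _ => ℂ) ζ y)

/-- The identification of the index sets of the standard frame and of the cylinder frame. -/
def endIdx (a : Fin 3 × Fin 2) : EndIdx :=
  Fin.lastCases (motive := fun _ => EndIdx) (Sum.inr a.2) (fun j : Fin 2 => Sum.inl (j, a.2)) a.1

theorem endIdx_bijective : Function.Bijective endIdx := by decide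

theorem endSplit_stdFrame (a : Fin 3 × Fin 2) : endSplit (stdFrame 3 a) = cylFrame (endIdx a) := by
  rw [endSplit_apply]
  obtain ⟨i, k⟩ := a
  refine Fin.lastCases ?_ (fun j => ?_) i
  · have h0 : ∀ j : Fin 2, (j.castSucc : Fin 3) ≠ Fin.last 2 := fun j => (Fin.castSucc_lt_last j).ne
    simp only [endIdx, Fin.lastCases_last, cylFrame, Sum.elim_inr, stdFrame, realFrame]
    refine Prod.ext ?_ ?_
    · funext j
      split_ifs
      · exact Pi.single_eq_of_ne (h0 j) _
      · dsimp only
        rw [Pi.smul_apply, Pi.single_eq_of_ne (h0 j), smul_zero]; rfl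
    · split_ifs <;> simp
  · have h0 : ∀ j : Fin 2, Fin.last 2 ≠ (j.castSucc : Fin 3) :=
      fun j => (Fin.castSucc_lt_last j).ne'
    simp only [endIdx, Fin.lastCases_castSucc, cylFrame, Sum.elim_inl, stdFrame, realFrame]
    refine Prod.ext ?_ ?_
    · funext l; split_ifs <;> simp [Pi.single_apply, Fin.castSucc_inj]
    · split_ifs
      · exact Pi.single_eq_of_ne (h0 j) _
      · dsimp only
        rw [Pi.smul_apply, Pi.single_eq_of_ne (h0 j), smul_zero]

/-- The function `e^{-δ Re ζ}` is integrable over one turn of the half-cylinder `Re ζ > s₀`. -/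
theorem integrable_exp_strip {δ : ℝ} (hδ : 0 < δ) (s₀ : ℝ) :
    Integrable (fun ζ : ℂ => (Ioi s₀).indicator (fun x => Real.exp (-δ * x)) ζ.re
      * (Icc (-Real.pi) Real.pi).indicator (fun _ => (1 : ℝ)) ζ.im) := by
  have h1 : Integrable ((Ioi s₀).indicator fun x => Real.exp (-δ * x)) :=
    (integrable_indicator_iff measurableSet_Ioi).2 (exp_neg_integrableOn_Ioi s₀ hδ)
  have h2 : Integrable ((Icc (-Real.pi) Real.pi).indicator fun _ => (1 : ℝ)) :=
    (integrable_indicator_iff measurableSet_Icc).2 (by simp)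
  exact (Complex.volume_preserving_equiv_real_prod.integrable_comp_emb
    Complex.measurableEquivRealProd.measurableEmbedding).2 (h1.mul_prod h2)

/-- The domain of the coordinates on the end: `y` in a ball, `s > s₀` and one turn of `α`. -/
def endDomain (x : V 2) (R s₀ : ℝ) : Set (V 3) :=
  {v | (endSplit v).1 ∈ Metric.ball x R ∧ s₀ < (endSplit v).2.re ∧
      (-(endSplit v).2).im ∈ Ioc (-Real.pi) Real.pi}

theorem measurableSet_endDomain (x : V 2) (R s₀ : ℝ) : MeasurableSet (endDomain x R s₀) := by
  have h1 : Continuous fun v => (endSplit v).1 := endSplit.continuous.fst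
  have h2 : Continuous fun v => (endSplit v).2.re := continuous_re.comp endSplit.continuous.snd
  have h3 : Continuous fun v => (-(endSplit v).2).im :=
    continuous_im.comp endSplit.continuous.snd.neg
  exact (h1.measurable Metric.isOpen_ball.measurableSet).inter
    ((h2.measurable measurableSet_Ioi).inter (h3.measurable measurableSet_Ioc))

/-- The previous integral, multiplied by that over a ball of a chart of `D`, by Fubini. -/
theorem lintegral_endDomain_ne_top {δ : ℝ} (hδ : 0 < δ) (x : V 2) (R s₀ : ℝ) :
    ∫⁻ v in endDomain x R s₀, ENNReal.ofReal (Real.exp (-δ * (endSplit v).2.re)) ≠ ⊤ := by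
  set f : Fin 3 → ℂ → ℝ := Fin.lastCases (motive := fun _ => ℂ → ℝ)
    (fun ζ : ℂ => (Ioi s₀).indicator (fun x => Real.exp (-δ * x)) ζ.re
      * (Icc (-Real.pi) Real.pi).indicator (fun _ => (1 : ℝ)) ζ.im)
    (fun j : Fin 2 => (Metric.ball (x j) R).indicator fun _ => (1 : ℝ)) with hf
  have hfi : ∀ i, Integrable (f i) volume := fun i => by
    refine Fin.lastCases ?_ (fun j => ?_) i
    · simp only [hf, Fin.lastCases_last]; exact integrable_exp_strip hδ s₀
    · simp only [hf, Fin.lastCases_castSucc]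
      exact (integrable_indicator_iff measurableSet_ball).2
        ((integrableOn_const_iff (by simp)).2 (Or.inr measure_ball_lt_top))
  have hint : Integrable (fun v : V 3 => ∏ i, f i (v i)) volume := Integrable.fintype_prod hfi
  refine ne_top_of_le_ne_top hint.lintegral_lt_top.ne
    (le_trans (setLIntegral_mono_ae hint.aemeasurable.ennreal_ofReal.restrict
      (ae_of_all _ fun v hv => ENNReal.ofReal_le_ofReal ?_)) (setLIntegral_le_lintegral _ _))
  obtain ⟨h1, h2, h3⟩ := hv
  have hR : ∀ j : Fin 2, v j.castSucc ∈ Metric.ball (x j) R := fun j =>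
    (dist_le_pi_dist (endSplit v).1 x j).trans_lt h1
  have him : (v (Fin.last 2)).im ∈ Icc (-Real.pi) Real.pi := by
    have h3' : -(v (Fin.last 2)).im ∈ Ioc (-Real.pi) Real.pi := h3
    exact ⟨by linarith [h3'.2], by linarith [h3'.1]⟩
  have h2' : (v (Fin.last 2)).re ∈ Ioi s₀ := h2
  rw [Fin.prod_univ_castSucc]
  simp only [hf, Fin.lastCases_castSucc, Fin.lastCases_last, indicator_of_mem (hR _),
    indicator_of_mem him, indicator_of_mem h2', Finset.prod_const_one, one_mul, mul_one]
  exact le_rfl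

/-- A parametrisation of a neighbourhood bounds the Riemannian measure there. -/
theorem exists_measure_of_parametrisation {n : ℕ} {X : Type*} [TopologicalSpace X]
    [ChartedSpace (V n) X] [MeasurableSpace X] [BorelSpace X] {U : Set X} (hU : IsOpen U)
    {β : KForm (V n) 2 X ℝ} {P : V n → X} {S : Set (V n)} (hS : MeasurableSet S)
    (hPc : ContinuousOn P S) (hinj : InjOn P S) {c : ℝ}
    (hP : ∀ p, ∀ y ∈ S, P y ∈ (chartAt (V n) p).source → ∃ D' : V n →L[ℝ] V n,
      HasFDerivAt (fun y => chartAt (V n) p (P y)) D' y ∧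
      |(skew (fun a => D' (stdFrame n a)) (inChart p β (chartAt (V n) p (P y)))).det| ≤ c)
    (hSU : ∀ y ∈ S, P y ∈ U) {N : Set X} (hN : N ∩ U ⊆ P '' S) {g : X → ENNReal}
    (hg : Measurable g) (hgi : ∫⁻ y in S, g (P y) ≠ ⊤) :
    ∃ ν : Measure X, ∫⁻ x, g x ∂ν ≠ ⊤ ∧ ν Uᶜ = 0 ∧
      ∀ p : X, ∀ B ⊆ N, MeasurableSet B → chartMeasure U β p B ≤ ν B := by
  have hPm : AEMeasurable P (volume.restrict S) := hPc.aemeasurable hS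
  have hν : ∀ B, MeasurableSet B → (ENNReal.ofReal (Real.sqrt c) • Measure.map P
      (volume.restrict S)) B = ENNReal.ofReal (Real.sqrt c) * volume (S ∩ P ⁻¹' B) :=
    fun B hB => by
      rw [Measure.smul_apply, smul_eq_mul, Measure.map_apply_of_aemeasurable hPm hB,
        Measure.restrict_apply' hS, inter_comm]
  refine ⟨ENNReal.ofReal (Real.sqrt c) • Measure.map P (volume.restrict S), ?_, ?_, ?_⟩
  · rw [lintegral_smul_measure, lintegral_map' hg.aemeasurable hPm]
    exact ENNReal.mul_ne_top ENNReal.ofReal_ne_top hgi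
  · rw [hν _ hU.measurableSet.compl]
    have : S ∩ P ⁻¹' Uᶜ = ∅ := eq_empty_of_forall_notMem fun y hy => hy.2 (hSU y hy.1)
    rw [this, measure_empty, mul_zero]
  · intro p B hBN hB
    rw [hν B hB]
    exact chartMeasure_le hU hS hPc hinj (hP p) hB fun b hb => hN ⟨hBN hb.1, hb.2⟩

/-! ### The tubular neighbourhood and the coordinate `z` -/

namespace ACylCalabiYau

variable {X D : Type*} [TopologicalSpace X] [ChartedSpace (V 3) X]
  [IsManifold 𝓘(ℂ, V 3) ω X]
  [TopologicalSpace D] [ChartedSpace (V 2) D]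
  [IsManifold 𝓘(ℂ, V 2) ω D]
  (A : ACylCalabiYau X D)

/-- The tubular neighbourhood in the coordinates of the chart of the divisor at `d`. -/
def tubeMap (d : D) (q : V 2 × ℂ) : X := A.tube ((chartAt (V 2) d).symm q.1, q.2)

/-- The domain of `tubeMap`. -/
def tubeDom (d : D) : Set (V 2 × ℂ) := (chartAt (V 2) d).target ×ˢ Metric.ball 0 1

/-- The image of the tubular neighbourhood. -/
def nbhd : Set X := A.tube '' (univ ×ˢ Metric.ball 0 1)

theorem isOpen_tubeDom (d : D) : IsOpen (tubeDom d) :=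
  (chartAt (V 2) d).open_target.prod Metric.isOpen_ball

theorem contMDiffOn_tubeMap (d : D) :
    ContMDiffOn 𝓘(ℝ, V 2 × ℂ) 𝓘(ℝ, V 3) ∞
      (A.tubeMap d) (tubeDom d) := by
  have : IsManifold 𝓘(ℝ, V 2) ∞ D := isManifold_real
  have h1 : ContMDiffOn 𝓘(ℝ, V 2 × ℂ) 𝓘(ℝ, V 2) ∞
      (fun q : V 2 × ℂ => (chartAt (V 2) d).symm q.1) (tubeDom d) :=
    (contMDiffOn_chart_symm (I := 𝓘(ℝ, V 2)) (n := ∞) (x := d)).comp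
      (contDiff_fst.contMDiff.contMDiffOn) fun q hq => hq.1
  have h2 : ContMDiffOn 𝓘(ℝ, V 2 × ℂ) 𝓘(ℝ, ℂ) ∞
      (fun q : V 2 × ℂ => q.2) (tubeDom d) := contDiff_snd.contMDiff.contMDiffOn
  exact A.tube_smooth.comp (h1.prodMk h2) fun q hq => ⟨mem_univ _, hq.2⟩

theorem continuousAt_tubeMap {d : D} {q : V 2 × ℂ} (hq : q ∈ tubeDom d) :
    ContinuousAt (A.tubeMap d) q :=
  (A.contMDiffOn_tubeMap d).continuousOn.continuousAt ((isOpen_tubeDom d).mem_nhds hq)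

theorem contDiffAt_chart_tubeMap {d : D} {q : V 2 × ℂ} (hq : q ∈ tubeDom d) {p : X}
    (hp : A.tubeMap d q ∈ (chartAt (V 3) p).source) :
    ContDiffAt ℝ ∞ (fun q => chartAt (V 3) p (A.tubeMap d q)) q := by
  have : IsManifold 𝓘(ℝ, V 3) ∞ X := isManifold_real
  rw [← contMDiffAt_iff_contDiffAt]
  have h1 := (contMDiffOn_chart (I := 𝓘(ℝ, V 3)) (n := ∞) (x := p)).contMDiffAt
    ((chartAt (V 3) p).open_source.mem_nhds hp)
  exact h1.comp q ((A.contMDiffOn_tubeMap d).contMDiffAt ((isOpen_tubeDom d).mem_nhds hq))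

theorem z_tubeMap {d : D} {q : V 2 × ℂ} (hq : q ∈ tubeDom d) : A.z (A.tubeMap d q) = q.2 :=
  A.z_tube _ _ hq.2

theorem tubeMap_mem_nbhd {d : D} {q : V 2 × ℂ} (hq : q ∈ tubeDom d) :
    A.tubeMap d q ∈ A.nbhd := ⟨_, ⟨mem_univ _, hq.2⟩, rfl⟩

theorem chart_mem_tubeDom (x : D) {w : ℂ} (hw : w ∈ Metric.ball (0 : ℂ) 1) :
    (chartAt (V 2) x x, w) ∈ tubeDom x := ⟨mem_chart_target _ x, hw⟩

theorem tubeMap_chart (d x : D) (hx : x ∈ (chartAt (V 2) d).source) (w : ℂ) :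
    A.tubeMap d (chartAt (V 2) d x, w) = A.tube (x, w) := by
  rw [tubeMap, (chartAt (V 2) d).left_inv hx]

theorem exists_tubeMap_eq {p : X} (hp : p ∈ A.nbhd) :
    ∃ x : D, ∃ w ∈ Metric.ball (0 : ℂ) 1, A.tubeMap x (chartAt (V 2) x x, w) = p := by
  obtain ⟨⟨x, w⟩, ⟨-, hw⟩, rfl⟩ := hp
  exact ⟨x, w, hw, A.tubeMap_chart x x (mem_chart_source _ x) w⟩

theorem mfderiv_tube_eq (x : D) {w : ℂ} (hw : w ∈ Metric.ball (0 : ℂ) 1) :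
    (mfderiv (𝓘(ℝ, V 2).prod 𝓘(ℝ, ℂ))
      𝓘(ℝ, V 3) A.tube (x, w) : V 2 × ℂ →L[ℝ] V 3)
      = fderiv ℝ (fun q => chartAt (V 3) (A.tube (x, w)) (A.tubeMap x q))
        (chartAt (V 2) x x, w) := by
  have ho : IsOpen ((univ : Set D) ×ˢ Metric.ball (0 : ℂ) 1) := isOpen_univ.prod Metric.isOpen_ball
  have h : MDifferentiableAt (𝓘(ℝ, V 2).prod 𝓘(ℝ, ℂ))
      𝓘(ℝ, V 3) A.tube (x, w) :=
    (A.tube_smooth.contMDiffAt (ho.mem_nhds ⟨mem_univ _, hw⟩)).mdifferentiableAt (by simp)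
  rw [h.mfderiv]
  have e : range (𝓘(ℝ, V 2).prod 𝓘(ℝ, ℂ)) = univ := by
    rw [modelWithCorners_prod_coe]; simp
  rw [e, fderivWithin_univ]
  rfl

theorem injective_fderiv_tubeMap {d : D} {q : V 2 × ℂ} (hq : q ∈ tubeDom d) {p : X}
    (hp : A.tubeMap d q ∈ (chartAt (V 3) p).source) :
    Function.Injective (fderiv ℝ (fun q => chartAt (V 3) p (A.tubeMap d q)) q) := by
  obtain ⟨y, w⟩ := q
  set x := (chartAt (V 2) d).symm y
  have hov : y ∈ overlap d x := ⟨hq.1, mem_chart_source _ _⟩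
  have hq' : (chartAt (V 2) x x, w) ∈ tubeDom x := chart_mem_tubeDom x hq.2
  have hpt : A.tubeMap x (chartAt (V 2) x x, w) = A.tube (x, w) :=
    A.tubeMap_chart x x (mem_chart_source _ x) w
  have hinj := A.tube_immersion (x, w) ⟨mem_univ _, hq.2⟩
  have hinj' : Function.Injective (fderiv ℝ (fun q => chartAt (V 3) (A.tube (x, w))
      (A.tubeMap x q)) (chartAt (V 2) x x, w)) := by
    rw [← A.mfderiv_tube_eq x hq.2]; exact hinj
  -- change of chart on the divisor
  set θ : V 2 × ℂ → V 2 × ℂ := Prod.map (coordChange d x) id with hθ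
  have hθd : HasFDerivAt θ ((fderiv ℝ (coordChange d x) y).prodMap (ContinuousLinearMap.id ℝ ℂ))
      (y, w) :=
    HasFDerivAt.prodMap (y, w)
      ((contDiffAt_coordChange hov).differentiableAt (by simp)).hasFDerivAt (hasFDerivAt_id w)
  have hθq : θ (y, w) = (chartAt (V 2) x x, w) := rfl
  have hd1 : HasFDerivAt (fun q => chartAt (V 3) (A.tube (x, w)) (A.tubeMap d q))
      ((fderiv ℝ (fun q => chartAt (V 3) (A.tube (x, w)) (A.tubeMap x q))
        (chartAt (V 2) x x, w)).comp ((fderiv ℝ (coordChange d x) y).prodMap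
          (ContinuousLinearMap.id ℝ ℂ))) (y, w) := by
    have h1 := ((A.contDiffAt_chart_tubeMap hq' (p := A.tube (x, w))
      (by rw [hpt]; exact mem_chart_source _ _)).differentiableAt (by simp)).hasFDerivAt
    rw [← hθq] at h1
    refine (h1.comp (y, w) hθd).congr_of_eventuallyEq ?_
    filter_upwards [((isOpen_overlap d x).prod isOpen_univ).mem_nhds
      (⟨hov, mem_univ _⟩ : (y, w) ∈ overlap d x ×ˢ univ)] with q' hq'
    simp only [Function.comp_apply, hθ, Prod.map, tubeMap, id, coordChange]
    rw [(chartAt (V 2) x).left_inv hq'.1.2]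
  have h2 := fderiv_chart_eq (A.continuousAt_tubeMap hq) (p := A.tube (x, w))
    (mem_chart_source _ _) hd1.differentiableAt p hp
  rw [h2, hd1.fderiv]
  refine Function.Injective.comp (g := fderiv ℝ (coordChange (A.tube (x, w)) p) _) ?_
    (hinj'.comp ?_)
  · have hm : chartAt (V 3) (A.tube (x, w)) (A.tube (x, w)) ∈ overlap (A.tube (x, w)) p :=
      ⟨mem_chart_target _ _, by
        rw [mem_preimage, (chartAt (V 3) _).left_inv (mem_chart_source _ _)]; exact hp⟩
    exact (injective_iff_map_eq_zero _).2 fun u hu =>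
      (fderiv_coordChange_eq_zero_iff hm u).1 hu
  · refine (injective_iff_map_eq_zero ((fderiv ℝ (coordChange d x) y).prodMap
      (ContinuousLinearMap.id ℝ ℂ))).2 fun u hu => ?_
    have h3 := congrArg Prod.fst hu
    have h4 := congrArg Prod.snd hu
    exact Prod.ext ((fderiv_coordChange_eq_zero_iff hov u.1).1 h3) h4

/-- The derivative of the tubular neighbourhood in charts, as an isomorphism. -/
theorem exists_equiv_fderiv_tubeMap {d : D} {q : V 2 × ℂ} (hq : q ∈ tubeDom d) {p : X}
    (hp : A.tubeMap d q ∈ (chartAt (V 3) p).source) :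
    ∃ e : (V 2 × ℂ) ≃L[ℝ] V 3,
      (e : V 2 × ℂ →L[ℝ] V 3) = fderiv ℝ (fun q => chartAt (V 3) p (A.tubeMap d q)) q := by
  have hr : ∀ m, Module.finrank ℝ (V m) = m * 2 := fun m => by
    rw [← Module.finrank_mul_finrank ℝ ℂ (V m), Complex.finrank_real_complex]; simp [mul_comm]
  have hfin : Module.finrank ℝ (V 2 × ℂ) = Module.finrank ℝ (V 3) := by
    rw [Module.finrank_prod, hr, hr, Complex.finrank_real_complex]
  refine ⟨(LinearEquiv.ofInjectiveOfFinrankEq _ (A.injective_fderiv_tubeMap hq hp)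
    hfin).toContinuousLinearEquiv, ?_⟩
  exact ContinuousLinearMap.ext fun v => rfl

/-- The tube map is open, by the inverse function theorem. -/
theorem map_nhds_tubeMap {d : D} {q : V 2 × ℂ} (hq : q ∈ tubeDom d) :
    map (A.tubeMap d) (𝓝 q) = 𝓝 (A.tubeMap d q) := by
  set p := A.tubeMap d q
  have hps := mem_chart_source (V 3) p
  obtain ⟨e, he⟩ := A.exists_equiv_fderiv_tubeMap hq hps
  have h1 := (A.contDiffAt_chart_tubeMap hq hps).hasStrictFDerivAt (by simp)
  rw [← he] at h1
  have h2 := h1.map_nhds_eq_of_equiv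
  have h3 : map (chartAt (V 3) p).symm (𝓝 (chartAt (V 3) p p)) = 𝓝 p :=
    (chartAt (V 3) p).symm_map_nhds_eq hps
  rw [← h3, ← h2, Filter.map_map]
  refine Filter.map_congr ?_
  filter_upwards [(A.continuousAt_tubeMap hq).eventually
    ((chartAt (V 3) p).open_source.mem_nhds hps)] with q' hq'
  exact ((chartAt (V 3) p).left_inv hq').symm

theorem isOpen_nbhd : IsOpen A.nbhd := by
  rw [isOpen_iff_mem_nhds]
  intro p hp
  obtain ⟨x, w, hw, rfl⟩ := A.exists_tubeMap_eq hp
  have hq := chart_mem_tubeDom x hw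
  rw [← A.map_nhds_tubeMap hq]
  rw [mem_map]
  filter_upwards [(isOpen_tubeDom x).mem_nhds hq] with q hq using A.tubeMap_mem_nbhd hq

/-- The coordinate `z` is smooth over the reals: it is a component of the inverse of the tubular
neighbourhood. -/
theorem contDiffAt_z {p : X} (hp : p ∈ A.nbhd) :
    ContDiffAt ℝ ∞ (fun y => A.z ((chartAt (V 3) p).symm y)) (chartAt (V 3) p p) := by
  obtain ⟨x, w, hw, hxw⟩ := A.exists_tubeMap_eq hp
  set q : V 2 × ℂ := (chartAt (V 2) x x, w)
  have hq : q ∈ tubeDom x := chart_mem_tubeDom x hw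
  have hps : A.tubeMap x q ∈ (chartAt (V 3) p).source := by rw [hxw]; exact mem_chart_source _ p
  obtain ⟨e, he⟩ := A.exists_equiv_fderiv_tubeMap hq hps
  have hc := A.contDiffAt_chart_tubeMap hq hps
  have hd : HasFDerivAt (fun q => chartAt (V 3) p (A.tubeMap x q)) (e : V 2 × ℂ →L[ℝ] V 3) q := by
    rw [he]; exact (hc.differentiableAt (by simp)).hasFDerivAt
  have hs := hc.hasStrictFDerivAt' hd (by simp)
  have hl : ContDiffAt ℝ ∞ (hc.localInverse hd (by simp)) (chartAt (V 3) p (A.tubeMap x q)) :=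
    hc.to_localInverse hd (by simp)
  rw [hxw] at hl
  refine (contDiff_snd.contDiffAt.comp _ hl).congr_of_eventuallyEq ?_
  have hr : ∀ᶠ y in 𝓝 (chartAt (V 3) p p), chartAt (V 3) p (A.tubeMap x
      (hc.localInverse hd (by simp) y)) = y := by
    have := hs.eventually_right_inverse
    rw [hxw] at this; exact this
  have hv : hc.localInverse hd (by simp) (chartAt (V 3) p p) = q := by
    have := hc.localInverse_apply_image hd (by simp)
    rwa [hxw] at this
  have ht : Tendsto (hc.localInverse hd (by simp)) (𝓝 (chartAt (V 3) p p)) (𝓝 q) := by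
    have := hl.continuousAt.tendsto; rwa [hv] at this
  filter_upwards [hr, ht.eventually ((isOpen_tubeDom x).mem_nhds hq),
    ht.eventually ((A.continuousAt_tubeMap hq).eventually
      ((chartAt (V 3) p).open_source.mem_nhds hps))] with y h1 h2 h3
  simp only [Function.comp_apply]
  rw [← A.z_tubeMap h2]
  conv_lhs => rw [← h1]
  rw [(chartAt (V 3) p).left_inv h3]

theorem differentiableAt_z_complex {p : X} {y : V 3} (hy : y ∈ (chartAt (V 3) p).target)
    (hU : (chartAt (V 3) p).symm y ∈ A.nbhd) :
    DifferentiableAt ℂ (fun y => A.z ((chartAt (V 3) p).symm y)) y := by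
  have h1 : MDifferentiableAt 𝓘(ℂ, V 3) 𝓘(ℂ, ℂ) A.z
      ((chartAt (V 3) p).symm y) :=
    (A.z_holo _ hU).mdifferentiableAt (A.isOpen_nbhd.mem_nhds hU)
  have h2 : MDifferentiableAt 𝓘(ℂ, V 3) 𝓘(ℂ, V 3)
      (chartAt (V 3) p).symm y :=
    ((contMDiffOn_chart_symm (I := 𝓘(ℂ, V 3)) (n := ω) (x := p)).contMDiffAt
      ((chartAt (V 3) p).open_target.mem_nhds hy)).mdifferentiableAt (by simp)
  rw [← mdifferentiableAt_iff_differentiableAt]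
  exact h1.comp y h2

theorem continuousAt_z {p : X} (hp : p ∈ A.nbhd) : ContinuousAt A.z p := by
  have h1 := (A.contDiffAt_z hp).continuousAt.comp (f := chartAt (V 3) p) (x := p)
    ((chartAt (V 3) p).continuousAt (mem_chart_source _ p))
  refine h1.congr ?_
  filter_upwards [(chartAt (V 3) p).open_source.mem_nhds (mem_chart_source _ p)] with x hx
  simp [(chartAt (V 3) p).left_inv hx]

/-- The differential of `z` at `p`. -/
def dz (p : X) : V 3 →L[ℝ] ℂ :=
  fderiv ℝ (fun y => A.z ((chartAt (V 3) p).symm y)) (chartAt (V 3) p p)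

theorem dz_I_smul {p : X} (hp : p ∈ A.nbhd) (u : V 3) : A.dz p (I • u) = I * A.dz p u :=
  fderiv_real_I_smul (A.differentiableAt_z_complex (mem_chart_target _ p)
    (by rwa [(chartAt (V 3) p).left_inv (mem_chart_source _ p)])) u

theorem mem_nbhd_eventually {p : X} (hp : p ∈ A.nbhd) :
    ∀ᶠ y in 𝓝 (chartAt (V 3) p p), y ∈ (chartAt (V 3) p).target ∧
      (chartAt (V 3) p).symm y ∈ A.nbhd := by
  have h := (chartAt (V 3) p).isOpen_inter_preimage_symm A.isOpen_nbhd
  refine h.mem_nhds ⟨mem_chart_target _ p, ?_⟩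
  rwa [mem_preimage, (chartAt (V 3) p).left_inv (mem_chart_source _ p)]

/-! ### The cylindrical end -/

/-- By compactness of `D`, bounds which hold near each point of `D` in cylindrical coordinates hold
with a common constant near the divisor. -/
theorem exists_bound_of_endFilter [CompactSpace D] (Q : ℝ → X → Prop)
    (hmono : ∀ C C' p, C ≤ C' → Q C p → Q C' p)
    (h : ∀ d : D, ∃ C, ∀ᶠ q in endFilter (chartAt (V 2) d d), Q C (cylMap A.tube d q)) :
    ∃ C ρ : ℝ, 0 < ρ ∧ ρ < 1 ∧ ∀ p ∈ A.nbhd, A.z p ≠ 0 → ‖A.z p‖ < ρ → Q C p := by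
  have h' : ∀ d : D, ∃ C s : ℝ, ∃ N ∈ 𝓝 (chartAt (V 2) d d), ∀ y ∈ N, ∀ ζ : ℂ, s ≤ ζ.re →
      Q C (cylMap A.tube d (y, ζ)) := fun d => by
    obtain ⟨C, hC⟩ := h d
    obtain ⟨pa, hpa, pb, hpb, hab⟩ := eventually_prod_iff.1 hC
    rw [eventually_comap] at hpb
    obtain ⟨s, hs⟩ := eventually_atTop.1 hpb
    exact ⟨C, s, {y | pa y}, hpa, fun y hy ζ hζ => hab hy (hs ζ.re hζ ζ rfl)⟩
  choose C s N hN hQ using h'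
  obtain ⟨t, -, ht⟩ := isCompact_univ.elim_nhds_subcover
    (fun d : D => (chartAt (V 2) d).source ∩ chartAt (V 2) d ⁻¹' N d) fun d _ =>
    inter_mem ((chartAt (V 2) d).open_source.mem_nhds (mem_chart_source _ d))
      ((chartAt (V 2) d).continuousAt (mem_chart_source _ d) (hN d))
  obtain ⟨C', hC'⟩ := (t.image C).exists_le
  obtain ⟨S, hS⟩ := (insert 1 (t.image s)).exists_le
  have hS1 : 1 ≤ S := hS 1 (Finset.mem_insert_self _ _)
  refine ⟨C', Real.exp (-S), Real.exp_pos _, Real.exp_lt_one_iff.2 (by linarith), fun p hp hz hzS => ?_⟩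
  obtain ⟨⟨x, w⟩, ⟨-, hw⟩, rfl⟩ := hp
  rw [A.z_tube x w hw] at hz hzS
  obtain ⟨d, hd, hx⟩ := mem_iUnion₂.1 (ht (mem_univ x))
  have hre : S ≤ (-Complex.log w).re := by
    rw [neg_re, log_re]
    have := Real.log_le_log (norm_pos_iff.2 hz) hzS.le
    rw [Real.log_exp] at this; linarith
  have h1 := hQ d _ hx.2 (-Complex.log w) ((hS _ (Finset.mem_insert_of_mem
    (Finset.mem_image_of_mem _ hd))).trans hre)
  have e : cylMap A.tube d (chartAt (V 2) d x, -Complex.log w) = A.tube (x, w) := by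
    simp only [cylMap, neg_neg, exp_log hz]
    rw [(chartAt (V 2) d).left_inv hx.1]
  rw [e] at h1
  exact hmono _ _ _ (hC' _ (Finset.mem_image_of_mem _ hd)) h1

/-- The matrix of `ω` in the cylinder frame. -/
def endMat (d : D) (q : V 2 × ℂ) : Matrix EndIdx EndIdx ℝ :=
  Matrix.of fun a b => pullback (E := V 2 × ℂ) (M := V 2 × ℂ) (cylMap A.tube d) A.om q
    ![cylFrame a, cylFrame b]

theorem kappaI_det_ne_zero {d : D} {y : V 2} (hy : y ∈ (chartAt (V 2) d).target) :
    (skew (stdFrame 2) (inChart d A.kappaI y)).det ≠ 0 :=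
  det_skew_ne_zero _ (inChart_type11 hy (A.divisor_calabiYau.kaehler.type11 _ (mem_univ _)))
    (inChart_pos hy (A.divisor_calabiYau.kaehler.pos _ (mem_univ _)))

theorem tendsto_cylMat (d : D) (a b : EndIdx) :
    Tendsto (fun q : V 2 × ℂ => cylMat (inChart d A.kappaI q.1) a b)
      (endFilter (chartAt (V 2) d d))
      (𝓝 (cylMat (inChart d A.kappaI (chartAt (V 2) d d)) a b)) := by
  have hc : ContinuousAt (inChart d A.kappaI) (chartAt (V 2) d d) := by
    refine (A.divisor_calabiYau.kaehler.smooth d).continuousOn.continuousAt ?_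
    rw [preimage_univ, inter_univ]
    exact (chartAt (V 2) d).open_target.mem_nhds (mem_chart_target _ d)
  have h1 : Tendsto (fun q : V 2 × ℂ => inChart d A.kappaI q.1) (endFilter (chartAt (V 2) d d))
      (𝓝 (inChart d A.kappaI (chartAt (V 2) d d))) := hc.tendsto.comp tendsto_fst
  have h2 : ∀ v : Fin 2 → V 2, Tendsto (fun q : V 2 × ℂ => inChart d A.kappaI q.1 v)
      (endFilter (chartAt (V 2) d d)) (𝓝 (inChart d A.kappaI (chartAt (V 2) d d) v)) := fun v =>
    ((ContinuousAlternatingMap.apply ℝ (V 2) ℝ v).continuous.tendsto _).comp h1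
  rcases a with a | i <;> rcases b with b | j
  · exact h2 _
  · exact tendsto_const_nhds
  · exact tendsto_const_nhds
  · exact tendsto_const_nhds

/-- The asymptotics of `ω`, written in the frame `∂_y, ∂_s, ∂_α` of the cylinder. -/
theorem exists_endMat_sub_le :
    ∃ rate : ℝ, 0 < rate ∧ ∀ d : D, ∃ C, 0 ≤ C ∧ ∀ᶠ q in endFilter (chartAt (V 2) d d), ∀ a b,
      |A.endMat d q a b - cylMat (inChart d A.kappaI q.1) a b|
        ≤ C * Real.exp (-rate * q.2.re) := by
  obtain ⟨rate, hr, h⟩ := A.asymptotic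
  refine ⟨rate, hr, fun d => ?_⟩
  obtain ⟨K, hK, hKt, hKc⟩ := exists_compact_subset (chartAt (V 2) d).open_target
    (mem_chart_target (V 2) d)
  choose C hC using fun a b => (h d).1 (cylFrame a) (cylFrame b) K hKc hK 0
  have hev : ∀ᶠ q in endFilter (chartAt (V 2) d d), q.1 ∈ K ∧ 1 ≤ q.2.re := by
    refine Filter.Eventually.and ?_ ?_
    · exact tendsto_fst.eventually (mem_interior_iff_mem_nhds.1 hKt)
    · exact tendsto_snd.eventually (tendsto_comap.eventually (eventually_ge_atTop 1))
  refine ⟨∑ a, ∑ b, |C a b|, Finset.sum_nonneg fun a _ => Finset.sum_nonneg fun b _ => abs_nonneg _,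
    ?_⟩
  filter_upwards [hev] with q hq a b
  have h1 := hC a b q.1 hq.1 q.2 hq.2
  rw [norm_iteratedFDeriv_zero, Real.norm_eq_abs, omegaInfty_cylFrame] at h1
  refine h1.trans (mul_le_mul_of_nonneg_right ?_ (Real.exp_pos _).le)
  calc C a b ≤ |C a b| := le_abs_self _
    _ ≤ _ := le_sum_sum (f := fun a b => |C a b|) (fun _ _ => abs_nonneg _) a b

/-- On the end, the inverse of the matrix of `ω` in the cylinder frame is bounded, and it converges
exponentially to the inverse of the matrix of `ω_∞`. -/
theorem exists_inv_endMat_le :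
    ∃ rate : ℝ, 0 < rate ∧ ∀ d : D, ∃ C, 0 ≤ C ∧ ∀ᶠ q in endFilter (chartAt (V 2) d d),
      (A.endMat d q).det ≠ 0 ∧ |(A.endMat d q).det| ≤ C ∧ (∀ a b, |(A.endMat d q)⁻¹ a b| ≤ C) ∧
      ∀ a b, |(A.endMat d q)⁻¹ a b - (cylMat (inChart d A.kappaI q.1))⁻¹ a b|
        ≤ C * Real.exp (-rate * q.2.re) := by
  obtain ⟨rate, hr, h⟩ := A.exists_endMat_sub_le
  refine ⟨rate, hr, fun d => ?_⟩
  obtain ⟨C₁, hC₁, hsub⟩ := h d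
  set y₀ := chartAt (V 2) d d
  set Ω₀ := cylMat (inChart d A.kappaI y₀)
  have hd₀ : Ω₀.det ≠ 0 := (inv_cylMat (A.kappaI_det_ne_zero (mem_chart_target _ d))).1
  have hexp : Tendsto (fun q : V 2 × ℂ => C₁ * Real.exp (-rate * q.2.re)) (endFilter y₀) (𝓝 0) := by
    have h1 : Tendsto (fun q : V 2 × ℂ => q.2.re) (endFilter y₀) atTop :=
      tendsto_comap.comp tendsto_snd
    have h2 := (Real.tendsto_exp_atBot.comp (h1.const_mul_atTop_of_neg (neg_neg_of_pos hr))).const_mul C₁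
    simpa using h2
  have htend : ∀ a b, Tendsto (fun q => A.endMat d q a b) (endFilter y₀) (𝓝 (Ω₀ a b)) := fun a b => by
    have h1 : Tendsto (fun q => A.endMat d q a b - cylMat (inChart d A.kappaI q.1) a b)
        (endFilter y₀) (𝓝 0) :=
      squeeze_zero_norm' (by filter_upwards [hsub] with q hq using hq a b) hexp
    simpa using h1.add (A.tendsto_cylMat d a b)
  have hinv := tendsto_matrix_inv htend hd₀
  have hinv' := tendsto_matrix_inv (A.tendsto_cylMat d) hd₀
  set M : ℝ := ∑ a, ∑ b, |Ω₀⁻¹ a b| + 1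
  have hMab : ∀ a b, |Ω₀⁻¹ a b| < M := fun a b =>
    (le_sum_sum (f := fun a b => |Ω₀⁻¹ a b|) (fun _ _ => abs_nonneg _) a b).trans_lt (lt_add_one _)
  have hM0 : 0 ≤ M := by positivity
  have hb1 : ∀ᶠ q in endFilter y₀, ∀ a b, |(A.endMat d q)⁻¹ a b| < M :=
    eventually_all.2 fun a => eventually_all.2 fun b =>
      (hinv a b).abs.eventually (gt_mem_nhds (hMab a b))
  have hb2 : ∀ᶠ q in endFilter y₀, ∀ a b, |(cylMat (inChart d A.kappaI q.1))⁻¹ a b| < M :=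
    eventually_all.2 fun a => eventually_all.2 fun b =>
      (hinv' a b).abs.eventually (gt_mem_nhds (hMab a b))
  have hd1 : ∀ᶠ q in endFilter y₀, (A.endMat d q).det ≠ 0 := (tendsto_det htend).eventually_ne hd₀
  have hd2 : ∀ᶠ q in endFilter y₀, (cylMat (inChart d A.kappaI q.1)).det ≠ 0 :=
    (tendsto_det (A.tendsto_cylMat d)).eventually_ne hd₀
  have hd3 : ∀ᶠ q in endFilter y₀, |(A.endMat d q).det| < |Ω₀.det| + 1 :=
    (tendsto_det htend).abs.eventually (gt_mem_nhds (lt_add_one _))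
  set N : ℝ := (Fintype.card EndIdx : ℝ)
  refine ⟨M + (|Ω₀.det| + 1) + N * (N * (M * C₁ * M)), by positivity, ?_⟩
  filter_upwards [hb1, hb2, hd1, hd2, hd3, hsub] with q h1 h2 h3 h4 h5 h6
  have hp1 : 0 ≤ |Ω₀.det| + 1 := by positivity
  have hp2 : 0 ≤ N * (N * (M * C₁ * M)) := by positivity
  refine ⟨h3, by linarith, fun a b => by linarith [h1 a b], fun a b => ?_⟩
  set Ω := A.endMat d q
  set Ω' := cylMat (inChart d A.kappaI q.1)
  have key : Ω⁻¹ - Ω'⁻¹ = -(Ω⁻¹ * (Ω - Ω') * Ω'⁻¹) := by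
    rw [mul_sub, sub_mul, nonsing_inv_mul _ h3.isUnit, one_mul,
      mul_assoc Ω⁻¹, mul_nonsing_inv _ h4.isUnit, mul_one, neg_sub]
  rw [← Matrix.sub_apply, key, Matrix.neg_apply, abs_neg, Matrix.mul_apply]
  have hterm : ∀ c, |(Ω⁻¹ * (Ω - Ω')) a c * Ω'⁻¹ c b| ≤ N * (M * C₁ * M) * Real.exp (-rate * q.2.re) :=
    fun c => by
    have h7 : |(Ω⁻¹ * (Ω - Ω')) a c| ≤ N * (M * (C₁ * Real.exp (-rate * q.2.re))) := by
      rw [Matrix.mul_apply]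
      refine (Finset.abs_sum_le_sum_abs _ _).trans ?_
      refine (Finset.sum_le_card_nsmul _ _ (M * (C₁ * Real.exp (-rate * q.2.re))) fun e _ => ?_).trans
        (by rw [nsmul_eq_mul, Finset.card_univ])
      rw [abs_mul]
      exact mul_le_mul (h1 a e).le (h6 e c) (abs_nonneg _) hM0
    rw [abs_mul]
    calc _ ≤ N * (M * (C₁ * Real.exp (-rate * q.2.re))) * M :=
          mul_le_mul h7 (h2 c b).le (abs_nonneg _) (by positivity)
      _ = _ := by ring
  refine (Finset.abs_sum_le_sum_abs _ _).trans ((Finset.sum_le_card_nsmul _ _ _ fun c _ => hterm c).trans ?_)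
  rw [nsmul_eq_mul, Finset.card_univ, ← mul_assoc]
  exact mul_le_mul_of_nonneg_right (by linarith) (Real.exp_pos _).le


theorem mem_tubeDom_exp {d : D} {q : V 2 × ℂ} (hq : q.1 ∈ (chartAt (V 2) d).target)
    (hs : 0 < q.2.re) : (q.1, Complex.exp (-q.2)) ∈ tubeDom d :=
  ⟨hq, by rw [mem_ball_zero_iff, norm_exp, neg_re]; exact Real.exp_lt_one_iff.2 (by linarith)⟩

theorem eventually_endFilter (d : D) :
    ∀ᶠ q in endFilter (chartAt (V 2) d d), q.1 ∈ (chartAt (V 2) d).target ∧ 0 < q.2.re := by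
  refine Filter.Eventually.and ?_ ?_
  · exact tendsto_fst.eventually ((chartAt (V 2) d).open_target.mem_nhds (mem_chart_target _ d))
  · exact tendsto_snd.eventually (tendsto_comap.eventually (eventually_gt_atTop 0))

theorem tendsto_endFilter_tube (d : D) :
    Tendsto (fun q : V 2 × ℂ => (q.1, Complex.exp (-q.2))) (endFilter (chartAt (V 2) d d))
      (𝓝 (chartAt (V 2) d d, 0)) := by
  refine tendsto_fst.prodMk_nhds ?_
  rw [tendsto_zero_iff_norm_tendsto_zero]
  have h1 : Tendsto (fun q : V 2 × ℂ => q.2.re) (endFilter (chartAt (V 2) d d)) atTop :=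
    tendsto_comap.comp tendsto_snd
  have h2 := Real.tendsto_exp_neg_atTop_nhds_zero.comp h1
  refine h2.congr fun q => ?_
  rw [norm_exp, neg_re]; rfl

/-- The cylinder frame `∂_y, ∂_s, ∂_α` at a point of the end, in the chart of `X` at `p`. -/
def endVec (d : D) (p : X) (q : V 2 × ℂ) (a : EndIdx) : V 3 :=
  fderiv ℝ (fun q => chartAt (V 3) p (A.tubeMap d q)) (q.1, Complex.exp (-q.2))
    ((cylFrame a).1, -Complex.exp (-q.2) * (cylFrame a).2)

theorem hasFDerivAt_expMap (q : V 2 × ℂ) :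
    HasFDerivAt (fun q : V 2 × ℂ => (q.1, Complex.exp (-q.2)))
      ((ContinuousLinearMap.fst ℝ (V 2) ℂ).prod
        ((-Complex.exp (-q.2)) • ContinuousLinearMap.snd ℝ (V 2) ℂ)) q := by
  have h1 : HasFDerivAt (fun ζ : ℂ => Complex.exp (-ζ))
      ((-Complex.exp (-q.2)) • ContinuousLinearMap.id ℝ ℂ) q.2 := by
    have h := ((hasDerivAt_neg q.2).cexp).hasFDerivAt.restrictScalars ℝ
    refine h.congr_fderiv ?_
    exact ContinuousLinearMap.ext fun v => by simp [mul_comm]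
  exact hasFDerivAt_fst.prodMk (h1.comp q hasFDerivAt_snd)

theorem hasFDerivAt_chart_cylMap {d : D} {p : X} {q : V 2 × ℂ}
    (hq : q.1 ∈ (chartAt (V 2) d).target) (hs : 0 < q.2.re)
    (hp : cylMap A.tube d q ∈ (chartAt (V 3) p).source) :
    HasFDerivAt (fun q => chartAt (V 3) p (cylMap A.tube d q))
      ((fderiv ℝ (fun q => chartAt (V 3) p (A.tubeMap d q)) (q.1, Complex.exp (-q.2))).comp
        ((ContinuousLinearMap.fst ℝ (V 2) ℂ).prod
        ((-Complex.exp (-q.2)) • ContinuousLinearMap.snd ℝ (V 2) ℂ))) q := by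
  have h1 := ((A.contDiffAt_chart_tubeMap (mem_tubeDom_exp hq hs) hp).differentiableAt
    (by simp)).hasFDerivAt
  exact HasFDerivAt.comp (f := fun q : V 2 × ℂ => (q.1, Complex.exp (-q.2))) q h1
    (hasFDerivAt_expMap q)

theorem continuousAt_cylMap {d : D} {q : V 2 × ℂ}
    (hq : q.1 ∈ (chartAt (V 2) d).target) (hs : 0 < q.2.re) :
    ContinuousAt (cylMap A.tube d) q :=
  ContinuousAt.comp (f := fun q : V 2 × ℂ => (q.1, Complex.exp (-q.2)))
    (A.continuousAt_tubeMap (mem_tubeDom_exp hq hs)) (hasFDerivAt_expMap q).continuousAt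

/-- In the chart at any point, the matrix of `ω` in the cylinder frame. -/
theorem endMat_eq_skew {d : D} {p : X} {q : V 2 × ℂ}
    (hq : q.1 ∈ (chartAt (V 2) d).target) (hs : 0 < q.2.re)
    (hp : cylMap A.tube d q ∈ (chartAt (V 3) p).source) :
    A.endMat d q = skew (A.endVec d p q)
      (inChart p A.om (chartAt (V 3) p (cylMap A.tube d q))) := by
  have hc := A.continuousAt_cylMap hq hs
  have hd := A.hasFDerivAt_chart_cylMap hq hs hp
  have e := (chartAt (V 3) p).left_inv hp
  have hm := fderiv_chart_eq hc hp hd.differentiableAt (cylMap A.tube d q) (mem_chart_source _ _)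
  ext a b
  rw [skew, of_apply, inChart_pair ((chartAt (V 3) p).map_source hp), e]
  simp only [endMat, of_apply, pullback]
  rw [mfderiv_eq_fderiv_chart hc, hm, hd.fderiv]
  refine congrArg (A.om (cylMap A.tube d q)) ?_
  funext i
  fin_cases i <;> rfl

theorem dz_endVec {d : D} {q : V 2 × ℂ}
    (hq : q.1 ∈ (chartAt (V 2) d).target) (hs : 0 < q.2.re) (a : EndIdx) :
    A.dz (cylMap A.tube d q) (A.endVec d (cylMap A.tube d q) q a)
      = -Complex.exp (-q.2) * (cylFrame a).2 := by
  have hq' := mem_tubeDom_exp hq hs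
  set p := cylMap A.tube d q
  have hps : A.tubeMap d (q.1, Complex.exp (-q.2)) ∈ (chartAt (V 3) p).source :=
    mem_chart_source _ p
  have h1 := ((A.contDiffAt_chart_tubeMap hq' hps).differentiableAt (by simp)).hasFDerivAt
  have h2 : HasFDerivAt (fun y => A.z ((chartAt (V 3) p).symm y)) (A.dz p)
      (chartAt (V 3) p (A.tubeMap d (q.1, Complex.exp (-q.2)))) :=
    ((A.contDiffAt_z (p := p) (A.tubeMap_mem_nbhd hq')).differentiableAt (by simp)).hasFDerivAt
  have h3 := HasFDerivAt.comp (f := fun q => chartAt (V 3) p (A.tubeMap d q)) _ h2 h1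
  have h4 := h3.congr_of_eventuallyEq (f₁ := Prod.snd) (by
    filter_upwards [(isOpen_tubeDom d).mem_nhds hq', (A.continuousAt_tubeMap hq').eventually
      ((chartAt (V 3) p).open_source.mem_nhds hps)] with q₁ h5 h6
    rw [Function.comp_apply, (chartAt (V 3) p).left_inv h6, A.z_tubeMap h5])
  exact congrArg (fun T : V 2 × ℂ →L[ℝ] ℂ =>
    T ((cylFrame a).1, -Complex.exp (-q.2) * (cylFrame a).2)) (h4.unique hasFDerivAt_snd)

theorem norm_cylFrame_snd_le (a : EndIdx) : ‖(cylFrame a).2‖ ≤ 1 := by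
  rcases a with a | i
  · simp [cylFrame]
  · fin_cases i <;> simp [cylFrame]

/-- The bilinear form `dz ∧ dz̄`. -/
def dzdzBar (p : X) : V 3 →ₗ[ℝ] V 3 →ₗ[ℝ] ℂ :=
  LinearMap.mk₂ ℝ (fun u v => A.dz p u * conj (A.dz p v) - A.dz p v * conj (A.dz p u))
    (fun u u' v => by simp only [map_add]; ring)
    (fun c u v => by
      simp only [map_smul, real_smul, map_mul, conj_ofReal]; ring)
    (fun u v v' => by simp only [map_add]; ring)
    (fun c u v => by
      simp only [map_smul, real_smul, map_mul, conj_ofReal]; ring)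

theorem dzdzBar_apply (p : X) (u v : V 3) :
    A.dzdzBar p u v = A.dz p u * conj (A.dz p v) - A.dz p v * conj (A.dz p u) := rfl

/-- The squared length of `dz` with respect to `ω` is at most a multiple of `|z|²` near the
divisor. -/
theorem exists_sum_normSq_dz_le [CompactSpace D] :
    ∃ C ρ : ℝ, 0 ≤ C ∧ 0 < ρ ∧ ρ < 1 ∧ ∀ p ∈ A.nbhd, A.z p ≠ 0 → ‖A.z p‖ < ρ →
      ∀ L : V 3 →ₗ[ℂ] V 3, LinearMap.det L ≠ 0 →
        (IsUnitary (A.om p) fun j => L (Pi.single j 1)) →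
        ∑ j, normSq (A.dz p (L (Pi.single j 1))) ≤ C * normSq (A.z p) := by
  obtain ⟨C, ρ, h0, h1, h⟩ := A.exists_bound_of_endFilter (fun C p =>
    ∀ L : V 3 →ₗ[ℂ] V 3, LinearMap.det L ≠ 0 →
        (IsUnitary (A.om p) fun j => L (Pi.single j 1)) →
        ∑ j, normSq (A.dz p (L (Pi.single j 1))) ≤ C * normSq (A.z p))
    (fun C C' p hCC h L hL hb => (h L hL hb).trans
      (mul_le_mul_of_nonneg_right hCC (normSq_nonneg _))) fun d => by
    obtain ⟨rate, -, hC⟩ := A.exists_inv_endMat_le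
    obtain ⟨C, hC0, hC⟩ := hC d
    refine ⟨(Fintype.card EndIdx : ℝ) ^ 2 * (C * 2), ?_⟩
    filter_upwards [hC, eventually_endFilter d] with q hq hqd L hL hb
    obtain ⟨hdet, -, hinv, -⟩ := hq
    have hq' := mem_tubeDom_exp hqd.1 hqd.2
    set p := cylMap A.tube d q with hp
    have hpU : p ∈ A.nbhd := A.tubeMap_mem_nbhd hq'
    have hz : A.z p = Complex.exp (-q.2) := A.z_tubeMap hq'
    have hE : A.endMat d q = skew (A.endVec d p q) (A.om p) := by
      rw [A.endMat_eq_skew hqd.1 hqd.2 (p := p) (mem_chart_source _ p)]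
      ext a b; exact inChart_self A.om p _
    have e1 := pairing_eq_sum_unitary (A.om p) L hL hb (A.dzdzBar p)
    obtain ⟨σ⟩ : Nonempty (Fin 3 × Fin 2 ≃ EndIdx) := ⟨Fintype.equivOfCardEq (by decide)⟩
    have e2 := pairing_frame σ (A.endVec d p q) (A.om p) (hE ▸ hdet) (A.dzdzBar p)
    have e3 : (1 / 2 : ℂ) • ∑ j, (A.dzdzBar p (L (Pi.single j 1)) (I • L (Pi.single j 1))
        - A.dzdzBar p (I • L (Pi.single j 1)) (L (Pi.single j 1)))
        = ((-2 * I) * ((∑ j, normSq (A.dz p (L (Pi.single j 1))) : ℝ) : ℂ)) := by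
      rw [smul_eq_mul, ofReal_sum, Finset.mul_sum, Finset.mul_sum]
      refine Finset.sum_congr rfl fun j _ => ?_
      rw [dzdzBar_apply, dzdzBar_apply, A.dz_I_smul hpU, normSq_eq_conj_mul_self, map_mul, conj_I]
      ring
    have e4 : ‖(-2 * I) * ((∑ j, normSq (A.dz p (L (Pi.single j 1))) : ℝ) : ℂ)‖
        ≤ (Fintype.card EndIdx : ℝ) ^ 2 * (C * (2 * normSq (A.z p))) := by
      rw [← e3, ← e1, e2, ← hE]
      refine norm_pairing_le _ _ hinv (fun a b => ?_) hC0
      have hn : ∀ a, ‖A.dz p (A.endVec d p q a)‖ ≤ ‖A.z p‖ := fun a => by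
        rw [A.dz_endVec hqd.1 hqd.2, norm_mul, norm_neg, hz]
        exact mul_le_of_le_one_right (norm_nonneg _) (norm_cylFrame_snd_le a)
      have hn2 : ∀ a b, ‖A.dz p (A.endVec d p q a) * conj (A.dz p (A.endVec d p q b))‖
          ≤ normSq (A.z p) := fun a b => by
        rw [norm_mul, RCLike.norm_conj, ← Complex.sq_norm, sq]
        exact mul_le_mul (hn a) (hn b) (norm_nonneg _) (norm_nonneg _)
      rw [dzdzBar_apply]
      refine (norm_sub_le _ _).trans ?_
      linarith [hn2 a b, hn2 b a]
    have hS : 0 ≤ ∑ j, normSq (A.dz p (L (Pi.single j 1))) :=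
      Finset.sum_nonneg fun j _ => normSq_nonneg _
    rw [norm_mul, norm_real, Real.norm_of_nonneg hS, norm_mul, norm_neg, Complex.norm_I] at e4
    have : ‖(2 : ℂ)‖ = 2 := by simp
    rw [this] at e4
    linarith
  refine ⟨max C 0, ρ, le_max_right _ _, h0, h1, fun p hp hz hzρ L hL hb =>
    (h p hp hz hzρ L hL hb).trans (mul_le_mul_of_nonneg_right (le_max_left _ _) (normSq_nonneg _))⟩

theorem z_eq_zero_iff {p : X} (hp : p ∈ A.nbhd) : A.z p = 0 ↔ p ∈ range A.emb := by
  obtain ⟨⟨x, w⟩, ⟨-, hw⟩, rfl⟩ := hp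
  rw [A.z_tube x w hw]
  constructor
  · rintro rfl; exact ⟨x, (A.tube_zero x).symm⟩
  · rintro ⟨x', hx'⟩
    rw [← A.tube_zero] at hx'
    exact (congrArg Prod.snd (A.tube_injOn ⟨mem_univ (x', (0 : ℂ)).1, by simp⟩
      ⟨mem_univ (x, w).1, hw⟩ hx')).symm

theorem range_emb_subset : range A.emb ⊆ A.nbhd := by
  rintro _ ⟨x, rfl⟩
  exact ⟨(x, 0), ⟨mem_univ _, by simp⟩, A.tube_zero x⟩

theorem isOpen_W [CompactSpace D] [T2Space X] : IsOpen A.W :=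
  (isCompact_range A.emb_holo.continuous).isClosed.isOpen_compl

theorem isClosed_tube [CompactSpace D] [T2Space X] {c : ℝ} (hc : c < 1) :
    IsClosed {p | p ∈ A.nbhd ∧ normSq (A.z p) ≤ c} := by
  have hcl : {p | p ∈ A.nbhd ∧ normSq (A.z p) ≤ c}
      = A.tube '' (univ ×ˢ {w : ℂ | normSq w ≤ c}) := by
    have hlt : ∀ w : ℂ, normSq w ≤ c → w ∈ Metric.ball (0 : ℂ) 1 := fun w hw => by
      rw [mem_ball_zero_iff, ← abs_norm, ← sq_lt_one_iff_abs_lt_one, Complex.sq_norm]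
      exact hw.trans_lt hc
    ext p
    constructor
    · rintro ⟨⟨⟨x, w⟩, ⟨-, hw⟩, rfl⟩, hz⟩
      rw [A.z_tube x w hw] at hz
      exact ⟨(x, w), ⟨mem_univ _, hz⟩, rfl⟩
    · rintro ⟨⟨x, w⟩, ⟨-, hw⟩, rfl⟩
      exact ⟨⟨(x, w), ⟨mem_univ _, hlt w hw⟩, rfl⟩, by rw [A.z_tube x w (hlt w hw)]; exact hw⟩
  rw [hcl]
  have hk : IsCompact {w : ℂ | normSq w ≤ c} := by
    refine (isCompact_closedBall (0 : ℂ) 1).of_isClosed_subset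
      (isClosed_le continuous_normSq continuous_const) fun w hw => ?_
    rw [mem_closedBall_zero_iff, ← abs_norm, ← sq_le_one_iff_abs_le_one, Complex.sq_norm]
    exact (show normSq w ≤ c from hw).trans hc.le
  refine ((isCompact_univ.prod hk).image_of_continuousOn
    (A.tube_smooth.continuousOn.mono ?_)).isClosed
  rintro ⟨x, w⟩ ⟨-, hw⟩
  refine ⟨mem_univ _, ?_⟩
  rw [mem_ball_zero_iff, ← abs_norm, ← sq_lt_one_iff_abs_lt_one, Complex.sq_norm]
  exact (show normSq w ≤ c from hw).trans_lt hc

/-! ### Barriers -/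

theorem normSq_lt_one {p : X} (hp : p ∈ A.nbhd) : normSq (A.z p) < 1 := by
  obtain ⟨⟨x, w⟩, ⟨-, hw⟩, rfl⟩ := hp
  rw [A.z_tube x w hw, ← Complex.sq_norm, sq_lt_one_iff_abs_lt_one, abs_norm]
  exact mem_ball_zero_iff.1 hw

open scoped Classical in
/-- A continuous function, equal to `|z|²` near the divisor, and constant far from it. -/
def modulus (a b : ℝ) (p : X) : ℝ :=
  if p ∈ A.nbhd then cutoff a b (normSq (A.z p)) else b

variable {a b : ℝ}

theorem modulus_le (hab : a < b) (p : X) : A.modulus a b p ≤ b := by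
  rw [modulus]; split_ifs
  · exact cutoff_le hab
  · exact le_rfl

theorem modulus_pos (hb : 0 < b) {p : X} (hp : p ∈ A.W) : 0 < A.modulus a b p := by
  rw [modulus]; split_ifs with h
  · refine lt_of_lt_of_le (lt_min ?_ hb) min_le_cutoff
    exact normSq_pos.2 fun h0 => hp ((A.z_eq_zero_iff h).1 h0)
  · exact hb

theorem modulus_eq_zero (ha : 0 < a) (hab : a < b) {p : X} (hp : p ∈ range A.emb) :
    A.modulus a b p = 0 := by
  have hU := A.range_emb_subset hp
  rw [modulus, if_pos hU, (A.z_eq_zero_iff hU).2 hp, normSq_zero, cutoff_of_le hab ha.le]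

theorem modulus_eventually_eq {p : X} (hp : p ∈ A.nbhd) :
    ∀ᶠ x in 𝓝 p, A.modulus a b x = cutoff a b (normSq (A.z x)) := by
  filter_upwards [A.isOpen_nbhd.mem_nhds hp] with x hx
  rw [modulus, if_pos hx]

theorem modulus_eventually_const [CompactSpace D] [T2Space X] (hab : a < b) (hb : b < 1) {p : X}
    (hp : ¬ (p ∈ A.nbhd ∧ normSq (A.z p) ≤ b)) : ∀ᶠ x in 𝓝 p, A.modulus a b x = b := by
  filter_upwards [(A.isClosed_tube hb).isOpen_compl.mem_nhds hp] with x hx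
  rw [modulus]
  split_ifs with h
  · refine cutoff_of_ge hab ?_
    by_contra! hlt
    exact hx ⟨h, hlt.le⟩
  · rfl

theorem continuous_modulus [CompactSpace D] [T2Space X] (hab : a < b) (hb : b < 1) :
    Continuous (A.modulus a b) := by
  rw [continuous_iff_continuousAt]
  intro p
  by_cases hp : p ∈ A.nbhd ∧ normSq (A.z p) ≤ b
  · have h1 : ContinuousAt (fun x => cutoff a b (normSq (A.z x))) p :=
      ((contDiff_cutoff a b).continuous.comp continuous_normSq).continuousAt.comp
        (A.continuousAt_z hp.1)
    exact h1.congr (EventuallyEq.symm (A.modulus_eventually_eq hp.1))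
  · exact continuousAt_const.congr (EventuallyEq.symm (A.modulus_eventually_const hab hb hp))

theorem tendsto_chart_symm (p : X) :
    Tendsto (chartAt (V 3) p).symm (𝓝 (chartAt (V 3) p p)) (𝓝 p) := by
  have h := (chartAt (V 3) p).continuousAt_symm (mem_chart_target (V 3) p)
  have h' := h.tendsto
  rwa [(chartAt (V 3) p).left_inv (mem_chart_source _ p)] at h'

/-- The Laplacian of a function of `|z|²`. -/
theorem levi_comp_normSq {p : X} (hp : p ∈ A.nbhd) {F : ℝ → ℝ}
    (hF : ContDiffAt ℝ 2 F (normSq (A.z p))) {g : X → ℝ}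
    (hg : ∀ᶠ x in 𝓝 p, g x = F (normSq (A.z x))) :
    ContDiffAt ℝ 2 (fun y => g ((chartAt (V 3) p).symm y)) (chartAt (V 3) p p) ∧
    ∀ u, levi (fun y => g ((chartAt (V 3) p).symm y)) (chartAt (V 3) p p) u
      = 4 * (normSq (A.z p) * deriv (deriv F) (normSq (A.z p)) + deriv F (normSq (A.z p)))
        * normSq (A.dz p u) := by
  set y₀ := chartAt (V 3) p p
  have e : (chartAt (V 3) p).symm y₀ = p := (chartAt (V 3) p).left_inv (mem_chart_source _ p)
  have hz : ContDiffAt ℝ 2 (fun y => A.z ((chartAt (V 3) p).symm y)) y₀ :=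
    (A.contDiffAt_z hp).of_le (by norm_cast)
  have hn : ContDiffAt ℝ 2 (fun y => normSq (A.z ((chartAt (V 3) p).symm y))) y₀ := by
    have h1 : ContDiffAt ℝ 2 (fun y => (A.z ((chartAt (V 3) p).symm y)).re) y₀ :=
      reCLM.contDiff.contDiffAt.comp y₀ hz
    have h2 : ContDiffAt ℝ 2 (fun y => (A.z ((chartAt (V 3) p).symm y)).im) y₀ :=
      imCLM.contDiff.contDiffAt.comp y₀ hz
    exact (h1.mul h1).add (h2.mul h2)
  have hF' : ContDiffAt ℝ 2 F ((fun y => normSq (A.z ((chartAt (V 3) p).symm y))) y₀) := by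
    simp only [e]; exact hF
  have hg' : (fun y => g ((chartAt (V 3) p).symm y)) =ᶠ[𝓝 y₀]
      fun y => F (normSq (A.z ((chartAt (V 3) p).symm y))) :=
    (tendsto_chart_symm p).eventually hg
  refine ⟨(hF'.comp y₀ hn).congr_of_eventuallyEq hg', fun u => ?_⟩
  have hI : ∀ᶠ x in 𝓝 y₀, ∀ u, fderiv ℝ (fun y => A.z ((chartAt (V 3) p).symm y)) x (I • u)
      = I * fderiv ℝ (fun y => A.z ((chartAt (V 3) p).symm y)) x u := by
    filter_upwards [A.mem_nbhd_eventually hp] with x hx u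
    exact fderiv_real_I_smul (A.differentiableAt_z_complex hx.1 hx.2) u
  obtain ⟨h1, h2⟩ := levi_normSq hz hI u
  rw [levi_congr hg', levi_comp hn hF', h1, h2, e]
  change _ * (4 * normSq (A.dz p u)) + _ * (4 * _ * normSq (A.dz p u)) = _
  ring

theorem levi_eventually_const {p : X} {g : X → ℝ} {c : ℝ} (hg : ∀ᶠ x in 𝓝 p, g x = c) :
    ContDiffAt ℝ 2 (fun y => g ((chartAt (V 3) p).symm y)) (chartAt (V 3) p p) ∧
    ∀ u, levi (fun y => g ((chartAt (V 3) p).symm y)) (chartAt (V 3) p p) u = 0 := by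
  have hg' : (fun y => g ((chartAt (V 3) p).symm y)) =ᶠ[𝓝 (chartAt (V 3) p p)] fun _ => c :=
    (tendsto_chart_symm p).eventually hg
  exact ⟨contDiffAt_const.congr_of_eventuallyEq hg', fun u => by
    rw [levi_congr hg', levi_const]⟩

/-- Here `4 (x F'' + F')`, at `x = |z|²`, is the ratio of the Laplacian of `F(|z|²)` to `|dz|²`. -/
theorem exists_bound_laplace {F : ℝ → ℝ} (hF : ContDiffOn ℝ ∞ F (Ioi 0)) (ha : 0 < a) :
    ∃ M, 0 ≤ M ∧ ∀ x ∈ Icc a b, 4 * (x * deriv (deriv F) x + deriv F x) ≤ M := by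
  have h1 : ContDiffOn ℝ ∞ (deriv F) (Ioi 0) := hF.deriv_of_isOpen isOpen_Ioi (by simp)
  have h2 : ContDiffOn ℝ ∞ (deriv (deriv F)) (Ioi 0) := h1.deriv_of_isOpen isOpen_Ioi (by simp)
  have hc : ContinuousOn (fun x => 4 * (x * deriv (deriv F) x + deriv F x)) (Icc a b) :=
    (continuousOn_const.mul ((continuousOn_id.mul h2.continuousOn).add h1.continuousOn)).mono
      fun x hx => ha.trans_le hx.1
  obtain ⟨M, hM⟩ := (isCompact_Icc.image_of_continuousOn hc).bddAbove
  exact ⟨max M 0, le_max_right _ _, fun x hx => (hM ⟨x, hx, rfl⟩).trans (le_max_left _ _)⟩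

theorem deriv_eq_of_eqOn_nhds {F G : ℝ → ℝ} {x : ℝ} (h : F =ᶠ[𝓝 x] G) :
    deriv F x = deriv G x ∧ deriv (deriv F) x = deriv (deriv G) x :=
  ⟨h.deriv_eq, h.deriv.deriv_eq⟩

/-- The function `-log |z|` is harmonic where `z ≠ 0`. -/
theorem laplace_log {x : ℝ} (hx : 0 < x) :
    x * deriv (deriv fun x => -(1 / 2) * Real.log x) x + deriv (fun x => -(1 / 2) * Real.log x) x
      = 0 := by
  have h1 : ∀ x : ℝ, deriv (fun x => -(1 / 2) * Real.log x) x = -(1 / 2) * x⁻¹ := fun x => by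
    rw [deriv_const_mul_field, Real.deriv_log]
  have h2 : (deriv fun x => -(1 / 2) * Real.log x) = fun x : ℝ => -(1 / 2) * x⁻¹ := funext h1
  rw [h2, deriv_const_mul_field, deriv_inv]
  field_simp; ring

/-- The Laplacian factor of `|z|^{2s}`. -/
theorem laplace_rpow {x s : ℝ} (hx : 0 < x) :
    x * deriv (deriv fun x : ℝ => x ^ s) x + deriv (fun x : ℝ => x ^ s) x = s ^ 2 * x ^ s / x := by
  have h1 : ∀ (s : ℝ) {x : ℝ}, 0 < x → deriv (fun x : ℝ => x ^ s) x = s * x ^ (s - 1) :=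
    fun s x hx => (Real.hasDerivAt_rpow_const (Or.inl hx.ne')).deriv
  have h2 : (deriv fun x : ℝ => x ^ s) =ᶠ[𝓝 x] fun x => s * x ^ (s - 1) := by
    filter_upwards [lt_mem_nhds hx] with y hy using h1 s hy
  rw [h2.deriv_eq, deriv_const_mul_field, h1 (s - 1) hx, h1 s hx, Real.rpow_sub_one hx.ne',
    Real.rpow_sub_one hx.ne']
  field_simp; ring

/-- Existence of barriers: near the divisor `φ = |z|^{2s}`, and `f = -log |z|`. -/
theorem exists_isBarrier [CompactSpace D] [T2Space X] [CompactSpace X] {s : ℝ} (hs : 0 < s) :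
    ∃ a b K : ℝ, 0 < a ∧ a < b ∧ b < 1 ∧ 0 ≤ K ∧
      IsBarrier A.W A.om K (fun p => A.modulus a b p ^ s)
        (fun p => -(1 / 2) * Real.log (A.modulus a b p)) := by
  obtain ⟨C, ρ, hC, hρ, hρ1, hΓ⟩ := A.exists_sum_normSq_dz_le
  -- since `b < ρ²`, the bound on `∑ |dz(b_j)|²` holds wherever the modulus is not constant
  set a := ρ ^ 2 / 4 with ha
  set b := ρ ^ 2 / 2 with hb
  have ha0 : 0 < a := by positivity
  have hab : a < b := by rw [ha, hb]; nlinarith [sq_pos_of_pos hρ]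
  have hb1 : b < 1 := by rw [hb]; nlinarith
  have hcut : ∀ x : ℝ, 0 < x → 0 < cutoff a b x := fun x hx =>
    lt_of_lt_of_le (lt_min hx (ha0.trans hab)) min_le_cutoff
  -- the two functions of `|z|²`
  have hFs : ContDiffOn ℝ ∞ (fun x => cutoff a b x ^ s) (Ioi 0) := fun x hx =>
    ((contDiff_cutoff a b).contDiffAt.rpow_const_of_ne (hcut x hx).ne').contDiffWithinAt
  have hFl : ContDiffOn ℝ ∞ (fun x => -(1 / 2) * Real.log (cutoff a b x)) (Ioi 0) := fun x hx =>
    (contDiffAt_const.mul ((contDiff_cutoff a b).contDiffAt.log (hcut x hx).ne')).contDiffWithinAt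
  obtain ⟨M₁, hM₁, hM₁'⟩ := exists_bound_laplace (b := b) hFs ha0
  obtain ⟨M₂, hM₂, hM₂'⟩ := exists_bound_laplace (b := b) hFl ha0
  have has : 0 < a ^ s := Real.rpow_pos_of_pos ha0 s
  -- the first term serves where the modulus is `|z|²`, the others on the region of the cutoff
  set K := 4 * s ^ 2 * C + M₁ * C / a ^ s + M₂ * C
  have hK1 : 4 * s ^ 2 * C ≤ K := by
    have : 0 ≤ M₁ * C / a ^ s := by positivity
    have : 0 ≤ M₂ * C := by positivity
    linarith
  have hK2 : M₁ * C / a ^ s ≤ K := by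
    have : 0 ≤ 4 * s ^ 2 * C := by positivity
    have : 0 ≤ M₂ * C := by positivity
    linarith
  have hK3 : M₂ * C ≤ K := by
    have : 0 ≤ 4 * s ^ 2 * C := by positivity
    have : 0 ≤ M₁ * C / a ^ s := by positivity
    linarith
  have hK0 : 0 ≤ K := by positivity
  have hzpos : ∀ {p : X}, p ∈ A.W → p ∈ A.nbhd → 0 < normSq (A.z p) := fun hp hU =>
    normSq_pos.2 fun h0 => hp ((A.z_eq_zero_iff hU).1 h0)
  have hΓ' : ∀ {p : X}, p ∈ A.W → p ∈ A.nbhd ∧ normSq (A.z p) ≤ b → ∀ L : V 3 →ₗ[ℂ] V 3,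
      LinearMap.det L ≠ 0 → (IsUnitary (A.om p) fun j => L (Pi.single j 1)) →
      ∑ j, normSq (A.dz p (L (Pi.single j 1))) ≤ C * normSq (A.z p) := fun hp hU L hL hu => by
    refine hΓ _ hU.1 (fun h0 => hp ((A.z_eq_zero_iff hU.1).1 h0)) ?_ L hL hu
    have h1 := hU.2
    rw [← Complex.sq_norm] at h1
    have : b < ρ ^ 2 := by rw [hb]; nlinarith [sq_pos_of_pos hρ]
    exact lt_of_pow_lt_pow_left₀ 2 hρ.le (h1.trans_lt this)
  have hphi : ∀ {p : X}, p ∈ A.nbhd →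
      ∀ᶠ x in 𝓝 p, A.modulus a b x ^ s = (fun x => cutoff a b x ^ s) (normSq (A.z x)) := fun hp =>
    (A.modulus_eventually_eq hp).mono fun x hx => by rw [hx]
  have hf : ∀ {p : X}, p ∈ A.nbhd → ∀ᶠ x in 𝓝 p, -(1 / 2) * Real.log (A.modulus a b x)
      = (fun x => -(1 / 2) * Real.log (cutoff a b x)) (normSq (A.z x)) := fun hp =>
    (A.modulus_eventually_eq hp).mono fun x hx => by rw [hx]
  have hFs' : ∀ {x : ℝ}, 0 < x → ContDiffAt ℝ 2 (fun x => cutoff a b x ^ s) x := fun hx =>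
    (hFs.contDiffAt (Ioi_mem_nhds hx)).of_le (by norm_cast)
  have hFl' : ∀ {x : ℝ}, 0 < x → ContDiffAt ℝ 2 (fun x => -(1 / 2) * Real.log (cutoff a b x)) x :=
    fun hx => (hFl.contDiffAt (Ioi_mem_nhds hx)).of_le (by norm_cast)
  refine ⟨a, b, K, ha0, hab, hb1, hK0, ?_, ?_, ?_, ?_, ?_, ?_, ?_⟩
  · intro p hp
    exact Real.rpow_nonneg (A.modulus_pos (ha0.trans hab) hp).le s
  · intro p hp
    have := Real.log_nonpos (A.modulus_pos (a := a) (ha0.trans hab) hp).le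
      ((A.modulus_le hab p).trans hb1.le)
    linarith
  · intro R
    have e : {p | p ∈ A.W ∧ -(1 / 2) * Real.log (A.modulus a b p) ≤ R}
        = {p | Real.exp (-2 * R) ≤ A.modulus a b p} := by
      ext p
      constructor
      · rintro ⟨hp, h⟩
        rw [mem_ofPred_eq, ← Real.le_log_iff_exp_le (A.modulus_pos (ha0.trans hab) hp)]
        linarith
      · intro h
        have hpos : 0 < A.modulus a b p := (Real.exp_pos _).trans_le h
        refine ⟨fun hD => ?_, ?_⟩
        · rw [A.modulus_eq_zero ha0 hab hD] at hpos; exact lt_irrefl _ hpos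
        · have := (Real.le_log_iff_exp_le hpos).2 h
          linarith
    rw [e]
    exact (isClosed_le continuous_const (A.continuous_modulus hab hb1)).isCompact
  · intro p hp
    by_cases h : p ∈ A.nbhd ∧ normSq (A.z p) ≤ b
    · exact (A.levi_comp_normSq h.1 (hFs' (hzpos hp h.1)) (hphi h.1)).1
    · exact (levi_eventually_const (g := fun x => A.modulus a b x ^ s)
        ((A.modulus_eventually_const hab hb1 h).mono fun x hx => by rw [hx])).1
  · intro p hp
    by_cases h : p ∈ A.nbhd ∧ normSq (A.z p) ≤ b
    · exact (A.levi_comp_normSq h.1 (hFl' (hzpos hp h.1)) (hf h.1)).1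
    · exact (levi_eventually_const (g := fun x => -(1 / 2) * Real.log (A.modulus a b x))
        ((A.modulus_eventually_const hab hb1 h).mono fun x hx => by rw [hx])).1
  · intro p hp L hL hu
    have hφ0 : 0 ≤ A.modulus a b p ^ s := Real.rpow_nonneg (A.modulus_pos (ha0.trans hab) hp).le s
    by_cases h : p ∈ A.nbhd ∧ normSq (A.z p) ≤ b
    · have hx := hzpos hp h.1
      have hG := hΓ' hp h L hL hu
      have hG0 : 0 ≤ ∑ j, normSq (A.dz p (L (Pi.single j 1))) :=
        Finset.sum_nonneg fun j _ => normSq_nonneg _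
      have hm : A.modulus a b p = cutoff a b (normSq (A.z p)) :=
        (A.modulus_eventually_eq h.1).self_of_nhds
      have e := (A.levi_comp_normSq h.1 (hFs' hx) (hphi h.1)).2
      simp_rw [e]
      rw [← Finset.mul_sum]
      -- the cutoff is the identity below `a`; on `[a, b]` the bound comes from compactness
      rcases lt_or_ge (normSq (A.z p)) a with hlt | hge
      · have h1 : (fun x => cutoff a b x ^ s) =ᶠ[𝓝 (normSq (A.z p))] fun x => x ^ s := by
          filter_upwards [gt_mem_nhds hlt] with x hx
          rw [cutoff_of_le hab (le_of_lt hx)]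
        obtain ⟨h2, h3⟩ := deriv_eq_of_eqOn_nhds h1
        rw [h2, h3, laplace_rpow hx, hm, cutoff_of_le hab hlt.le]
        have hxs : 0 ≤ normSq (A.z p) ^ s := Real.rpow_nonneg hx.le s
        calc _ ≤ 4 * (s ^ 2 * normSq (A.z p) ^ s / normSq (A.z p)) * (C * normSq (A.z p)) :=
              mul_le_mul_of_nonneg_left hG (by positivity)
          _ = 4 * s ^ 2 * C * normSq (A.z p) ^ s := by field_simp
          _ ≤ _ := mul_le_mul_of_nonneg_right hK1 hxs
      · have h1 := hM₁' _ ⟨hge, h.2⟩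
        have h2 : a ^ s ≤ A.modulus a b p ^ s := by
          refine Real.rpow_le_rpow ha0.le ?_ hs.le
          rw [hm]
          exact (le_min hge hab.le).trans min_le_cutoff
        calc _ ≤ M₁ * ∑ j, normSq (A.dz p (L (Pi.single j 1))) :=
              mul_le_mul_of_nonneg_right h1 hG0
          _ ≤ M₁ * C := by
              refine mul_le_mul_of_nonneg_left (hG.trans ?_) hM₁
              exact mul_le_of_le_one_right hC (A.normSq_lt_one h.1).le
          _ = M₁ * C / a ^ s * a ^ s := by field_simp
          _ ≤ K * A.modulus a b p ^ s := mul_le_mul hK2 h2 has.le hK0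
    · have e := (levi_eventually_const (g := fun x => A.modulus a b x ^ s)
        ((A.modulus_eventually_const hab hb1 h).mono fun x hx => by rw [hx])).2
      simp_rw [e]
      simpa using mul_nonneg hK0 hφ0
  · intro p hp L hL hu
    by_cases h : p ∈ A.nbhd ∧ normSq (A.z p) ≤ b
    · have hx := hzpos hp h.1
      have hG := hΓ' hp h L hL hu
      have hG0 : 0 ≤ ∑ j, normSq (A.dz p (L (Pi.single j 1))) :=
        Finset.sum_nonneg fun j _ => normSq_nonneg _
      have e := (A.levi_comp_normSq h.1 (hFl' hx) (hf h.1)).2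
      simp_rw [e]
      rw [← Finset.mul_sum]
      rcases lt_or_ge (normSq (A.z p)) a with hlt | hge
      · have h1 : (fun x => -(1 / 2) * Real.log (cutoff a b x)) =ᶠ[𝓝 (normSq (A.z p))]
            fun x => -(1 / 2) * Real.log x := by
          filter_upwards [gt_mem_nhds hlt] with x hx
          rw [cutoff_of_le hab (le_of_lt hx)]
        obtain ⟨h2, h3⟩ := deriv_eq_of_eqOn_nhds h1
        rw [h2, h3, laplace_log hx]
        simpa using hK0
      · calc _ ≤ M₂ * ∑ j, normSq (A.dz p (L (Pi.single j 1))) :=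
              mul_le_mul_of_nonneg_right (hM₂' _ ⟨hge, h.2⟩) hG0
          _ ≤ M₂ * C := by
              refine mul_le_mul_of_nonneg_left (hG.trans ?_) hM₂
              exact mul_le_of_le_one_right hC (A.normSq_lt_one h.1).le
          _ ≤ K := hK3
    · have e := (levi_eventually_const (g := fun x => -(1 / 2) * Real.log (A.modulus a b x))
        ((A.modulus_eventually_const hab hb1 h).mono fun x hx => by rw [hx])).2
      simp_rw [e]
      simpa using hK0

/-! ### Decay of the curvature of the reference metric -/

theorem mfderiv_z_eq {p : X} (hp : p ∈ A.nbhd) (u : V 3) :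
    mfderiv 𝓘(ℂ, V 3) 𝓘(ℂ, ℂ) A.z p u = A.dz p u := by
  have h1 : MDifferentiableAt 𝓘(ℂ, V 3) 𝓘(ℂ, ℂ) A.z p :=
    (A.z_holo _ hp).mdifferentiableAt (A.isOpen_nbhd.mem_nhds hp)
  have h2 := A.differentiableAt_z_complex (mem_chart_target (V 3) p)
    (by rwa [(chartAt (V 3) p).left_inv (mem_chart_source _ p)])
  rw [h1.mfderiv, dz, h2.fderiv_restrictScalars ℝ]
  rw [modelWithCornersSelf_coe, range_id, fderivWithin_univ]
  rfl

/-- The derivative of the embedding of the divisor, in the preferred charts. -/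
def demb (x : D) : V 2 →L[ℝ] V 3 :=
  fderiv ℝ (fun y => chartAt (V 3) (A.tube (x, 0)) (A.tubeMap x (y, 0))) (chartAt (V 2) x x)

theorem zero_mem_tubeDom {d : D} {y : V 2} (hy : y ∈ (chartAt (V 2) d).target) :
    (y, (0 : ℂ)) ∈ tubeDom d := ⟨hy, by simp⟩

/-- The derivative of a restriction to the divisor. -/
theorem hasFDerivAt_tubeMap_slice {d : D} {y : V 2} (hy : y ∈ (chartAt (V 2) d).target) {p : X}
    (hp : A.tubeMap d (y, 0) ∈ (chartAt (V 3) p).source) :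
    HasFDerivAt (fun y => chartAt (V 3) p (A.tubeMap d (y, 0)))
      ((fderiv ℝ (fun q => chartAt (V 3) p (A.tubeMap d q)) (y, 0)).comp
        (ContinuousLinearMap.inl ℝ (V 2) ℂ)) y := by
  have h1 := ((A.contDiffAt_chart_tubeMap (zero_mem_tubeDom hy) hp).differentiableAt
    (by simp)).hasFDerivAt
  exact HasFDerivAt.comp (f := fun y : V 2 => (y, (0 : ℂ))) y h1 (hasFDerivAt_prodMk_left y 0)

theorem tube_mem_source (x : D) : A.tubeMap x (chartAt (V 2) x x, 0)
    ∈ (chartAt (V 3) (A.tube (x, 0))).source := by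
  rw [A.tubeMap_chart x x (mem_chart_source _ x)]; exact mem_chart_source _ _

theorem demb_eq (x : D) : A.demb x =
    (fderiv ℝ (fun q => chartAt (V 3) (A.tube (x, 0)) (A.tubeMap x q)) (chartAt (V 2) x x, 0)).comp
        (ContinuousLinearMap.inl ℝ (V 2) ℂ) :=
  (A.hasFDerivAt_tubeMap_slice (mem_chart_target _ x) (A.tube_mem_source x)).fderiv

theorem tubeMap_zero (d : D) (y : V 2) : A.tubeMap d (y, 0) = A.emb ((chartAt (V 2) d).symm y) :=
  A.tube_zero _

theorem demb_I_smul (x : D) (u : V 2) : A.demb x (I • u) = I • A.demb x u := by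
  refine fderiv_real_I_smul ?_ u
  have e : A.tube (x, 0) = A.emb x := A.tube_zero x
  have h1 : MDifferentiableAt 𝓘(ℂ, V 2) 𝓘(ℂ, V 3) A.emb
      ((chartAt (V 2) x).symm (chartAt (V 2) x x)) :=
    (A.emb_holo.contMDiffAt).mdifferentiableAt (by simp)
  have h2 : MDifferentiableAt 𝓘(ℂ, V 2) 𝓘(ℂ, V 2)
      (chartAt (V 2) x).symm (chartAt (V 2) x x) :=
    ((contMDiffOn_chart_symm (I := 𝓘(ℂ, V 2)) (n := ω) (x := x)).contMDiffAt
      ((chartAt (V 2) x).open_target.mem_nhds (mem_chart_target _ x))).mdifferentiableAt (by simp)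
  have h3 : MDifferentiableAt 𝓘(ℂ, V 3) 𝓘(ℂ, V 3)
      (chartAt (V 3) (A.tube (x, 0))) (A.emb ((chartAt (V 2) x).symm (chartAt (V 2) x x))) := by
    refine ((contMDiffOn_chart (I := 𝓘(ℂ, V 3)) (n := ω)
      (x := A.tube (x, 0))).contMDiffAt ((chartAt (V 3) _).open_source.mem_nhds ?_)).mdifferentiableAt
      (by simp)
    rw [(chartAt (V 2) x).left_inv (mem_chart_source _ x), e]; exact mem_chart_source _ _
  rw [← mdifferentiableAt_iff_differentiableAt]
  have h4 : (fun y => chartAt (V 3) (A.tube (x, 0)) (A.tubeMap x (y, 0)))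
      = (chartAt (V 3) (A.tube (x, 0))) ∘ A.emb ∘ (chartAt (V 2) x).symm := by
    funext y; rw [A.tubeMap_zero]; rfl
  rw [h4]
  exact MDifferentiableAt.comp (f := A.emb ∘ (chartAt (V 2) x).symm) (chartAt (V 2) x x) h3
    (h1.comp _ h2)

theorem demb_injective (x : D) : Function.Injective (A.demb x) := by
  rw [A.demb_eq x]
  exact (A.injective_fderiv_tubeMap (zero_mem_tubeDom (mem_chart_target _ x))
    (A.tube_mem_source x)).comp fun u v h => congrArg Prod.fst h

theorem dz_demb (x : D) (u : V 2) : A.dz (A.tube (x, 0)) (A.demb x u) = 0 := by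
  have hU : A.tube (x, 0) ∈ A.nbhd := ⟨(x, 0), ⟨mem_univ _, by simp⟩, rfl⟩
  have h1 := A.hasFDerivAt_tubeMap_slice (mem_chart_target _ x) (A.tube_mem_source x)
  rw [← A.demb_eq x] at h1
  have e : A.tubeMap x (chartAt (V 2) x x, 0) = A.tube (x, 0) :=
    A.tubeMap_chart x x (mem_chart_source _ x) 0
  have h2 : HasFDerivAt (fun y => A.z ((chartAt (V 3) (A.tube (x, 0))).symm y))
      (A.dz (A.tube (x, 0)))
      (chartAt (V 3) (A.tube (x, 0)) (A.tubeMap x (chartAt (V 2) x x, 0))) := by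
    rw [e]; exact ((A.contDiffAt_z hU).differentiableAt (by simp)).hasFDerivAt
  have h3 := HasFDerivAt.comp (f := fun y => chartAt (V 3) (A.tube (x, 0)) (A.tubeMap x (y, 0)))
    _ h2 h1
  have h4 := h3.congr_of_eventuallyEq (f₁ := fun _ => (0 : ℂ)) (by
    have hc : ContinuousAt (fun y : V 2 => A.tubeMap x (y, 0)) (chartAt (V 2) x x) :=
      ContinuousAt.comp (f := fun y : V 2 => (y, (0 : ℂ)))
        (A.continuousAt_tubeMap (zero_mem_tubeDom (mem_chart_target _ x))) (by fun_prop)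
    filter_upwards [(chartAt (V 2) x).open_target.mem_nhds (mem_chart_target _ x),
      hc.eventually ((chartAt (V 3) _).open_source.mem_nhds (A.tube_mem_source x))] with y h5 h6
    rw [Function.comp_apply, (chartAt (V 3) _).left_inv h6, A.z_tubeMap (zero_mem_tubeDom h5)])
  exact congrArg (fun T : V 2 →L[ℝ] ℂ => T u) (h4.unique (hasFDerivAt_const _ _))

theorem mfderiv_emb_eq (x : D) :
    (mfderiv 𝓘(ℝ, V 2) 𝓘(ℝ, V 3) A.emb x : V 2 →L[ℝ] V 3)
      = fderiv ℝ (fun y => chartAt (V 3) (A.emb x) (A.emb ((chartAt (V 2) x).symm y)))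
        (chartAt (V 2) x x) := by
  have h : MDifferentiableAt 𝓘(ℝ, V 2) 𝓘(ℝ, V 3)
      A.emb x := by
    rw [mdifferentiableAt_iff]
    refine ⟨A.emb_holo.continuous.continuousAt, ?_⟩
    rw [modelWithCornersSelf_coe, range_id, differentiableWithinAt_univ]
    have h1 := (A.hasFDerivAt_tubeMap_slice (mem_chart_target _ x) (A.tube_mem_source x)).differentiableAt
    have e : A.tube (x, 0) = A.emb x := A.tube_zero x
    simp only [e, A.tubeMap_zero] at h1
    exact h1
  rw [h.mfderiv, modelWithCornersSelf_coe, range_id, fderivWithin_univ]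
  rfl

theorem pullback_emb_apply (κ : KForm (V 3) 2 X ℝ) (x : D) (u v : V 2) :
    pullback A.emb κ x ![u, v] = κ (A.tube (x, 0)) ![A.demb x u, A.demb x v] := by
  have key : ∀ (p : X), p = A.emb x → κ (A.emb x)
      ![fderiv ℝ (fun y => chartAt (V 3) (A.emb x) (A.emb ((chartAt (V 2) x).symm y)))
        (chartAt (V 2) x x) u, fderiv ℝ (fun y => chartAt (V 3) (A.emb x)
        (A.emb ((chartAt (V 2) x).symm y))) (chartAt (V 2) x x) v]
      = κ p ![fderiv ℝ (fun y => chartAt (V 3) p (A.tubeMap x (y, 0))) (chartAt (V 2) x x) u,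
        fderiv ℝ (fun y => chartAt (V 3) p (A.tubeMap x (y, 0))) (chartAt (V 2) x x) v] := by
    rintro p rfl
    simp only [A.tubeMap_zero]
  rw [demb, ← key _ (A.tube_zero x), ← A.mfderiv_emb_eq x]
  simp only [pullback]
  refine congrArg (κ (A.emb x)) ?_
  funext i; fin_cases i <;> rfl

/-- The derivative of the embedding of the divisor, as a complex linear map. -/
def dembComplex (x : D) : V 2 →ₗ[ℂ] V 3 where
  toFun := A.demb x
  map_add' := map_add _
  map_smul' c v := by
    have e : c • v = c.re • v + c.im • (I • v) := by
      ext i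
      simp only [Pi.smul_apply, Pi.add_apply, smul_eq_mul, real_smul]
      conv_lhs => rw [← re_add_im c]
      ring
    rw [e, map_add, map_smul, map_smul, A.demb_I_smul]
    ext i
    simp only [Pi.smul_apply, Pi.add_apply, smul_eq_mul, real_smul, RingHom.id_apply]
    conv_rhs => rw [← re_add_im c]
    ring

theorem linearIndependent_demb (x : D) :
    LinearIndependent ℂ fun j : Fin 2 => A.demb x (Pi.single j (1 : ℂ)) := by
  have h1 : LinearIndependent ℂ fun j : Fin 2 => (Pi.single j 1 : V 2) := by
    have e : ⇑(Pi.basisFun ℂ (Fin 2)) = fun j => Pi.single j 1 := by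
      funext j; exact Pi.basisFun_apply ..
    rw [← e]; exact (Pi.basisFun ℂ (Fin 2)).linearIndependent
  exact h1.map' (A.dembComplex x) (LinearMap.ker_eq_bot.2 (A.demb_injective x))

theorem realFrame_demb (x : D) (a : Fin 2 × Fin 2) :
    realFrame (fun j : Fin 2 => A.demb x (Pi.single j (1 : ℂ))) a = A.demb x (stdFrame 2 a) := by
  unfold stdFrame realFrame
  split_ifs
  · rfl
  · rw [A.demb_I_smul]

/-- The contraction on the divisor computed inside the threefold. -/
theorem pairing_kappaI_eq_traceForm {r : ℕ} {κ : KForm (V 3) 2 X ℝ}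
    (hκ : A.IsSliceKaehler 0 κ) (x : D) (F : V 3 → V 3 → 𝕄(r)) :
    pairing (skew (stdFrame 2) (A.kappaI x)) (fun a a' =>
      F (A.demb x (stdFrame 2 a)) (A.demb x (stdFrame 2 a')))
      = traceForm (realFrame fun j : Fin 2 => A.demb x (Pi.single j (1 : ℂ)))
        (κ (A.tube (x, 0))) F := by
  have hκI : ∀ u v, κ (A.tube (x, 0)) ![A.demb x u, A.demb x v] = A.kappaI x ![u, v] := fun u v => by
    rw [← A.pullback_emb_apply, hκ.at_zero rfl x]
  have hg : gram (realFrame fun j : Fin 2 => A.demb x (Pi.single j (1 : ℂ))) (κ (A.tube (x, 0)))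
      = gram (stdFrame 2) (A.kappaI x) := by
    ext a c
    simp only [gram, of_apply, realFrame_demb]
    rw [← A.demb_I_smul, hκI]
  have e1 : traceForm (stdFrame 2) (A.kappaI x) (fun v w => F (A.demb x v) (A.demb x w))
      = traceForm (realFrame fun j : Fin 2 => A.demb x (Pi.single j (1 : ℂ)))
        (κ (A.tube (x, 0))) F := by
    simp only [traceForm, hg, realFrame_demb, hκI]
  rw [← e1]
  have h := traceForm_eq_pairing (n := 2) (m := 2) (fun j : Fin 2 => Pi.single j (1 : ℂ))
    (A.kappaI x) (A.divisor_calabiYau.kaehler.type11 x (mem_univ _))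
    (fun v w => F (A.demb x v) (A.demb x w))
  rw [stdFrame, h]

/-- The frame `∂_y, ∂_s, ∂_α` as a function of `(y, w)`; it extends smoothly to `w = 0`, where the
last two vectors vanish. -/
def tubeVec (d : D) (p : X) (q : V 2 × ℂ) (a : EndIdx) : V 3 :=
  fderiv ℝ (fun q => chartAt (V 3) p (A.tubeMap d q)) q ((cylFrame a).1, -q.2 * (cylFrame a).2)

theorem tubeVec_inr_zero (d : D) (p : X) (y : V 2) (i : Fin 2) :
    A.tubeVec d p (y, 0) (Sum.inr i) = 0 := by
  have : ((cylFrame (Sum.inr i)).1, -(0 : ℂ) * (cylFrame (Sum.inr i)).2) = (0 : V 2 × ℂ) := by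
    simp [cylFrame]
  rw [tubeVec]; dsimp only; rw [this, map_zero]

theorem contDiffAt_tubeVec {d : D} {p : X} {q : V 2 × ℂ} (hq : q ∈ tubeDom d)
    (hp : A.tubeMap d q ∈ (chartAt (V 3) p).source) (a : EndIdx) :
    ContDiffAt ℝ 1 (fun q => A.tubeVec d p q a) q := by
  have h := (A.contDiffAt_chart_tubeMap hq hp).fderiv_right (m := 1) (by norm_cast)
  refine h.clm_apply (contDiffAt_const.prodMk ?_)
  exact contDiffAt_snd.neg.mul contDiffAt_const

variable {r : ℕ} {E : X → Type*} [∀ x, AddCommGroup (E x)] [∀ x, Module ℂ (E x)]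
  [TopologicalSpace (TotalSpace (V r) E)] [∀ x, TopologicalSpace (E x)]
  [FiberBundle (V r) E] [VectorBundle ℂ (V r) E]
  [ContMDiffVectorBundle ω (V r) E 𝓘(ℂ, V 3)]

/-- The Hermitian Yang-Mills equation on the divisor, at a point, with respect to `κ_I`. -/
theorem pairing_kappaI_eq_zero {κ : KForm (V 3) 2 X ℝ} {H₀ : HermitianMetric E}
    (hκ : A.IsSliceKaehler 0 κ) (hH : A.IsSliceHYM r 0 κ H₀) (x : D) :
    pairing (skew (stdFrame 2) (A.kappaI x)) (fun a a' => curvature 3 r H₀ (A.tube (x, 0))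
      (A.demb x (stdFrame 2 a)) (A.demb x (stdFrame 2 a'))) = 0 := by
  have hU : A.tube (x, 0) ∈ A.nbhd := ⟨(x, 0), ⟨mem_univ _, by simp⟩, rfl⟩
  have h0 := hH x (fun j : Fin 2 => A.demb x (Pi.single j (1 : ℂ))) (A.linearIndependent_demb x)
    fun j => by rw [A.mfderiv_z_eq hU]; exact A.dz_demb x _
  generalize curvature 3 r H₀ (A.tube (x, 0)) = F at h0 ⊢
  rw [A.pairing_kappaI_eq_traceForm hκ, h0]

/-- The Hermitian Yang-Mills equation on the divisor, near a point, in the frame at that point. -/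
theorem pairing_slice_eq_zero {κ : KForm (V 3) 2 X ℝ} {H₀ : HermitianMetric E}
    (hκ : A.IsSliceKaehler 0 κ) (hH : A.IsSliceHYM r 0 κ H₀) (hs : SmoothMetric 3 r univ H₀)
    {d : D} {p : X} {y : V 2} (hy : y ∈ (chartAt (V 2) d).target)
    (hp : A.tubeMap d (y, 0) ∈ (chartAt (V 3) p).source)
    (hpb : A.tubeMap d (y, 0) ∈ baseSet r E p) :
    pairing (skew (stdFrame 2) (inChart d A.kappaI y)) (fun a a' =>
      curv (hermMatrix 3 r H₀ p) (chartAt (V 3) p (A.tubeMap d (y, 0)))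
      (fderiv ℝ (fun q => chartAt (V 3) p (A.tubeMap d q)) (y, 0) (stdFrame 2 a, 0))
      (fderiv ℝ (fun q => chartAt (V 3) p (A.tubeMap d q)) (y, 0) (stdFrame 2 a', 0))) = 0 := by
  set x := (chartAt (V 2) d).symm y
  set p' := A.tube (x, 0)
  have hpt : A.tubeMap d (y, 0) = p' := rfl
  set Y := chartAt (V 3) p p'
  have eY : (chartAt (V 3) p).symm Y = p' := (chartAt (V 3) p).left_inv hp
  have hYc : Y ∈ chartFrame 3 r E p := ⟨(chartAt (V 3) p).map_source hp, by
    rw [mem_preimage, eY]; exact hpb⟩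
  have hYo : Y ∈ frameOverlap r E p p' := by
    have := mem_frameOverlap_of_mem_chartFrame hYc
    rwa [eY] at this
  have hYo1 : coordChange p p' Y = chartAt (V 3) p' p' := by rw [coordChange, eY]
  have hov : y ∈ overlap d x := overlap_self hy
  set D' := fderiv ℝ (coordChange d x) y
  set DΨ := fderiv ℝ (fun q => chartAt (V 3) p (A.tubeMap d q)) (y, 0)
  set Dc := fderiv ℝ (coordChange p p') Y
  have hsm : SmoothMatAt 2 (hermMatrix 3 r H₀ p') (chartAt (V 3) p' p') :=
    (SmoothMetric.smoothMatAt isOpen_univ hs (chart_mem_frameDomain (mem_univ p'))).mono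
      (by norm_cast)
  have hd : (hermMatrix 3 r H₀ p' (chartAt (V 3) p' p')).det ≠ 0 :=
    (hermMatrix_posDef H₀ (chart_mem_chartFrame (r := r) p').2).det_pos.ne'
  -- two ways to compute the derivative of the restriction to the divisor
  have hchain : ∀ v : V 2, Dc (DΨ (v, 0)) = A.demb x (D' v) := fun v => by
    have h1 := A.hasFDerivAt_tubeMap_slice hy hp
    have h2 := ((contDiffAt_coordChange hYo.1).differentiableAt (by simp)).hasFDerivAt
    have h3 := HasFDerivAt.comp (f := fun y => chartAt (V 3) p (A.tubeMap d (y, 0))) y h2 h1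
    have h4 : HasFDerivAt (fun y => chartAt (V 3) p' (A.tubeMap x (y, 0))) (A.demb x)
        (coordChange d x y) := by
      have := A.hasFDerivAt_tubeMap_slice (mem_chart_target _ x) (A.tube_mem_source x)
      rwa [← A.demb_eq x] at this
    have h5 := ((contDiffAt_coordChange hov).differentiableAt (by simp)).hasFDerivAt
    have h6 := h4.comp y h5
    have hc : ContinuousAt (fun y : V 2 => A.tubeMap d (y, 0)) y :=
      ContinuousAt.comp (f := fun y : V 2 => (y, (0 : ℂ)))
        (A.continuousAt_tubeMap (zero_mem_tubeDom hy)) (by fun_prop)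
    have h7 := h6.congr_of_eventuallyEq
      (f₁ := coordChange p p' ∘ fun y => chartAt (V 3) p (A.tubeMap d (y, 0))) (by
      filter_upwards [(isOpen_overlap d x).mem_nhds hov,
        hc.eventually ((chartAt (V 3) p).open_source.mem_nhds hp)] with y1 hy1 hy2
      simp only [Function.comp_apply, coordChange]
      rw [(chartAt (V 3) p).left_inv hy2]
      simp only [tubeMap]
      rw [(chartAt (V 2) x).left_inv hy1.2])
    exact congrArg (fun T : V 2 →L[ℝ] V 3 => T v) (h3.unique h7)
  set τ := transMatrix r E p p' Y
  have hτd : IsUnit τ.det := (transMatrix_det_ne_zero hYo).isUnit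
  obtain ⟨B, hB⟩ := exists_bilin_curv hsm hd
  have hcurv : ∀ v w : V 2, curv (hermMatrix 3 r H₀ p) Y (DΨ (v, 0)) (DΨ (w, 0))
      = τ⁻¹ * B (A.demb x (D' v)) (A.demb x (D' w)) * τ := fun v w => by
    have h1 : τ * curv (hermMatrix 3 r H₀ p) Y (DΨ (v, 0)) (DΨ (w, 0))
        = curv (hermMatrix 3 r H₀ p') (coordChange p p' Y) (Dc (DΨ (v, 0))) (Dc (DΨ (w, 0))) * τ :=
      curv_hermMatrix_trans H₀ hYo (by rw [hYo1]; exact hsm) _ _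
    rw [hYo1, hchain, hchain, hB] at h1
    rw [mul_assoc, ← h1, nonsing_inv_mul_cancel_left _ _ hτd]
  have hdet : LinearMap.det (D' : V 2 →ₗ[ℝ] V 2) ≠ 0 := by
    intro h
    have := LinearMap.bot_lt_ker_of_det_eq_zero h
    obtain ⟨u, hu, hu0⟩ := (Submodule.ne_bot_iff _).1 this.ne'
    exact hu0 ((fderiv_coordChange_eq_zero_iff hov u).1 hu)
  set T : V 2 →ₗ[ℝ] V 3 := (A.demb x : V 2 →ₗ[ℝ] V 3)
  have h3 := pairing_comp (D' : V 2 →ₗ[ℝ] V 2) hdet (A.kappaI x) (B.compl₁₂ T T)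
  have h4 : pairing (skew (stdFrame 2) (A.kappaI x))
      (fun a a' => B.compl₁₂ T T (stdFrame 2 a) (stdFrame 2 a')) = 0 := by
    rw [← A.pairing_kappaI_eq_zero hκ hH x]
    congr 1
    funext a a'
    exact (hB _ _).symm
  rw [h4] at h3
  have h5 : skew (stdFrame 2) (inChart d A.kappaI y)
      = skew (fun a => (D' : V 2 →ₗ[ℝ] V 2) (stdFrame 2 a)) (A.kappaI x) := by
    ext a c; exact inChart_pair hy _ _
  have h6 : (fun a a' : Fin 2 × Fin 2 => curv (hermMatrix 3 r H₀ p) Y (DΨ (stdFrame 2 a, 0))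
      (DΨ (stdFrame 2 a', 0))) = fun a a' => τ⁻¹ * (B.compl₁₂ T T ((D' : V 2 →ₗ[ℝ] V 2)
        (stdFrame 2 a)) ((D' : V 2 →ₗ[ℝ] V 2) (stdFrame 2 a'))) * τ := by
    funext a a'; rw [hcurv]; rfl
  rw [hpt]
  change pairing _ (fun a a' : Fin 2 × Fin 2 => curv (hermMatrix 3 r H₀ p) Y
    (DΨ (stdFrame 2 a, 0)) (DΨ (stdFrame 2 a', 0))) = 0
  rw [h6, pairing_conj, h5, h3, mul_zero, zero_mul]

theorem mem_W_of_z_ne_zero {p : X} (hp : p ∈ A.nbhd) (hz : A.z p ≠ 0) : p ∈ A.W :=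
  fun h => hz ((A.z_eq_zero_iff hp).2 h)

/-- The contracted curvature at a point of the end, computed in the cylinder frame. -/
theorem hatLocal_eq_pairing_endMat {H₀ : HermitianMetric E} (hs : SmoothMetric 3 r univ H₀)
    {d : D} {p : X} {q : V 2 × ℂ} (hq : q.1 ∈ (chartAt (V 2) d).target) (hre : 0 < q.2.re)
    (hp : cylMap A.tube d q ∈ (chartAt (V 3) p).source) (hpb : cylMap A.tube d q ∈ baseSet r E p)
    (hdet : (A.endMat d q).det ≠ 0) :
    hatLocal A.om H₀ p (chartAt (V 3) p (cylMap A.tube d q))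
      = pairing (A.endMat d q) (fun a a' =>
        curv (hermMatrix 3 r H₀ p) (chartAt (V 3) p (cylMap A.tube d q))
          (A.endVec d p q a) (A.endVec d p q a')) := by
  set p' := cylMap A.tube d q with hp'
  set Y := chartAt (V 3) p p' with hY
  have eY : (chartAt (V 3) p).symm Y = p' := (chartAt (V 3) p).left_inv hp
  have hYt : Y ∈ (chartAt (V 3) p).target := (chartAt (V 3) p).map_source hp
  have hq' := mem_tubeDom_exp hq hre
  have hpW : p' ∈ A.W := A.mem_W_of_z_ne_zero (A.tubeMap_mem_nbhd hq') (by
    have : A.z p' = Complex.exp (-q.2) := A.z_tubeMap hq'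
    rw [this]; exact Complex.exp_ne_zero _)
  have hYb : (chartAt (V 3) p).symm Y ∈ baseSet r E p := by rw [eY]; exact hpb
  have hYf : Y ∈ frameDomain 3 r E univ p := ⟨hYt, mem_univ _, hYb⟩
  have hsm : SmoothMatAt 2 (hermMatrix 3 r H₀ p) Y :=
    (SmoothMetric.smoothMatAt isOpen_univ hs hYf).mono (by norm_cast)
  have hd : (hermMatrix 3 r H₀ p Y).det ≠ 0 := (hermMatrix_posDef H₀ hYb).det_pos.ne'
  have h11 : ∀ u v : V 3, inChart p A.om Y ![I • u, I • v] = inChart p A.om Y ![u, v] :=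
    inChart_type11 hYt (by rw [eY]; exact A.calabiYau.kaehler.type11 p' hpW)
  obtain ⟨B, hB⟩ := exists_bilin_curv hsm hd
  obtain ⟨σ⟩ : Nonempty (Fin 3 × Fin 2 ≃ EndIdx) := ⟨Fintype.equivOfCardEq (by decide)⟩
  have hE := A.endMat_eq_skew hq hre hp
  rw [← hp', ← hY] at hE
  have h1 := traceForm_eq_pairing (n := 3) (fun j : Fin 3 => Pi.single j (1 : ℂ))
    (inChart p A.om Y) h11 (fun u v => B u v)
  have h2 := pairing_frame σ (A.endVec d p q) (inChart p A.om Y) (hE ▸ hdet) B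
  have h3 : curv (hermMatrix 3 r H₀ p) Y = fun u v => B u v := by
    funext u v; exact hB u v
  rw [hatLocal, h3, hE, ← h2]
  exact h1

theorem tubeVec_inl (d : D) (p : X) (q : V 2 × ℂ) (a : Fin 2 × Fin 2) :
    A.tubeVec d p q (Sum.inl a)
      = fderiv ℝ (fun q => chartAt (V 3) p (A.tubeMap d q)) q (stdFrame 2 a, 0) := by
  simp [tubeVec, cylFrame]

/-- Near a point of the divisor, the contracted curvature of a reference metric decays like a power
of the distance. -/
theorem exists_norm_hatLocal_le {H₀ : HermitianMetric E} (hH₀ : SmoothMetric 3 r univ H₀)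
    {κ : KForm (V 3) 2 X ℝ} (hκ : A.IsSliceKaehler 0 κ) (hHs : A.IsSliceHYM r 0 κ H₀)
    {rate : ℝ} (d : D)
    (hend : ∃ C, 0 ≤ C ∧ ∀ᶠ q in endFilter (chartAt (V 2) d d),
      (A.endMat d q).det ≠ 0 ∧ |(A.endMat d q).det| ≤ C ∧ (∀ a b, |(A.endMat d q)⁻¹ a b| ≤ C) ∧
      ∀ a b, |(A.endMat d q)⁻¹ a b - (cylMat (inChart d A.kappaI q.1))⁻¹ a b|
        ≤ C * Real.exp (-rate * q.2.re)) :
    ∃ C, 0 ≤ C ∧ ∀ᶠ q in endFilter (chartAt (V 2) d d), ∀ i j,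
      ‖hatLocal (r := r) A.om H₀ (A.tube (d, 0)) (chartAt (V 3) (A.tube (d, 0)) (cylMap A.tube d q)) i j‖
        ≤ C * Real.exp (-(min rate 1) * q.2.re) := by
  obtain ⟨C, hC0, hC⟩ := hend
  set p := A.tube (d, 0)
  set y₀ := chartAt (V 2) d d
  have hq₀ : (y₀, (0 : ℂ)) ∈ tubeDom d := zero_mem_tubeDom (mem_chart_target _ d)
  have ep : A.tubeMap d (y₀, 0) = p := A.tubeMap_chart d d (mem_chart_source _ d) 0
  have hps : A.tubeMap d (y₀, 0) ∈ (chartAt (V 3) p).source := A.tube_mem_source d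
  have hpb : A.tubeMap d (y₀, 0) ∈ baseSet r E p := by rw [ep]; exact mem_baseSet p
  set G := hermMatrix 3 r H₀ p
  have hnear : ∀ᶠ q in 𝓝 (y₀, (0 : ℂ)), q ∈ tubeDom d ∧
      A.tubeMap d q ∈ (chartAt (V 3) p).source ∧ A.tubeMap d q ∈ baseSet r E p := by
    filter_upwards [(isOpen_tubeDom d).mem_nhds hq₀, (A.continuousAt_tubeMap hq₀).eventually
      ((chartAt (V 3) p).open_source.mem_nhds hps), (A.continuousAt_tubeMap hq₀).eventually
      ((isOpen_baseSet p).mem_nhds hpb)] with q h1 h2 h3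
    exact ⟨h1, h2, h3⟩
  -- the curvature in the frame `∂_y, ∂_s, ∂_α`, as a function of `(y, w)`
  set g : EndIdx → EndIdx → Fin r → Fin r → V 2 × ℂ → ℂ := fun a a' i j q =>
    curv G (chartAt (V 3) p (A.tubeMap d q)) (A.tubeVec d p q a) (A.tubeVec d p q a') i j with hg
  have hgs : ∀ a a' i j, ContDiffAt ℝ 1 (g a a' i j) (y₀, 0) := fun a a' i j => by
    have hY : chartAt (V 3) p (A.tubeMap d (y₀, 0)) ∈ frameDomain 3 r E univ p :=
      ⟨(chartAt (V 3) p).map_source hps, mem_univ _, by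
        rw [(chartAt (V 3) p).left_inv hps]; exact hpb⟩
    exact contDiffAt_curv_comp (Ψ := fun q => chartAt (V 3) p (A.tubeMap d q)) (q := (y₀, 0))
      (SmoothMetric.smoothMatAt isOpen_univ hH₀ hY)
      (hermMatrix_posDef H₀ hY.2.2).det_pos.ne'
      ((A.contDiffAt_chart_tubeMap hq₀ hps).of_le (by norm_cast))
      (A.contDiffAt_tubeVec hq₀ hps a) (A.contDiffAt_tubeVec hq₀ hps a') i j
  -- bounds and Lipschitz bounds for it
  have hbd : ∃ M K : ℝ, 0 ≤ K ∧ ∃ N ∈ 𝓝 (y₀, (0 : ℂ)), ∀ a a' i j,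
      (∀ q ∈ N, ‖g a a' i j q‖ ≤ M) ∧
      ∀ q ∈ N, ∀ q' ∈ N, ‖g a a' i j q - g a a' i j q'‖ ≤ K * ‖q - q'‖ := by
    choose K N hN hL using fun a a' i j => (hgs a a' i j).exists_lipschitzOnWith
    refine ⟨∑ a, ∑ a', ∑ i, ∑ j, (‖g a a' i j (y₀, 0)‖ + 1),
      ∑ a, ∑ a', ∑ i, ∑ j, (K a a' i j : ℝ), by positivity,
      {q | ∀ a a' i j, q ∈ N a a' i j ∧ ‖g a a' i j q‖ ≤ ‖g a a' i j (y₀, 0)‖ + 1}, ?_, ?_⟩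
    · have : ∀ᶠ q in 𝓝 (y₀, (0 : ℂ)), ∀ a a' i j, q ∈ N a a' i j ∧
          ‖g a a' i j q‖ ≤ ‖g a a' i j (y₀, 0)‖ + 1 := by
        simp only [eventually_all]
        intro a a' i j
        filter_upwards [hN a a' i j, (hgs a a' i j).continuousAt.norm.eventually
          (gt_mem_nhds (lt_add_one _))] with q h1 h2
        exact ⟨h1, h2.le⟩
      exact this
    · have hsum : ∀ (f : EndIdx → EndIdx → Fin r → Fin r → ℝ), (∀ a a' i j, 0 ≤ f a a' i j) →
          ∀ a a' i j, f a a' i j ≤ ∑ a, ∑ a', ∑ i, ∑ j, f a a' i j := fun f hf a a' i j =>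
        (le_sum_sum (hf a a') i j).trans (le_sum_sum (f := fun a a' => ∑ i, ∑ j, f a a' i j)
          (fun a a' => Finset.sum_nonneg fun i _ => Finset.sum_nonneg fun j _ => hf a a' i j) a a')
      refine fun a a' i j => ⟨fun q hq => (hq a a' i j).2.trans
        (hsum (fun a a' i j => ‖g a a' i j (y₀, 0)‖ + 1) (fun _ _ _ _ => by positivity) a a' i j),
        fun q hq q' hq' => ?_⟩
      have h1 := (hL a a' i j).dist_le_mul q (hq a a' i j).1 q' (hq' a a' i j).1
      rw [dist_eq_norm, dist_eq_norm] at h1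
      exact h1.trans (mul_le_mul_of_nonneg_right
        (hsum (fun a a' i j => (K a a' i j : ℝ)) (fun _ _ _ _ => NNReal.coe_nonneg _) a a' i j)
        (norm_nonneg _))
  obtain ⟨M, K, hK0, N, hN, hgN⟩ := hbd
  have hM0 : ∀ i j : Fin r, 0 ≤ M := fun i j =>
    (norm_nonneg _).trans ((hgN (Sum.inr 0) (Sum.inr 0) i j).1 _ (mem_of_mem_nhds hN))
  have ht := tendsto_endFilter_tube d
  have ht0 : Tendsto (fun q : V 2 × ℂ => (q.1, (0 : ℂ))) (endFilter y₀) (𝓝 (y₀, 0)) :=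
    tendsto_fst.prodMk_nhds tendsto_const_nhds
  refine ⟨(Fintype.card EndIdx : ℝ) ^ 2 * (C * K + C * |M|), by positivity, ?_⟩
  filter_upwards [hC, eventually_endFilter d, ht.eventually hnear, ht0.eventually hnear,
    ht.eventually hN, ht0.eventually hN] with q hq hqd hn hn0 hqN hqN0 i j
  obtain ⟨hdet, -, hinv, hinv'⟩ := hq
  rw [A.hatLocal_eq_pairing_endMat hH₀ hqd.1 hqd.2 hn.2.1 hn.2.2 hdet, pairing_apply]
  -- the limit at `w = 0` vanishes, by the equation on the divisor
  have hlim : pairing (cylMat (inChart d A.kappaI q.1)) (fun a a' => g a a' i j (q.1, 0)) = 0 := by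
    rw [pairing_cylMat (A.kappaI_det_ne_zero hqd.1)]
    · have h1 := A.pairing_slice_eq_zero hκ hHs hH₀ (p := p) hqd.1 hn0.2.1 hn0.2.2
      have h2 := congrFun (congrFun h1 i) j
      rw [pairing_apply] at h2
      refine Eq.trans ?_ h2
      congr 1
      funext a a'
      simp only [hg, tubeVec_inl]
      rfl
    · intro k a
      simp only [hg, tubeVec_inr_zero]
      have hY : chartAt (V 3) p (A.tubeMap d (q.1, 0)) ∈ frameDomain 3 r E univ p :=
        ⟨(chartAt (V 3) p).map_source hn0.2.1, mem_univ _, by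
          rw [(chartAt (V 3) p).left_inv hn0.2.1]; exact hn0.2.2⟩
      obtain ⟨B, hB⟩ := exists_bilin_curv (G := G)
        ((SmoothMetric.smoothMatAt isOpen_univ hH₀ hY).mono (by norm_cast))
        (hermMatrix_posDef H₀ hY.2.2).det_pos.ne'
      rw [hB, map_zero]; rfl
  -- the Kähler form contributes an error `e^{-rate s}`, and the variation of the curvature between
  -- `w` and `0` one of order `|w| = e^{-s}`
  have hexp : ∀ c, min rate 1 ≤ c → Real.exp (-c * q.2.re) ≤ Real.exp (-(min rate 1) * q.2.re) :=
    fun c hc => Real.exp_le_exp.2 (by nlinarith [hqd.2])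
  have hw : ‖((q.1, Complex.exp (-q.2)) : V 2 × ℂ) - (q.1, 0)‖ = Real.exp (-1 * q.2.re) := by
    rw [Prod.mk_sub_mk, sub_self, sub_zero, Prod.norm_def]
    dsimp only
    rw [norm_zero, norm_exp, neg_re, max_eq_right (Real.exp_pos _).le, neg_one_mul]
  have hmain := norm_pairing_sub_le (A.endMat d q) (cylMat (inChart d A.kappaI q.1))
    (fun a a' => g a a' i j (q.1, Complex.exp (-q.2))) (fun a a' => g a a' i j (q.1, 0)) hinv hinv'
    (fun a a' => (hgN a a' i j).1 _ hqN0)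
    (fun a a' => ((hgN a a' i j).2 _ hqN _ hqN0).trans (le_of_eq (by rw [hw]))) hC0
    (mul_nonneg hC0 (Real.exp_pos _).le)
  rw [hlim, sub_zero] at hmain
  refine hmain.trans ?_
  rw [mul_assoc ((Fintype.card EndIdx : ℝ) ^ 2) (C * K + C * |M|)]
  refine mul_le_mul_of_nonneg_left ?_ (by positivity)
  have h1 := mul_le_mul_of_nonneg_left (hexp 1 (min_le_right _ _)) (mul_nonneg hC0 hK0)
  have h2 := mul_le_mul_of_nonneg_left (hexp rate (min_le_left _ _))
    (mul_nonneg hC0 (abs_nonneg M))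
  have h3 := mul_le_mul_of_nonneg_left (le_abs_self M)
    (mul_nonneg hC0 (Real.exp_pos (-rate * q.2.re)).le)
  calc _ = C * K * Real.exp (-1 * q.2.re) + C * Real.exp (-rate * q.2.re) * M := by ring
    _ ≤ _ := by linarith

/-- Decay of the contracted curvature of a reference metric at infinity. -/
theorem exists_quad_hatF_le_end [CompactSpace D] {H₀ : HermitianMetric E}
    (hH₀ : SmoothMetric 3 r univ H₀)
    {κ : KForm (V 3) 2 X ℝ} (hκ : A.IsSliceKaehler 0 κ) (hHs : A.IsSliceHYM r 0 κ H₀) :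
    ∃ s : ℝ, 0 < s ∧ ∃ C ρ : ℝ, 0 < ρ ∧ ρ < 1 ∧ ∀ p ∈ A.nbhd, A.z p ≠ 0 → ‖A.z p‖ < ρ →
      ∀ w : V r, |quad w (hermMatrixAt 3 r H₀ p * ((-2 * I) • hatF 3 r A.om H₀ p))|
        ≤ C * normSq (A.z p) ^ s * quad w (hermMatrixAt 3 r H₀ p) := by
  obtain ⟨rate, hrate, hend⟩ := A.exists_inv_endMat_le
  have hmin : 0 < min rate 1 := lt_min hrate one_pos
  -- with `|z| = e^{-s}` the decay `e^{-min(rate, 1) s}` is that of `(|z|²)^{min(rate, 1) / 2}`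
  refine ⟨min rate 1 / 2, half_pos hmin, ?_⟩
  have hpd : ∀ p, (hermMatrixAt 3 r H₀ p).PosDef := hermMatrixAt_posDef H₀
  have hq0 : ∀ p (w : V r), 0 ≤ quad w (hermMatrixAt 3 r H₀ p) := fun p w => quad_nonneg (hpd p) w
  refine A.exists_bound_of_endFilter (fun C p => ∀ w : V r,
    |quad w (hermMatrixAt 3 r H₀ p * ((-2 * I) • hatF 3 r A.om H₀ p))|
        ≤ C * normSq (A.z p) ^ (min rate 1 / 2) * quad w (hermMatrixAt 3 r H₀ p))
    (fun C C' p hCC h w => (h w).trans (mul_le_mul_of_nonneg_right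
      (mul_le_mul_of_nonneg_right hCC (Real.rpow_nonneg (normSq_nonneg _) _)) (hq0 p w)))
    fun d => ?_
  obtain ⟨C, hC0, hC⟩ := A.exists_norm_hatLocal_le hH₀ hκ hHs d (hend d)
  set p := A.tube (d, 0)
  set y₀ := chartAt (V 2) d d
  have hq₀ : (y₀, (0 : ℂ)) ∈ tubeDom d := zero_mem_tubeDom (mem_chart_target _ d)
  have ep : A.tubeMap d (y₀, 0) = p := A.tubeMap_chart d d (mem_chart_source _ d) 0
  have ht := tendsto_endFilter_tube d
  have htp : Tendsto (cylMap A.tube d) (endFilter y₀) (𝓝 p) := by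
    have := (A.continuousAt_tubeMap hq₀).tendsto.comp ht
    rw [ep] at this
    exact this
  have hty : Tendsto (fun q => chartAt (V 3) p (cylMap A.tube d q)) (endFilter y₀)
      (𝓝 (chartAt (V 3) p p)) :=
    ((chartAt (V 3) p).continuousAt (mem_chart_source _ p)).tendsto.comp htp
  have hGc : ∀ a b, ContinuousAt (fun y => hermMatrix 3 r H₀ p y a b) (chartAt (V 3) p p) :=
    fun a b => (SmoothMetric.smoothMatAt isOpen_univ hH₀
      (chart_mem_frameDomain (mem_univ p)) a b).continuousAt
  obtain ⟨C', hC'0, hC'⟩ := exists_abs_quad_mul_le hGc (fun v hv => quad_pos (hpd p) hv) hty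
    (fun q => (Real.exp_pos (-(min rate 1) * q.2.re)).le) hC0 hC
  refine ⟨C', ?_⟩
  filter_upwards [hC', eventually_endFilter d,
    htp.eventually ((chartAt (V 3) p).open_source.mem_nhds (mem_chart_source _ p)),
    htp.eventually ((isOpen_baseSet p).mem_nhds (mem_baseSet (r := r) (E := E) p))]
    with q hq hqd hps hpb w
  have hq' := mem_tubeDom_exp hqd.1 hqd.2
  have hz : A.z (cylMap A.tube d q) = Complex.exp (-q.2) := A.z_tubeMap hq'
  have hW : cylMap A.tube d q ∈ A.W := A.mem_W_of_z_ne_zero (A.tubeMap_mem_nbhd hq') (by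
    rw [hz]; exact Complex.exp_ne_zero _)
  have he : normSq (A.z (cylMap A.tube d q)) ^ (min rate 1 / 2)
      = Real.exp (-(min rate 1) * q.2.re) := by
    rw [hz, ← Complex.sq_norm, norm_exp, neg_re, ← Real.exp_nat_mul, ← Real.exp_mul]
    congr 1; push_cast; ring
  rw [he]
  set Y := chartAt (V 3) p (cylMap A.tube d q)
  have eY : (chartAt (V 3) p).symm Y = cylMap A.tube d q := (chartAt (V 3) p).left_inv hps
  have hYc : Y ∈ chartFrame 3 r E p :=
    ⟨(chartAt (V 3) p).map_source hps, by rw [mem_preimage, eY]; exact hpb⟩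
  have h11 : ∀ u v : V 3, A.om ((chartAt (V 3) p).symm Y) ![I • u, I • v]
      = A.om ((chartAt (V 3) p).symm Y) ![u, v] := by
    rw [eY]; exact A.calabiYau.kaehler.type11 _ hW
  have hsm : SmoothMatAt 2 (hermMatrix 3 r H₀ ((chartAt (V 3) p).symm Y))
      (chartAt (V 3) ((chartAt (V 3) p).symm Y) ((chartAt (V 3) p).symm Y)) :=
    (SmoothMetric.smoothMatAt isOpen_univ hH₀ (chart_mem_frameDomain (mem_univ _))).mono
      (by norm_cast)
  have hfin := abs_quad_hatF_le_of_local hYc h11 hsm hq w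
  rw [eY] at hfin
  exact hfin

/-- The velocity of the flow at time zero is bounded by a multiple of `|z|^{2s}` near the divisor,
hence by a multiple of the barrier function everywhere. -/
theorem exists_quad_hatF_le [CompactSpace D] [CompactSpace X] [T2Space X] [MeasurableSpace X]
    {H₀ : HermitianMetric E} (hH₀ : A.IsReferenceMetric r H₀) {H : ℝ → HermitianMetric E}
    (hH : A.IsFlow r H₀ H) :
    ∃ s : ℝ, 0 < s ∧ ∀ a b : ℝ, 0 < a → a < b → b < 1 → ∃ C, 0 ≤ C ∧ ∀ p ∈ A.W, ∀ w : V r,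
      |quad w (hermMatrixAt 3 r (H 0) p * ((-2 * I) • hatF 3 r A.om (H 0) p))|
        ≤ C * A.modulus a b p ^ s * quad w (hermMatrixAt 3 r (H 0) p) := by
  obtain ⟨δ, hδ, -, hsl⟩ := hH₀.slices
  obtain ⟨κ, hκ, hHs⟩ := hsl 0 (by simpa using hδ)
  obtain ⟨s, hs, C₀, ρ, hρ, hρ1, hend⟩ := A.exists_quad_hatF_le_end hH₀.smooth hκ hHs
  refine ⟨s, hs, fun a b ha hab hb => ?_⟩
  have hb0 : 0 < b := ha.trans hab
  have hpd : ∀ p, (hermMatrixAt 3 r (H 0) p).PosDef := hermMatrixAt_posDef (H 0)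
  have hq0 : ∀ p (w : V r), 0 ≤ quad w (hermMatrixAt 3 r (H 0) p) := fun p w => quad_nonneg (hpd p) w
  have hW := A.isOpen_W
  have hφ0 : ∀ p ∈ A.W, 0 < A.modulus a b p ^ s := fun p hp =>
    Real.rpow_pos_of_pos (A.modulus_pos hb0 hp) s
  -- the bound near the points of `W`
  have hloc : ∀ p ∈ A.W, ∃ C, 0 ≤ C ∧ ∀ᶠ x in 𝓝 p, x ∈ A.W ∧ ∀ w : V r,
      |quad w (hermMatrixAt 3 r (H 0) x * ((-2 * I) • hatF 3 r A.om (H 0) x))|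
        ≤ C * A.modulus a b x ^ s * quad w (hermMatrixAt 3 r (H 0) x) := fun p hp => by
    have hfd := chart_mem_frameDomain (n := 3) (r := r) (E := E) hp
    have hG : ∀ i j, ContinuousAt (fun y => hermMatrix 3 r (H 0) p y i j) (chartAt (V 3) p p) :=
      fun i j => (SmoothFamily.smoothMatAt hW hH.smooth le_rfl hfd i j).continuousAt
    have hV : ∀ i j, ContinuousAt (fun y => velocity 3 r H 0 p y i j) (chartAt (V 3) p p) :=
      fun i j => by
        have h1 := SmoothFamily.continuousOn_velocity hW hH.smooth p i j
        have h2 : ContinuousOn (fun y => velocity 3 r H 0 p y i j) (frameDomain 3 r E A.W p) :=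
          ContinuousOn.comp (f := fun y : V 3 => ((0 : ℝ), y)) h1 (by fun_prop)
            fun y hy => ⟨self_mem_Ici, hy⟩
        exact h2.continuousAt ((isOpen_frameDomain hW p).mem_nhds hfd)
    obtain ⟨C, hC0, hC⟩ := eventually_abs_quad_le
      (M := fun y => hermMatrix 3 r (H 0) p y) (N := fun y => velocity 3 r H 0 p y)
      (fun v hv => quad_pos (hpd p) hv) (fun i j => (hG i j).tendsto)
      (fun i j => (hV i j).tendsto)
    have hm := A.modulus_pos (a := a) hb0 hp
    refine ⟨C / (A.modulus a b p / 2) ^ s, by positivity, ?_⟩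
    have hch : Tendsto (chartAt (V 3) p) (𝓝 p) (𝓝 (chartAt (V 3) p p)) :=
      (chartAt (V 3) p).continuousAt (mem_chart_source _ p)
    filter_upwards [hch.eventually hC, hch.eventually ((isOpen_frameDomain hW p).mem_nhds hfd),
      (chartAt (V 3) p).open_source.mem_nhds (mem_chart_source _ p), hW.mem_nhds hp,
      (A.continuous_modulus hab hb).continuousAt.eventually (lt_mem_nhds (half_lt_self hm))]
      with x hx hxd hxs hxW hxm
    refine ⟨hxW, fun w => ?_⟩
    have e : (chartAt (V 3) p).symm (chartAt (V 3) p x) = x := (chartAt (V 3) p).left_inv hxs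
    have h11 : ∀ u v : V 3, A.om ((chartAt (V 3) p).symm (chartAt (V 3) p x)) ![I • u, I • v]
        = A.om ((chartAt (V 3) p).symm (chartAt (V 3) p x)) ![u, v] := by
      rw [e]; exact A.calabiYau.kaehler.type11 _ hxW
    have hsm : SmoothMatAt 2 (hermMatrix 3 r (H 0) ((chartAt (V 3) p).symm (chartAt (V 3) p x)))
        (chartAt (V 3) ((chartAt (V 3) p).symm (chartAt (V 3) p x))
          ((chartAt (V 3) p).symm (chartAt (V 3) p x))) :=
      (SmoothFamily.smoothMatAt hW hH.smooth le_rfl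
        (chart_mem_frameDomain (by rw [e]; exact hxW))).mono (by norm_cast)
    have hv := velocity_eq hW hH.smooth A.calabiYau.kaehler.type11 hH.evolution le_rfl hxd
    rw [hv] at hx
    have h1 := abs_quad_hatF_le_of_local (frameDomain_subset p hxd) h11 hsm hx w
    rw [e] at h1
    refine h1.trans (mul_le_mul_of_nonneg_right ?_ (hq0 x w))
    rw [div_mul_eq_mul_div, le_div_iff₀ (by positivity)]
    exact mul_le_mul_of_nonneg_left (Real.rpow_le_rpow (by positivity) hxm.le hs.le) hC0
  -- away from the divisor, by compactness
  set N : Set X := {p | p ∈ A.nbhd ∧ normSq (A.z p) < min (ρ ^ 2) a}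
  have hNo : IsOpen N := by
    refine isOpen_iff_mem_nhds.2 fun p hp => ?_
    filter_upwards [A.isOpen_nbhd.mem_nhds hp.1, (continuous_normSq.continuousAt.comp
      (A.continuousAt_z hp.1)).eventually (gt_mem_nhds hp.2)] with x h1 h2 using ⟨h1, h2⟩
  have hcomp : ∃ C, 0 ≤ C ∧ ∀ p ∈ Nᶜ, ∀ w : V r,
      |quad w (hermMatrixAt 3 r (H 0) p * ((-2 * I) • hatF 3 r A.om (H 0) p))|
        ≤ C * A.modulus a b p ^ s * quad w (hermMatrixAt 3 r (H 0) p) := by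
    have hNW : Nᶜ ⊆ A.W := fun p hp hD => hp ⟨A.range_emb_subset hD, by
      rw [(A.z_eq_zero_iff (A.range_emb_subset hD)).2 hD, normSq_zero]; positivity⟩
    have : ∃ C, 0 ≤ C ∧ ∀ p ∈ Nᶜ, p ∈ A.W ∧ ∀ w : V r,
      |quad w (hermMatrixAt 3 r (H 0) p * ((-2 * I) • hatF 3 r A.om (H 0) p))|
        ≤ C * A.modulus a b p ^ s * quad w (hermMatrixAt 3 r (H 0) p) := by
      refine hNo.isClosed_compl.isCompact.induction_on (p := fun S => ∃ C, 0 ≤ C ∧ ∀ p ∈ S,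
        p ∈ A.W ∧ ∀ w : V r,
        |quad w (hermMatrixAt 3 r (H 0) p * ((-2 * I) • hatF 3 r A.om (H 0) p))|
        ≤ C * A.modulus a b p ^ s * quad w (hermMatrixAt 3 r (H 0) p))
        ⟨0, le_rfl, fun p hp => hp.elim⟩
        (fun S T hST ⟨C, h0, h⟩ => ⟨C, h0, fun p hp => h p (hST hp)⟩) ?_ fun p hp => ?_
      · rintro S T ⟨C, h0, h⟩ ⟨C', h0', h'⟩
        have hmono : ∀ C C' : ℝ, C ≤ C' → ∀ p ∈ A.W, ∀ w : V r,
            C * A.modulus a b p ^ s * quad w (hermMatrixAt 3 r (H 0) p)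
            ≤ C' * A.modulus a b p ^ s * quad w (hermMatrixAt 3 r (H 0) p) := fun C C' h p hp w =>
          mul_le_mul_of_nonneg_right (mul_le_mul_of_nonneg_right h (hφ0 p hp).le) (hq0 p w)
        refine ⟨max C C', h0.trans (le_max_left _ _), fun p hp => ?_⟩
        rcases hp with hp | hp
        · exact ⟨(h p hp).1, fun w => ((h p hp).2 w).trans
            (hmono _ _ (le_max_left _ _) p (h p hp).1 w)⟩
        · exact ⟨(h' p hp).1, fun w => ((h' p hp).2 w).trans
            (hmono _ _ (le_max_right _ _) p (h' p hp).1 w)⟩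
      · obtain ⟨C, h0, h⟩ := hloc p (hNW hp)
        exact ⟨_, mem_nhdsWithin_of_mem_nhds h, C, h0, fun x hx => hx⟩
    obtain ⟨C, h0, h⟩ := this
    exact ⟨C, h0, fun p hp => (h p hp).2⟩
  obtain ⟨C₁, hC₁, hcomp⟩ := hcomp
  refine ⟨max C₁ C₀, hC₁.trans (le_max_left _ _), fun p hp w => ?_⟩
  have hmono : ∀ C ≤ max C₁ C₀, C * A.modulus a b p ^ s * quad w (hermMatrixAt 3 r (H 0) p)
      ≤ max C₁ C₀ * A.modulus a b p ^ s * quad w (hermMatrixAt 3 r (H 0) p) := fun C h =>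
    mul_le_mul_of_nonneg_right (mul_le_mul_of_nonneg_right h (hφ0 p hp).le) (hq0 p w)
  by_cases hpN : p ∈ N
  · refine le_trans ?_ (hmono _ (le_max_right _ _))
    have h1 : A.modulus a b p = normSq (A.z p) := by
      rw [modulus, if_pos hpN.1, cutoff_of_le hab (hpN.2.le.trans (min_le_right _ _))]
    have h2 : ‖A.z p‖ < ρ := by
      have := hpN.2.trans_le (min_le_left _ _)
      rw [← Complex.sq_norm] at this
      exact lt_of_pow_lt_pow_left₀ 2 hρ.le this
    obtain ⟨h3, h4⟩ := hatF_congr (r := r) hW (β := A.om) hH.initial hp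
    rw [h1, h3, h4]
    exact hend p hpN.1 (fun h0 => hp ((A.z_eq_zero_iff hpN.1).1 h0)) h2 w
  · exact (hcomp p hpN w).trans (hmono _ (le_max_left _ _))

/-! ### Integrability -/

section Volume

variable [MeasurableSpace X] [BorelSpace X]

/-- Parametrisation near a point of `W`. -/
theorem exists_measure_of_mem_W (hW : IsOpen A.W) {g : X → ENNReal} (hg : Measurable g)
    (hg1 : ∀ x, g x ≤ 1) {x : X} (hx : x ∈ A.W) :
    ∃ N : Set X, IsOpen N ∧ x ∈ N ∧ ∃ ν : Measure X, ∫⁻ x, g x ∂ν ≠ ⊤ ∧ ν A.Wᶜ = 0 ∧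
      ∀ p : X, ∀ B ⊆ N, MeasurableSet B → chartMeasure A.W A.om p B ≤ ν B := by
  set T := (chartAt (V 3) x).target ∩ (chartAt (V 3) x).symm ⁻¹' A.W
  have hTo : IsOpen T := (chartAt (V 3) x).isOpen_inter_preimage_symm hW
  have hxT : chartAt (V 3) x x ∈ T := ⟨mem_chart_target _ x, by
    rw [mem_preimage, (chartAt (V 3) x).left_inv (mem_chart_source _ x)]; exact hx⟩
  have hom : ContinuousAt (inChart x A.om) (chartAt (V 3) x x) :=
    (A.calabiYau.kaehler.smooth x).continuousOn.continuousAt (hTo.mem_nhds hxT)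
  have hdet : ContinuousAt (fun y => |(skew (stdFrame 3) (inChart x A.om y)).det|)
      (chartAt (V 3) x x) := by
    have h1 : Tendsto (fun y => (skew (stdFrame 3) (inChart x A.om y)).det) (𝓝 (chartAt (V 3) x x))
        (𝓝 (skew (stdFrame 3) (inChart x A.om (chartAt (V 3) x x))).det) := by
      refine tendsto_det fun a b => ?_
      have h2 : Continuous fun β : V 3 [⋀^Fin 2]→L[ℝ] ℝ => β ![stdFrame 3 a, stdFrame 3 b] :=
        (ContinuousAlternatingMap.apply ℝ (V 3) ℝ _).continuous
      exact (h2.tendsto _).comp hom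
    exact h1.abs
  obtain ⟨ε, hε, hball⟩ := Metric.mem_nhds_iff.1 (inter_mem (hTo.mem_nhds hxT)
    (hdet.eventually (gt_mem_nhds (lt_add_one _))))
  set S := Metric.ball (chartAt (V 3) x x) ε
  refine ⟨(chartAt (V 3) x).source ∩ chartAt (V 3) x ⁻¹' S,
    (chartAt (V 3) x).isOpen_inter_preimage Metric.isOpen_ball,
    ⟨mem_chart_source _ x, Metric.mem_ball_self hε⟩,
    exists_measure_of_parametrisation (P := (chartAt (V 3) x).symm)
      (c := |(skew (stdFrame 3) (inChart x A.om (chartAt (V 3) x x))).det| + 1) hW measurableSet_ball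
      ((chartAt (V 3) x).continuousOn_symm.mono fun y hy => (hball hy).1.1)
      ((chartAt (V 3) x).symm.injOn.mono fun y hy => (hball hy).1.1) ?_ (fun y hy => (hball hy).1.2)
      (fun b hb => ⟨chartAt (V 3) x b, hb.1.2, (chartAt (V 3) x).left_inv hb.1.1⟩) hg ?_⟩
  · intro p y hy hp
    have hov : y ∈ overlap x p := ⟨(hball hy).1.1, hp⟩
    refine ⟨fderiv ℝ (coordChange x p) y,
      ((contDiffAt_coordChange hov).differentiableAt (by simp)).hasFDerivAt, ?_⟩
    have h := skew_coordChange (β := A.om) hov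
    rw [coordChange] at h
    rw [h]
    exact le_of_lt (hball hy).2
  · refine ne_top_of_le_ne_top ?_ (lintegral_mono fun y => hg1 _)
    rw [lintegral_one, Measure.restrict_apply_univ]
    exact measure_ball_lt_top.ne

/-- Parametrisation near a point of the divisor. -/
theorem exists_measure_of_mem_divisor (hW : IsOpen A.W) {g : X → ENNReal} (hg : Measurable g)
    {a δ : ℝ} (ha : 0 < a) (hδ : 0 < δ)
    (hgz : ∀ p ∈ A.nbhd, normSq (A.z p) ≤ a → g p = ENNReal.ofReal (normSq (A.z p) ^ δ)) (d : D) :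
    ∃ N : Set X, IsOpen N ∧ A.emb d ∈ N ∧ ∃ ν : Measure X, ∫⁻ x, g x ∂ν ≠ ⊤ ∧ ν A.Wᶜ = 0 ∧
      ∀ p : X, ∀ B ⊆ N, MeasurableSet B → chartMeasure A.W A.om p B ≤ ν B := by
  obtain ⟨rate, -, hC⟩ := A.exists_inv_endMat_le
  obtain ⟨C, -, hC⟩ := hC d
  set y₀ := chartAt (V 2) d d
  have hza : ∀ᶠ q in endFilter y₀, normSq (Complex.exp (-q.2)) ≤ a := by
    have h1 := (continuous_normSq.comp continuous_snd).continuousAt.tendsto.comp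
      (tendsto_endFilter_tube d)
    exact (h1.eventually (p := fun c : ℝ => c < a) (eventually_lt_nhds (by simpa using ha))).mono
      fun q hq => hq.le
  obtain ⟨pa, hpa, pb, hpb, hab⟩ := eventually_prod_iff.1 (hC.and ((eventually_endFilter d).and hza))
  rw [eventually_comap] at hpb
  obtain ⟨s₀, hs⟩ := eventually_atTop.1 hpb
  obtain ⟨R, hR, hball⟩ := Metric.mem_nhds_iff.1 hpa
  have hq : ∀ v ∈ endDomain y₀ R s₀, |(A.endMat d (endSplit v)).det| ≤ C ∧
      (endSplit v).1 ∈ (chartAt (V 2) d).target ∧ 0 < (endSplit v).2.re ∧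
      normSq (Complex.exp (-(endSplit v).2)) ≤ a := fun v hv => by
    have h := hab (hball hv.1) (hs _ hv.2.1.le _ rfl)
    exact ⟨h.1.2.1, h.2.1.1, h.2.1.2, h.2.2⟩
  set P : V 3 → X := fun v => cylMap A.tube d (endSplit v)
  have hPt : ∀ v, P v = A.tubeMap d ((endSplit v).1, Complex.exp (-(endSplit v).2)) := fun v => rfl
  have hPz : ∀ v ∈ endDomain y₀ R s₀, A.z (P v) = Complex.exp (-(endSplit v).2) := fun v hv =>
    A.z_tubeMap (mem_tubeDom_exp (hq v hv).2.1 (hq v hv).2.2.1)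
  have hPn : ∀ v ∈ endDomain y₀ R s₀, P v ∈ A.nbhd := fun v hv =>
    ⟨_, ⟨mem_univ _, (mem_tubeDom_exp (hq v hv).2.1 (hq v hv).2.2.1).2⟩, rfl⟩
  refine ⟨A.tubeMap d '' ((Metric.ball y₀ R ∩ (chartAt (V 2) d).target) ×ˢ
    Metric.ball 0 (min 1 (Real.exp (-s₀)))), ?_, ?_,
    exists_measure_of_parametrisation (P := P) hW (measurableSet_endDomain y₀ R s₀) ?_ ?_ (c := C)
      ?_ ?_ ?_ hg ?_⟩
  · refine isOpen_iff_mem_nhds.2 ?_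
    rintro _ ⟨q, hq, rfl⟩
    rw [← A.map_nhds_tubeMap (d := d) (q := q) ⟨hq.1.2, Metric.ball_subset_ball (min_le_left _ _) hq.2⟩]
    exact image_mem_map (((Metric.isOpen_ball.inter (chartAt (V 2) d).open_target).prod
      Metric.isOpen_ball).mem_nhds hq)
  · exact ⟨(y₀, 0), ⟨⟨Metric.mem_ball_self hR, mem_chart_target _ d⟩,
      Metric.mem_ball_self (lt_min one_pos (Real.exp_pos _))⟩, by
      rw [A.tubeMap_zero, (chartAt (V 2) d).left_inv (mem_chart_source _ d)]⟩
  · intro v hv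
    exact (ContinuousAt.comp (f := endSplit) (A.continuousAt_cylMap (hq v hv).2.1 (hq v hv).2.2.1)
      endSplit.continuous.continuousAt).continuousWithinAt
  -- one turn of the angle is taken, so the parametrisation is injective
  · intro v hv v' hv' h
    have h1 := A.tube_injOn (x₁ := ((chartAt (V 2) d).symm (endSplit v).1,
        Complex.exp (-(endSplit v).2)))
      (x₂ := ((chartAt (V 2) d).symm (endSplit v').1, Complex.exp (-(endSplit v').2)))
      ⟨mem_univ _, (mem_tubeDom_exp (hq v hv).2.1 (hq v hv).2.2.1).2⟩
      ⟨mem_univ _, (mem_tubeDom_exp (hq v' hv').2.1 (hq v' hv').2.2.1).2⟩ h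
    rw [Prod.mk.injEq] at h1
    have h2 := (chartAt (V 2) d).symm.injOn (hq v hv).2.1 (hq v' hv').2.1 h1.1
    have h3 := exp_inj_of_neg_pi_lt_of_le_pi hv.2.2.1 hv.2.2.2 hv'.2.2.1 hv'.2.2.2 h1.2
    exact endSplit_bijective.1 (Prod.ext h2 (neg_injective h3))
  · intro p v hv hp
    refine ⟨_, HasFDerivAt.comp (f := endSplit) v (A.hasFDerivAt_chart_cylMap (hq v hv).2.1
      (hq v hv).2.2.1 hp) endSplit.hasFDerivAt, le_trans (le_of_eq ?_) (hq v hv).1⟩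
    rw [A.endMat_eq_skew (hq v hv).2.1 (hq v hv).2.2.1 hp,
      ← Matrix.det_submatrix_equiv_self (Equiv.ofBijective endIdx endIdx_bijective)]
    congr 2
    ext a b
    simp only [skew, of_apply, Matrix.submatrix_apply, Equiv.ofBijective_apply]
    simp only [ContinuousLinearMap.comp_apply, endSplit_stdFrame]
    rfl
  · intro v hv
    exact A.mem_W_of_z_ne_zero (hPn v hv) (by rw [hPz v hv]; exact Complex.exp_ne_zero _)
  -- it reaches every point of the neighbourhood off the divisor: `ζ = -log w`
  · rintro _ ⟨⟨⟨y, w⟩, ⟨⟨hy, hyt⟩, hw⟩, rfl⟩, hpW⟩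
    have hw0 : w ≠ 0 := by
      rintro rfl
      exact hpW ⟨_, (A.tubeMap_zero d y).symm⟩
    have hw' : ‖w‖ < Real.exp (-s₀) := by
      have := hw; rw [mem_ball_zero_iff] at this
      exact this.trans_le (min_le_right _ _)
    obtain ⟨v, hv⟩ := endSplit_bijective.2 (y, -Complex.log w)
    refine ⟨v, ⟨by rw [hv]; exact hy, ?_, ?_⟩, ?_⟩
    · rw [hv]
      dsimp only
      rw [neg_re, log_re, lt_neg]
      exact (Real.log_lt_iff_lt_exp (norm_pos_iff.2 hw0)).2 hw'
    · rw [hv]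
      dsimp only
      rw [neg_neg, log_im]
      exact ⟨neg_pi_lt_arg w, arg_le_pi w⟩
    · rw [hPt, hv, neg_neg, exp_log hw0]
  · have h1 : ∫⁻ v in endDomain y₀ R s₀, g (P v) = ∫⁻ v in endDomain y₀ R s₀,
        ENNReal.ofReal (Real.exp (-(2 * δ) * (endSplit v).2.re)) := by
      refine setLIntegral_congr_fun (measurableSet_endDomain y₀ R s₀) fun v hv => ?_
      have h2 := hPz v hv
      rw [hgz _ (hPn v hv) (by rw [h2]; exact (hq v hv).2.2.2), h2, ← Complex.sq_norm, norm_exp,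
        neg_re, ← Real.exp_nat_mul, ← Real.exp_mul]
      congr 2; push_cast; ring
    rw [h1]
    exact lintegral_endDomain_ne_top (by positivity) _ _ _

/-- The square of the barrier function is integrable over `W`. -/
theorem integrable_sq_modulus [CompactSpace D] [T2Space X] [CompactSpace X] {a b s : ℝ}
    (ha : 0 < a) (hab : a < b) (hb : b < 1) (hs : 0 < s) :
    Integrable (fun p => (A.modulus a b p ^ s) ^ 2) A.vol ∧ A.vol A.Wᶜ = 0 := by
  have hb0 : 0 < b := ha.trans hab
  have hm0 : ∀ p, 0 ≤ A.modulus a b p := fun p => by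
    by_cases hp : p ∈ A.W
    · exact (A.modulus_pos hb0 hp).le
    · exact (A.modulus_eq_zero ha hab (not_not.1 hp)).ge
  have hc : Continuous fun p => (A.modulus a b p ^ s) ^ 2 :=
    ((A.continuous_modulus hab hb).rpow_const fun _ => Or.inr hs.le).pow 2
  set g : X → ENNReal := fun p => ENNReal.ofReal ((A.modulus a b p ^ s) ^ 2) with hg
  have hgm : Measurable g := hc.measurable.ennreal_ofReal
  have hW := A.isOpen_W
  have h := exists_volumeMeasure_le (U := A.W) (β := A.om) (g := g) fun x => by
    by_cases hx : x ∈ A.W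
    · refine A.exists_measure_of_mem_W hW hgm (fun p => ?_) hx
      rw [hg, ENNReal.ofReal_le_one]
      exact pow_le_one₀ (Real.rpow_nonneg (hm0 p) s)
        (Real.rpow_le_one (hm0 p) ((A.modulus_le hab p).trans hb.le) hs.le)
    · obtain ⟨d, rfl⟩ := not_not.1 hx
      refine A.exists_measure_of_mem_divisor hW hgm ha (δ := 2 * s) (by positivity)
        (fun p hp hz => ?_) d
      simp only [hg]
      rw [modulus, if_pos hp, cutoff_of_le hab hz, ← Real.rpow_mul_natCast (normSq_nonneg _)]
      congr 2; push_cast; ring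
  refine ⟨⟨hc.aestronglyMeasurable, ?_⟩, h.2⟩
  rw [hasFiniteIntegral_iff_ofReal (ae_of_all _ fun p => sq_nonneg _)]
  exact h.1.lt_top

end Volume

/-! ### The energy along the flow -/

variable {A}

/-- Along the flow `Φ_t ∧ ω² = -8 |F̂|² dVol`. -/
theorem IsFlow.rhoDensity_eq (hW : IsOpen A.W) {H₀ : HermitianMetric E}
    {H : ℝ → HermitianMetric E} (hH : A.IsFlow r H₀ H) {t : ℝ} (ht : 0 ≤ t) {p : X}
    (hp : p ∈ A.W) :
    A.rhoDensity r H t p = ((-8 * normSqHatF 3 r A.om (H t) p : ℝ) : ℂ) := by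
  have h11 := A.calabiYau.kaehler.type11 p hp
  have hpos := A.calabiYau.kaehler.pos p hp
  have hs : SmoothMatAt 2 (hermMatrix 3 r (H t) p) (chartAt (V 3) p p) :=
    (hH.smooth.smoothMatAt hW ht (chart_mem_frameDomain hp)).mono (by norm_cast)
  have hG := hermMatrixAt_posDef (n := 3) (r := r) (H t) p
  obtain ⟨L, hL, hb⟩ := exists_isUnitary (A.om p) h11 hpos
  obtain ⟨B, hB⟩ := exists_bilin_curv hs hG.det_pos.ne'
  have hcurv : ∀ u v, curvature 3 r (H t) p u v = B u v := hB
  set N := (-2 * I) • hatF 3 r A.om (H t) p with hN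
  let α : V 3 →ₗ[ℝ] V 3 →ₗ[ℝ] ℂ := LinearMap.mk₂ ℝ (fun u v => 2 * I * (N * B u v).trace)
    (fun u u' v => by simp [mul_add])
    (fun c u v => by simp [trace_smul]; ring)
    (fun u v v' => by simp [mul_add])
    (fun c u v => by simp [trace_smul]; ring)
  have hα : ∀ u v, α u v = 2 * I * (N * B u v).trace := fun u v => rfl
  have hΦ : Phi r H t p = fun u v => α u v := by
    funext u v
    rw [Phi, hH.evolution t ht p hp, hcurv, hα]
  have hsum : hatF 3 r A.om (H t) p = ∑ j, B (L (Pi.single j 1)) (I • L (Pi.single j 1)) := by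
    simp_rw [← hB]
    exact traceForm_curv_eq_sum hs hG.det_pos.ne' (A.om p) h11 L hL hb
  have hanti : ∀ u v, B u v = -B v u := fun u v => by rw [← hB, ← hB, curv_antisymm]
  rw [rhoDensity, hΦ, topCoeff_eq_sum_unitary (A.om p) L hL hb]
  have h1 : ∀ j, α (L (Pi.single j 1)) (I • L (Pi.single j 1))
      - α (I • L (Pi.single j 1)) (L (Pi.single j 1))
      = 4 * I * (N * B (L (Pi.single j 1)) (I • L (Pi.single j 1))).trace := fun j => by
    rw [hα, hα, hanti (I • L (Pi.single j 1)), mul_neg, Matrix.trace_neg]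
    ring
  simp_rw [h1]
  rw [← Finset.mul_sum, ← Matrix.trace_sum, ← Finset.mul_sum, ← hsum, hN, Matrix.smul_mul,
    trace_smul, trace_adjoint_mul_self hG.det_pos.ne'.isUnit hG.1
      (isHermitian_mul_hatF h11 hpos hs), smul_eq_mul, normSqHatF]
  push_cast
  linear_combination 8 * (((((hermMatrixAt 3 r (H t) p)⁻¹ * (hatF 3 r A.om (H t) p)ᴴ
    * hermMatrixAt 3 r (H t) p * hatF 3 r A.om (H t) p).trace).re : ℝ) : ℂ) * I_mul_I

variable [T2Space X] [CompactSpace X] [MeasurableSpace X] [BorelSpace X] [CompactSpace D]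
  {H₀ : HermitianMetric E} {H : ℝ → HermitianMetric E}

/-- Along the flow `|F̂|²` is dominated, on bounded time intervals, by a fixed integrable
function. -/
theorem IsFlow.exists_normSqHatF_le (hH₀ : A.IsReferenceMetric r H₀) (hH : A.IsFlow r H₀ H) :
    A.vol A.Wᶜ = 0 ∧ ∃ ψ : X → ℝ, Integrable ψ A.vol ∧ ∀ T, 0 ≤ T → ∃ C, ∀ t ∈ Icc 0 T,
      ∀ p ∈ A.W, normSqHatF 3 r A.om (H t) p ≤ C * ψ p := by
  have hW := A.isOpen_W
  have h11 := A.calabiYau.kaehler.type11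
  have hpos := A.calabiYau.kaehler.pos
  obtain ⟨s, hs, hdecay⟩ := A.exists_quad_hatF_le hH₀ hH
  obtain ⟨a, b, K, ha, hab, hb1, hK, hb⟩ := A.exists_isBarrier hs
  obtain ⟨c, hc, h0⟩ := hdecay a b ha hab hb1
  obtain ⟨hint, hnull⟩ := A.integrable_sq_modulus ha hab hb1 hs
  refine ⟨hnull, _, hint, fun T hT => ?_⟩
  obtain ⟨c', hc', h⟩ := exists_abs_quad_hatF_le hW h11 hpos hK hb hH.smooth hH.evolution
    hH.bounded hc h0 hT
  refine ⟨9 * r ^ 2 * c' ^ 2, fun t ht p hp => ?_⟩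
  refine (normSqHatF_le (h11 p hp) (hpos p hp) ((hH.smooth.smoothMatAt hW ht.1
    (chart_mem_frameDomain hp)).mono (by norm_cast)) (mul_nonneg hc' (hb.nonneg p hp))
    (h t ht p hp)).trans (le_of_eq ?_)
  ring

theorem IsFlow.continuousOn_normSqHatF_time (hH : A.IsFlow r H₀ H) {p : X} (hp : p ∈ A.W) :
    ContinuousOn (fun t => normSqHatF 3 r A.om (H t) p) (Ici 0) := by
  have h := (continuousOn_normSqHatF A.isOpen_W A.calabiYau.kaehler.type11 hH.smooth hH.evolution
    p).comp (f := fun t : ℝ => (t, chartAt (V 3) p p)) (s := Ici 0) (by fun_prop)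
    fun t ht => ⟨ht, chart_mem_frameDomain hp⟩
  simp only [Function.comp_def, (chartAt (V 3) p).left_inv (mem_chart_source _ p)] at h
  exact h

theorem IsFlow.continuousOn_normSqHatF_space (hH : A.IsFlow r H₀ H) {t : ℝ} (ht : 0 ≤ t) :
    ContinuousOn (normSqHatF 3 r A.om (H t)) A.W := fun p hp => by
  have h := (continuousOn_normSqHatF A.isOpen_W A.calabiYau.kaehler.type11 hH.smooth hH.evolution
    p).comp (f := fun y : V 3 => (t, y)) (s := frameDomain 3 r E A.W p) (by fun_prop)
    fun y hy => ⟨ht, hy⟩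
  have h1 := h.continuousAt ((isOpen_frameDomain A.isOpen_W p).mem_nhds (chart_mem_frameDomain hp))
  have h2 := ContinuousAt.comp (f := chartAt (V 3) p) h1
    ((chartAt (V 3) p).continuousAt (mem_chart_source _ p))
  refine (h2.congr ?_).continuousWithinAt
  filter_upwards [(chartAt (V 3) p).open_source.mem_nhds (mem_chart_source _ p)] with x hx
  simp only [Function.comp_def, (chartAt (V 3) p).left_inv hx]

/-- The energy is finite, and continuous in time by dominated convergence. -/
theorem IsFlow.integrable_normSqHatF (hH₀ : A.IsReferenceMetric r H₀) (hH : A.IsFlow r H₀ H) :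
    (∀ t, 0 ≤ t → Integrable (normSqHatF 3 r A.om (H t)) A.vol) ∧
      ContinuousOn (fun t => A.energy r (H t)) (Ici 0) := by
  obtain ⟨hnull, ψ, hψ, hle⟩ := hH.exists_normSqHatF_le hH₀
  have hae : ∀ᵐ p ∂A.vol, p ∈ A.W := mem_ae_iff.2 hnull
  have hmeas : ∀ t, 0 ≤ t → AEStronglyMeasurable (normSqHatF 3 r A.om (H t)) A.vol := fun t ht => by
    have h := (hH.continuousOn_normSqHatF_space ht).aestronglyMeasurable (μ := A.vol)
      A.isOpen_W.measurableSet
    rwa [Measure.restrict_eq_self_of_ae_mem hae] at h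
  have hbound : ∀ T, 0 ≤ T → ∃ C, ∀ t ∈ Icc 0 T, ∀ᵐ p ∂A.vol,
      ‖normSqHatF 3 r A.om (H t) p‖ ≤ C * ψ p := fun T hT => by
    obtain ⟨C, hC⟩ := hle T hT
    refine ⟨C, fun t ht => hae.mono fun p hp => ?_⟩
    rw [Real.norm_of_nonneg normSqHatF_nonneg]
    exact hC t ht p hp
  constructor
  · intro t ht
    obtain ⟨C, hC⟩ := hbound t ht
    exact (hψ.const_mul C).mono' (hmeas t ht) (hC t ⟨ht, le_rfl⟩)
  · intro t ht
    obtain ⟨C, hC⟩ := hbound (t + 1) (add_nonneg ht zero_le_one)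
    have hev : ∀ᶠ τ in 𝓝[Ici 0] t, τ ∈ Icc 0 (t + 1) := by
      filter_upwards [self_mem_nhdsWithin, mem_nhdsWithin_of_mem_nhds (Iio_mem_nhds (lt_add_one t))]
        with τ h0 h1 using ⟨h0, le_of_lt h1⟩
    exact continuousWithinAt_of_dominated (hev.mono fun τ hτ => hmeas τ hτ.1)
      (hev.mono fun τ hτ => hC τ hτ) (hψ.const_mul C)
      (hae.mono fun p hp => hH.continuousOn_normSqHatF_time hp t ht)

/-- The pointwise identity `Φ_t ∧ ω² = -8 |F̂|² dVol`, integrated over `W`. -/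
theorem IsFlow.rho_eq (hH₀ : A.IsReferenceMetric r H₀) (hH : A.IsFlow r H₀ H) {t : ℝ}
    (ht : 0 ≤ t) : Integrable (A.rhoDensity r H t) A.vol ∧
      A.rho r H t = ((-8 * A.energy r (H t) : ℝ) : ℂ) := by
  have hae : ∀ᵐ p ∂A.vol, A.rhoDensity r H t p
      = ((-8 * normSqHatF 3 r A.om (H t) p : ℝ) : ℂ) := by
    filter_upwards [mem_ae_iff.2 (hH.exists_normSqHatF_le hH₀).1] with p hp
    exact hH.rhoDensity_eq A.isOpen_W ht hp
  refine ⟨(((hH.integrable_normSqHatF hH₀).1 t ht).const_mul (-8)).ofReal.congr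
    (hae.mono fun p hp => hp.symm), ?_⟩
  rw [rho, integral_congr_ae hae, integral_complex_ofReal, integral_const_mul, energy]

end ACylCalabiYau

end HYM

end

theorem mainTheorem10 {X D : Type*}
    [TopologicalSpace X] [ChartedSpace (HYM.V 3) X]
    [IsManifold (modelWithCornersSelf ℂ (HYM.V 3)) ω X]
    [T2Space X] [CompactSpace X] [SimplyConnectedSpace X] [MeasurableSpace X] [BorelSpace X]
    [TopologicalSpace D] [ChartedSpace (HYM.V 2) D]
    [IsManifold (modelWithCornersSelf ℂ (HYM.V 2)) ω D]
    [T2Space D] [CompactSpace D] [SimplyConnectedSpace D]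
    (A : HYM.ACylCalabiYau X D)
    {r : ℕ} (E : X → Type*) [∀ x, AddCommGroup (E x)] [∀ x, Module ℂ (E x)]
    [TopologicalSpace (Bundle.TotalSpace (HYM.V r) E)] [∀ x, TopologicalSpace (E x)]
    [FiberBundle (HYM.V r) E] [VectorBundle ℂ (HYM.V r) E]
    [ContMDiffVectorBundle ω (HYM.V r) E (modelWithCornersSelf ℂ (HYM.V 3))]
    (H₀ : HYM.HermitianMetric E) (hH₀ : A.IsReferenceMetric r H₀)
    (H : ℝ → HYM.HermitianMetric E) (hH : A.IsFlow r H₀ H) :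
    -- the functional is well defined, and real, for all times
    ((∀ t, 0 ≤ t → Integrable (A.rhoDensity r H t) A.vol) ∧
      (∀ T, 0 ≤ T → IntervalIntegrable (A.rho r H) volume 0 T) ∧
      (∀ T, 0 ≤ T → (A.functionalN r H T).im = 0)) ∧
    -- its derivative along the flow
    (∀ t, 0 ≤ t → A.FiniteEnergy r (H t) ∧
      HasDerivWithinAt (fun T => (A.functionalN r H T).re)
        (-8 * A.energy r (H t)) (Ici 0) t) ∧
    -- limits of the flow are Hermitian Yang-Mills
    (∀ Hlim : HYM.HermitianMetric E, HYM.SmoothMetric 3 r A.W Hlim →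
      HYM.ConvergesOn A.W H Hlim → HYM.IsHYM r A.W A.om Hlim) := by
  have hen := hH.integrable_normSqHatF hH₀
  have hrho := fun t (ht : 0 ≤ t) => hH.rho_eq hH₀ ht
  -- the energy, extended to negative times by its initial value, is continuous
  have hcont : Continuous fun t => -8 * A.energy r (H (max t 0)) :=
    continuous_const.mul (hen.2.comp_continuous (continuous_id.max continuous_const)
      fun t => le_max_right t 0)
  have hrho' : ∀ T, 0 ≤ T → EqOn (fun t => ((-8 * A.energy r (H (max t 0)) : ℝ) : ℂ))
      (A.rho r H) (uIcc 0 T) := fun T hT t ht => by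
    rw [uIcc_of_le hT] at ht
    simp only [max_eq_left ht.1, (hrho t ht.1).2]
  have hN : ∀ T, 0 ≤ T → A.functionalN r H T
      = ((∫ t in (0 : ℝ)..T, -8 * A.energy r (H (max t 0)) : ℝ) : ℂ) := fun T hT => by
    rw [HYM.ACylCalabiYau.functionalN, ← intervalIntegral.integral_congr (hrho' T hT),
      intervalIntegral.integral_ofReal]
  refine ⟨⟨fun t ht => (hrho t ht).1, fun T hT => ?_, fun T hT => ?_⟩, fun t ht => ⟨hen.1 t ht, ?_⟩,
    fun Hlim hs hconv => HYM.isHYM_of_convergesOn A.isOpen_W A.calabiYau.kaehler hH.smooth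
      hH.evolution hs hconv⟩
  · exact ((Complex.continuous_ofReal.comp hcont).continuousOn.congr
      fun t ht => (hrho' T hT ht).symm).intervalIntegrable
  · rw [hN T hT, Complex.ofReal_im]
  · have h := (hcont.integral_hasStrictDerivAt 0 t).hasDerivAt.hasDerivWithinAt (s := Ici 0)
    rw [max_eq_left ht] at h
    exact h.congr (fun T hT => by rw [hN T hT, Complex.ofReal_re])
      (by rw [hN t ht, Complex.ofReal_re])
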